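/- Let $\nu\ge 0$ be an integer, $\hbar>0$, and $\mathcal H_n=L^2(\mathbb R^{\nu n})$ ($\mathcal H_0=\mathbb C$). For $k\ge1$ let $\Phi^{(k)}:(\mathbb R^\nu)^k\to\mathbb R$ be symmetric and locally square integrable. Let $H_n$ be the closure of $$H_n\psi=-\tfrac{\hbar^2}{2}\sum_{i=1}^n\Delta_{q_i}\psi+\sum_{k=1}^n\ \sum_{i_1<\dots<i_k}\Phi^{(k)}(q_{i_1},\dots,q_{i_k})\,\psi ,\qquad \psi\in C_c^\infty(\mathbb R^{\nu n}),$$ and suppose that every $H_n$ is self-adjoint (the purpose of the Kato conditions on the potentials). Put $\mathcal U_n(t)=e^{itH_n/\hbar}$ and $(\mathcal G(t)f)_n=\mathcal G_n(t)f_n=\mathcal U_n(t)f_n\,\mathcal U_n(-t)$. For a set $Z$ of particles, $\mathcal G_{|Z|}(t,Z)$ is the conjugation by $\mathcal U_{|Z|}(t)$ acting on the particles of $Z$ (and by the identity on the others), and $g_{|Z|}(Z)$ is $g_{|Z|}$ acting on the particles of $Z$. For $\alpha>1$ let $\mathfrak L^1_\alpha$ be the space of sequences $f=(f_n)_{n\ge0}$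 of trace class operators $f_n$ on $\mathcal H_n$, invariant under permutations of the particles, with $\|f\|_\alpha=\sum_n\alpha^n\,\mathrm{Tr}|f_n|<\infty$; let $\mathfrak L^1_{\alpha,0}$ be the subset of the finite sequences of finite rank operators with $C_c^\infty$ kernels. For $0<\gamma<1$ let $\mathfrak L_\gamma$ be the space of sequences $g=(g_n)_{n\ge0}$ of permutation invariant bounded operators with $\|g\|_\gamma=\sup_n\frac{\gamma^n}{n!}\|g_n\|<\infty$; it is paired with $\mathfrak L^1_{1/\gamma}$ by $\langle g|f\rangle=\sum_n\frac1{n!}\mathrm{Tr}\,g_nf_n$, and $*$-weak convergence refers to this pairing. The operator $\mathcal N$ is $(\mathcal Nf)_n=-\frac{i}{\hbar}(f_nH_n-H_nf_n)$. Its domain in $\mathfrak L^1_\alpha$ (resp. $\mathfrak L_\gamma$) consists of the $f$ such that each $f_n$ maps $D(H_n)$ into itself and the commutators extend from $D(H_n)$ to a sequence in $\mathfrak L^1_\alpha$ (resp. $\mathfrak L_\gamma$). For a subset $J$ of a finite set of $m$ particles let $J_1$ denote $J$ regarded as a single element, and set $$\mathfrak C(t;J_1,J^c)=\sum_{\mathrm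 P:\{J_1\}\cup J^c=\bigcup_iX_i}(-1)^{|\mathrm P|-1}(|\mathrm P|-1)!\prod_{X_i\in\mathrm P}\mathcal G_{|X_i|}(t,X_i),$$ summed over all partitions; in $\mathcal G_{|X_i|}(t,X_i)$ the block $X_i$ stands for the set of all particles in it. Write $\mathfrak A_{1+n}(t)=\mathfrak C(-t)$ and $\mathfrak A^+_{1+n}(t)=\mathfrak C(t)$ when $|J^c|=n$. With $Y=\{1,\dots,s\}$, the BBGKY group and the dual BBGKY group are $$(U(t)f)_s=\sum_{n\ge0}\tfrac1{n!}\mathrm{Tr}_{s+1,\dots,s+n}\,\mathfrak A_{1+n}(t,Y_1,s+1,\dots,s+n)f_{s+n},$$ $$(U^+(t)g)_s=\sum_{n=0}^s\tfrac1{(s-n)!}\sum_{j_1\ne\dots\ne j_{s-n}}\mathfrak A^+_{1+n}(t,(Y\setminus X)_1,X)\,g_{s-n}(Y\setminus X),\qquad Y\setminus X=\{j_1,\dots,j_{s-n}\}.$$ Finally $(\mathfrak af)_s=\mathrm{Tr}_{s+1}f_{s+1}$, $(\mathfrak a^+g)_s=\sum_{j=1}^sg_{s-1}(Y\setminus\{j\})$,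 and $$(e^{\pm\mathfrak a}f)_s=\sum_{n\ge0}\tfrac{(\pm1)^n}{n!}\mathrm{Tr}_{s+1,\dots,s+n}f_{s+n},\qquad (e^{\pm\mathfrak a^+}g)_s=\sum_{n=0}^s\tfrac{(\pm1)^n}{n!}\sum_{j_1\ne\dots\ne j_n}g_{s-n}(Y\setminus\{j_1,\dots,j_n\}).$$ Then the following hold. **(1)** Let $\alpha>1$. The operators $e^{\pm\mathfrak a}$ map $\mathfrak L^1_\alpha$ into itself and $e^{\pm\mathfrak a}f=\sum_n\frac{(\pm1)^n}{n!}\mathfrak a^nf$ in norm. For all $t\in\mathbb R$ and $f\in\mathfrak L^1_\alpha$ one has $U(t)f\in\mathfrak L^1_\alpha$, $$\big([\underbrace{\mathfrak a,\dots,[\mathfrak a}_{n},\mathcal G(-t)]\dots]f\big)_s=\mathrm{Tr}_{s+1,\dots,s+n}\mathfrak A_{1+n}(t,Y_1,s+1,\dots,s+n)f_{s+n}\qquad(n,s\ge0),$$ $$U(t)f=\mathcal G(-t)f+\sum_{n\ge1}\tfrac1{n!}[\underbrace{\mathfrak a,\dots,[\mathfrak a}_{n},\mathcal G(-t)]\dots]f=e^{\mathfrak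 a}\mathcal G(-t)e^{-\mathfrak a}f ,$$ the series converging in norm. **(2)** Let $\mathfrak B$ be the infinitesimal generator of $U(t)$ on $\mathfrak L^1_\alpha$ (norm derivative at $t=0$). Then $\mathfrak B=e^{\mathfrak a}(-\mathcal N)e^{-\mathfrak a}$, including domains: $f\in D(\mathfrak B)$ iff $e^{-\mathfrak a}f\in D(\mathcal N)$. Moreover $$\mathfrak Bf=-\mathcal Nf+\sum_{n\ge1}\tfrac1{n!}[\underbrace{\mathfrak a,\dots,[\mathfrak a}_{n},-\mathcal N]\dots]f$$ for every $f\in\mathfrak L^1_\alpha$ for which all the commutators are defined (on their natural domains) and the series converges in norm to an element of $\mathfrak L^1_\alpha$ (in particular then $f\in D(\mathfrak B)$). This is the case for every $f\in\mathfrak L^1_{\alpha,0}$. **(3)** Let $0<\gamma<1$. The operators $e^{\pm\mathfrak a^+}$ map $\mathfrak L_\gamma$ into itself and $e^{\pm\mathfrak a^+}g=\sum_n\frac{(\pm1)^n}{n!}(\mathfrak a^+)^ng$ in norm. For all $t\in\mathbb R$ and $g\in\mathfrak L_\gamma$ one has $U^+(t)g\in\mathfrak L_\gamma$, $$\tfrac1{n!}\big([\dots[\mathcal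 G(t),\underbrace{\mathfrak a^+],\dots,\mathfrak a^+}_{n}]g\big)_s=\tfrac1{(s-n)!}\sum_{j_1\ne\dots\ne j_{s-n}}\mathfrak A^+_{1+n}(t,(Y\setminus X)_1,X)\,g_{s-n}(Y\setminus X)\qquad(0\le n\le s),$$ $$U^+(t)g=\mathcal G(t)g+\sum_{n\ge1}\tfrac1{n!}[\dots[\mathcal G(t),\underbrace{\mathfrak a^+],\dots,\mathfrak a^+}_{n}]g=e^{-\mathfrak a^+}\mathcal G(t)e^{\mathfrak a^+}g ,$$ the series converging in norm. **(4)** Let $\mathfrak B^+$ be the infinitesimal generator of $U^+(t)$ on $\mathfrak L_\gamma$ ($*$-weak derivative at $t=0$). Then $\mathfrak B^+=e^{-\mathfrak a^+}\mathcal Ne^{\mathfrak a^+}$, including domains: $g\in D(\mathfrak B^+)$ iff $e^{\mathfrak a^+}g\in D(\mathcal N)$. Moreover, for every $g\in\mathfrak L_\gamma$ for which all the commutators below are defined (on their natural domains) and every $h\in\mathfrak L_\gamma$: $g\in D(\mathfrak B^+)$ and $\mathfrak B^+g=h$ if and only if $$h_s=\Big(\mathcal Ng+\sum_{n\ge1}\tfrac1{n!}[\dots[\mathcal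 N,\underbrace{\mathfrak a^+],\dots,\mathfrak a^+}_{n}]g\Big)_s\qquad\text{for every } s\ge 0 .$$ -/

import Mathlib

open MeasureTheory Filter Topology
open scoped ENNReal Laplacian

noncomputable section
namespace BBGKY

/-- The position space `ℝ^ν` of one particle. -/
abbrev Pos (ν : ℕ) : Type := EuclideanSpace ℝ (Fin ν)

/-- The Hilbert space `L²((ℝ^ν)^ι)` of particles labelled by `ι`. -/
abbrev Hil (ν : ℕ) (ι : Type) [Fintype ι] : Type :=
  Lp ℂ 2 (volume : Measure (ι → Pos ν))

section Tensor
variable {ν : ℕ} {ι κ ρ : Type} [Fintype ι] [Fintype κ] [Fintype ρ]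

/-- Splitting a configuration along a partition `e : ι ⊕ κ ≃ ρ` of the labels. -/
def splitConf (e : ι ⊕ κ ≃ ρ) (x : ρ → Pos ν) : (ι → Pos ν) × (κ → Pos ν) :=
  (fun i => x (e (Sum.inl i)), fun j => x (e (Sum.inr j)))

theorem measurePreserving_splitConf (e : ι ⊕ κ ≃ ρ) :
    MeasurePreserving (splitConf (ν := ν) e) volume volume := by
  have h1 := (volume_measurePreserving_piCongrLeft (fun _ : ρ => Pos ν) e).symm
  have h2 := (volume_measurePreserving_sumPiEquivProdPi_symm
    (fun _ : ι ⊕ κ => Pos ν)).symm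
  exact h2.comp h1

theorem memLp_tensor (e : ι ⊕ κ ≃ ρ) (φ : Hil ν ι) (χ : Hil ν κ) :
    MemLp (fun x : ρ → Pos ν => φ (splitConf e x).1 * χ (splitConf e x).2) 2 volume := by
  have h : MemLp (fun p : (ι → Pos ν) × (κ → Pos ν) => φ p.1 * χ p.2) 2 volume := by
    have hφ := Lp.memLp φ
    have hχ := Lp.memLp χ
    refine (memLp_two_iff_integrable_sq_norm (hφ.1.comp_fst.mul hχ.1.comp_snd)).2 ?_
    rw [memLp_two_iff_integrable_sq_norm hφ.1] at hφ
    rw [memLp_two_iff_integrable_sq_norm hχ.1] at hχ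
    simpa only [Pi.mul_apply, norm_mul, mul_pow] using hφ.mul_prod hχ
  exact h.comp_measurePreserving (measurePreserving_splitConf e)

/-- The product vector `φ ⊗ χ`, that is, `(φ ⊗ χ)(x) = φ(x restricted to ι) χ(x restricted to κ)`. -/
def tensor (e : ι ⊕ κ ≃ ρ) (φ : Hil ν ι) (χ : Hil ν κ) : Hil ν ρ :=
  (memLp_tensor e φ χ).toLp

theorem coeFn_tensor (e : ι ⊕ κ ≃ ρ) (φ : Hil ν ι) (χ : Hil ν κ) :
    tensor e φ χ =ᵐ[volume] fun x => φ (splitConf e x).1 * χ (splitConf e x).2 :=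
  MemLp.coeFn_toLp _

theorem ae_fst (e : ι ⊕ κ ≃ ρ) {p : (ι → Pos ν) → Prop} (h : ∀ᵐ y, p y) :
    ∀ᵐ x : ρ → Pos ν, p (splitConf e x).1 :=
  ((Measure.quasiMeasurePreserving_fst (μ := (volume : Measure (ι → Pos ν)))
    (ν := (volume : Measure (κ → Pos ν)))).comp
    (measurePreserving_splitConf e).quasiMeasurePreserving).ae h

theorem ae_snd (e : ι ⊕ κ ≃ ρ) {p : (κ → Pos ν) → Prop} (h : ∀ᵐ y, p y) :
    ∀ᵐ x : ρ → Pos ν, p (splitConf e x).2 :=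
  ((Measure.quasiMeasurePreserving_snd (μ := (volume : Measure (ι → Pos ν)))
    (ν := (volume : Measure (κ → Pos ν)))).comp
    (measurePreserving_splitConf e).quasiMeasurePreserving).ae h

theorem tensor_add_left (e : ι ⊕ κ ≃ ρ) (φ φ' : Hil ν ι) (χ : Hil ν κ) :
    tensor e (φ + φ') χ = tensor e φ χ + tensor e φ' χ := by
  apply Lp.ext
  filter_upwards [coeFn_tensor e (φ + φ') χ, coeFn_tensor e φ χ, coeFn_tensor e φ' χ,
    Lp.coeFn_add (tensor e φ χ) (tensor e φ' χ), ae_fst e (Lp.coeFn_add φ φ')] with x h1 h2 h3 h4 h5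
  rw [h1, h4, Pi.add_apply, h2, h3, h5, Pi.add_apply, add_mul]

theorem tensor_smul_left (e : ι ⊕ κ ≃ ρ) (c : ℂ) (φ : Hil ν ι) (χ : Hil ν κ) :
    tensor e (c • φ) χ = c • tensor e φ χ := by
  apply Lp.ext
  filter_upwards [coeFn_tensor e (c • φ) χ, coeFn_tensor e φ χ,
    Lp.coeFn_smul c (tensor e φ χ), ae_fst e (Lp.coeFn_smul c φ)] with x h1 h2 h3 h4
  rw [h1, h3, Pi.smul_apply, h2, h4, Pi.smul_apply, smul_eq_mul, smul_eq_mul, mul_assoc]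

theorem tensor_add_right (e : ι ⊕ κ ≃ ρ) (φ : Hil ν ι) (χ χ' : Hil ν κ) :
    tensor e φ (χ + χ') = tensor e φ χ + tensor e φ χ' := by
  apply Lp.ext
  filter_upwards [coeFn_tensor e φ (χ + χ'), coeFn_tensor e φ χ, coeFn_tensor e φ χ',
    Lp.coeFn_add (tensor e φ χ) (tensor e φ χ'), ae_snd e (Lp.coeFn_add χ χ')] with x h1 h2 h3 h4 h5
  rw [h1, h4, Pi.add_apply, h2, h3, h5, Pi.add_apply, mul_add]

theorem tensor_smul_right (e : ι ⊕ κ ≃ ρ) (c : ℂ) (φ : Hil ν ι) (χ : Hil ν κ) :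
    tensor e φ (c • χ) = c • tensor e φ χ := by
  apply Lp.ext
  filter_upwards [coeFn_tensor e φ (c • χ), coeFn_tensor e φ χ,
    Lp.coeFn_smul c (tensor e φ χ), ae_snd e (Lp.coeFn_smul c χ)] with x h1 h2 h3 h4
  rw [h1, h3, Pi.smul_apply, h2, h4, Pi.smul_apply, smul_eq_mul, smul_eq_mul]
  ring

theorem inner_tensor (e : ι ⊕ κ ≃ ρ) (φ φ' : Hil ν ι) (χ χ' : Hil ν κ) :
    inner ℂ (tensor e φ χ) (tensor e φ' χ') = inner ℂ φ φ' * inner ℂ χ χ' := by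
  have hs : AEStronglyMeasurable (fun p : (ι → Pos ν) × (κ → Pos ν) =>
      inner ℂ (φ p.1) (φ' p.1) * inner ℂ (χ p.2) (χ' p.2)) volume :=
    ((Lp.aestronglyMeasurable φ).inner (Lp.aestronglyMeasurable φ')).comp_fst.mul
      ((Lp.aestronglyMeasurable χ).inner (Lp.aestronglyMeasurable χ')).comp_snd
  rw [L2.inner_def, L2.inner_def, L2.inner_def, ← integral_prod_mul]
  have hm := measurePreserving_splitConf (ν := ν) e
  have h1 : (∫ p : (ι → Pos ν) × (κ → Pos ν),
      inner ℂ (φ p.1) (φ' p.1) * inner ℂ (χ p.2) (χ' p.2)) =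
      ∫ x : ρ → Pos ν, inner ℂ (φ (splitConf e x).1) (φ' (splitConf e x).1) *
        inner ℂ (χ (splitConf e x).2) (χ' (splitConf e x).2) := by
    rw [← hm.map_eq, integral_map hm.measurable.aemeasurable (by rw [hm.map_eq]; exact hs)]
  refine Eq.trans ?_ h1.symm
  apply integral_congr_ae
  filter_upwards [coeFn_tensor e φ χ, coeFn_tensor e φ' χ'] with x hx hx'
  rw [hx, hx']
  simp only [RCLike.inner_apply, map_mul]
  ring

theorem norm_tensor (e : ι ⊕ κ ≃ ρ) (φ : Hil ν ι) (χ : Hil ν κ) :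
    ‖tensor e φ χ‖ = ‖φ‖ * ‖χ‖ := by
  have h := inner_tensor e φ φ χ χ
  rw [inner_self_eq_norm_sq_to_K, inner_self_eq_norm_sq_to_K, inner_self_eq_norm_sq_to_K] at h
  have h' : ‖tensor e φ χ‖ ^ 2 = (‖φ‖ * ‖χ‖) ^ 2 := by
    rw [mul_pow]; exact_mod_cast h
  exact (pow_left_inj₀ (norm_nonneg _) (by positivity) two_ne_zero).1 h'

/-- The bounded operator `φ ↦ φ ⊗ χ`. -/
def tensorRight (e : ι ⊕ κ ≃ ρ) (χ : Hil ν κ) : Hil ν ι →L[ℂ] Hil ν ρ :=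
  LinearMap.mkContinuous
    { toFun := fun φ => tensor e φ χ
      map_add' := fun φ φ' => tensor_add_left e φ φ' χ
      map_smul' := fun c φ => tensor_smul_left e c φ χ } ‖χ‖
    (fun φ => by rw [mul_comm]; exact (norm_tensor e φ χ).le)

/-- The bounded operator `χ ↦ φ ⊗ χ`. -/
def tensorLeft (e : ι ⊕ κ ≃ ρ) (φ : Hil ν ι) : Hil ν κ →L[ℂ] Hil ν ρ :=
  LinearMap.mkContinuous
    { toFun := fun χ => tensor e φ χ
      map_add' := fun χ χ' => tensor_add_right e φ χ χ'
      map_smul' := fun c χ => tensor_smul_right e c φ χ } ‖φ‖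
    (fun χ => (norm_tensor e φ χ).le)

end Tensor

section Basis
variable (E : Type) [NormedAddCommGroup E] [InnerProductSpace ℂ E] [CompleteSpace E]

/-- The index set of a fixed orthonormal basis of `E`. -/
def basisSet : Set E := (exists_hilbertBasis ℂ E).choose

/-- A fixed orthonormal basis of `E`. -/
def onBasis : HilbertBasis (basisSet E) ℂ E := (exists_hilbertBasis ℂ E).choose_spec.choose

end Basis

section Ampliation
variable {ν : ℕ} {ι κ ρ : Type} [Fintype ι] [Fintype κ] [Fintype ρ]

theorem exists_ampliation (e : ι ⊕ κ ≃ ρ) (A : Hil ν ι →L[ℂ] Hil ν ι) :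
    ∃ B : Hil ν ρ →L[ℂ] Hil ν ρ, ∀ φ χ, B (tensor e φ χ) = tensor e (A φ) χ := by
  classical
  let b := onBasis (Hil ν κ)
  let V : basisSet (Hil ν κ) → Hil ν ι →ₗᵢ[ℂ] Hil ν ρ := fun j =>
    { toLinearMap := (tensorRight e (b j)).toLinearMap
      norm_map' := fun φ => by
        change ‖tensor e φ (b j)‖ = _
        rw [norm_tensor, b.orthonormal.1 j, mul_one] }
  have hV : OrthogonalFamily ℂ (fun _ : basisSet (Hil ν κ) => Hil ν ι) V := by
    intro i j hij φ φ'
    change inner ℂ (tensor e φ (b i)) (tensor e φ' (b j)) = 0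
    rw [inner_tensor, b.orthonormal.2 hij, mul_zero]
  let W := hV.linearIsometry
  let D : lp (fun _ : basisSet (Hil ν κ) => Hil ν ι) 2 →L[ℂ]
      lp (fun _ : basisSet (Hil ν κ) => Hil ν ι) 2 :=
    lp.mapCLM 2 (fun _ => A) (norm_nonneg A) (fun _ => le_rfl)
  let B := W.toContinuousLinearMap ∘L D ∘L W.toContinuousLinearMap.adjoint
  have hW : ∀ x, W.toContinuousLinearMap.adjoint (W x) = x := fun x => by
    refine ext_inner_left ℂ fun y => ?_
    rw [ContinuousLinearMap.adjoint_inner_right]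
    exact W.inner_map_map y x
  have hB : ∀ φ j, B (tensor e φ (b j)) = tensor e (A φ) (b j) := by
    intro φ j
    have h1 : ∀ ψ, W (lp.single 2 j ψ) = tensor e ψ (b j) := fun ψ =>
      hV.linearIsometry_apply_single ψ
    have h2 : D (lp.single 2 j φ) = lp.single 2 j (A φ) := by
      ext i
      by_cases h : i = j
      · subst h; simp [D]
      · simp [D, h]
    change W (D (W.toContinuousLinearMap.adjoint (tensor e φ (b j)))) = _
    rw [← h1, hW, h2, h1]
  refine ⟨B, fun φ χ => ?_⟩
  have h : B ∘L tensorLeft e φ = tensorLeft e (A φ) := by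
    refine ContinuousLinearMap.ext_on
      (Submodule.dense_iff_topologicalClosure_eq_top.2 b.dense_span) ?_
    rintro _ ⟨j, rfl⟩
    exact hB φ j
  exact DFunLike.congr_fun h χ

/-- The ampliation `A ⊗ 1`: the bounded operator with `(A ⊗ 1)(φ ⊗ χ) = (A φ) ⊗ χ`. It is unique,
since the product vectors span a dense subspace. -/
def ampliation (e : ι ⊕ κ ≃ ρ) (A : Hil ν ι →L[ℂ] Hil ν ι) : Hil ν ρ →L[ℂ] Hil ν ρ :=
  (exists_ampliation e A).choose

/-- The partial trace over the particles labelled by `κ`: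
`⟨φ, (Tr_κ T) ψ⟩ = ∑ j, ⟨φ ⊗ e_j, T (ψ ⊗ e_j)⟩` for an orthonormal basis `e_j`.
For trace class `T` the series converges absolutely in operator norm. -/
def partialTrace (e : ι ⊕ κ ≃ ρ) (T : Hil ν ρ →L[ℂ] Hil ν ρ) : Hil ν ι →L[ℂ] Hil ν ι :=
  ∑' j : basisSet (Hil ν κ), (tensorRight e (onBasis (Hil ν κ) j)).adjoint ∘L T ∘L
    tensorRight e (onBasis (Hil ν κ) j)

end Ampliation

section TraceClass
variable {E : Type} [NormedAddCommGroup E] [InnerProductSpace ℂ E] [CompleteSpace E]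

/-- The trace norm `Tr |T|`; it is finite exactly when `T` is of trace class. -/
def traceNorm (T : E →L[ℂ] E) : ℝ≥0∞ :=
  ∑' j : basisSet E, ENNReal.ofReal (RCLike.re (inner ℂ (onBasis E j) (CFC.abs T (onBasis E j))))

/-- The trace of a trace class operator. -/
def opTrace (T : E →L[ℂ] E) : ℂ := ∑' j : basisSet E, inner ℂ (onBasis E j) (T (onBasis E j))

/-- `V t = e^{itA}`: `V` is a strongly continuous one-parameter group of isometries, and
its derivative at `t = 0` exists exactly on the domain of `A`, where it is `iA`. -/
structure IsUnitaryGroupOf (A : E →ₗ.[ℂ] E) (V : ℝ → E →L[ℂ] E) : Prop where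
  zero : V 0 = 1
  add : ∀ s t, V (s + t) = V s * V t
  isometry : ∀ t ψ, ‖V t ψ‖ = ‖ψ‖
  continuous : ∀ ψ, Continuous fun t => V t ψ
  generator : ∀ ψ η, (ψ, η) ∈ A.graph ↔ HasDerivAt (fun t => V t ψ) (Complex.I • η) 0

open Classical in
/-- The unitary group `t ↦ e^{itA}` of a self-adjoint operator `A` (it exists and is unique by
Stone's theorem; the other case of the definition is not used for self-adjoint `A`). -/
def unitaryGroup (A : E →ₗ.[ℂ] E) : ℝ → E →L[ℂ] E :=
  if h : ∃ V, IsUnitaryGroupOf A V then h.choose else fun _ => 1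

end TraceClass

/-- Bounded operators on the `n`-particle space `L²(ℝ^{νn})`. -/
abbrev Op (ν n : ℕ) : Type := Hil ν (Fin n) →L[ℂ] Hil ν (Fin n)

/-- Sequences `f = (f_0, f_1, f_2, …)` of bounded `n`-particle operators. -/
abbrev OpSeq (ν : ℕ) : Type := ∀ n : ℕ, Op ν n

section Hamiltonian
variable {ν : ℕ}

/-- `∑_i Δ_{q_i} φ`. -/
def totalLaplacian {n : ℕ} (φ : (Fin n → Pos ν) → ℂ) (q : Fin n → Pos ν) : ℂ :=
  ∑ i, (Δ fun y : Pos ν => φ (Function.update q i y)) (q i)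

/-- `∑_{k=1}^n ∑_{i_1 < … < i_k} Φ^{(k)}(q_{i_1}, …, q_{i_k})`. -/
def potentialEnergy (Φ : ∀ k : ℕ, (Fin k → Pos ν) → ℝ) {n : ℕ} (q : Fin n → Pos ν) : ℝ :=
  ∑ S : Finset (Fin n) with S.Nonempty, Φ S.card fun i => q (S.orderEmbOfFin rfl i)

/-- The differential expression of the `n`-particle Hamiltonian. -/
def hamiltonianExpr (ħ : ℝ) (Φ : ∀ k : ℕ, (Fin k → Pos ν) → ℝ) {n : ℕ}
    (φ : (Fin n → Pos ν) → ℂ) (q : Fin n → Pos ν) : ℂ :=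
  -((ħ : ℂ) ^ 2 / 2) * totalLaplacian φ q + (potentialEnergy Φ q : ℂ) * φ q

theorem contDiff_slice {n : ℕ} {φ : (Fin n → Pos ν) → ℂ} (h : ContDiff ℝ (⊤ : ℕ∞) φ)
    (q : Fin n → Pos ν) (i : Fin n) :
    ContDiffAt ℝ 2 (fun y : Pos ν => φ (Function.update q i y)) (q i) :=
  ((h.comp (contDiff_update _ q i)).of_le (WithTop.coe_le_coe.2 (le_top : (2 : ℕ∞) ≤ ⊤))).contDiffAt

theorem hamiltonianExpr_add (ħ : ℝ) (Φ : ∀ k : ℕ, (Fin k → Pos ν) → ℝ) {n : ℕ}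
    {φ φ' : (Fin n → Pos ν) → ℂ} (h : ContDiff ℝ (⊤ : ℕ∞) φ) (h' : ContDiff ℝ (⊤ : ℕ∞) φ') (q : Fin n → Pos ν) :
    hamiltonianExpr ħ Φ (φ + φ') q = hamiltonianExpr ħ Φ φ q + hamiltonianExpr ħ Φ φ' q := by
  have : totalLaplacian (φ + φ') q = totalLaplacian φ q + totalLaplacian φ' q := by
    unfold totalLaplacian
    rw [← Finset.sum_add_distrib]
    exact Finset.sum_congr rfl fun i _ =>
      (contDiff_slice h q i).laplacian_add (contDiff_slice h' q i)
  simp only [hamiltonianExpr, this, Pi.add_apply]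
  ring

theorem hamiltonianExpr_smul (ħ : ℝ) (Φ : ∀ k : ℕ, (Fin k → Pos ν) → ℝ) {n : ℕ} (c : ℂ)
    {φ : (Fin n → Pos ν) → ℂ} (h : ContDiff ℝ (⊤ : ℕ∞) φ) (q : Fin n → Pos ν) :
    hamiltonianExpr ħ Φ (c • φ) q = c • hamiltonianExpr ħ Φ φ q := by
  have : totalLaplacian (c • φ) q = c * totalLaplacian φ q := by
    unfold totalLaplacian
    rw [Finset.mul_sum]
    exact Finset.sum_congr rfl fun i _ =>
      InnerProductSpace.laplacian_smul c (contDiff_slice h q i)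
  simp only [hamiltonianExpr, this, Pi.smul_apply, smul_eq_mul]
  ring

/-- The graph of the `n`-particle Hamiltonian on the infinitely differentiable functions with
compact support. -/
def minimalGraph (ħ : ℝ) (Φ : ∀ k : ℕ, (Fin k → Pos ν) → ℝ) (n : ℕ) :
    Submodule ℂ (Hil ν (Fin n) × Hil ν (Fin n)) where
  carrier := {p | ∃ φ : (Fin n → Pos ν) → ℂ, ContDiff ℝ (⊤ : ℕ∞) φ ∧ HasCompactSupport φ ∧
    p.1 =ᵐ[volume] φ ∧ p.2 =ᵐ[volume] hamiltonianExpr ħ Φ φ}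
  zero_mem' := by
    refine ⟨0, contDiff_zero_fun, HasCompactSupport.zero, Lp.coeFn_zero _ _ _, ?_⟩
    have : hamiltonianExpr ħ Φ (0 : (Fin n → Pos ν) → ℂ) = 0 := by
      funext q
      have := hamiltonianExpr_smul ħ Φ (0 : ℂ) (contDiff_zero_fun : ContDiff ℝ (⊤ : ℕ∞)
        (0 : (Fin n → Pos ν) → ℂ)) q
      simpa using this
    rw [this]
    exact Lp.coeFn_zero _ _ _
  add_mem' := by
    rintro p p' ⟨φ, h1, h2, h3, h4⟩ ⟨φ', h1', h2', h3', h4'⟩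
    refine ⟨φ + φ', h1.add h1', h2.add h2', (Lp.coeFn_add _ _).trans (h3.add h3'), ?_⟩
    refine (Lp.coeFn_add _ _).trans ((h4.add h4').trans (Filter.EventuallyEq.of_eq ?_))
    funext q
    exact (hamiltonianExpr_add ħ Φ h1 h1' q).symm
  smul_mem' := by
    rintro c p ⟨φ, h1, h2, h3, h4⟩
    refine ⟨c • φ, h1.const_smul c, h2.smul_left (f := fun _ => c),
      (Lp.coeFn_smul _ _).trans (h3.const_smul c), ?_⟩
    refine (Lp.coeFn_smul _ _).trans ((h4.const_smul c).trans (Filter.EventuallyEq.of_eq ?_))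
    funext q
    exact (hamiltonianExpr_smul ħ Φ c h1 q).symm

/-- The `n`-particle Hamiltonian `H_n`: the closure of the differential expression on the
infinitely differentiable functions with compact support. -/
def hamiltonian (ħ : ℝ) (Φ : ∀ k : ℕ, (Fin k → Pos ν) → ℝ) (n : ℕ) :
    Hil ν (Fin n) →ₗ.[ℂ] Hil ν (Fin n) :=
  (minimalGraph ħ Φ n).toLinearPMap.closure

/-- `𝒰_n(t) = e^{(i/ħ) t H_n}`. -/
def evol (ħ : ℝ) (Φ : ∀ k : ℕ, (Fin k → Pos ν) → ℝ) (n : ℕ) (t : ℝ) : Op ν n :=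
  unitaryGroup (hamiltonian ħ Φ n) (t / ħ)

end Hamiltonian

section Sequences
variable {ν : ℕ}

/-- The permutation operator `(P_σ ψ)(q) = ψ(q ∘ σ)`. -/
def permOp {n : ℕ} (σ : Equiv.Perm (Fin n)) : Op ν n :=
  (Lp.compMeasurePreservingₗᵢ ℂ (fun (q : Fin n → Pos ν) i => q (σ i))
    ((volume_measurePreserving_piCongrLeft (fun _ : Fin n => Pos ν) σ).symm)).toContinuousLinearMap

/-- The symmetry condition `T(1, …, n) = T(i_1, …, i_n)`. -/
def IsSymmetricOp {n : ℕ} (T : Op ν n) : Prop :=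
  ∀ σ : Equiv.Perm (Fin n), permOp σ * T = T * permOp σ

/-- The norm `∑ α^n Tr |f_n|`. -/
def normTr (α : ℝ) (f : OpSeq ν) : ℝ≥0∞ := ∑' n, ENNReal.ofReal (α ^ n) * traceNorm (f n)

/-- Membership in the space `𝔏¹_α` of symmetric sequences of trace class operators. -/
def MemTr (α : ℝ) (f : OpSeq ν) : Prop := (∀ n, IsSymmetricOp (f n)) ∧ normTr α f < ∞

/-- The norm `sup_n (γ^n / n!) ‖g_n‖`. -/
def normBd (γ : ℝ) (g : OpSeq ν) : ℝ≥0∞ := ⨆ n, ENNReal.ofReal (γ ^ n / n.factorial) * ‖g n‖ₑ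

/-- Membership in the space `𝔏_γ` of symmetric sequences of bounded operators. -/
def MemBd (γ : ℝ) (g : OpSeq ν) : Prop := (∀ n, IsSymmetricOp (g n)) ∧ normBd γ g < ∞

/-- Convergence `∑ u_n = S` in the norm of `𝔏¹_α`. -/
def SumsToTr (α : ℝ) (u : ℕ → OpSeq ν) (S : OpSeq ν) : Prop :=
  Tendsto (fun N => normTr α (∑ n ∈ Finset.range N, u n - S)) atTop (𝓝 0)

/-- Convergence `∑ u_n = S` in the norm of `𝔏_γ`. -/
def SumsToBd (γ : ℝ) (u : ℕ → OpSeq ν) (S : OpSeq ν) : Prop :=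
  Tendsto (fun N => normBd γ (∑ n ∈ Finset.range N, u n - S)) atTop (𝓝 0)

/-- The bilinear form `⟨g | f⟩ = ∑ (1/n!) Tr g_n f_n`. -/
def pairing (g f : OpSeq ν) : ℂ := ∑' n, ((n.factorial : ℂ))⁻¹ * opTrace (g n * f n)

/-- Infinitely differentiable functions with compact support, as elements of `L²`. -/
def IsTestVec {n : ℕ} (u : Hil ν (Fin n)) : Prop :=
  ∃ φ : (Fin n → Pos ν) → ℂ, ContDiff ℝ (⊤ : ℕ∞) φ ∧ HasCompactSupport φ ∧ u =ᵐ[volume] φ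

/-- The set `𝔏¹_{α,0}` of finite symmetric sequences of degenerate (finite rank) operators whose
kernels are infinitely differentiable with compact support. -/
def IsTestSeq (f : OpSeq ν) : Prop :=
  (∀ n, IsSymmetricOp (f n)) ∧ (∃ N, ∀ n, N < n → f n = 0) ∧
  ∀ n, f n ∈ Submodule.span ℂ {T : Op ν n | ∃ u v, IsTestVec u ∧ IsTestVec v ∧
    T = InnerProductSpace.rankOne ℂ u v}

end Sequences

section Dynamics
variable {ν : ℕ}

/-- The labels of a subset `Z` of the `m` particles (in increasing order), and the others. -/
def subsetEquiv {m : ℕ} (Z : Finset (Fin m)) : Fin Z.card ⊕ {i // i ∉ Z} ≃ Fin m :=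
  (Equiv.sumCongr (Z.orderIsoOfFin rfl).toEquiv (Equiv.refl _)).trans (Equiv.sumCompl (· ∈ Z))

/-- `A(Z)`: the `|Z|`-particle operator `A` acting on the particles of `Z ⊆ {1, …, m}`. -/
def onSubset {m : ℕ} (Z : Finset (Fin m)) (A : Op ν Z.card) : Op ν m :=
  ampliation (subsetEquiv Z) A

/-- The particles `s+1, …, s+n` are traced out: `Tr_{s+1,…,s+n}`. -/
def trLast (s n : ℕ) (T : Op ν (s + n)) : Op ν s := partialTrace finSumFinEquiv T

variable (ħ : ℝ) (Φ : ∀ k : ℕ, (Fin k → Pos ν) → ℝ)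

/-- `𝒢(t) f = 𝒰(t) f 𝒰⁻¹(t)`. -/
def groupG (t : ℝ) (f : OpSeq ν) : OpSeq ν := fun n => evol ħ Φ n t * f n * evol ħ Φ n (-t)

/-- `𝒢_{|Z|}(t, Z)` as a linear map on `m`-particle operators, `Z ⊆ {1, …, m}`. -/
def groupOn (t : ℝ) {m : ℕ} (Z : Finset (Fin m)) : Module.End ℂ (Op ν m) :=
  LinearMap.mulLeftRight ℂ (onSubset Z (evol ħ Φ Z.card t), onSubset Z (evol ħ Φ Z.card (-t)))

/-- The particles in a set `B` of elements of `{J_1} ∪ Jᶜ`, where the cluster `J_1` (the set `J`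
regarded as one element) is represented by `none`. -/
def decluster {m : ℕ} (J : Finset (Fin m)) (B : Finset (Option {i : Fin m // i ∉ J})) :
    Finset (Fin m) :=
  Finset.univ.filter fun i => if h : i ∈ J then none ∈ B else some ⟨i, h⟩ ∈ B

/-- The cumulant of order `1 + |Jᶜ|`,
`∑_{P : {J_1, Jᶜ} = ⋃ X_i} (-1)^{|P|-1} (|P|-1)! ∏_{X_i ∈ P} 𝒢_{|X_i|}(t, X_i)`.
The factors of the product commute, as the blocks `X_i` are disjoint. -/
def cumulant (t : ℝ) {m : ℕ} (J : Finset (Fin m)) : Module.End ℂ (Op ν m) :=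
  ∑ P : Finpartition (Finset.univ : Finset (Option {i : Fin m // i ∉ J})),
    ((-1 : ℂ) ^ (P.parts.card - 1) * ((P.parts.card - 1).factorial : ℂ)) •
      (P.parts.toList.map fun B => groupOn ħ Φ t (decluster J B)).prod

/-- The term `Tr_{s+1,…,s+n} 𝔄_{1+n}(t, Y_1, s+1, …, s+n) f_{s+n}`, `Y = (1, …, s)`, where
`𝔄_{1+n}(t)` is the cumulant of the groups `𝒢(-t)`. -/
def bbgkyTerm (t : ℝ) (f : OpSeq ν) (s n : ℕ) : Op ν s :=
  trLast s n (cumulant ħ Φ (-t) (Finset.univ.map (Fin.castAddEmb n)) (f (s + n)))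

/-- The group `U(t)` of the BBGKY hierarchy. -/
def bbgky (t : ℝ) (f : OpSeq ν) : OpSeq ν := fun s => ∑' n : ℕ, (n.factorial : ℂ)⁻¹ • bbgkyTerm ħ Φ t f s n

/-- The term `(1/(s-n)!) ∑_{j_1 ≠ … ≠ j_{s-n}} 𝔄⁺_{1+n}(t, (Y∖X)_1, X) g_{s-n}(Y∖X)` with
`Y = (1, …, s)` and `Y∖X = (j_1, …, j_{s-n})`. -/
def dualTerm (t : ℝ) (g : OpSeq ν) (s n : ℕ) : Op ν s :=
  ((s - n).factorial : ℂ)⁻¹ • ∑ j : Fin (s - n) ↪ Fin s,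
    cumulant ħ Φ t (Finset.univ.map j) (onSubset (Finset.univ.map j) (g (Finset.univ.map j).card))

/-- The group `U⁺(t)` of the dual BBGKY hierarchy. -/
def dualBbgky (t : ℝ) (g : OpSeq ν) : OpSeq ν :=
  fun s => ∑ n ∈ Finset.range (s + 1), dualTerm ħ Φ t g s n

end Dynamics

section Ladder
variable {ν : ℕ}

/-- `(𝔞 f)_s = Tr_{s+1} f_{s+1}`. -/
def annih (f : OpSeq ν) : OpSeq ν := fun s => trLast s 1 (f (s + 1))

/-- `(e^{ε𝔞} f)_s = ∑_n (ε^n / n!) Tr_{s+1,…,s+n} f_{s+n}`. -/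
def expAnnih (ε : ℂ) (f : OpSeq ν) : OpSeq ν :=
  fun s => ∑' n : ℕ, (ε ^ n / (n.factorial : ℂ)) • trLast s n (f (s + n))

/-- `(𝔞⁺ g)_s = ∑_{j=1}^s g_{s-1}(Y ∖ {j})`. -/
def creat (g : OpSeq ν) : OpSeq ν :=
  fun s => ∑ j : Fin s, onSubset (Finset.univ.erase j) (g (Finset.univ.erase j).card)

/-- `(e^{ε𝔞⁺} g)_s = ∑_{n=0}^s (ε^n / n!) ∑_{j_1 ≠ … ≠ j_n} g_{s-n}(Y ∖ {j_1, …, j_n})`. -/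
def expCreat (ε : ℂ) (g : OpSeq ν) : OpSeq ν :=
  fun s => ∑ n ∈ Finset.range (s + 1), (ε ^ n / (n.factorial : ℂ)) • ∑ j : Fin n ↪ Fin s,
    onSubset (Finset.univ.map j)ᶜ (g (Finset.univ.map j)ᶜ.card)

/-- The `n`-fold commutator `[A, …, [A, B] … ]`. -/
def commLeft (A B : OpSeq ν → OpSeq ν) : ℕ → OpSeq ν → OpSeq ν
  | 0 => B
  | n + 1 => fun f => A (commLeft A B n f) - commLeft A B n (A f)

/-- The `n`-fold commutator `[ … [B, A], …, A]`. -/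
def commRight (A B : OpSeq ν → OpSeq ν) : ℕ → OpSeq ν → OpSeq ν
  | 0 => B
  | n + 1 => fun g => commRight A B n (A g) - A (commRight A B n g)

/-- The graph of the `n`-fold commutator `[A, …, [A, R] … ]` of an everywhere defined `A` with a
partially defined operator, given by its graph `R`; each commutator is defined on its natural
domain. -/
def CommLeft (A : OpSeq ν → OpSeq ν) (R : OpSeq ν → OpSeq ν → Prop) :
    ℕ → OpSeq ν → OpSeq ν → Prop
  | 0 => R
  | n + 1 => fun f h => ∃ h₁ h₂, CommLeft A R n f h₁ ∧ CommLeft A R n (A f) h₂ ∧ h = A h₁ - h₂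

/-- The graph of the `n`-fold commutator `[ … [R, A], …, A]`, with natural domains. -/
def CommRight (A : OpSeq ν → OpSeq ν) (R : OpSeq ν → OpSeq ν → Prop) :
    ℕ → OpSeq ν → OpSeq ν → Prop
  | 0 => R
  | n + 1 => fun g h => ∃ h₁ h₂, CommRight A R n (A g) h₁ ∧ CommRight A R n g h₂ ∧ h = h₁ - A h₂

end Ladder

section Generators
variable {ν : ℕ} (ħ : ℝ) (Φ : ∀ k : ℕ, (Fin k → Pos ν) → ℝ)

/-- `S = 𝒩_n T = -(i/ħ)(T H_n - H_n T)`: `T` maps the domain of `H_n` into itself, and the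
commutator, defined on this domain, is the restriction of the bounded operator `S`. -/
def IsCommH (n : ℕ) (T S : Op ν n) : Prop :=
  ∀ ψ η, (ψ, η) ∈ (hamiltonian ħ Φ n).graph →
    ∃ ξ, (T ψ, ξ) ∈ (hamiltonian ħ Φ n).graph ∧ S ψ = -(Complex.I / (ħ : ℂ)) • (T η - ξ)

/-- `h = -𝒩 f` in the space `𝔏¹_α`. -/
def IsNegN (α : ℝ) (f h : OpSeq ν) : Prop :=
  MemTr α f ∧ MemTr α h ∧ ∀ n, IsCommH ħ Φ n (f n) (-(h n))

/-- `h = 𝒩 g` in the space `𝔏_γ`. -/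
def IsN (γ : ℝ) (g h : OpSeq ν) : Prop :=
  MemBd γ g ∧ MemBd γ h ∧ ∀ n, IsCommH ħ Φ n (g n) (h n)

/-- `h = 𝔅 f`, where `𝔅` is the infinitesimal generator of `U(t)` on `𝔏¹_α`. -/
def IsBbgkyGen (α : ℝ) (f h : OpSeq ν) : Prop :=
  MemTr α f ∧ MemTr α h ∧
    Tendsto (fun t : ℝ => normTr α (((t : ℂ)⁻¹) • (bbgky ħ Φ t f - f) - h)) (𝓝[≠] 0) (𝓝 0)

/-- `h = 𝔅⁺ g`, where `𝔅⁺` is the infinitesimal generator of `U⁺(t)` on `𝔏_γ`, in the sense of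
the ∗-weak convergence of `𝔏_γ` as the dual of `𝔏¹_{1/γ}` under the bilinear form `pairing`. -/
def IsDualGen (γ : ℝ) (g h : OpSeq ν) : Prop :=
  MemBd γ g ∧ MemBd γ h ∧ ∀ f : OpSeq ν, MemTr γ⁻¹ f →
    Tendsto (fun t : ℝ => pairing (((t : ℂ)⁻¹) • (dualBbgky ħ Φ t g - g) - h) f) (𝓝[≠] 0) (𝓝 0)

end Generators

end BBGKY

end

open BBGKY

open scoped InnerProductSpace
set_option linter.unusedSectionVars false
set_option linter.unusedVariables false
set_option linter.style.haveILetI false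

namespace BBGKY

section TraceClass
variable {E : Type} [NormedAddCommGroup E] [InnerProductSpace ℂ E] [CompleteSpace E]

theorem norm_cfcAbs_apply (T : E →L[ℂ] E) (x : E) : ‖CFC.abs T x‖ = ‖T x‖ := by
  have hsa : IsSelfAdjoint (CFC.abs T) := IsSelfAdjoint.of_nonneg (CFC.abs_nonneg T)
  have h : inner ℂ (CFC.abs T x) (CFC.abs T x) = inner ℂ (T x) (T x) := by
    rw [← ContinuousLinearMap.adjoint_inner_right, ← ContinuousLinearMap.star_eq_adjoint,
      hsa.star_eq, ← mul_apply_eq_comp, CFC.abs_mul_abs,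
      mul_apply_eq_comp, ContinuousLinearMap.star_eq_adjoint,
      ContinuousLinearMap.adjoint_inner_right]
  rw [inner_self_eq_norm_sq_to_K, inner_self_eq_norm_sq_to_K] at h
  exact (pow_left_inj₀ (norm_nonneg _) (norm_nonneg _) two_ne_zero).1 (by exact_mod_cast h)

/-- Polar decomposition. -/
theorem exists_polar (T : E →L[ℂ] E) :
    ∃ V : E →L[ℂ] E, ‖V‖ ≤ 1 ∧ T = V * CFC.abs T ∧ CFC.abs T = V.adjoint * T := by
  let K := (LinearMap.range (CFC.abs T).toLinearMap).topologicalClosure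
  have hmem : ∀ x, CFC.abs T x ∈ K := fun x =>
    Submodule.le_topologicalClosure _ ⟨x, rfl⟩
  let e : E →ₗ[ℂ] K := (CFC.abs T).toLinearMap.codRestrict K hmem
  have he : DenseRange e := by
    rw [DenseRange, Subtype.dense_iff]
    intro x hx
    rw [← Set.range_comp]
    exact hx
  have hn : ∀ x, ‖T x‖ ≤ 1 * ‖e x‖ := fun x => by
    rw [one_mul, ← norm_cfcAbs_apply]; rfl
  haveI : CompleteSpace K := (Submodule.isClosed_topologicalClosure _).completeSpace_coe
  let V₀ : K →L[ℂ] E := T.toLinearMap.extendOfNorm e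
  let V : E →L[ℂ] E := V₀ ∘L K.orthogonalProjectionOnto
  have hV₀ : ‖V₀‖ ≤ 1 := LinearMap.opNorm_extendOfNorm_le he zero_le_one hn
  have hV : ‖V‖ ≤ 1 := (ContinuousLinearMap.opNorm_comp_le _ _).trans
    (mul_le_one₀ hV₀ (norm_nonneg _) K.orthogonalProjectionOnto_norm_le)
  have h1 : ∀ x, V (CFC.abs T x) = T x := fun x => by
    change V₀ (K.orthogonalProjectionOnto (CFC.abs T x)) = _
    have : K.orthogonalProjectionOnto (CFC.abs T x) = e x :=
      Submodule.orthogonalProjectionOnto_mem_subspace_eq_self (⟨_, hmem x⟩ : K)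
    rw [this]
    exact LinearMap.extendOfNorm_eq he ⟨1, hn⟩ x
  refine ⟨V, hV, ContinuousLinearMap.ext fun x => (h1 x).symm, ContinuousLinearMap.ext fun x => ?_⟩
  set a := CFC.abs T x
  change a = V.adjoint (T x)
  rw [← h1]
  have h2 : ‖V.adjoint (V a)‖ ≤ ‖a‖ := by
    refine (V.adjoint.le_opNorm _).trans ?_
    rw [LinearIsometryEquiv.norm_map]
    refine (mul_le_of_le_one_left (norm_nonneg _) hV).trans ?_
    exact (V.le_opNorm _).trans (mul_le_of_le_one_left (norm_nonneg _) hV)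
  have h3 : ‖a - V.adjoint (V a)‖ ^ 2 ≤ 0 := by
    rw [@norm_sub_sq ℂ, ContinuousLinearMap.adjoint_inner_right, inner_self_eq_norm_sq,
      show ‖V a‖ = ‖a‖ by rw [h1, norm_cfcAbs_apply]]
    nlinarith [norm_nonneg (V.adjoint (V a)), norm_nonneg a]
  exact sub_eq_zero.1 (norm_eq_zero.1 (pow_eq_zero_iff two_ne_zero |>.1
    (le_antisymm h3 (sq_nonneg _))))

/-- `T = ∑ j, ⟨v j, ·⟩ u j` in the strong sense. -/
def IsRep {J : Type} (u v : J → E) (T : E →L[ℂ] E) : Prop :=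
  ∀ x, HasSum (fun j => inner ℂ (v j) x • u j) (T x)

/-- The nuclear size `∑ j, ‖u j‖ ‖v j‖`. -/
noncomputable def repSize {J : Type} (u v : J → E) : ℝ≥0∞ := ∑' j, ‖u j‖ₑ * ‖v j‖ₑ

theorem exists_rep (T : E →L[ℂ] E) :
    ∃ u v : basisSet E → E, IsRep u v T ∧ repSize u v ≤ traceNorm T := by
  obtain ⟨V, hV, hT, -⟩ := exists_polar T
  set Q := CFC.sqrt (CFC.abs T) with hQdef
  have hQQ : Q * Q = CFC.abs T := CFC.sqrt_mul_sqrt_self _ (CFC.abs_nonneg T)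
  have hQ : Q.adjoint = Q := by
    rw [← ContinuousLinearMap.star_eq_adjoint]
    exact (IsSelfAdjoint.of_nonneg (CFC.sqrt_nonneg _)).star_eq
  refine ⟨fun j => V (Q (onBasis E j)), fun j => Q (onBasis E j), fun x => ?_, ?_⟩
  · have h := ((onBasis E).hasSum_repr (Q x)).mapL (V ∘L Q)
    have hx : (V ∘L Q) (Q x) = T x := by
      conv_rhs => rw [hT, ← hQQ]
      rfl
    rw [hx] at h
    convert h using 2 with j
    rw [map_smul, HilbertBasis.repr_apply_apply, ← ContinuousLinearMap.adjoint_inner_right, hQ]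
    rfl
  · refine ENNReal.tsum_le_tsum fun j => ?_
    set e := onBasis E j
    have h1 : RCLike.re (inner ℂ e (CFC.abs T e)) = ‖Q e‖ ^ 2 := by
      rw [← hQQ, mul_apply_eq_comp, ← ContinuousLinearMap.adjoint_inner_left, hQ]
      exact inner_self_eq_norm_sq _
    rw [h1, ← ofReal_norm, ← ofReal_norm, ← ENNReal.ofReal_mul (norm_nonneg _), sq]
    refine ENNReal.ofReal_le_ofReal (mul_le_mul_of_nonneg_right ?_ (norm_nonneg _))
    exact (V.le_opNorm _).trans (mul_le_of_le_one_left (norm_nonneg _) hV)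

theorem tsum_enorm_inner_mul_le {J : Type} {e : J → E} (he : Orthonormal ℂ e) (u v : E) :
    ∑' i, ‖inner ℂ (e i) u‖ₑ * ‖inner ℂ (e i) v‖ₑ ≤ ‖u‖ₑ * ‖v‖ₑ := by
  rw [ENNReal.tsum_eq_iSup_sum]
  refine iSup_le fun F => ?_
  have h : ∑ i ∈ F, ‖inner ℂ (e i) u‖ * ‖inner ℂ (e i) v‖ ≤ ‖u‖ * ‖v‖ := by
    refine (Real.sum_mul_le_sqrt_mul_sqrt _ _ _).trans ?_
    gcongr
    · exact Real.sqrt_le_iff.2 ⟨norm_nonneg _, he.sum_inner_products_le u⟩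
    · exact Real.sqrt_le_iff.2 ⟨norm_nonneg _, he.sum_inner_products_le v⟩
  calc _ = ENNReal.ofReal (∑ i ∈ F, ‖inner ℂ (e i) u‖ * ‖inner ℂ (e i) v‖) := by
        rw [ENNReal.ofReal_sum_of_nonneg fun i _ => by positivity]
        simp only [ENNReal.ofReal_mul (norm_nonneg _), ofReal_norm]
    _ ≤ ENNReal.ofReal (‖u‖ * ‖v‖) := ENNReal.ofReal_le_ofReal h
    _ = _ := by rw [ENNReal.ofReal_mul (norm_nonneg _), ofReal_norm, ofReal_norm]

theorem enorm_le_tsum_of_hasSum {J F : Type} [NormedAddCommGroup F] {f : J → F} {a : F}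
    (h : HasSum f a) : ‖a‖ₑ ≤ ∑' j, ‖f j‖ₑ := by
  refine le_of_tendsto (h.enorm) (Eventually.of_forall fun s => ?_)
  exact (enorm_sum_le _ _).trans (ENNReal.sum_le_tsum _)

theorem tsum_enorm_rep_le {I J : Type} {e : I → E} (he : Orthonormal ℂ e) {u v : J → E}
    {T : E →L[ℂ] E} (h : IsRep u v T) (A : E →L[ℂ] E) :
    ∑' i, ∑' j, ‖inner ℂ (A (e i)) (u j) * inner ℂ (v j) (e i)‖ₑ ≤ ‖A‖ₑ * repSize u v := by
  rw [ENNReal.tsum_comm, repSize, ← ENNReal.tsum_mul_left]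
  refine ENNReal.tsum_le_tsum fun j => ?_
  have h1 := tsum_enorm_inner_mul_le he (A.adjoint (u j)) (v j)
  have h2 : ‖A.adjoint (u j)‖ₑ ≤ ‖A‖ₑ * ‖u j‖ₑ := by
    have := A.adjoint.le_opENorm (u j)
    rwa [show ‖A.adjoint‖ₑ = ‖A‖ₑ by rw [← ofReal_norm, LinearIsometryEquiv.norm_map, ofReal_norm]]
      at this
  refine (le_of_eq ?_).trans (h1.trans ?_)
  · congr 1 with i
    rw [enorm_mul, ContinuousLinearMap.adjoint_inner_right, ← inner_conj_symm (v j) (e i)]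
    congr 1
    rw [← ofReal_norm, RCLike.norm_conj, ofReal_norm]
  · rw [← mul_assoc]
    gcongr

theorem tsum_enorm_inner_le {I J : Type} {e : I → E} (he : Orthonormal ℂ e) {u v : J → E}
    {T : E →L[ℂ] E} (h : IsRep u v T) (A : E →L[ℂ] E) :
    ∑' i, ‖inner ℂ (A (e i)) (T (e i))‖ₑ ≤ ‖A‖ₑ * repSize u v := by
  refine le_trans (ENNReal.tsum_le_tsum fun i => ?_) (tsum_enorm_rep_le he h A)
  have := (h (e i)).mapL (innerSL ℂ (A (e i)))
  refine (enorm_le_tsum_of_hasSum this).trans (le_of_eq ?_)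
  congr 1 with j
  rw [map_smul, innerSL_apply_apply, smul_eq_mul, mul_comm]

theorem traceNorm_le_rep {J : Type} {u v : J → E} {T : E →L[ℂ] E} (h : IsRep u v T) :
    traceNorm T ≤ repSize u v := by
  obtain ⟨V, hV, -, hT⟩ := exists_polar T
  have h1 := tsum_enorm_inner_le (onBasis E).orthonormal h V
  refine le_trans (ENNReal.tsum_le_tsum fun i => ?_) (h1.trans ?_)
  · rw [hT, mul_apply_eq_comp, ContinuousLinearMap.adjoint_inner_right, ← ofReal_norm]
    exact ENNReal.ofReal_le_ofReal (RCLike.re_le_norm _)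
  · refine mul_le_of_le_one_left' ?_
    rw [← ofReal_norm]
    exact ENNReal.ofReal_le_one.2 hV

theorem tsum_enorm_inner_le_traceNorm {I : Type} {e : I → E} (he : Orthonormal ℂ e)
    (T A : E →L[ℂ] E) :
    ∑' i, ‖inner ℂ (A (e i)) (T (e i))‖ₑ ≤ ‖A‖ₑ * traceNorm T := by
  obtain ⟨u, v, h, hs⟩ := exists_rep T
  exact (tsum_enorm_inner_le he h A).trans (by gcongr)

theorem IsRep.add {J J' : Type} {u v : J → E} {u' v' : J' → E} {T T' : E →L[ℂ] E}
    (h : IsRep u v T) (h' : IsRep u' v' T') :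
    IsRep (Sum.elim u u') (Sum.elim v v') (T + T') :=
  fun x => HasSum.sum (f := fun j => inner ℂ (Sum.elim v v' j) x • Sum.elim u u' j) (h x) (h' x)

theorem traceNorm_add_le (S T : E →L[ℂ] E) : traceNorm (S + T) ≤ traceNorm S + traceNorm T := by
  obtain ⟨u, v, h, hs⟩ := exists_rep S
  obtain ⟨u', v', h', hs'⟩ := exists_rep T
  refine (traceNorm_le_rep (h.add h')).trans (le_trans (le_of_eq ?_) (add_le_add hs hs'))
  simp only [repSize]
  rw [Summable.tsum_sum ENNReal.summable ENNReal.summable]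
  rfl

theorem IsRep.mul {J : Type} {u v : J → E} {T : E →L[ℂ] E} (h : IsRep u v T) (A B : E →L[ℂ] E) :
    IsRep (fun j => A (u j)) (fun j => B.adjoint (v j)) (A * T * B) := fun x => by
  have := (h (B x)).mapL A
  simp only [map_smul] at this
  simp only [ContinuousLinearMap.adjoint_inner_left]
  exact this

theorem enorm_adjoint (A : E →L[ℂ] E) : ‖A.adjoint‖ₑ = ‖A‖ₑ := by
  rw [← ofReal_norm, LinearIsometryEquiv.norm_map, ofReal_norm]

theorem repSize_mul_le {J : Type} (u v : J → E) (A B : E →L[ℂ] E) :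
    repSize (fun j => A (u j)) (fun j => B.adjoint (v j)) ≤ ‖A‖ₑ * repSize u v * ‖B‖ₑ := by
  rw [repSize, repSize, ← ENNReal.tsum_mul_left, ← ENNReal.tsum_mul_right]
  refine ENNReal.tsum_le_tsum fun j => ?_
  refine (mul_le_mul' (A.le_opENorm _) (B.adjoint.le_opENorm _)).trans (le_of_eq ?_)
  rw [enorm_adjoint]
  ring

theorem traceNorm_mul_mul_le (A T B : E →L[ℂ] E) :
    traceNorm (A * T * B) ≤ ‖A‖ₑ * traceNorm T * ‖B‖ₑ := by
  obtain ⟨u, v, h, hs⟩ := exists_rep T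
  refine (traceNorm_le_rep (h.mul A B)).trans ((repSize_mul_le u v A B).trans ?_)
  gcongr

theorem enorm_one_le : ‖(1 : E →L[ℂ] E)‖ₑ ≤ 1 := by
  rw [← ofReal_norm]
  exact ENNReal.ofReal_le_one.2 ContinuousLinearMap.norm_id_le

theorem traceNorm_mul_le (A T : E →L[ℂ] E) : traceNorm (A * T) ≤ ‖A‖ₑ * traceNorm T := by
  have := traceNorm_mul_mul_le A T 1
  rw [mul_one] at this
  exact this.trans (mul_le_of_le_one_right' enorm_one_le)

theorem traceNorm_mul_le' (T B : E →L[ℂ] E) : traceNorm (T * B) ≤ traceNorm T * ‖B‖ₑ := by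
  have := traceNorm_mul_mul_le 1 T B
  rw [one_mul] at this
  exact this.trans (by gcongr; exact mul_le_of_le_one_left' enorm_one_le)

theorem traceNorm_zero : traceNorm (0 : E →L[ℂ] E) = 0 := by
  simpa using traceNorm_mul_le (0 : E →L[ℂ] E) 0

theorem traceNorm_smul_le (c : ℂ) (T : E →L[ℂ] E) : traceNorm (c • T) ≤ ‖c‖ₑ * traceNorm T := by
  have := traceNorm_mul_le (c • (1 : E →L[ℂ] E)) T
  rw [smul_mul_assoc, one_mul, enorm_smul] at this
  refine this.trans ?_
  gcongr
  exact mul_le_of_le_one_right' enorm_one_le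

theorem traceNorm_smul (c : ℂ) (T : E →L[ℂ] E) : traceNorm (c • T) = ‖c‖ₑ * traceNorm T := by
  refine le_antisymm (traceNorm_smul_le c T) ?_
  rcases eq_or_ne c 0 with rfl | hc
  · simp
  have := traceNorm_smul_le c⁻¹ (c • T)
  rw [inv_smul_smul₀ hc] at this
  calc ‖c‖ₑ * traceNorm T ≤ ‖c‖ₑ * (‖c⁻¹‖ₑ * traceNorm (c • T)) := by gcongr
    _ = traceNorm (c • T) := by
      rw [← mul_assoc, ← enorm_mul, mul_inv_cancel₀ hc, enorm_one, one_mul]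

theorem traceNorm_neg (T : E →L[ℂ] E) : traceNorm (-T) = traceNorm T := by
  simpa using traceNorm_smul (-1) T

theorem traceNorm_sub_le (S T : E →L[ℂ] E) : traceNorm (S - T) ≤ traceNorm S + traceNorm T := by
  rw [sub_eq_add_neg]
  exact (traceNorm_add_le _ _).trans (by rw [traceNorm_neg])

theorem enorm_le_traceNorm (T : E →L[ℂ] E) : ‖T‖ₑ ≤ traceNorm T := by
  obtain ⟨u, v, h, hs⟩ := exists_rep T
  rcases eq_or_ne (traceNorm T) ∞ with ht | ht
  · rw [ht]; exact le_top
  rw [← ENNReal.ofReal_toReal ht, ← ofReal_norm]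
  refine ENNReal.ofReal_le_ofReal (T.opNorm_le_bound ENNReal.toReal_nonneg fun x => ?_)
  have h1 : ‖T x‖ₑ ≤ traceNorm T * ‖x‖ₑ := by
    refine (enorm_le_tsum_of_hasSum (h x)).trans (le_trans ?_ (mul_le_mul_left hs _))
    rw [repSize, ← ENNReal.tsum_mul_right]
    refine ENNReal.tsum_le_tsum fun j => ?_
    rw [enorm_smul, mul_comm, mul_assoc]
    gcongr
    rw [← ofReal_norm, ← ofReal_norm, ← ofReal_norm, ← ENNReal.ofReal_mul (norm_nonneg _)]
    exact ENNReal.ofReal_le_ofReal (norm_inner_le_norm _ _)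
  have := ENNReal.toReal_mono (by finiteness) h1
  rwa [ENNReal.toReal_mul, toReal_enorm, toReal_enorm] at this

theorem traceNorm_le_of_tendsto {l : Filter ℕ} [l.NeBot] {T : ℕ → E →L[ℂ] E} {S : E →L[ℂ] E}
    {c : ℝ≥0∞} (h : ∀ x, Tendsto (fun n => T n x) l (𝓝 (S x))) (hc : ∀ᶠ n in l, traceNorm (T n) ≤ c) :
    traceNorm S ≤ c := by
  obtain ⟨V, hV, -, hT⟩ := exists_polar S
  rw [traceNorm, ENNReal.tsum_eq_iSup_sum]
  refine iSup_le fun F => ?_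
  have h1 : Tendsto (fun n => ∑ i ∈ F, ‖inner ℂ (V (onBasis E i)) (T n (onBasis E i))‖ₑ) l
      (𝓝 (∑ i ∈ F, ‖inner ℂ (V (onBasis E i)) (S (onBasis E i))‖ₑ)) :=
    tendsto_finsetSum _ fun i _ => ((tendsto_const_nhds.inner (h _))).enorm
  refine le_trans (Finset.sum_le_sum fun i _ => ?_) (le_of_tendsto h1 ?_)
  · rw [hT, mul_apply_eq_comp, ContinuousLinearMap.adjoint_inner_right, ← ofReal_norm]
    exact ENNReal.ofReal_le_ofReal (RCLike.re_le_norm _)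
  · filter_upwards [hc] with n hn
    refine (ENNReal.sum_le_tsum _).trans
      ((tsum_enorm_inner_le_traceNorm (onBasis E).orthonormal _ V).trans ?_)
    refine (mul_le_of_le_one_left' ?_).trans hn
    rw [← ofReal_norm]
    exact ENNReal.ofReal_le_one.2 hV

theorem isClosed_traceNorm_le (c : ℝ≥0∞) : IsClosed {T : E →L[ℂ] E | traceNorm T ≤ c} := by
  refine IsSeqClosed.isClosed fun T S hT hS => ?_
  exact traceNorm_le_of_tendsto (fun x => ((ContinuousLinearMap.apply ℂ E x).continuous.tendsto _).comp hS)
    (Eventually.of_forall hT)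

theorem summable_norm_of_tsum_enorm {J F : Type} [NormedAddCommGroup F] {f : J → F}
    (h : ∑' j, ‖f j‖ₑ ≠ ∞) : Summable fun j => ‖f j‖ := by
  have := ENNReal.summable_toReal h
  simpa using this

theorem exists_rep_summable {T : E →L[ℂ] E} (hT : traceNorm T ≠ ∞) :
    ∃ u v : basisSet E → E, IsRep u v T ∧ (Summable fun j => ‖u j‖ * ‖v j‖) ∧
      ∑' j, ‖u j‖ * ‖v j‖ ≤ (traceNorm T).toReal := by
  obtain ⟨u, v, h, hs⟩ := exists_rep T
  have h1 : (fun j => ‖u j‖ * ‖v j‖) = fun j => (‖u j‖ₑ * ‖v j‖ₑ).toReal := by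
    funext j; rw [ENNReal.toReal_mul, toReal_enorm, toReal_enorm]
  have h2 : ∑' j, ‖u j‖ₑ * ‖v j‖ₑ ≠ ∞ := ne_top_of_le_ne_top hT hs
  refine ⟨u, v, h, ?_, ?_⟩
  · rw [h1]; exact ENNReal.summable_toReal h2
  · rw [h1, ← ENNReal.tsum_toReal_eq fun j => by finiteness]
    exact ENNReal.toReal_mono hT hs

theorem repSize_ne_top {J : Type} {u v : J → E} (h : Summable fun j => ‖u j‖ * ‖v j‖) :
    repSize u v ≠ ∞ := by
  have := h.tsum_ofReal_ne_top
  simpa only [ENNReal.ofReal_mul (norm_nonneg _), ofReal_norm, repSize] using this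

theorem hasSum_opTrace_rep {J : Type} {u v : J → E} {T : E →L[ℂ] E} (h : IsRep u v T)
    (hs : Summable fun j => ‖u j‖ * ‖v j‖) :
    HasSum (fun i => inner ℂ (onBasis E i) (T (onBasis E i))) (∑' j, inner ℂ (v j) (u j)) := by
  have h1 := tsum_enorm_rep_le (onBasis E).orthonormal h 1
  have h2 : Summable (fun p : basisSet E × J =>
      inner ℂ (onBasis E p.1) (u p.2) * inner ℂ (v p.2) (onBasis E p.1)) := by
    apply Summable.of_norm
    apply summable_norm_of_tsum_enorm
    rw [ENNReal.tsum_prod']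
    refine ne_top_of_le_ne_top ?_ h1
    exact ENNReal.mul_ne_top enorm_ne_top (repSize_ne_top hs)
  have h3 : ∀ i, HasSum (fun j => inner ℂ (onBasis E i) (u j) * inner ℂ (v j) (onBasis E i))
      (inner ℂ (onBasis E i) (T (onBasis E i))) := fun i => by
    have := (h (onBasis E i)).mapL (innerSL ℂ (onBasis E i))
    simpa only [map_smul, innerSL_apply_apply, smul_eq_mul, mul_comm] using this
  have h4 := h2.hasSum.prod_fiberwise h3
  convert h4 using 1
  have h5 := h2.prod_symm.hasSum.prod_fiberwise (fun j => by
    have := (onBasis E).hasSum_inner_mul_inner (v j) (u j)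
    simp only [mul_comm (inner ℂ (v j) _)] at this
    exact this)
  have h6 : ∑' p : J × basisSet E, inner ℂ (onBasis E p.swap.1) (u p.swap.2) *
      inner ℂ (v p.swap.2) (onBasis E p.swap.1) = ∑' p : basisSet E × J,
      inner ℂ (onBasis E p.1) (u p.2) * inner ℂ (v p.2) (onBasis E p.1) :=
    (Equiv.prodComm J (basisSet E)).tsum_eq
      (fun p => inner ℂ (onBasis E p.1) (u p.2) * inner ℂ (v p.2) (onBasis E p.1))
  rw [h5.tsum_eq, h6]

theorem opTrace_rep {J : Type} {u v : J → E} {T : E →L[ℂ] E} (h : IsRep u v T)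
    (hs : Summable fun j => ‖u j‖ * ‖v j‖) : opTrace T = ∑' j, inner ℂ (v j) (u j) :=
  (hasSum_opTrace_rep h hs).tsum_eq

theorem summable_opTrace {T : E →L[ℂ] E} (hT : traceNorm T ≠ ∞) :
    Summable fun i => inner ℂ (onBasis E i) (T (onBasis E i)) := by
  obtain ⟨u, v, h, hs, -⟩ := exists_rep_summable hT
  exact (hasSum_opTrace_rep h hs).summable

theorem opTrace_add {S T : E →L[ℂ] E} (hS : traceNorm S ≠ ∞) (hT : traceNorm T ≠ ∞) :
    opTrace (S + T) = opTrace S + opTrace T := by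
  rw [opTrace, opTrace, opTrace, ← (summable_opTrace hS).tsum_add (summable_opTrace hT)]
  simp only [add_apply, inner_add_right]

theorem opTrace_smul (c : ℂ) (T : E →L[ℂ] E) : opTrace (c • T) = c * opTrace T := by
  rw [opTrace, opTrace, ← tsum_mul_left]
  simp only [smul_apply, inner_smul_right]

theorem summable_rep_mul {J : Type} {u v : J → E} (hs : Summable fun j => ‖u j‖ * ‖v j‖)
    (A B : E →L[ℂ] E) : Summable fun j => ‖A (u j)‖ * ‖B (v j)‖ := by
  refine Summable.of_nonneg_of_le (fun j => by positivity) (fun j => ?_)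
    (hs.mul_left (‖A‖ * ‖B‖))
  calc ‖A (u j)‖ * ‖B (v j)‖ ≤ (‖A‖ * ‖u j‖) * (‖B‖ * ‖v j‖) := by
        gcongr
        · exact A.le_opNorm _
        · exact B.le_opNorm _
    _ = _ := by ring

theorem opTrace_mul_rep {J : Type} {u v : J → E} {T : E →L[ℂ] E} (h : IsRep u v T)
    (hs : Summable fun j => ‖u j‖ * ‖v j‖) (A : E →L[ℂ] E) :
    opTrace (A * T) = ∑' j, inner ℂ (v j) (A (u j)) := by
  have h1 := h.mul A 1
  rw [mul_one] at h1
  rw [opTrace_rep h1 (by simpa using summable_rep_mul hs A (1 : E →L[ℂ] E).adjoint)]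
  simp [ContinuousLinearMap.adjoint_inner_left]

theorem opTrace_mul_rep' {J : Type} {u v : J → E} {T : E →L[ℂ] E} (h : IsRep u v T)
    (hs : Summable fun j => ‖u j‖ * ‖v j‖) (A : E →L[ℂ] E) :
    opTrace (T * A) = ∑' j, inner ℂ (v j) (A (u j)) := by
  have h1 := h.mul 1 A
  rw [one_mul] at h1
  rw [opTrace_rep h1 (by simpa using summable_rep_mul hs 1 A.adjoint)]
  simp [ContinuousLinearMap.adjoint_inner_left]

theorem opTrace_comm {T : E →L[ℂ] E} (hT : traceNorm T ≠ ∞) (A : E →L[ℂ] E) :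
    opTrace (A * T) = opTrace (T * A) := by
  obtain ⟨u, v, h, hs, -⟩ := exists_rep_summable hT
  rw [opTrace_mul_rep h hs, opTrace_mul_rep' h hs]

theorem norm_opTrace_mul_le {T : E →L[ℂ] E} (hT : traceNorm T ≠ ∞) (A : E →L[ℂ] E) :
    ‖opTrace (A * T)‖ ≤ ‖A‖ * (traceNorm T).toReal := by
  obtain ⟨u, v, h, hs, hle⟩ := exists_rep_summable hT
  rw [opTrace_mul_rep h hs]
  have h1 : ∀ j, ‖inner ℂ (v j) (A (u j))‖ ≤ ‖A‖ * (‖u j‖ * ‖v j‖) := fun j => by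
    refine (norm_inner_le_norm _ _).trans ?_
    have := mul_le_mul_of_nonneg_left (A.le_opNorm (u j)) (norm_nonneg (v j))
    linarith
  have h2 := hs.mul_left ‖A‖
  refine (tsum_of_norm_bounded h2.hasSum h1).trans ?_
  rw [tsum_mul_left]
  gcongr

theorem isRep_rankOne (u v : E) :
    IsRep (fun _ : Unit => u) (fun _ => v) (InnerProductSpace.rankOne ℂ u v) := fun x => by
  exact hasSum_unique (fun _ : Unit => inner ℂ v x • u)

theorem traceNorm_rankOne_le (u v : E) :
    traceNorm (InnerProductSpace.rankOne ℂ u v) ≤ ‖u‖ₑ * ‖v‖ₑ := by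
  refine (traceNorm_le_rep (isRep_rankOne u v)).trans (le_of_eq ?_)
  rw [repSize, tsum_fintype, Finset.univ_unique, Finset.sum_singleton]

theorem traceNorm_rankOne_ne_top (u v : E) :
    traceNorm (InnerProductSpace.rankOne ℂ u v) ≠ ∞ :=
  ne_top_of_le_ne_top (by finiteness) (traceNorm_rankOne_le u v)

theorem opTrace_mul_rankOne (A : E →L[ℂ] E) (u v : E) :
    opTrace (A * InnerProductSpace.rankOne ℂ u v) = inner ℂ v (A u) := by
  rw [opTrace_mul_rep (isRep_rankOne u v) (Summable.of_finite), tsum_fintype, Finset.univ_unique, Finset.sum_singleton]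

theorem eq_of_opTrace_mul_eq {S T : E →L[ℂ] E}
    (h : ∀ A : E →L[ℂ] E, traceNorm A ≠ ∞ → opTrace (S * A) = opTrace (T * A)) : S = T := by
  refine ContinuousLinearMap.ext fun x => ext_inner_left ℂ fun y => ?_
  rw [← opTrace_mul_rankOne, ← opTrace_mul_rankOne, h _ (traceNorm_rankOne_ne_top x y)]

end TraceClass

section Stone
variable {E : Type} [NormedAddCommGroup E] [InnerProductSpace ℂ E] [CompleteSpace E]

theorem tendsto_of_dense {X : Type} {l : Filter X} {F : X → E →L[ℂ] E} {G : E →L[ℂ] E} {C : ℝ}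
    (hF : ∀ a, ‖F a‖ ≤ C) {S : Set E} (hS : Dense S)
    (h : ∀ x ∈ S, Tendsto (fun a => F a x) l (𝓝 (G x))) (x : E) :
    Tendsto (fun a => F a x) l (𝓝 (G x)) := by
  rw [Metric.tendsto_nhds]
  intro ε hε
  have hK : 0 < |C| + ‖G‖ + 1 := by positivity
  obtain ⟨y, hyS, hy⟩ := hS.exists_dist_lt x (div_pos (half_pos hε) hK)
  filter_upwards [Metric.tendsto_nhds.1 (h y hyS) (ε / 2) (half_pos hε)] with a ha
  have h1 : dist (F a x) (F a y) ≤ |C| * dist x y := by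
    rw [dist_eq_norm, dist_eq_norm, ← map_sub]
    exact ((F a).le_opNorm _).trans
      (mul_le_mul_of_nonneg_right ((hF a).trans (le_abs_self C)) (norm_nonneg _))
  have h2 : dist (G y) (G x) ≤ ‖G‖ * dist x y := by
    rw [dist_comm, dist_eq_norm, dist_eq_norm, ← map_sub]
    exact G.le_opNorm _
  have h3 : (|C| + ‖G‖) * dist x y ≤ (|C| + ‖G‖ + 1) * dist x y := by
    nlinarith [dist_nonneg (x := x) (y := y)]
  have h4 : (|C| + ‖G‖ + 1) * dist x y < ε / 2 := by
    rw [lt_div_iff₀ hK] at hy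
    linarith
  have := dist_triangle4 (F a x) (F a y) (G y) (G x)
  linarith

variable {A : E →ₗ.[ℂ] E}

theorem mem_graph_iff_of_isSelfAdjoint (hA : IsSelfAdjoint A) {a b : E} :
    (a, b) ∈ A.graph ↔ ∀ x y, (x, y) ∈ A.graph → inner ℂ y a = inner ℂ x b := by
  have h := A.adjoint_graph_eq_graph_adjoint hA.dense_domain
  rw [LinearPMap.isSelfAdjoint_def.1 hA] at h
  conv_lhs => rw [h]
  rw [Submodule.mem_adjoint_iff]
  simp only [sub_eq_zero]

theorem inner_graph_comm (hA : IsSelfAdjoint A) {x y a b : E} (h : (x, y) ∈ A.graph)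
    (h' : (a, b) ∈ A.graph) : inner ℂ y a = inner ℂ x b :=
  (mem_graph_iff_of_isSelfAdjoint hA).1 h' x y h

theorem dense_graph_fst (hA : IsSelfAdjoint A) : Dense {x : E | ∃ y, (x, y) ∈ A.graph} := by
  refine hA.dense_domain.mono fun x hx => ?_
  exact ⟨A ⟨x, hx⟩, A.mem_graph ⟨x, hx⟩⟩

theorem eq_of_inner_graph (hA : IsSelfAdjoint A) {a b : E}
    (h : ∀ x y, (x, y) ∈ A.graph → inner ℂ x a = inner ℂ x b) : a = b := by
  refine (dense_graph_fst hA).eq_of_inner_right ℂ fun x hx => ?_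
  obtain ⟨y, hy⟩ := hx
  exact h x y hy

theorem isClosed_graph (hA : IsSelfAdjoint A) : IsClosed (A.graph : Set (E × E)) := hA.isClosed

theorem norm_sq_add_smul (hA : IsSelfAdjoint A) {c : ℂ} (hc : star c = -c) (hc1 : ‖c‖ = 1)
    {x y : E} (h : (x, y) ∈ A.graph) : ‖y + c • x‖ ^ 2 = ‖y‖ ^ 2 + ‖x‖ ^ 2 := by
  have h1 : (inner ℂ y (c • x)).re = 0 := by
    have h2 := inner_graph_comm hA h h
    have h3 : (starRingEnd ℂ) (inner ℂ y (c • x)) = - inner ℂ y (c • x) := by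
      rw [inner_smul_right, map_mul, inner_conj_symm, ← h2]
      change star c * _ = _
      rw [hc]; ring
    have := congrArg Complex.re h3
    simp only [Complex.conj_re, Complex.neg_re] at this
    linarith
  rw [@norm_add_sq ℂ]
  have : RCLike.re (inner ℂ y (c • x)) = 0 := h1
  rw [this, norm_smul, hc1]
  ring

theorem exists_graph_add_smul (hA : IsSelfAdjoint A) {c : ℂ} (hc : star c = -c) (hc1 : ‖c‖ = 1)
    (ψ : E) : ∃ x y, (x, y) ∈ A.graph ∧ y + c • x = ψ := by
  haveI : CompleteSpace A.graph := (isClosed_graph hA).completeSpace_coe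
  let f : A.graph →L[ℂ] E :=
    (ContinuousLinearMap.snd ℂ E E + c • ContinuousLinearMap.fst ℂ E E) ∘L A.graph.subtypeL
  have hf : ∀ g : A.graph, f g = g.1.2 + c • g.1.1 := fun g => rfl
  have hanti : AntilipschitzWith 1 f := by
    refine ContinuousLinearMap.antilipschitz_of_bound f fun g => ?_
    have h := norm_sq_add_smul hA hc hc1 (x := g.1.1) (y := g.1.2) g.2
    rw [NNReal.coe_one, one_mul, hf]
    change max ‖g.1.1‖ ‖g.1.2‖ ≤ _
    refine max_le ?_ ?_ <;> refine abs_le_of_sq_le_sq' ?_ (norm_nonneg _) |>.2 <;> rw [h] <;>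
      nlinarith [sq_nonneg ‖g.1.1‖, sq_nonneg ‖g.1.2‖]
  have hclosed : IsClosed (Set.range f) := hanti.isClosed_range f.uniformContinuous
  let K : Submodule ℂ E := LinearMap.range f.toLinearMap
  have hK : K.topologicalClosure = K := IsClosed.submodule_topologicalClosure_eq hclosed
  have hperp : Kᗮ = ⊥ := by
    rw [Submodule.eq_bot_iff]
    intro z hz
    have h1 : ∀ x y, (x, y) ∈ A.graph → inner ℂ y z = inner ℂ x (c • z) := fun x y hxy => by
      have := hz (f ⟨(x, y), hxy⟩) ⟨_, rfl⟩
      rw [hf, inner_add_left, inner_smul_left] at this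
      rw [inner_smul_right]
      have h2 : (starRingEnd ℂ) c = -c := hc
      rw [h2] at this
      linear_combination this
    have h2 := (mem_graph_iff_of_isSelfAdjoint hA).2 h1
    have h3 := norm_sq_add_smul hA hc hc1 h2
    have h4 := norm_sq_add_smul hA (c := -c) (by rw [star_neg, hc]) (by rw [norm_neg, hc1]) h2
    rw [neg_smul, add_neg_cancel, norm_zero] at h4
    have : ‖z‖ ^ 2 = 0 := by nlinarith [sq_nonneg ‖z‖, sq_nonneg ‖c • z‖]
    exact norm_eq_zero.1 (pow_eq_zero_iff two_ne_zero |>.1 this)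
  have htop : K = ⊤ := by
    rw [← hK, Submodule.topologicalClosure_eq_top_iff, hperp]
  obtain ⟨g, hg⟩ : ψ ∈ K := by rw [htop]; trivial
  exact ⟨g.1.1, g.1.2, g.2, hg⟩

theorem exists_resolvent (hA : IsSelfAdjoint A) :
    ∃ R : E →L[ℂ] E, ∀ x y, (x, y) ∈ A.graph ↔ x = R (y + Complex.I • x) := by
  have hc : star Complex.I = -Complex.I := Complex.conj_I
  have hc1 := Complex.norm_I
  choose X Y hXY hsum using exists_graph_add_smul hA hc hc1
  have huniq : ∀ x y x' y' : E, (x, y) ∈ A.graph → (x', y') ∈ A.graph →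
      y + Complex.I • x = y' + Complex.I • x' → x = x' := fun x y x' y' h h' he => by
    have h1 := norm_sq_add_smul hA hc hc1 (A.graph.sub_mem h h')
    have h2 : (y - y') + Complex.I • (x - x') = 0 := by
      rw [smul_sub]; rw [← sub_eq_zero] at he; rw [← he]; abel
    change ‖(y - y') + Complex.I • (x - x')‖ ^ 2 = ‖y - y'‖ ^ 2 + ‖x - x'‖ ^ 2 at h1
    rw [h2, norm_zero] at h1
    have : ‖x - x'‖ ^ 2 = 0 := by nlinarith [sq_nonneg ‖x - x'‖, sq_nonneg ‖y - y'‖]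
    exact sub_eq_zero.1 (norm_eq_zero.1 (pow_eq_zero_iff two_ne_zero |>.1 this))
  let R : E →L[ℂ] E := LinearMap.mkContinuous
    { toFun := X
      map_add' := fun a b => huniq _ (Y (a + b)) _ (Y a + Y b) (hXY _)
        (A.graph.add_mem (hXY a) (hXY b)) (by
          change _ = Y a + Y b + Complex.I • (X a + X b)
          rw [hsum, smul_add, ← hsum a, ← hsum b]
          simp only [hsum]
          nth_rewrite 1 [← hsum a, ← hsum b]; abel)
      map_smul' := fun r a => huniq _ (Y (r • a)) _ (r • Y a) (hXY _)
        (A.graph.smul_mem r (hXY a)) (by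
          change _ = r • Y a + Complex.I • r • X a
          rw [hsum, smul_comm, ← smul_add, hsum]) } 1 (fun ψ => by
    change ‖X ψ‖ ≤ _
    rw [one_mul]
    have h := norm_sq_add_smul hA hc hc1 (hXY ψ)
    rw [hsum] at h
    exact (abs_le_of_sq_le_sq' (by nlinarith [sq_nonneg ‖Y ψ‖]) (norm_nonneg _)).2)
  refine ⟨R, fun x y => ⟨fun h => huniq _ _ _ _ h (hXY _) (hsum _).symm, fun h => ?_⟩⟩
  have h1 := hXY (y + Complex.I • x)
  have h2 := hsum (y + Complex.I • x)
  have h3 : X (y + Complex.I • x) = x := h.symm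
  rw [h3] at h1 h2
  rwa [add_right_cancel h2] at h1

theorem isStarNormal_resolvent (hA : IsSelfAdjoint A) {R : E →L[ℂ] E}
    (hR : ∀ x y, (x, y) ∈ A.graph ↔ x = R (y + Complex.I • x)) :
    IsStarNormal R ∧ star R = R + (2 * Complex.I) • (star R * R) := by
  have hg : ∀ ψ, (R ψ, ψ - Complex.I • R ψ) ∈ A.graph := fun ψ => by
    rw [hR, sub_add_cancel]
  have h1 : star R = R + (2 * Complex.I) • (star R * R) := by
    refine ContinuousLinearMap.ext fun φ => ext_inner_left ℂ fun ψ => ?_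
    rw [ContinuousLinearMap.star_eq_adjoint, add_apply, smul_apply, mul_apply_eq_comp,
      inner_add_right, inner_smul_right, ContinuousLinearMap.adjoint_inner_right,
      ContinuousLinearMap.adjoint_inner_right]
    have h := inner_graph_comm hA (hg ψ) (hg φ)
    rw [inner_sub_left, inner_sub_right, inner_smul_left, inner_smul_right, Complex.conj_I] at h
    linear_combination -h
  refine ⟨⟨?_⟩, h1⟩
  let W : E →L[ℂ] E := 1 - (2 * Complex.I) • R
  have hW : star W = 1 + (2 * Complex.I) • star R := by
    simp [W, star_sub, star_smul]
  have hI : (2 * Complex.I) * (2 * Complex.I) = -4 := by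
    linear_combination 4 * Complex.I_mul_I
  have hWW : star W * W = 1 := by
    rw [hW]
    have : (1 + (2 * Complex.I) • star R) * W = 1 + (2 * Complex.I) • (star R -
        (R + (2 * Complex.I) • (star R * R))) := by
      simp only [W, mul_sub, add_mul, mul_one, one_mul, smul_mul_assoc, mul_smul_comm, smul_sub,
        smul_add, smul_smul]
      abel
    rw [this, ← h1, sub_self, smul_zero, add_zero]
  have hsurj : Function.Surjective W := fun ψ => by
    obtain ⟨x, y, hxy, rfl⟩ := exists_graph_add_smul hA (c := -Complex.I)
      (by rw [star_neg]; exact congrArg _ Complex.conj_I) (by rw [norm_neg, Complex.norm_I]) ψ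
    refine ⟨y + Complex.I • x, ?_⟩
    change (y + Complex.I • x) - (2 * Complex.I) • R (y + Complex.I • x) = _
    rw [← (hR x y).1 hxy]
    module
  have hWW' : W * star W = 1 := by
    refine ContinuousLinearMap.ext fun ψ => ?_
    obtain ⟨φ, rfl⟩ := hsurj ψ
    rw [← mul_apply_eq_comp, mul_assoc, hWW, mul_one, one_apply_eq_self]
  have h2 : star R = R + (2 * Complex.I) • (R * star R) := by
    rw [hW] at hWW'
    have : W * (1 + (2 * Complex.I) • star R) = 1 + (2 * Complex.I) • (star R -
        (R + (2 * Complex.I) • (R * star R))) := by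
      simp only [W, mul_add, sub_mul, mul_one, one_mul, smul_mul_assoc, mul_smul_comm, smul_sub,
        smul_add, smul_smul]
      abel
    rw [this, add_eq_left] at hWW'
    exact sub_eq_zero.1 ((smul_eq_zero.1 hWW').resolve_left (by simp))
  have h3 := h1.symm.trans h2
  exact smul_right_injective _ (by simp : (2 * Complex.I) ≠ 0) (add_left_cancel h3)

/-- The function `z ↦ z e^{ita}` with `a = Re (1/z)`. -/
noncomputable def resolventPhase (t : ℝ) (z : ℂ) : ℂ := z * Complex.exp (((t * (z⁻¹).re : ℝ) : ℂ) * Complex.I)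

theorem norm_resolventPhase (t : ℝ) (z : ℂ) : ‖resolventPhase t z‖ = ‖z‖ := by
  rw [resolventPhase, norm_mul, Complex.norm_exp_ofReal_mul_I, mul_one]

theorem continuous_resolventPhase (t : ℝ) : Continuous (resolventPhase t) := by
  rw [continuous_iff_continuousAt]
  intro z
  rcases eq_or_ne z 0 with rfl | hz
  · have h0 : resolventPhase t 0 = 0 := by simp [resolventPhase]
    rw [ContinuousAt, h0, tendsto_zero_iff_norm_tendsto_zero]
    simp only [norm_resolventPhase]
    simpa using (continuous_norm (E := ℂ)).tendsto 0
  · have h1 : ContinuousAt (fun z : ℂ => (z⁻¹).re) z :=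
      Complex.continuous_re.continuousAt.comp (continuousAt_inv₀ hz)
    unfold resolventPhase
    refine continuousAt_id.mul (Complex.continuous_exp.continuousAt.comp ?_)
    exact (Complex.continuous_ofReal.continuousAt.comp (continuousAt_const.mul h1)).mul
      continuousAt_const

theorem norm_mul_re_inv_le (z : ℂ) : ‖z‖ * |(z⁻¹).re| ≤ 1 := by
  refine (mul_le_mul_of_nonneg_left (Complex.abs_re_le_norm _) (norm_nonneg _)).trans ?_
  rw [← norm_mul]
  rcases eq_or_ne z 0 with rfl | hz
  · simp
  · rw [mul_inv_cancel₀ hz, norm_one]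

theorem norm_exp_ofReal_mul_I_sub_one_le (x : ℝ) : ‖Complex.exp ((x : ℂ) * Complex.I) - 1‖ ≤ |x| := by
  have := Real.norm_exp_I_mul_ofReal_sub_one_le (x := x)
  rwa [mul_comm, Real.norm_eq_abs] at this

theorem norm_exp_ofReal_mul_I_sub_le (x : ℝ) :
    ‖Complex.exp ((x : ℂ) * Complex.I) - 1 - x * Complex.I‖ ≤ 2 * x ^ 2 := by
  have hx : ‖(x : ℂ) * Complex.I‖ = |x| := by simp
  rcases le_total |x| 1 with h | h
  · refine (Complex.norm_exp_sub_one_sub_id_le (by rw [hx]; exact h)).trans ?_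
    rw [hx, sq_abs]
    nlinarith [sq_nonneg x]
  · refine (norm_sub_le _ _).trans ?_
    rw [hx]
    have := norm_exp_ofReal_mul_I_sub_one_le x
    nlinarith [sq_abs x]

theorem norm_resolventPhase_sub_le (s t : ℝ) (z : ℂ) :
    ‖resolventPhase t z - resolventPhase s z‖ ≤ |t - s| := by
  have h : resolventPhase t z - resolventPhase s z = resolventPhase s z *
      (Complex.exp ((((t - s) * (z⁻¹).re : ℝ) : ℂ) * Complex.I) - 1) := by
    simp only [resolventPhase]
    rw [mul_sub, mul_assoc, ← Complex.exp_add, mul_one]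
    congr 3
    push_cast; ring
  rw [h, norm_mul, norm_resolventPhase]
  refine (mul_le_mul_of_nonneg_left (norm_exp_ofReal_mul_I_sub_one_le _) (norm_nonneg _)).trans ?_
  rw [abs_mul]
  nlinarith [norm_mul_re_inv_le z, abs_nonneg (t - s)]

theorem norm_resolventPhase_deriv_le (t : ℝ) {z : ℂ}
    (hz : star z = z + 2 * Complex.I * (star z * z)) :
    ‖resolventPhase t z * z - z * z - (t : ℂ) * (Complex.I * (z - Complex.I * z * z))‖ ≤ 2 * t ^ 2 := by
  rcases eq_or_ne z 0 with rfl | h0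
  · simp [resolventPhase]; positivity
  have h1 : (((z⁻¹).re : ℝ) : ℂ) = z⁻¹ - Complex.I := by
    have hs : star z ≠ 0 := star_ne_zero.2 h0
    have h2 : star z⁻¹ = z⁻¹ - 2 * Complex.I := by
      rw [star_inv₀]
      field_simp
      linear_combination -hz
    have h3 := Complex.re_eq_add_conj z⁻¹
    rw [h3]
    change (z⁻¹ + star z⁻¹) / 2 = _
    rw [h2]; ring
  have h : resolventPhase t z * z - z * z - (t : ℂ) * (Complex.I * (z - Complex.I * z * z)) =
      z * z * (Complex.exp (((t * (z⁻¹).re : ℝ) : ℂ) * Complex.I) - 1 -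
        ((t * (z⁻¹).re : ℝ) : ℂ) * Complex.I) := by
    have h4 : z * z * (((t * (z⁻¹).re : ℝ) : ℂ) * Complex.I) =
        (t : ℂ) * (Complex.I * (z - Complex.I * z * z)) := by
      push_cast
      rw [h1]
      field_simp
    linear_combination (norm := skip) h4
    rw [resolventPhase]
    ring
  rw [h, norm_mul, norm_mul]
  refine (mul_le_mul_of_nonneg_left (norm_exp_ofReal_mul_I_sub_le _) (by positivity)).trans ?_
  have h5 := norm_mul_re_inv_le z
  have h6 : (‖z‖ * |(z⁻¹).re|) ^ 2 ≤ 1 := pow_le_one₀ (by positivity) h5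
  rw [mul_pow, sq_abs] at h6
  calc ‖z‖ * ‖z‖ * (2 * (t * (z⁻¹).re) ^ 2) = 2 * t ^ 2 * (‖z‖ ^ 2 * (z⁻¹).re ^ 2) := by ring
    _ ≤ 2 * t ^ 2 * 1 := by gcongr
    _ = _ := mul_one _

theorem isometry_inner {V : E →L[ℂ] E} (h : ∀ x, ‖V x‖ = ‖x‖) (x y : E) :
    inner ℂ (V x) (V y) = inner ℂ x y :=
  LinearIsometry.inner_map_map ⟨V.toLinearMap, h⟩ x y

/-- Stone's theorem. -/
theorem exists_isUnitaryGroupOf (hA : IsSelfAdjoint A) : ∃ V, IsUnitaryGroupOf A V := by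
  obtain ⟨R, hR⟩ := exists_resolvent hA
  obtain ⟨hN, hstar⟩ := isStarNormal_resolvent hA hR
  have hspec : ∀ z ∈ spectrum ℂ R, star z = z + 2 * Complex.I * (star z * z) := by
    have h1 : cfc (fun z : ℂ => star z) R =
        cfc (fun z : ℂ => z + 2 * Complex.I * (star z * z)) R := by
      rw [cfc_star_id (R := ℂ) R, cfc_add (R := ℂ) R (fun z => z) (fun z => 2 * Complex.I * (star z * z)) (by fun_prop) (by fun_prop),
        cfc_const_mul (2 * Complex.I) (fun z : ℂ => star z * z) R, cfc_mul (fun z : ℂ => star z) (fun z => z) R,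
        cfc_star_id (R := ℂ) R, cfc_id' ℂ R]
      exact hstar
    exact (cfc_eq_cfc_iff_eqOn (by assumption) (by fun_prop) (by fun_prop)).1 h1
  let C : ℝ → E →L[ℂ] E := fun t => cfc (resolventPhase t) R
  have hcont : ∀ t, ContinuousOn (resolventPhase t) (spectrum ℂ R) := fun t =>
    (continuous_resolventPhase t).continuousOn
  have hC0 : C 0 = R := by
    have : resolventPhase 0 = fun z => z := by funext z; simp [resolventPhase]
    simp only [C, this]
    exact cfc_id' ℂ R
  have hCadd : ∀ s t, C s * C t = C (s + t) * R := fun s t => by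
    have h : C (s + t) * R = cfc (fun z => resolventPhase (s + t) z * z) R := by
      rw [cfc_mul (resolventPhase (s + t)) (fun z => z) R (hcont _), cfc_id' ℂ R]
    rw [h, ← cfc_mul (resolventPhase s) (resolventPhase t) R (hcont s) (hcont t)]
    congr 1
    funext z
    simp only [resolventPhase]
    rw [mul_mul_mul_comm, ← Complex.exp_add, mul_right_comm]
    congr 2
    push_cast; ring_nf
  have hCR : ∀ t, C t * R = R * C t := fun t => by
    have h1 := hCadd t 0
    have h2 := hCadd 0 t
    rw [hC0] at h1 h2
    rw [add_zero] at h1; rw [zero_add] at h2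
    rw [← h2]
  have hCnorm : ∀ t x, ‖C t x‖ = ‖R x‖ := fun t x => by
    have h : star (C t) * C t = star R * R := by
      have h1 : star (C t) = cfc (fun z => star (resolventPhase t z)) R := (cfc_star _ _).symm
      have h2 : star R * R = cfc (fun z : ℂ => star z * z) R := by
        rw [cfc_mul (fun z : ℂ => star z) (fun z => z) R, cfc_star_id (R := ℂ) R, cfc_id' ℂ R]
      rw [h1, h2, ← cfc_mul (fun z => star (resolventPhase t z)) (resolventPhase t) R
        ((continuous_resolventPhase t).star.continuousOn) (hcont t)]
      congr 1
      funext z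
      change (starRingEnd ℂ) _ * _ = (starRingEnd ℂ) _ * _
      rw [← Complex.normSq_eq_conj_mul_self, ← Complex.normSq_eq_conj_mul_self,
        Complex.normSq_eq_norm_sq, Complex.normSq_eq_norm_sq, norm_resolventPhase]
    have h3 : inner ℂ (C t x) (C t x) = inner ℂ (R x) (R x) := by
      rw [← ContinuousLinearMap.adjoint_inner_right, ← ContinuousLinearMap.adjoint_inner_right,
        ← ContinuousLinearMap.star_eq_adjoint, ← ContinuousLinearMap.star_eq_adjoint,
        ← mul_apply_eq_comp, ← mul_apply_eq_comp, h]
    rw [inner_self_eq_norm_sq_to_K, inner_self_eq_norm_sq_to_K] at h3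
    exact (pow_left_inj₀ (norm_nonneg _) (norm_nonneg _) two_ne_zero).1 (by exact_mod_cast h3)
  have hRdense : DenseRange R := by
    refine (dense_graph_fst hA).mono ?_
    rintro x ⟨y, hy⟩
    exact ⟨_, ((hR x y).1 hy).symm⟩
  have hle : ∀ t x, ‖(C t).toLinearMap x‖ ≤ 1 * ‖R.toLinearMap x‖ := fun t x => by
    rw [one_mul]; exact (hCnorm t x).le
  let V : ℝ → E →L[ℂ] E := fun t => (C t).toLinearMap.extendOfNorm R.toLinearMap
  have hV : ∀ t x, V t (R x) = C t x := fun t x =>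
    LinearMap.extendOfNorm_eq (f := (C t).toLinearMap) (e := R.toLinearMap) hRdense ⟨1, hle t⟩ x
  have hVnorm : ∀ t, ‖V t‖ ≤ 1 := fun t =>
    LinearMap.opNorm_extendOfNorm_le hRdense zero_le_one (hle t)
  have hiso : ∀ t ψ, ‖V t ψ‖ = ‖ψ‖ := fun t => by
    refine fun ψ => hRdense.induction_on (p := fun ψ => ‖V t ψ‖ = ‖ψ‖) ψ
      (isClosed_eq (V t).continuous.norm continuous_norm) fun x => ?_
    rw [hV, hCnorm]
  have hadd : ∀ s t, V (s + t) = V s * V t := fun s t => by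
    have hd : DenseRange (R ∘ R) := hRdense.comp hRdense R.continuous
    refine ContinuousLinearMap.ext fun ψ => hd.induction_on
      (p := fun ψ => V (s + t) ψ = (V s * V t) ψ) ψ
      (isClosed_eq (V _).continuous (V s * V t).continuous) fun x => ?_
    have h1 : C t (R x) = R (C t x) := DFunLike.congr_fun (hCR t) x
    have h2 : C s (C t x) = C (s + t) (R x) := DFunLike.congr_fun (hCadd s t) x
    rw [mul_apply_eq_comp, Function.comp_apply, hV, hV, h1, hV, h2]
  have hzero : V 0 = 1 := by
    refine ContinuousLinearMap.ext fun ψ => hRdense.induction_on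
      (p := fun ψ => V 0 ψ = (1 : E →L[ℂ] E) ψ) ψ
      (isClosed_eq (V 0).continuous (1 : E →L[ℂ] E).continuous) fun x => ?_
    rw [hV, hC0]; rfl
  have hCsub : ∀ s t, ‖C t - C s‖ ≤ |t - s| := fun s t => by
    simp only [C]
    rw [← cfc_sub (resolventPhase t) (resolventPhase s) R (hcont t) (hcont s)]
    exact norm_cfc_le (abs_nonneg _) fun z _ => norm_resolventPhase_sub_le s t z
  have hcontV : ∀ ψ, Continuous fun t => V t ψ := fun ψ => by
    rw [continuous_iff_continuousAt]
    intro s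
    refine tendsto_of_dense (F := V) (G := V s) hVnorm (S := Set.range R) hRdense ?_ ψ
    rintro _ ⟨x, rfl⟩
    simp only [hV]
    rw [tendsto_iff_norm_sub_tendsto_zero]
    have h0 : Tendsto (fun t : ℝ => |t - s| * ‖x‖) (𝓝 s) (𝓝 0) := by
      have : Continuous fun t : ℝ => |t - s| * ‖x‖ := by fun_prop
      simpa using this.tendsto s
    refine squeeze_zero (fun _ => norm_nonneg _) (fun t => ?_) h0
    rw [← sub_apply]
    exact ((C t - C s).le_opNorm x).trans
      (mul_le_mul_of_nonneg_right (hCsub s t) (norm_nonneg _))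
  have hgen : ∀ ψ η, (ψ, η) ∈ A.graph → HasDerivAt (fun t => V t ψ) (Complex.I • η) 0 := by
    intro ψ η h
    rw [hasDerivAt_iff_tendsto_slope_zero]
    set φ := η + Complex.I • ψ with hφ
    have hψ : ψ = R φ := (hR ψ η).1 h
    have hη : Complex.I • η = (Complex.I • ((1 : E →L[ℂ] E) - Complex.I • R)) φ := by
      change _ = Complex.I • (φ - Complex.I • R φ)
      rw [← hψ, hφ, add_sub_cancel_right]
    have hF : ∀ t : ℝ, t⁻¹ • (V (0 + t) ψ - V 0 ψ) = (t⁻¹ • (C t - R)) φ := fun t => by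
      rw [zero_add, hψ, hV, hV, hC0]; rfl
    simp only [hF, hη]
    refine tendsto_of_dense (F := fun t : ℝ => t⁻¹ • (C t - R)) (C := 1) (fun t => ?_)
      (S := Set.range R) hRdense ?_ φ
    · rw [norm_smul, ← hC0, norm_inv, Real.norm_eq_abs]
      have := hCsub 0 t
      rw [sub_zero] at this
      exact (mul_le_mul_of_nonneg_left this (by positivity)).trans (inv_mul_le_one)
    · rintro _ ⟨x, rfl⟩
      rw [tendsto_iff_norm_sub_tendsto_zero]
      have h0 : Tendsto (fun t : ℝ => 2 * |t| * ‖x‖) (𝓝[≠] 0) (𝓝 0) := by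
        have : Continuous fun t : ℝ => 2 * |t| * ‖x‖ := by fun_prop
        simpa using (this.tendsto 0).mono_left nhdsWithin_le_nhds
      refine squeeze_zero' (Eventually.of_forall fun _ => norm_nonneg _) ?_ h0
      filter_upwards [self_mem_nhdsWithin] with t ht
      have ht0 : t ≠ 0 := ht
      have hD : ‖C t * R - R * R - (t : ℂ) • (Complex.I • (R - Complex.I • (R * R)))‖ ≤ 2 * t ^ 2 := by
        have hid : C t * R - R * R - (t : ℂ) • (Complex.I • (R - Complex.I • (R * R))) =
            cfc (fun z => resolventPhase t z * z - z * z -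
              (t : ℂ) * (Complex.I * (z - Complex.I * z * z))) R := by
          have hc1 := hcont t
          rw [cfc_sub (fun z => resolventPhase t z * z - z * z) (fun z : ℂ =>
              (t : ℂ) * (Complex.I * (z - Complex.I * z * z))) R (by fun_prop) (by fun_prop),
            cfc_sub (fun z => resolventPhase t z * z) (fun z : ℂ => z * z) R (by fun_prop) (by fun_prop),
            cfc_mul (resolventPhase t) (fun z => z) R hc1 (by fun_prop),
            cfc_mul (fun z : ℂ => z) (fun z => z) R (by fun_prop) (by fun_prop),
            cfc_const_mul (t : ℂ) (fun z : ℂ => Complex.I * (z - Complex.I * z * z)) R (by fun_prop),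
            cfc_const_mul Complex.I (fun z : ℂ => z - Complex.I * z * z) R (by fun_prop),
            cfc_sub (fun z : ℂ => z) (fun z : ℂ => Complex.I * z * z) R (by fun_prop) (by fun_prop),
            cfc_mul (fun z : ℂ => Complex.I * z) (fun z => z) R (by fun_prop) (by fun_prop),
            cfc_const_mul Complex.I (fun z : ℂ => z) R (by fun_prop), cfc_id' ℂ R, smul_mul_assoc]
        rw [hid]
        exact norm_cfc_le (by positivity) fun z hz => norm_resolventPhase_deriv_le t (hspec z hz)
      have hv : (t⁻¹ • (C t - R)) (R x) - (Complex.I • ((1 : E →L[ℂ] E) - Complex.I • R)) (R x) =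
          t⁻¹ • ((C t * R - R * R - (t : ℂ) • (Complex.I • (R - Complex.I • (R * R)))) x) := by
        change t⁻¹ • (C t (R x) - R (R x)) - Complex.I • (R x - Complex.I • R (R x)) =
          t⁻¹ • (C t (R x) - R (R x) - (t : ℂ) • (Complex.I • (R x - Complex.I • R (R x))))
        rw [smul_sub t⁻¹ (C t (R x) - R (R x))]
        congr 1
        rw [← Complex.coe_smul t⁻¹, smul_smul, ← Complex.ofReal_mul, inv_mul_cancel₀ ht0,
          Complex.ofReal_one, one_smul]
      rw [hv, norm_smul, norm_inv, Real.norm_eq_abs]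
      have h5 := (ContinuousLinearMap.le_opNorm (C t * R - R * R -
        (t : ℂ) • (Complex.I • (R - Complex.I • (R * R)))) x).trans
        (mul_le_mul_of_nonneg_right hD (norm_nonneg x))
      refine (mul_le_mul_of_nonneg_left h5 (by positivity)).trans (le_of_eq ?_)
      have : |t| ≠ 0 := abs_ne_zero.2 ht0
      rw [← sq_abs]
      field_simp
  refine ⟨V, hzero, hadd, hiso, hcontV, fun ψ η => ⟨hgen ψ η, fun h => ?_⟩⟩
  rw [mem_graph_iff_of_isSelfAdjoint hA]
  intro x y hxy
  have h1 : ∀ t, inner ℂ (V (-t) x) ψ = inner ℂ x (V t ψ) := fun t => by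
    have h2 := isometry_inner (hiso t) (V (-t) x) ψ
    rw [← h2, ← mul_apply_eq_comp, ← hadd, add_neg_cancel, hzero]; rfl
  have h2 : HasDerivAt (fun t => V (-t) x) (-(Complex.I • y)) 0 := by
    have h3 := hgen x y hxy
    rw [← neg_zero] at h3
    have := h3.scomp (0 : ℝ) (hasDerivAt_neg (0 : ℝ))
    simp only [neg_smul, one_smul] at this
    exact this
  have h3 := (h2.inner ℂ (hasDerivAt_const (0 : ℝ) ψ)).unique (by
    have := (hasDerivAt_const (0 : ℝ) x).inner ℂ h
    simpa only [h1] using this)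
  simp only [inner_zero_right, inner_zero_left, inner_neg_left, inner_smul_left, inner_smul_right,
    Complex.conj_I, zero_add, add_zero, neg_mul, neg_neg] at h3
  exact mul_left_cancel₀ Complex.I_ne_zero h3

theorem isUnitaryGroupOf_unitaryGroup (hA : IsSelfAdjoint A) :
    IsUnitaryGroupOf A (unitaryGroup A) := by
  have h := exists_isUnitaryGroupOf hA
  rw [unitaryGroup, dif_pos h]
  exact h.choose_spec

end Stone

section UnitaryGroup
variable {E : Type} [NormedAddCommGroup E] [InnerProductSpace ℂ E] [CompleteSpace E]
  {A : E →ₗ.[ℂ] E} {V : ℝ → E →L[ℂ] E}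

theorem forall_of_dense_graph_fst (hA : IsSelfAdjoint A) {p : E → Prop} (hp : IsClosed {x | p x})
    (h : ∀ x ∈ {x : E | ∃ y, (x, y) ∈ A.graph}, p x) (x : E) : p x := by
  have h1 : closure {x : E | ∃ y, (x, y) ∈ A.graph} ⊆ {x | p x} := closure_minimal h hp
  exact h1 (dense_graph_fst hA x)

namespace IsUnitaryGroupOf

theorem mul_neg_self (hV : IsUnitaryGroupOf A V) (t : ℝ) : V t * V (-t) = 1 := by
  rw [← hV.add, add_neg_cancel, hV.zero]

theorem inner_map (hV : IsUnitaryGroupOf A V) (t : ℝ) (x y : E) :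
    inner ℂ (V t x) (V t y) = inner ℂ x y := isometry_inner (hV.isometry t) x y

theorem inner_neg_left (hV : IsUnitaryGroupOf A V) (t : ℝ) (x y : E) :
    inner ℂ (V (-t) x) y = inner ℂ x (V t y) := by
  rw [← hV.inner_map t, ← mul_apply_eq_comp, hV.mul_neg_self]; rfl

theorem adjoint_eq (hV : IsUnitaryGroupOf A V) (t : ℝ) : (V t).adjoint = V (-t) := by
  refine ContinuousLinearMap.ext fun x => ext_inner_right ℂ fun y => ?_
  rw [ContinuousLinearMap.adjoint_inner_left, hV.inner_neg_left]

theorem enorm_le (hV : IsUnitaryGroupOf A V) (t : ℝ) : ‖V t‖ₑ ≤ 1 := by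
  rw [← ofReal_norm]
  exact ENNReal.ofReal_le_one.2 ((V t).opNorm_le_bound zero_le_one fun x => by
    rw [hV.isometry, one_mul])

theorem norm_le (hV : IsUnitaryGroupOf A V) (t : ℝ) : ‖V t‖ ≤ 1 :=
  (V t).opNorm_le_bound zero_le_one fun x => by rw [hV.isometry, one_mul]

theorem hasDerivAt (hV : IsUnitaryGroupOf A V) {ψ η : E} (h : (ψ, η) ∈ A.graph) (t : ℝ) :
    HasDerivAt (fun s => V s ψ) (Complex.I • V t η) t := by
  have h1 := (hV.generator ψ η).1 h
  rw [← sub_self t] at h1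
  have h2 := h1.comp_sub_const t t
  have h3 := ((V t).restrictScalars ℝ).hasFDerivAt.comp_hasDerivAt t h2
  have h4 : HasDerivAt (fun s => V t (V (s - t) ψ)) (V t (Complex.I • η)) t := h3
  rw [map_smul] at h4
  convert h4 using 2 with s
  rw [← mul_apply_eq_comp, ← hV.add, add_sub_cancel]

theorem hasDerivAt_neg (hV : IsUnitaryGroupOf A V) {ψ η : E} (h : (ψ, η) ∈ A.graph) (t : ℝ) :
    HasDerivAt (fun s => V (-s) ψ) (-(Complex.I • V (-t) η)) t := by
  have := (hV.hasDerivAt h (-t)).scomp t (_root_.hasDerivAt_neg t)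
  simp only [neg_smul, one_smul] at this
  exact this

theorem map_graph (hV : IsUnitaryGroupOf A V) {ψ η : E} (h : (ψ, η) ∈ A.graph) (t : ℝ) :
    (V t ψ, V t η) ∈ A.graph := by
  rw [hV.generator]
  have h1 := (hV.generator ψ η).1 h
  have h3 : HasDerivAt (fun s => V t (V s ψ)) (V t (Complex.I • η)) 0 :=
    ((V t).restrictScalars ℝ).hasFDerivAt.comp_hasDerivAt (0 : ℝ) h1
  rw [map_smul] at h3
  convert h3 using 2 with s
  rw [← mul_apply_eq_comp, ← mul_apply_eq_comp, ← hV.add, ← hV.add, add_comm]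

theorem commute_of_map_graph (hA : IsSelfAdjoint A) (hV : IsUnitaryGroupOf A V) {P : E →L[ℂ] E}
    (hP : ∀ ψ η, (ψ, η) ∈ A.graph → (P ψ, P η) ∈ A.graph) (t : ℝ) : P * V t = V t * P := by
  have key : ∀ x y ψ η, (x, y) ∈ A.graph → (ψ, η) ∈ A.graph →
      inner ℂ (V t x) (P (V t ψ)) = inner ℂ x (P ψ) := by
    intro x y ψ η hx hψ
    let g : ℝ → ℂ := fun s => inner ℂ (V s x) (P (V s ψ))
    have hg : ∀ s, HasDerivAt g 0 s := fun s => by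
      have h1 := hV.hasDerivAt hx s
      have h2 : HasDerivAt (fun s => P (V s ψ)) (P (Complex.I • V s η)) s :=
        (P.restrictScalars ℝ).hasFDerivAt.comp_hasDerivAt s (hV.hasDerivAt hψ s)
      have h3 := h1.inner ℂ h2
      have h4 := inner_graph_comm hA (hV.map_graph hx s) (hP _ _ (hV.map_graph hψ s))
      have h6 : inner ℂ (V s x) (P (Complex.I • V s η)) + inner ℂ (Complex.I • V s y) (P (V s ψ)) =
          (0 : ℂ) := by
        rw [map_smul, inner_smul_right, inner_smul_left, h4, Complex.conj_I]
        ring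
      rw [h6] at h3
      exact h3
    have h5 := is_const_of_deriv_eq_zero (fun s => (hg s).differentiableAt) (fun s => (hg s).deriv) t 0
    simp only [g, hV.zero] at h5
    exact h5
  refine ContinuousLinearMap.ext fun ψ => ?_
  refine forall_of_dense_graph_fst hA (p := fun ψ => (P * V t) ψ = (V t * P) ψ)
    (isClosed_eq (P * V t).continuous (V t * P).continuous) ?_ ψ
  rintro ψ ⟨η, hψ⟩
  have h1 : V (-t) (P (V t ψ)) = P ψ := eq_of_inner_graph hA fun x y hx => by
    rw [← hV.inner_map t, ← mul_apply_eq_comp (V t), hV.mul_neg_self, one_apply_eq_self]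
    exact key x y ψ η hx hψ
  rw [mul_apply_eq_comp, mul_apply_eq_comp, ← h1, ← mul_apply_eq_comp (V t), hV.mul_neg_self,
    one_apply_eq_self]

theorem continuous_apply (hV : IsUnitaryGroupOf A V) {f : ℝ → E} (hf : Continuous f) :
    Continuous fun t => V t (f t) := by
  rw [continuous_iff_continuousAt]
  intro s
  rw [ContinuousAt, tendsto_iff_norm_sub_tendsto_zero]
  have h1 : Tendsto (fun t => ‖f t - f s‖ + ‖V t (f s) - V s (f s)‖) (𝓝 s) (𝓝 0) := by
    have h2 := tendsto_iff_norm_sub_tendsto_zero.1 (hf.tendsto s)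
    have h3 := tendsto_iff_norm_sub_tendsto_zero.1 ((hV.continuous (f s)).tendsto s)
    simpa using h2.add h3
  refine squeeze_zero (fun _ => norm_nonneg _) (fun t => ?_) h1
  have : V t (f t) - V s (f s) = V t (f t - f s) + (V t (f s) - V s (f s)) := by
    rw [map_sub]; abel
  rw [this]
  exact (norm_add_le _ _).trans (by rw [hV.isometry])

theorem continuous_neg_apply (hV : IsUnitaryGroupOf A V) (x : E) :
    Continuous fun t => V (-t) x := (hV.continuous x).comp continuous_neg

theorem continuous_conj (hV : IsUnitaryGroupOf A V) (S : E →L[ℂ] E) (x : E) :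
    Continuous fun t => (V t * S * V (-t)) x :=
  hV.continuous_apply (S.continuous.comp (hV.continuous_neg_apply x))

end IsUnitaryGroupOf

/-- `S` is the bounded extension of `i[A, T]`, and `T` preserves the domain of `A`. -/
def IsComm (A : E →ₗ.[ℂ] E) (T S : E →L[ℂ] E) : Prop :=
  ∀ ψ η, (ψ, η) ∈ A.graph → ∃ ξ, (T ψ, ξ) ∈ A.graph ∧ S ψ = Complex.I • (ξ - T η)

theorem IsComm.unique (hA : IsSelfAdjoint A) {T S S' : E →L[ℂ] E} (h : IsComm A T S)
    (h' : IsComm A T S') : S = S' := by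
  refine ContinuousLinearMap.ext fun ψ => ?_
  refine forall_of_dense_graph_fst hA (p := fun ψ => S ψ = S' ψ)
    (isClosed_eq S.continuous S'.continuous) ?_ ψ
  rintro ψ ⟨η, hψ⟩
  obtain ⟨ξ, h1, h2⟩ := h ψ η hψ
  obtain ⟨ξ', h1', h2'⟩ := h' ψ η hψ
  have : ξ = ξ' := by
    have h3 := A.graph.sub_mem h1 h1'
    have h4 : ((0 : E), ξ - ξ') ∈ A.graph := by
      have : (T ψ, ξ) - (T ψ, ξ') = ((0 : E), ξ - ξ') := by ext <;> simp
      rwa [this] at h3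
    exact sub_eq_zero.1 (A.graph_fst_eq_zero_snd h4 rfl)
  rw [h2, h2', this]

theorem isComm_zero : IsComm A (0 : E →L[ℂ] E) 0 := fun ψ η h =>
  ⟨0, A.graph.zero_mem, by simp⟩

theorem IsComm.add {T S T' S' : E →L[ℂ] E} (h : IsComm A T S) (h' : IsComm A T' S') :
    IsComm A (T + T') (S + S') := fun ψ η hψ => by
  obtain ⟨ξ, h1, h2⟩ := h ψ η hψ
  obtain ⟨ξ', h1', h2'⟩ := h' ψ η hψ
  refine ⟨ξ + ξ', A.graph.add_mem h1 h1', ?_⟩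
  rw [add_apply, add_apply, h2, h2']
  module

theorem IsComm.smul {T S : E →L[ℂ] E} (h : IsComm A T S) (c : ℂ) :
    IsComm A (c • T) (c • S) := fun ψ η hψ => by
  obtain ⟨ξ, h1, h2⟩ := h ψ η hψ
  refine ⟨c • ξ, A.graph.smul_mem c h1, ?_⟩
  rw [smul_apply, smul_apply, h2]
  module

theorem IsComm.sum {ι : Type} (s : Finset ι) {T S : ι → E →L[ℂ] E}
    (h : ∀ i ∈ s, IsComm A (T i) (S i)) : IsComm A (∑ i ∈ s, T i) (∑ i ∈ s, S i) := by
  classical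
  induction s using Finset.induction_on with
  | empty => simpa using isComm_zero
  | insert i s hi ih =>
    rw [Finset.sum_insert hi, Finset.sum_insert hi]
    exact (h i (Finset.mem_insert_self _ _)).add (ih fun j hj => h j (Finset.mem_insert_of_mem hj))

theorem isComm_of_tendsto (hA : IsSelfAdjoint A) {T S : ℕ → E →L[ℂ] E} {T' S' : E →L[ℂ] E}
    (h : ∀ n, IsComm A (T n) (S n)) (hT : ∀ x, Tendsto (fun n => T n x) atTop (𝓝 (T' x)))
    (hS : ∀ x, Tendsto (fun n => S n x) atTop (𝓝 (S' x))) : IsComm A T' S' := by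
  intro ψ η hψ
  choose ξ h1 h2 using fun n => h n ψ η hψ
  have h3 : ∀ n, ξ n = T n η - Complex.I • S n ψ := fun n => by
    rw [h2, smul_smul, Complex.I_mul_I]; module
  refine ⟨T' η - Complex.I • S' ψ, ?_, ?_⟩
  · refine (isClosed_graph hA).mem_of_tendsto ((hT ψ).prodMk_nhds
      ((hT η).sub ((hS ψ).const_smul Complex.I))) (Eventually.of_forall fun n => ?_)
    have := h1 n
    rwa [h3 n] at this
  · rw [sub_sub_cancel_left, smul_neg, smul_smul, Complex.I_mul_I]; module

theorem isComm_of_tendsto_inner (hA : IsSelfAdjoint A) (hV : IsUnitaryGroupOf A V)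
    {T S : E →L[ℂ] E} (h : ∀ x y, Tendsto (fun t : ℝ =>
      inner ℂ x (((t : ℂ)⁻¹ • (V t * T * V (-t) - T)) y)) (𝓝[≠] 0) (𝓝 (inner ℂ x (S y)))) :
    IsComm A T S := by
  intro ψ η hψ
  refine ⟨T η - Complex.I • S ψ, ?_, ?_⟩
  · rw [mem_graph_iff_of_isSelfAdjoint hA]
    intro x y hx
    have h1 := hV.hasDerivAt_neg hx 0
    have h2 : HasDerivAt (fun s => T (V (-s) ψ)) (T (-(Complex.I • V (-0) η))) 0 :=
      (T.restrictScalars ℝ).hasFDerivAt.comp_hasDerivAt 0 (hV.hasDerivAt_neg hψ 0)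
    have h3 := hasDerivAt_iff_tendsto_slope_zero.1 (h1.inner ℂ h2)
    have h4 := tendsto_nhds_unique (h x ψ) (h3.congr fun t => ?_)
    · simp only [neg_zero, hV.zero, one_apply_eq_self, inner_neg_left, inner_neg_right, map_neg,
        map_smul, inner_smul_left, inner_smul_right, Complex.conj_I] at h4
      rw [inner_sub_right, inner_smul_right, h4]
      linear_combination inner ℂ y (T ψ) * Complex.I_mul_I - inner ℂ x (T η) * Complex.I_mul_I
    · simp only [zero_add, neg_zero, hV.zero, one_apply_eq_self]
      rw [smul_apply, inner_smul_right, sub_apply, inner_sub_right, mul_apply_eq_comp,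
        mul_apply_eq_comp, ← hV.inner_neg_left, Complex.real_smul, Complex.ofReal_inv]
  · rw [sub_sub_cancel_left, smul_neg, smul_smul, Complex.I_mul_I]; module

theorem IsComm.conj_sub_eq_integral (hA : IsSelfAdjoint A) (hV : IsUnitaryGroupOf A V)
    {T S : E →L[ℂ] E} (h : IsComm A T S) (t : ℝ) (v : E) :
    (V t * T * V (-t)) v - T v = ∫ τ in (0 : ℝ)..t, (V τ * S * V (-τ)) v := by
  have hint : ∀ v, IntervalIntegrable (fun τ => (V τ * S * V (-τ)) v) volume 0 t := fun v =>
    (hV.continuous_conj S v).intervalIntegrable _ _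
  have hbound : ∀ τ v, ‖(V τ * S * V (-τ)) v‖ ≤ ‖S‖ * ‖v‖ := fun τ v => by
    rw [mul_apply_eq_comp, mul_apply_eq_comp, hV.isometry]
    exact (S.le_opNorm _).trans (by rw [hV.isometry])
  have hcont : Continuous fun v => ∫ τ in (0 : ℝ)..t, (V τ * S * V (-τ)) v := by
    refine LipschitzWith.continuous (K := ‖S‖₊ * ‖t‖₊) (LipschitzWith.of_dist_le_mul fun v w => ?_)
    rw [dist_eq_norm, ← intervalIntegral.integral_sub (hint v) (hint w)]
    have := intervalIntegral.norm_integral_le_of_norm_le_const (a := (0 : ℝ)) (b := t)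
      (f := fun τ => (V τ * S * V (-τ)) v - (V τ * S * V (-τ)) w) (C := ‖S‖ * ‖v - w‖)
      fun τ _ => by rw [← map_sub]; exact hbound τ _
    refine this.trans (le_of_eq ?_)
    rw [sub_zero, dist_eq_norm]
    push_cast
    rw [Real.norm_eq_abs]; ring
  refine forall_of_dense_graph_fst hA
    (p := fun v => (V t * T * V (-t)) v - T v = ∫ τ in (0 : ℝ)..t, (V τ * S * V (-τ)) v)
    (isClosed_eq ((V t * T * V (-t)).continuous.sub T.continuous) hcont) ?_ v
  rintro v ⟨η, hv⟩
  refine eq_of_inner_graph hA fun x y hx => ?_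
  have hd : ∀ τ, HasDerivAt (fun s => inner ℂ (V (-s) x) (T (V (-s) v)))
      (inner ℂ x ((V τ * S * V (-τ)) v)) τ := fun τ => by
    have h1 := hV.hasDerivAt_neg hx τ
    have h2 : HasDerivAt (fun s => T (V (-s) v)) (T (-(Complex.I • V (-τ) η))) τ :=
      (T.restrictScalars ℝ).hasFDerivAt.comp_hasDerivAt τ (hV.hasDerivAt_neg hv τ)
    obtain ⟨ξ, h3, h4⟩ := h _ _ (hV.map_graph hv (-τ))
    have h5 := inner_graph_comm hA (hV.map_graph hx (-τ)) h3
    refine (h1.inner ℂ h2).congr_deriv ?_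
    rw [mul_apply_eq_comp, mul_apply_eq_comp, ← hV.inner_neg_left, h4, map_neg, map_smul,
      inner_neg_left, inner_neg_right, inner_smul_left, inner_smul_right, inner_smul_right,
      inner_sub_right, h5, Complex.conj_I]
    ring
  have hc : Continuous fun τ => (inner ℂ x ((V τ * S * V (-τ)) v) : ℂ) :=
    continuous_const.inner (hV.continuous_conj S v)
  have h6 := intervalIntegral.integral_eq_sub_of_hasDerivAt (a := 0) (b := t) (fun τ _ => hd τ)
    (hc.intervalIntegrable _ _)
  have h7 : (inner ℂ x (∫ τ in (0 : ℝ)..t, (V τ * S * V (-τ)) v) : ℂ) =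
      ∫ τ in (0 : ℝ)..t, inner ℂ x ((V τ * S * V (-τ)) v) :=
    ((innerSL ℂ x).intervalIntegral_comp_comm (hint v)).symm
  rw [h7, h6, inner_sub_right, mul_apply_eq_comp, mul_apply_eq_comp, ← hV.inner_neg_left]
  simp [hV.zero]

theorem IsComm.norm_conj_sub_le (hA : IsSelfAdjoint A) (hV : IsUnitaryGroupOf A V)
    {T S : E →L[ℂ] E} (h : IsComm A T S) (t : ℝ) :
    ‖V t * T * V (-t) - T‖ ≤ ‖S‖ * |t| := by
  refine ContinuousLinearMap.opNorm_le_bound _ (by positivity) fun v => ?_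
  rw [sub_apply, h.conj_sub_eq_integral hA hV]
  have := intervalIntegral.norm_integral_le_of_norm_le_const (a := (0 : ℝ)) (b := t)
      (f := fun τ => (V τ * S * V (-τ)) v) (C := ‖S‖ * ‖v‖)
      fun τ _ => by
        rw [mul_apply_eq_comp, mul_apply_eq_comp, hV.isometry]
        exact (S.le_opNorm _).trans (by rw [hV.isometry])
  rw [sub_zero] at this
  linarith

theorem IsComm.tendsto (hA : IsSelfAdjoint A) (hV : IsUnitaryGroupOf A V)
    {T S : E →L[ℂ] E} (h : IsComm A T S) (v : E) :
    Tendsto (fun t : ℝ => ((t : ℂ)⁻¹ • (V t * T * V (-t) - T)) v) (𝓝[≠] 0) (𝓝 (S v)) := by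
  have hc := hV.continuous_conj S v
  have h1 := intervalIntegral.integral_hasDerivAt_right (a := (0 : ℝ)) (b := 0)
    (hc.intervalIntegrable _ _) hc.stronglyMeasurable.stronglyMeasurableAtFilter hc.continuousAt
  have h2 := hasDerivAt_iff_tendsto_slope_zero.1 h1
  simp only [neg_zero, hV.zero, one_mul, mul_one] at h2
  refine h2.congr fun t => ?_
  rw [zero_add, intervalIntegral.integral_same, sub_zero, ← h.conj_sub_eq_integral hA hV,
    ← Complex.coe_smul, Complex.ofReal_inv]
  rfl

theorem traceNorm_integral_le {Y : ℝ → E →L[ℂ] E} {X : E →L[ℂ] E} {t : ℝ} {c : ℝ≥0∞}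
    (hY : ∀ v, Continuous fun τ => Y τ v) (hX : ∀ v, X v = ∫ τ in (0 : ℝ)..t, Y τ v)
    (hc : ∀ τ, |τ| ≤ |t| → traceNorm (Y τ) ≤ c) : traceNorm X ≤ c * ENNReal.ofReal |t| := by
  rcases eq_or_ne t 0 with rfl | ht
  · have : X = 0 := by ext v; simp [hX]
    rw [this, traceNorm_zero]; exact zero_le
  rcases eq_or_ne c ∞ with rfl | hc'
  · rw [ENNReal.top_mul (by simpa using ht)]; exact le_top
  obtain ⟨W, hW, -, hT⟩ := exists_polar X
  rw [traceNorm, ENNReal.tsum_eq_iSup_sum]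
  refine iSup_le fun F => ?_
  have hnn : ∀ i, 0 ≤ RCLike.re (inner ℂ (onBasis E i) (CFC.abs X (onBasis E i))) := fun i => by
    exact ((ContinuousLinearMap.nonneg_iff_isPositive _).1 (CFC.abs_nonneg X)).re_inner_nonneg_right _
  rw [← ENNReal.ofReal_sum_of_nonneg fun i _ => hnn i]
  have h1 : ∀ i, inner ℂ (onBasis E i) (CFC.abs X (onBasis E i)) =
      ∫ τ in (0 : ℝ)..t, (inner ℂ (W (onBasis E i)) (Y τ (onBasis E i)) : ℂ) := fun i => by
    rw [hT, mul_apply_eq_comp, ContinuousLinearMap.adjoint_inner_right, hX]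
    exact ((innerSL ℂ (W (onBasis E i))).intervalIntegral_comp_comm
      ((hY _).intervalIntegrable _ _)).symm
  have h2 : (∑ i ∈ F, inner ℂ (onBasis E i) (CFC.abs X (onBasis E i)) : ℂ) =
      ∫ τ in (0 : ℝ)..t, ∑ i ∈ F, (inner ℂ (W (onBasis E i)) (Y τ (onBasis E i)) : ℂ) := by
    rw [intervalIntegral.integral_finsetSum fun i _ =>
      (continuous_const.inner (hY _)).intervalIntegrable _ _]
    exact Finset.sum_congr rfl fun i _ => h1 i
  have h3 : ‖(∑ i ∈ F, inner ℂ (onBasis E i) (CFC.abs X (onBasis E i)) : ℂ)‖ ≤ c.toReal * |t - 0| := by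
    rw [h2]
    refine intervalIntegral.norm_integral_le_of_norm_le_const fun τ hτ => ?_
    have hτ' : |τ| ≤ |t| := by
      rcases Set.mem_uIoc.1 hτ with ⟨a, b⟩ | ⟨a, b⟩
      · rw [abs_of_pos a, abs_of_pos (a.trans_le b)]; exact b
      · rw [abs_of_nonpos b, abs_of_neg (a.trans_le b)]; linarith
    refine (norm_sum_le _ _).trans ?_
    have h4 : ∑ i ∈ F, ‖inner ℂ (W (onBasis E i)) (Y τ (onBasis E i))‖ₑ ≤ c :=
      (ENNReal.sum_le_tsum F).trans
        ((tsum_enorm_inner_le_traceNorm (onBasis E).orthonormal _ W).trans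
          ((mul_le_of_le_one_left' (by rw [← ofReal_norm]; exact ENNReal.ofReal_le_one.2 hW)).trans
            (hc τ hτ')))
    have h5 := ENNReal.toReal_mono hc' h4
    rwa [ENNReal.toReal_sum fun i _ => by finiteness, Finset.sum_congr rfl fun i _ => toReal_enorm _] at h5
  rw [← ENNReal.ofReal_toReal hc', ← ENNReal.ofReal_mul ENNReal.toReal_nonneg]
  refine ENNReal.ofReal_le_ofReal ?_
  rw [sub_zero] at h3
  refine le_trans ?_ h3
  rw [← map_sum]
  exact RCLike.re_le_norm _

theorem traceNorm_conj_le (hV : IsUnitaryGroupOf A V) (S : E →L[ℂ] E) (t : ℝ) :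
    traceNorm (V t * S * V (-t)) ≤ traceNorm S := by
  refine (traceNorm_mul_mul_le _ _ _).trans ?_
  calc _ ≤ 1 * traceNorm S * 1 := by
        gcongr
        · exact hV.enorm_le t
        · exact hV.enorm_le (-t)
    _ = _ := by rw [one_mul, mul_one]

theorem repSize_eq_ofReal {J : Type} {u v : J → E} (h : Summable fun j => ‖u j‖ * ‖v j‖) :
    repSize u v = ENNReal.ofReal (∑' j, ‖u j‖ * ‖v j‖) := by
  rw [ENNReal.ofReal_tsum_of_nonneg (fun j => by positivity) h, repSize]
  simp only [ENNReal.ofReal_mul (norm_nonneg _), ofReal_norm]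

theorem tendsto_traceNorm_conj_sub (hV : IsUnitaryGroupOf A V) {S : E →L[ℂ] E}
    (hS : traceNorm S ≠ ∞) :
    Tendsto (fun t => traceNorm (V t * S * V (-t) - S)) (𝓝 0) (𝓝 0) := by
  obtain ⟨u, v, h, hs, -⟩ := exists_rep_summable hS
  let b : ℝ → basisSet E → ℝ := fun t j => ‖V t (u j) - u j‖ * ‖V t (v j)‖ + ‖u j‖ * ‖V t (v j) - v j‖
  have hb1 : ∀ t j, ‖V t (u j) - u j‖ * ‖V t (v j)‖ ≤ 2 * (‖u j‖ * ‖v j‖) := fun t j => by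
    rw [hV.isometry]
    have := norm_sub_le (V t (u j)) (u j)
    rw [hV.isometry] at this
    nlinarith [norm_nonneg (v j)]
  have hb2 : ∀ t j, ‖u j‖ * ‖V t (v j) - v j‖ ≤ 2 * (‖u j‖ * ‖v j‖) := fun t j => by
    have := norm_sub_le (V t (v j)) (v j)
    rw [hV.isometry] at this
    nlinarith [norm_nonneg (u j)]
  have hs1 : ∀ t, Summable fun j => ‖V t (u j) - u j‖ * ‖V t (v j)‖ := fun t =>
    Summable.of_nonneg_of_le (fun j => by positivity) (hb1 t) (hs.mul_left 2)
  have hs2 : ∀ t, Summable fun j => ‖u j‖ * ‖V t (v j) - v j‖ := fun t =>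
    Summable.of_nonneg_of_le (fun j => by positivity) (hb2 t) (hs.mul_left 2)
  have hle : ∀ t, traceNorm (V t * S * V (-t) - S) ≤ ENNReal.ofReal (∑' j, b t j) := fun t => by
    have hrep : IsRep (Sum.elim (fun j => V t (u j) - u j) u)
        (Sum.elim (fun j => V t (v j)) (fun j => V t (v j) - v j)) (V t * S * V (-t) - S) := fun x => by
      refine HasSum.congr_fun ?_ (fun _ => rfl)
      have h1 := h.mul (V t) (V (-t)) x
      have h2 : HasSum (fun j => inner ℂ (V t (v j)) x • u j) ((S * V (-t)) x) := by
        have := h.mul 1 (V (-t)) x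
        simpa [hV.adjoint_eq] using this
      simp only [hV.adjoint_eq, neg_neg] at h1
      have h3 := h1.sub h2
      have h4 := h2.sub (h x)
      have h5 := HasSum.sum (f := fun j => inner ℂ (Sum.elim (fun j => V t (v j))
        (fun j => V t (v j) - v j) j) x • Sum.elim (fun j => V t (u j) - u j) u j)
        (a := (V t * S * V (-t)) x - (S * V (-t)) x) (b := (S * V (-t)) x - S x)
        (by convert h3 using 2 with j; simp [smul_sub])
        (by convert h4 using 2 with j; simp [sub_smul])
      rwa [sub_add_sub_cancel, ← sub_apply] at h5
    refine (traceNorm_le_rep hrep).trans (le_of_eq ?_)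
    rw [Summable.tsum_add (hs1 t) (hs2 t), ENNReal.ofReal_add (tsum_nonneg fun j => by positivity)
      (tsum_nonneg fun j => by positivity), ← repSize_eq_ofReal (hs1 t), ← repSize_eq_ofReal (hs2 t)]
    simp only [repSize]
    rw [Summable.tsum_sum ENNReal.summable ENNReal.summable]
    rfl
  have hlim : Tendsto (fun t => ∑' j, b t j) (𝓝 0) (𝓝 0) := by
    have h1 := tendsto_tsum_of_dominated_convergence (𝓕 := 𝓝 (0 : ℝ)) (f := b) (g := fun _ => 0)
      (bound := fun j => 4 * (‖u j‖ * ‖v j‖)) (hs.mul_left 4) (fun j => ?_)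
      (Eventually.of_forall fun t j => ?_)
    · simpa using h1
    · have hu := hV.continuous (u j)
      have hv := hV.continuous (v j)
      have : Continuous fun t => b t j := by fun_prop
      have := this.tendsto 0
      simpa [b, hV.zero] using this
    · rw [Real.norm_of_nonneg (by positivity)]
      linarith [hb1 t j, hb2 t j]
  refine tendsto_of_tendsto_of_tendsto_of_le_of_le tendsto_const_nhds ?_ (fun _ => zero_le) hle
  simpa using ENNReal.tendsto_ofReal hlim

theorem IsComm.traceNorm_conj_sub_le (hA : IsSelfAdjoint A) (hV : IsUnitaryGroupOf A V)
    {T S : E →L[ℂ] E} (h : IsComm A T S) (t : ℝ) :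
    traceNorm (V t * T * V (-t) - T) ≤ traceNorm S * ENNReal.ofReal |t| :=
  traceNorm_integral_le (fun v => hV.continuous_conj S v)
    (fun v => h.conj_sub_eq_integral hA hV t v) fun τ _ => traceNorm_conj_le hV S τ

theorem IsComm.traceNorm_conj_sub_sub_le (hA : IsSelfAdjoint A) (hV : IsUnitaryGroupOf A V)
    {T S : E →L[ℂ] E} (h : IsComm A T S) {t : ℝ} {c : ℝ≥0∞}
    (hc : ∀ τ, |τ| ≤ |t| → traceNorm (V τ * S * V (-τ) - S) ≤ c) :
    traceNorm (V t * T * V (-t) - T - (t : ℂ) • S) ≤ c * ENNReal.ofReal |t| := by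
  refine traceNorm_integral_le (Y := fun τ => V τ * S * V (-τ) - S)
    (fun v => (hV.continuous_conj S v).sub continuous_const) (fun v => ?_) hc
  simp only [sub_apply]
  rw [intervalIntegral.integral_sub ((hV.continuous_conj S v).intervalIntegrable _ _)
    (continuous_const.intervalIntegrable _ _), ← h.conj_sub_eq_integral hA hV,
    intervalIntegral.integral_const, sub_zero, smul_apply, Complex.coe_smul]

theorem IsComm.tendsto_traceNorm (hA : IsSelfAdjoint A) (hV : IsUnitaryGroupOf A V)
    {T S : E →L[ℂ] E} (h : IsComm A T S) (hS : traceNorm S ≠ ∞) :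
    Tendsto (fun t : ℝ => traceNorm ((t : ℂ)⁻¹ • (V t * T * V (-t) - T) - S)) (𝓝[≠] 0) (𝓝 0) := by
  rw [ENNReal.tendsto_nhds_zero]
  intro ε hε
  have h1 := (ENNReal.tendsto_nhds_zero.1 (tendsto_traceNorm_conj_sub hV hS)) ε hε
  obtain ⟨δ, hδ, h2⟩ := Metric.eventually_nhds_iff.1 h1
  have h3 : ∀ᶠ t : ℝ in 𝓝[≠] 0, dist t 0 < δ :=
    nhdsWithin_le_nhds (Metric.ball_mem_nhds 0 hδ)
  filter_upwards [h3, self_mem_nhdsWithin] with t ht ht0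
  have ht1 : (t : ℂ) ≠ 0 := Complex.ofReal_ne_zero.2 ht0
  have h4 := h.traceNorm_conj_sub_sub_le hA hV (t := t) (c := ε) fun τ hτ => h2 (by
    rw [dist_zero_right, Real.norm_eq_abs] at ht ⊢
    exact hτ.trans_lt ht)
  have h5 : (t : ℂ)⁻¹ • (V t * T * V (-t) - T) - S =
      (t : ℂ)⁻¹ • (V t * T * V (-t) - T - (t : ℂ) • S) := by
    rw [smul_sub _ _ ((t : ℂ) • S), inv_smul_smul₀ ht1]
  rw [h5, traceNorm_smul]
  have h6 : ‖(t : ℂ)⁻¹‖ₑ * ENNReal.ofReal |t| = 1 := by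
    have : ENNReal.ofReal |t| = ‖(t : ℂ)‖ₑ := by rw [← ofReal_norm, Complex.norm_real, Real.norm_eq_abs]
    rw [this, ← enorm_mul, inv_mul_cancel₀ ht1, enorm_one]
  calc _ ≤ ‖(t : ℂ)⁻¹‖ₑ * (ε * ENNReal.ofReal |t|) := by gcongr
    _ = ε * (‖(t : ℂ)⁻¹‖ₑ * ENNReal.ofReal |t|) := by ring
    _ = ε := by rw [h6, mul_one]

theorem IsComm.tendsto_opTrace (hA : IsSelfAdjoint A) (hV : IsUnitaryGroupOf A V)
    {T S f : E →L[ℂ] E} (h : IsComm A T S) (hf : traceNorm f ≠ ∞) :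
    Tendsto (fun t : ℝ => opTrace (((t : ℂ)⁻¹ • (V t * T * V (-t) - T) - S) * f)) (𝓝[≠] 0) (𝓝 0) := by
  obtain ⟨u, v, hr, hs, -⟩ := exists_rep_summable hf
  simp only [opTrace_mul_rep hr hs]
  have h1 := tendsto_tsum_of_dominated_convergence (𝓕 := 𝓝[≠] (0 : ℝ))
    (f := fun t j => inner ℂ (v j) (((t : ℂ)⁻¹ • (V t * T * V (-t) - T) - S) (u j)))
    (g := fun _ => 0) (bound := fun j => 2 * ‖S‖ * (‖u j‖ * ‖v j‖)) (hs.mul_left _) (fun j => ?_) ?_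
  · simpa using h1
  · have h2 := (tendsto_const_nhds (x := v j)).inner (𝕜 := ℂ) ((h.tendsto hA hV (u j)).sub_const (S (u j)))
    rw [sub_self, inner_zero_right] at h2
    exact h2
  · filter_upwards [self_mem_nhdsWithin] with t ht j
    refine (norm_inner_le_norm _ _).trans ?_
    have ht0 : |t| ≠ 0 := abs_ne_zero.2 ht
    have h3 : ‖(t : ℂ)⁻¹ • (V t * T * V (-t) - T) - S‖ ≤ 2 * ‖S‖ := by
      refine (norm_sub_le _ _).trans ?_
      rw [norm_smul, norm_inv, Complex.norm_real, Real.norm_eq_abs]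
      have := mul_le_mul_of_nonneg_left (h.norm_conj_sub_le hA hV t) (inv_nonneg.2 (abs_nonneg t))
      have h4 : |t|⁻¹ * (‖S‖ * |t|) = ‖S‖ := by field_simp
      linarith
    have h5 := (ContinuousLinearMap.le_opNorm ((t : ℂ)⁻¹ • (V t * T * V (-t) - T) - S) (u j)).trans
      (mul_le_mul_of_nonneg_right h3 (norm_nonneg _))
    nlinarith [norm_nonneg (v j)]

end UnitaryGroup

section TensorDensity
variable {ν : ℕ} {ι κ ρ : Type} [Fintype ι] [Fintype κ] [Fintype ρ]

/-- `splitConf` as a measurable equivalence. -/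
def splitEquiv (e : ι ⊕ κ ≃ ρ) : (ρ → Pos ν) ≃ᵐ (ι → Pos ν) × (κ → Pos ν) :=
  (MeasurableEquiv.piCongrLeft (fun _ : ρ => Pos ν) e).symm.trans
    (MeasurableEquiv.sumPiEquivProdPi fun _ : ι ⊕ κ => Pos ν)

theorem coe_splitEquiv (e : ι ⊕ κ ≃ ρ) : ⇑(splitEquiv (ν := ν) e) = splitConf e := rfl

theorem tensor_indicator (e : ι ⊕ κ ≃ ρ) {s : Set (ι → Pos ν)} {t : Set (κ → Pos ν)}
    (hs : MeasurableSet s) (ht : MeasurableSet t) (hs' : volume s ≠ ∞) (ht' : volume t ≠ ∞)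
    (F : Hil ν ρ) :
    inner ℂ (tensor e (indicatorConstLp 2 hs hs' (1 : ℂ)) (indicatorConstLp 2 ht ht' (1 : ℂ))) F =
      ∫ p in s ×ˢ t, F ((splitEquiv e).symm p) := by
  have hm := measurePreserving_splitConf (ν := ν) e
  have h1 : (∫ p in s ×ˢ t, F ((splitEquiv e).symm p)) =
      ∫ x in (splitConf e) ⁻¹' (s ×ˢ t), F x := by
    rw [← coe_splitEquiv] at hm ⊢
    rw [← hm.setIntegral_preimage_emb (splitEquiv e).measurableEmbedding]
    simp
  rw [h1, L2.inner_def, ← integral_indicator (hm.measurable (hs.prod ht))]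
  apply integral_congr_ae
  filter_upwards [coeFn_tensor e (indicatorConstLp 2 hs hs' (1 : ℂ)) (indicatorConstLp 2 ht ht' (1 : ℂ)),
    ae_fst e (indicatorConstLp_coeFn (p := 2) (hs := hs) (hμs := hs') (c := (1 : ℂ))),
    ae_snd e (indicatorConstLp_coeFn (p := 2) (hs := ht) (hμs := ht') (c := (1 : ℂ)))] with x h2 h3 h4
  rw [h2, h3, h4]
  by_cases h5 : (splitConf e x).1 ∈ s <;> by_cases h6 : (splitConf e x).2 ∈ t <;>
    simp [Set.indicator, h5, h6]

theorem eq_zero_of_inner_tensor (e : ι ⊕ κ ≃ ρ) (F : Hil ν ρ)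
    (h : ∀ φ χ, inner ℂ (tensor e φ χ) F = 0) : F = 0 := by
  set G : (ι → Pos ν) × (κ → Pos ν) → ℂ := fun p => F ((splitEquiv e).symm p) with hG
  have hm : MeasurePreserving (splitEquiv (ν := ν) e) volume volume := measurePreserving_splitConf e
  have hG2 : MemLp G 2 volume := (Lp.memLp F).comp_measurePreserving hm.symm
  have hint : ∀ u : Set ((ι → Pos ν) × (κ → Pos ν)), volume u < ∞ → IntegrableOn G u := fun u hu => by
    haveI : IsFiniteMeasure (volume.restrict u) := ⟨by simpa using hu⟩
    exact (hG2.restrict u).integrable (by norm_num)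
  let B : ℕ → Set (ι → Pos ν) := spanningSets volume
  let B' : ℕ → Set (κ → Pos ν) := spanningSets volume
  have hrect : ∀ s t, MeasurableSet s → MeasurableSet t → volume s < ∞ → volume t < ∞ →
      ∫ p in s ×ˢ t, G p = 0 := fun s t hs ht hs' ht' => by
    rw [hG, ← tensor_indicator e hs ht hs'.ne ht'.ne F, h]
  have hBfin : ∀ n, volume (B n ×ˢ B' n) < ∞ := fun n => by
    rw [Measure.volume_eq_prod, Measure.prod_prod]
    exact ENNReal.mul_lt_top (measure_spanningSets_lt_top _ n) (measure_spanningSets_lt_top _ n)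
  have hBm : ∀ n, MeasurableSet (B n) := fun n => measurableSet_spanningSets _ n
  have hBm' : ∀ n, MeasurableSet (B' n) := fun n => measurableSet_spanningSets _ n
  have key : ∀ n u, MeasurableSet u → ∫ p in u ∩ (B n ×ˢ B' n), G p = 0 := fun n u hu => by
    have hi : ∀ w, IntegrableOn G (w ∩ (B n ×ˢ B' n)) := fun w =>
      hint _ ((measure_mono Set.inter_subset_right).trans_lt (hBfin n))
    refine MeasurableSpace.induction_on_inter
      (C := fun u _ => ∫ p in u ∩ (B n ×ˢ B' n), G p = 0) generateFrom_prod.symm isPiSystem_prod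
      (by simp) ?_ ?_ ?_ u hu
    · rintro _ ⟨s, hs, t, ht, rfl⟩
      replace hs : MeasurableSet s := hs
      replace ht : MeasurableSet t := ht
      rw [Set.prod_inter_prod]
      exact hrect _ _ (hs.inter (hBm n)) (ht.inter (hBm' n))
        ((measure_mono Set.inter_subset_right).trans_lt (measure_spanningSets_lt_top _ n))
        ((measure_mono Set.inter_subset_right).trans_lt (measure_spanningSets_lt_top _ n))
    · intro w hw h0
      have h1 : ∫ p in B n ×ˢ B' n, G p = 0 := hrect _ _ (hBm n) (hBm' n)
        (measure_spanningSets_lt_top _ n) (measure_spanningSets_lt_top _ n)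
      rw [← integral_inter_add_sdiff hw (hint _ (hBfin n)), Set.inter_comm, h0, zero_add] at h1
      rw [Set.inter_comm]
      exact h1
    · intro f hd hf h0
      rw [Set.iUnion_inter, integral_iUnion (fun i => (hf i).inter ((hBm n).prod (hBm' n)))
        (fun i j hij => (hd hij).mono Set.inter_subset_left Set.inter_subset_left)]
      · simp only [h0, tsum_zero]
      · rw [← Set.iUnion_inter]; exact hi _
  have hzero : G =ᵐ[volume] 0 := by
    refine ae_eq_zero_of_forall_setIntegral_eq_of_sigmaFinite (fun s _ hs => hint s hs) fun s hs hs' => ?_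
    have hmono : Monotone fun n => s ∩ (B n ×ˢ B' n) := fun i j hij =>
      Set.inter_subset_inter_right _ (Set.prod_mono (monotone_spanningSets _ hij)
        (monotone_spanningSets _ hij))
    have hU : (⋃ n, s ∩ (B n ×ˢ B' n)) = s := by
      rw [← Set.inter_iUnion, Set.iUnion_prod_of_monotone (monotone_spanningSets _)
        (monotone_spanningSets _)]
      simp [iUnion_spanningSets]
    have h1 := tendsto_setIntegral_of_monotone (fun n => hs.inter ((hBm n).prod (hBm' n))) hmono
      (by rw [hU]; exact hint s hs')
    rw [hU] at h1
    simp only [key _ s hs] at h1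
    exact tendsto_nhds_unique h1 tendsto_const_nhds |>.symm ▸ rfl
  apply Lp.ext
  have h2 := hm.quasiMeasurePreserving.ae hzero
  filter_upwards [h2, Lp.coeFn_zero ℂ 2 (volume : Measure (ρ → Pos ν))] with x hx h0
  rw [h0]
  simpa [hG] using hx

theorem dense_span_tensor (e : ι ⊕ κ ≃ ρ) :
    Dense (Submodule.span ℂ {F : Hil ν ρ | ∃ φ χ, F = tensor e φ χ} : Set (Hil ν ρ)) := by
  rw [Submodule.dense_iff_topologicalClosure_eq_top, Submodule.topologicalClosure_eq_top_iff,
    Submodule.eq_bot_iff]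
  intro F hF
  refine eq_zero_of_inner_tensor e F fun φ χ => ?_
  exact hF _ (Submodule.subset_span ⟨φ, χ, rfl⟩)

theorem ext_tensor (e : ι ⊕ κ ≃ ρ) {E : Type} [NormedAddCommGroup E] [NormedSpace ℂ E]
    {S T : Hil ν ρ →L[ℂ] E}
    (h : ∀ φ χ, S (tensor e φ χ) = T (tensor e φ χ)) : S = T := by
  refine ContinuousLinearMap.ext_on (dense_span_tensor e) ?_
  rintro _ ⟨φ, χ, rfl⟩
  exact h φ χ

end TensorDensity

section Relabel
variable {ν : ℕ} {ι κ ρ τ : Type} [Fintype ι] [Fintype κ] [Fintype ρ] [Fintype τ]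

theorem measurePreserving_relabel (σ : ι ≃ ρ) :
    MeasurePreserving (fun (q : ρ → Pos ν) i => q (σ i)) volume volume :=
  (volume_measurePreserving_piCongrLeft (fun _ : ρ => Pos ν) σ).symm

/-- `(U_σ ψ)(q) = ψ(q ∘ σ)`. -/
noncomputable def relabel (σ : ι ≃ ρ) : Hil ν ι →L[ℂ] Hil ν ρ :=
  (Lp.compMeasurePreservingₗᵢ ℂ _ (measurePreserving_relabel σ)).toContinuousLinearMap

theorem permOp_eq_relabel {n : ℕ} (σ : Equiv.Perm (Fin n)) : permOp (ν := ν) σ = relabel σ := rfl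

theorem coeFn_relabel (σ : ι ≃ ρ) (ψ : Hil ν ι) :
    relabel σ ψ =ᵐ[volume] fun q => ψ fun i => q (σ i) :=
  Lp.coeFn_compMeasurePreserving ψ (measurePreserving_relabel σ)

theorem relabel_trans (σ : ι ≃ ρ) (σ' : ρ ≃ τ) (ψ : Hil ν ι) :
    relabel (σ.trans σ') ψ = relabel σ' (relabel σ ψ) := by
  apply Lp.ext
  filter_upwards [coeFn_relabel (σ.trans σ') ψ, coeFn_relabel σ' (relabel σ ψ),
    (measurePreserving_relabel σ').quasiMeasurePreserving.ae (coeFn_relabel σ ψ)] with x h1 h2 h3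
  rw [h1, h2, h3]; rfl

theorem relabel_refl (ψ : Hil ν ι) : relabel (Equiv.refl ι) ψ = ψ := by
  apply Lp.ext
  filter_upwards [coeFn_relabel (Equiv.refl ι) ψ] with x h1
  rw [h1]; rfl

theorem relabel_symm_relabel (σ : ι ≃ ρ) (ψ : Hil ν ι) : relabel σ.symm (relabel σ ψ) = ψ := by
  rw [← relabel_trans, Equiv.self_trans_symm, relabel_refl]

theorem relabel_relabel_symm (σ : ι ≃ ρ) (ψ : Hil ν ρ) : relabel σ (relabel σ.symm ψ) = ψ := by
  rw [← relabel_trans, Equiv.symm_trans_self, relabel_refl]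

theorem tensor_relabel {ι' κ' : Type} [Fintype ι'] [Fintype κ'] (e : ι ⊕ κ ≃ ρ) (σ : ι' ≃ ι)
    (τ : κ' ≃ κ) (φ : Hil ν ι') (χ : Hil ν κ') :
    tensor e (relabel σ φ) (relabel τ χ) = tensor ((Equiv.sumCongr σ τ).trans e) φ χ := by
  apply Lp.ext
  filter_upwards [coeFn_tensor e (relabel σ φ) (relabel τ χ),
    coeFn_tensor ((Equiv.sumCongr σ τ).trans e) φ χ, ae_fst e (coeFn_relabel σ φ),
    ae_snd e (coeFn_relabel τ χ)] with x h1 h2 h3 h4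
  rw [h1, h2, h3, h4]; rfl

theorem tensor_comm (e : ι ⊕ κ ≃ ρ) (φ : Hil ν ι) (χ : Hil ν κ) :
    tensor ((Equiv.sumComm κ ι).trans e) χ φ = tensor e φ χ := by
  apply Lp.ext
  filter_upwards [coeFn_tensor e φ χ, coeFn_tensor ((Equiv.sumComm κ ι).trans e) χ φ] with x h1 h2
  rw [h1, h2, mul_comm]; rfl

theorem tensor_assoc {κ' : Type} [Fintype κ'] (e : ι ⊕ κ ≃ ρ) (e' : ρ ⊕ κ' ≃ τ) (φ : Hil ν ι)
    (χ : Hil ν κ) (χ' : Hil ν κ') :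
    tensor e' (tensor e φ χ) χ' =
      tensor (((Equiv.sumAssoc ι κ κ').symm.trans (Equiv.sumCongr e (Equiv.refl κ'))).trans e') φ
        (tensor (Equiv.refl _) χ χ') := by
  apply Lp.ext
  set e'' := ((Equiv.sumAssoc ι κ κ').symm.trans (Equiv.sumCongr e (Equiv.refl κ'))).trans e'
  filter_upwards [coeFn_tensor e' (tensor e φ χ) χ', ae_fst e' (coeFn_tensor e φ χ),
    coeFn_tensor e'' φ (tensor (Equiv.refl _) χ χ'),
    ae_snd e'' (coeFn_tensor (Equiv.refl _) χ χ')] with x h1 h2 h3 h4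
  rw [h1, h2, h3, h4, mul_assoc]; rfl

theorem exists_tensor_eq_smul [IsEmpty κ] (e : ι ⊕ κ ≃ ρ) (σ : ι ≃ ρ)
    (he : ∀ i, e (Sum.inl i) = σ i) (χ : Hil ν κ) :
    ∃ c : ℂ, ∀ φ, tensor e φ χ = c • relabel σ φ := by
  refine ⟨χ fun k => isEmptyElim k, fun φ => ?_⟩
  apply Lp.ext
  filter_upwards [coeFn_tensor e φ χ, coeFn_relabel σ φ,
    Lp.coeFn_smul (χ fun k => isEmptyElim k) (relabel σ φ)] with x h1 h2 h3
  rw [h1, h3, Pi.smul_apply, h2, smul_eq_mul, mul_comm]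
  congr 2
  · funext k; exact isEmptyElim k
  · funext i; simp only [splitConf, he]

end Relabel

section Lift
variable {ν : ℕ} {ι κ ρ τ : Type} [Fintype ι] [Fintype κ] [Fintype ρ] [Fintype τ]

theorem ampliation_tensor (e : ι ⊕ κ ≃ ρ) (A : Hil ν ι →L[ℂ] Hil ν ι) (φ : Hil ν ι) (χ : Hil ν κ) :
    ampliation e A (tensor e φ χ) = tensor e (A φ) χ :=
  (exists_ampliation e A).choose_spec φ χ

theorem ampliation_unique (e : ι ⊕ κ ≃ ρ) {A : Hil ν ι →L[ℂ] Hil ν ι} {B : Hil ν ρ →L[ℂ] Hil ν ρ}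
    (h : ∀ φ χ, B (tensor e φ χ) = tensor e (A φ) χ) : ampliation e A = B :=
  ext_tensor e fun φ χ => by rw [ampliation_tensor, h]

/-- The ampliation as a homomorphism of C⋆-algebras. -/
noncomputable def ampliationHom (e : ι ⊕ κ ≃ ρ) :
    (Hil ν ι →L[ℂ] Hil ν ι) →⋆ₐ[ℂ] (Hil ν ρ →L[ℂ] Hil ν ρ) where
  toFun := ampliation e
  map_one' := ampliation_unique e fun φ χ => rfl
  map_mul' A B := ampliation_unique e fun φ χ => by
    rw [mul_apply_eq_comp, ampliation_tensor, ampliation_tensor]; rfl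
  map_zero' := ampliation_unique e fun φ χ => by
    have := tensor_smul_left e 0 φ χ
    simpa using this.symm
  map_add' A B := ampliation_unique e fun φ χ => by
    rw [add_apply, ampliation_tensor, ampliation_tensor, add_apply, tensor_add_left]
  commutes' c := ampliation_unique e fun φ χ => by
    rw [Algebra.algebraMap_eq_smul_one, Algebra.algebraMap_eq_smul_one]
    exact (tensor_smul_left e c φ χ).symm
  map_star' A := ampliation_unique e fun φ χ => by
    rw [ContinuousLinearMap.star_eq_adjoint, ContinuousLinearMap.star_eq_adjoint]
    refine ext_inner_left ℂ fun F => ?_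
    have : innerSL ℂ ((ampliation e A).adjoint (tensor e φ χ)) = innerSL ℂ (tensor e (A.adjoint φ) χ) :=
      ext_tensor e fun φ' χ' => by
        rw [innerSL_apply_apply, innerSL_apply_apply, ContinuousLinearMap.adjoint_inner_left,
          ampliation_tensor, inner_tensor, inner_tensor, ContinuousLinearMap.adjoint_inner_left]
    have h2 := DFunLike.congr_fun this F
    rw [innerSL_apply_apply, innerSL_apply_apply] at h2
    rw [← inner_conj_symm, h2, inner_conj_symm]

open Classical in
/-- The complement of the range of an embedding of labels. -/
noncomputable def embEquiv (f : ι ↪ ρ) : ι ⊕ {r : ρ // r ∉ Set.range f} ≃ ρ :=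
  (Equiv.sumCongr (Equiv.ofInjective f f.injective) (Equiv.refl _)).trans
    (Equiv.sumCompl (· ∈ Set.range f))

open Classical in
/-- The operator `A` acting on the particles selected by the embedding `f`. -/
noncomputable def lift (f : ι ↪ ρ) :
    (Hil ν ι →L[ℂ] Hil ν ι) →⋆ₐ[ℂ] (Hil ν ρ →L[ℂ] Hil ν ρ) := ampliationHom (embEquiv f)

theorem lift_tensor (f : ι ↪ ρ) (e : ι ⊕ κ ≃ ρ) (he : ∀ i, e (Sum.inl i) = f i)
    (A : Hil ν ι →L[ℂ] Hil ν ι) (φ : Hil ν ι) (χ : Hil ν κ) :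
    lift f A (tensor e φ χ) = tensor e (A φ) χ := by
  classical
  have h1 : ∀ k, e (Sum.inr k) ∉ Set.range f := by
    rintro k ⟨i, hi⟩
    rw [← he] at hi
    exact Sum.inl_ne_inr (e.injective hi)
  have hbij : Function.Bijective fun k : κ => (⟨e (Sum.inr k), h1 k⟩ : {r : ρ // r ∉ Set.range f}) := by
    refine ⟨fun a b hab => Sum.inr_injective (e.injective (congrArg Subtype.val hab)), ?_⟩
    rintro ⟨r, hr⟩
    obtain ⟨x, rfl⟩ := e.surjective r
    rcases x with i | k
    · exact absurd ⟨i, (he i).symm⟩ hr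
    · exact ⟨k, rfl⟩
  let g : κ ≃ {r : ρ // r ∉ Set.range f} := Equiv.ofBijective _ hbij
  have hg : (Equiv.sumCongr (Equiv.refl ι) g).trans (embEquiv f) = e := by
    ext x
    rcases x with i | k
    · exact (he i).symm
    · rfl
  have ht : ∀ φ, tensor e φ χ = tensor (embEquiv f) φ (relabel g χ) := fun φ => by
    have := tensor_relabel (embEquiv f) (Equiv.refl ι) g φ χ
    rw [relabel_refl, hg] at this
    exact this.symm
  rw [ht, ht]
  exact ampliation_tensor _ _ _ _

theorem lift_unique (f : ι ↪ ρ) (e : ι ⊕ κ ≃ ρ) (he : ∀ i, e (Sum.inl i) = f i)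
    {A : Hil ν ι →L[ℂ] Hil ν ι} {B : Hil ν ρ →L[ℂ] Hil ν ρ}
    (h : ∀ φ χ, B (tensor e φ χ) = tensor e (A φ) χ) : lift f A = B :=
  ext_tensor e fun φ χ => by rw [lift_tensor f e he, h]

theorem ampliation_eq_lift (e : ι ⊕ κ ≃ ρ) (f : ι ↪ ρ) (he : ∀ i, e (Sum.inl i) = f i)
    (A : Hil ν ι →L[ℂ] Hil ν ι) : ampliation e A = lift f A :=
  ampliation_unique e fun φ χ => lift_tensor f e he A φ χ

theorem norm_lift_le (f : ι ↪ ρ) (A : Hil ν ι →L[ℂ] Hil ν ι) : ‖lift f A‖ ≤ ‖A‖ :=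
  NonUnitalStarAlgHom.norm_apply_le (lift f) A

theorem lift_tensor_snd (g : κ ↪ ρ) (e : ι ⊕ κ ≃ ρ) (he : ∀ k, e (Sum.inr k) = g k)
    (B : Hil ν κ →L[ℂ] Hil ν κ) (φ : Hil ν ι) (χ : Hil ν κ) :
    lift g B (tensor e φ χ) = tensor e φ (B χ) := by
  rw [← tensor_comm, ← tensor_comm e φ (B χ)]
  exact lift_tensor g _ he B χ φ

theorem lift_trans (f : ι ↪ ρ) (g : ρ ↪ τ) (A : Hil ν ι →L[ℂ] Hil ν ι) :
    lift (f.trans g) A = lift g (lift f A) := by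
  classical
  set e'' := ((Equiv.sumAssoc ι _ _).symm.trans (Equiv.sumCongr (embEquiv f)
    (Equiv.refl {r // r ∉ Set.range g}))).trans (embEquiv g)
  refine lift_unique (f.trans g) e'' (fun i => rfl) fun φ χ => ?_
  have : lift g (lift f A) ∘L tensorLeft e'' φ = tensorLeft e'' (A φ) := by
    refine ext_tensor (Equiv.refl _) fun χ χ' => ?_
    change lift g (lift f A) (tensor e'' φ (tensor (Equiv.refl _) χ χ')) =
      tensor e'' (A φ) (tensor (Equiv.refl _) χ χ')
    rw [← tensor_assoc (embEquiv f) (embEquiv g), ← tensor_assoc (embEquiv f) (embEquiv g),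
      lift_tensor g _ (fun _ => rfl), lift_tensor f _ (fun _ => rfl)]
  exact DFunLike.congr_fun this χ

theorem commute_lift (f : ι ↪ ρ) (g : κ ↪ ρ) (h : Disjoint (Set.range f) (Set.range g))
    (A : Hil ν ι →L[ℂ] Hil ν ι) (B : Hil ν κ →L[ℂ] Hil ν κ) :
    lift f A * lift g B = lift g B * lift f A := by
  classical
  let g' : κ ↪ {r : ρ // r ∉ Set.range f} :=
    ⟨fun k => ⟨g k, fun hk => Set.disjoint_left.1 h hk ⟨k, rfl⟩⟩, fun a b hab =>
      g.injective (congrArg Subtype.val hab)⟩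
  let j : {r : ρ // r ∉ Set.range f} ↪ ρ := Function.Embedding.subtype _
  have hg : g = g'.trans j := rfl
  rw [hg, lift_trans]
  refine ext_tensor (embEquiv f) fun φ χ => ?_
  rw [mul_apply_eq_comp, mul_apply_eq_comp, lift_tensor f _ (fun _ => rfl),
    lift_tensor_snd j _ (fun _ => rfl), lift_tensor_snd j _ (fun _ => rfl), lift_tensor f _ (fun _ => rfl)]

theorem lift_equiv (σ : ι ≃ ρ) (A : Hil ν ι →L[ℂ] Hil ν ι) :
    lift σ.toEmbedding A = relabel σ ∘L A ∘L relabel σ.symm := by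
  classical
  haveI : IsEmpty {r : ρ // r ∉ Set.range σ.toEmbedding} :=
    ⟨fun r => r.2 (σ.surjective r.1)⟩
  refine lift_unique _ (embEquiv σ.toEmbedding) (fun _ => rfl) fun φ χ => ?_
  obtain ⟨c, hc⟩ := exists_tensor_eq_smul (embEquiv σ.toEmbedding) σ (fun _ => rfl) χ
  rw [hc, hc]
  simp only [ContinuousLinearMap.comp_apply, map_smul, relabel_symm_relabel]

theorem lift_refl (A : Hil ν ι →L[ℂ] Hil ν ι) : lift (Function.Embedding.refl ι) A = A := by
  have := lift_equiv (Equiv.refl ι) A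
  rw [Equiv.refl_toEmbedding] at this
  rw [this]
  ext1 ψ
  simp only [ContinuousLinearMap.comp_apply, Equiv.refl_symm, relabel_refl]

end Lift

section PartialTrace
variable {ν : ℕ} {ι κ ρ τ : Type} [Fintype ι] [Fintype κ] [Fintype ρ] [Fintype τ]

theorem tensorRight_apply (e : ι ⊕ κ ≃ ρ) (χ : Hil ν κ) (φ : Hil ν ι) :
    tensorRight e χ φ = tensor e φ χ := rfl

theorem adjoint_tensorRight_tensor (e : ι ⊕ κ ≃ ρ) (φ : Hil ν ι) (χ χ' : Hil ν κ) :
    (tensorRight e χ').adjoint (tensor e φ χ) = (inner ℂ χ' χ : ℂ) • φ := by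
  refine ext_inner_left ℂ fun ψ => ?_
  rw [ContinuousLinearMap.adjoint_inner_right, tensorRight_apply, inner_tensor, inner_smul_right,
    mul_comm]

/-- The compression `ψ ↦ R_k† ψ` along the basis vector `e_k`. -/
noncomputable def slice (e : ι ⊕ κ ≃ ρ) (k : basisSet (Hil ν κ)) : Hil ν ρ →L[ℂ] Hil ν ι :=
  (tensorRight e (onBasis (Hil ν κ) k)).adjoint

theorem sum_norm_slice_sq_le (e : ι ⊕ κ ≃ ρ) (F : Finset (basisSet (Hil ν κ))) (u : Hil ν ρ) :
    ∑ k ∈ F, ‖slice e k u‖ ^ 2 ≤ ‖u‖ ^ 2 := by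
  let b := onBasis (Hil ν κ)
  let V : basisSet (Hil ν κ) → Hil ν ι →ₗᵢ[ℂ] Hil ν ρ := fun j =>
    { toLinearMap := (tensorRight e (b j)).toLinearMap
      norm_map' := fun φ => by
        change ‖tensor e φ (b j)‖ = _
        rw [norm_tensor, b.orthonormal.1 j, mul_one] }
  have hV : OrthogonalFamily ℂ (fun _ : basisSet (Hil ν κ) => Hil ν ι) V := by
    intro i j hij φ φ'
    change inner ℂ (tensor e φ (b i)) (tensor e φ' (b j)) = 0
    rw [inner_tensor, b.orthonormal.2 hij, mul_zero]
  set p := ∑ k ∈ F, V k (slice e k u) with hp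
  have h1 : ‖p‖ ^ 2 = ∑ k ∈ F, ‖slice e k u‖ ^ 2 := hV.norm_sum (fun k => slice e k u) F
  have h2 : (inner ℂ u p : ℂ) = ((‖p‖ ^ 2 : ℝ) : ℂ) := by
    rw [h1, hp, inner_sum, Complex.ofReal_sum]
    refine Finset.sum_congr rfl fun k _ => ?_
    change inner ℂ u (tensorRight e (b k) (slice e k u)) = _
    rw [← ContinuousLinearMap.adjoint_inner_left]
    change inner ℂ (slice e k u) (slice e k u) = _
    rw [inner_self_eq_norm_sq_to_K]
    simp
  have h3 : ‖p‖ ^ 2 ≤ ‖u‖ * ‖p‖ := by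
    have := norm_inner_le_norm (𝕜 := ℂ) u p
    rw [h2, Complex.norm_real, Real.norm_of_nonneg (sq_nonneg _)] at this
    exact this
  rw [← h1]
  have h4 : ‖p‖ ≤ ‖u‖ := by
    by_contra hlt
    push Not at hlt
    nlinarith [norm_nonneg u]
  exact pow_le_pow_left₀ (norm_nonneg _) h4 2

theorem tsum_enorm_slice_le (e : ι ⊕ κ ≃ ρ) (u v : Hil ν ρ) :
    ∑' k, ‖slice e k u‖ₑ * ‖slice e k v‖ₑ ≤ ‖u‖ₑ * ‖v‖ₑ := by
  rw [ENNReal.tsum_eq_iSup_sum]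
  refine iSup_le fun F => ?_
  have h : ∑ k ∈ F, ‖slice e k u‖ * ‖slice e k v‖ ≤ ‖u‖ * ‖v‖ := by
    refine (Real.sum_mul_le_sqrt_mul_sqrt _ _ _).trans ?_
    exact mul_le_mul (Real.sqrt_le_iff.2 ⟨norm_nonneg _, sum_norm_slice_sq_le e F u⟩)
      (Real.sqrt_le_iff.2 ⟨norm_nonneg _, sum_norm_slice_sq_le e F v⟩) (Real.sqrt_nonneg _)
      (norm_nonneg _)
  calc _ = ENNReal.ofReal (∑ k ∈ F, ‖slice e k u‖ * ‖slice e k v‖) := by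
        rw [ENNReal.ofReal_sum_of_nonneg fun i _ => mul_nonneg (norm_nonneg _) (norm_nonneg _)]
        simp only [ENNReal.ofReal_mul (norm_nonneg _), ofReal_norm]
    _ ≤ ENNReal.ofReal (‖u‖ * ‖v‖) := ENNReal.ofReal_le_ofReal h
    _ = _ := by rw [ENNReal.ofReal_mul (norm_nonneg _), ofReal_norm, ofReal_norm]

theorem hasSum_tensorRight_slice (e : ι ⊕ κ ≃ ρ) (u : Hil ν ρ) :
    HasSum (fun k => tensorRight e (onBasis (Hil ν κ) k) (slice e k u)) u := by
  let P : Finset (basisSet (Hil ν κ)) → Hil ν ρ →L[ℂ] Hil ν ρ := fun F =>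
    ∑ k ∈ F, tensorRight e (onBasis (Hil ν κ) k) ∘L slice e k
  have hP : ∀ F, ‖P F‖ ≤ 1 := fun F => by
    refine ContinuousLinearMap.opNorm_le_of_unit_norm zero_le_one fun u hu => ?_
    refine le_of_forall_pos_le_add fun ε hε => ?_
    have h1 : ‖(inner ℂ (P F u) (P F u) : ℂ)‖ ≤ ‖u‖ * ‖P F u‖ := by
      have h2 : (inner ℂ (P F u) (P F u) : ℂ) =
          ∑ k ∈ F, inner ℂ (slice e k u) (slice e k (P F u)) := by
        nth_rewrite 1 [show P F u = ∑ k ∈ F, tensorRight e (onBasis (Hil ν κ) k) (slice e k u) by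
          simp [P]]
        rw [sum_inner]
        exact Finset.sum_congr rfl fun k _ => (ContinuousLinearMap.adjoint_inner_right _ _ _).symm
      rw [h2]
      refine (norm_sum_le _ _).trans ?_
      refine (Finset.sum_le_sum fun k _ => norm_inner_le_norm _ _).trans ?_
      refine (Real.sum_mul_le_sqrt_mul_sqrt _ _ _).trans ?_
      gcongr
      · exact Real.sqrt_le_iff.2 ⟨norm_nonneg _, sum_norm_slice_sq_le e F _⟩
      · exact Real.sqrt_le_iff.2 ⟨norm_nonneg _, sum_norm_slice_sq_le e F _⟩
    rw [inner_self_eq_norm_sq_to_K, hu, one_mul] at h1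
    simp only [norm_pow, RCLike.norm_ofReal, abs_norm] at h1
    nlinarith [norm_nonneg (P F u)]
  have h := tendsto_of_dense (l := SummationFilter.unconditional _ |>.filter) (F := P)
    (G := 1) hP (dense_span_tensor e) (fun x hx => ?_) u
  · refine h.congr fun F => ?_
    simp [P]
  · induction hx using Submodule.span_induction with
    | mem x hx =>
      obtain ⟨φ, χ, rfl⟩ := hx
      have h1 := ((onBasis (Hil ν κ)).hasSum_repr χ).mapL (tensorLeft e φ)
      refine Tendsto.congr (fun F => ?_) h1
      simp only [P, sum_apply]
      refine Finset.sum_congr rfl fun k _ => ?_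
      rw [HilbertBasis.repr_apply_apply, map_smul, ContinuousLinearMap.comp_apply, slice,
        adjoint_tensorRight_tensor, map_smul]
      rfl
    | zero => simp
    | add x y _ _ hx hy => simpa using hx.add hy
    | smul c x _ hx => simpa using hx.const_smul c

theorem IsRep.summable_slice {J : Type} {u v : J → Hil ν ρ} (e : ι ⊕ κ ≃ ρ)
    (hs : Summable fun j => ‖u j‖ * ‖v j‖) :
    repSize (fun p : basisSet (Hil ν κ) × J => slice e p.1 (u p.2)) (fun p => slice e p.1 (v p.2)) ≤
      repSize u v := by
  rw [repSize, ENNReal.tsum_prod', ENNReal.tsum_comm]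
  exact ENNReal.tsum_le_tsum fun j => tsum_enorm_slice_le e (u j) (v j)

theorem summable_of_repSize {E J : Type} [NormedAddCommGroup E] {u v : J → E}
    (h : repSize u v ≠ ∞) : Summable fun j => ‖u j‖ * ‖v j‖ := by
  have := ENNReal.summable_toReal h
  simpa using this

theorem isRep_partialTrace {J : Type} {u v : J → Hil ν ρ} {T : Hil ν ρ →L[ℂ] Hil ν ρ}
    (e : ι ⊕ κ ≃ ρ) (h : IsRep u v T) (hs : Summable fun j => ‖u j‖ * ‖v j‖) :
    IsRep (fun p : basisSet (Hil ν κ) × J => slice e p.1 (u p.2)) (fun p => slice e p.1 (v p.2))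
      (partialTrace e T) := by
  have hfin := ne_top_of_le_ne_top (repSize_ne_top hs) (IsRep.summable_slice e hs)
  have hsum := summable_of_repSize hfin
  have hk : ∀ k x, HasSum (fun j => inner ℂ (slice e k (v j)) x • slice e k (u j))
      ((slice e k ∘L T ∘L tensorRight e (onBasis (Hil ν κ) k)) x) := fun k x => by
    have := (h (tensorRight e (onBasis (Hil ν κ) k) x)).mapL (slice e k)
    simp only [map_smul] at this
    simp only [slice, ContinuousLinearMap.adjoint_inner_left]
    exact this
  have hnorm : ∀ k, ‖slice e k ∘L T ∘L tensorRight e (onBasis (Hil ν κ) k)‖ₑ ≤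
      repSize (fun j => slice e k (u j)) (fun j => slice e k (v j)) := fun k =>
    (enorm_le_traceNorm _).trans (traceNorm_le_rep (hk k))
  have hopsum : Summable fun k => slice e k ∘L T ∘L tensorRight e (onBasis (Hil ν κ) k) := by
    apply Summable.of_norm
    apply summable_norm_of_tsum_enorm
    refine ne_top_of_le_ne_top hfin ?_
    rw [repSize, ENNReal.tsum_prod']
    exact ENNReal.tsum_le_tsum hnorm
  intro x
  have h1 : Summable fun p : basisSet (Hil ν κ) × J =>
      inner ℂ (slice e p.1 (v p.2)) x • slice e p.1 (u p.2) := by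
    refine Summable.of_norm_bounded (hsum.mul_right ‖x‖) fun p => ?_
    rw [norm_smul]
    have := mul_le_mul_of_nonneg_right (norm_inner_le_norm (𝕜 := ℂ) (slice e p.1 (v p.2)) x)
      (norm_nonneg (slice e p.1 (u p.2)))
    linarith
  have h2 := h1.hasSum.prod_fiberwise (fun k => hk k x)
  have h3 : HasSum (fun k => (slice e k ∘L T ∘L tensorRight e (onBasis (Hil ν κ) k)) x)
      (partialTrace e T x) := hopsum.hasSum.mapL (ContinuousLinearMap.apply ℂ _ x)
  rw [← h2.unique h3]
  exact h1.hasSum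

theorem traceNorm_partialTrace_le (e : ι ⊕ κ ≃ ρ) (T : Hil ν ρ →L[ℂ] Hil ν ρ)
    (hT : traceNorm T ≠ ∞) : traceNorm (partialTrace e T) ≤ traceNorm T := by
  obtain ⟨u, v, h, hle⟩ := exists_rep T
  have hs := summable_of_repSize (ne_top_of_le_ne_top hT hle)
  exact (traceNorm_le_rep (isRep_partialTrace e h hs)).trans ((IsRep.summable_slice e hs).trans hle)

/-- The partial trace is dual to the ampliation. -/
theorem opTrace_mul_partialTrace (e : ι ⊕ κ ≃ ρ) (f : ι ↪ ρ) (he : ∀ i, e (Sum.inl i) = f i)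
    {T : Hil ν ρ →L[ℂ] Hil ν ρ} (hT : traceNorm T ≠ ∞) (A : Hil ν ι →L[ℂ] Hil ν ι) :
    opTrace (A * partialTrace e T) = opTrace (lift f A * T) := by
  obtain ⟨u, v, h, hs, -⟩ := exists_rep_summable hT
  have hfin := ne_top_of_le_ne_top (repSize_ne_top hs) (IsRep.summable_slice e hs)
  have hsum := summable_of_repSize hfin
  rw [opTrace_mul_rep (isRep_partialTrace e h hs) hsum, opTrace_mul_rep h hs]
  have h1 : Summable fun p : basisSet (Hil ν κ) × basisSet (Hil ν ρ) =>
      (inner ℂ (slice e p.1 (v p.2)) (A (slice e p.1 (u p.2))) : ℂ) := by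
    refine Summable.of_norm_bounded (hsum.mul_left ‖A‖) fun p => ?_
    refine (norm_inner_le_norm _ _).trans ?_
    have := mul_le_mul_of_nonneg_left (A.le_opNorm (slice e p.1 (u p.2)))
      (norm_nonneg (slice e p.1 (v p.2)))
    linarith
  have h2 : ∀ j, HasSum (fun k => (inner ℂ (slice e k (v j)) (A (slice e k (u j))) : ℂ))
      (inner ℂ (v j) (lift f A (u j))) := fun j => by
    have h3 := (hasSum_tensorRight_slice e (u j)).mapL (innerSL ℂ (v j) ∘L lift f A)
    refine h3.congr_fun fun k => ?_
    rw [ContinuousLinearMap.comp_apply, innerSL_apply_apply, tensorRight_apply,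
      lift_tensor f e he, slice, ContinuousLinearMap.adjoint_inner_left]
    rfl
  have h4 := h1.prod_symm.hasSum.prod_fiberwise h2
  rw [h4.tsum_eq]
  exact ((Equiv.prodComm (basisSet (Hil ν ρ)) (basisSet (Hil ν κ))).tsum_eq
    (fun p => (inner ℂ (slice e p.1 (v p.2)) (A (slice e p.1 (u p.2))) : ℂ))).symm

end PartialTrace

section Partitions
variable {α : Type} [DecidableEq α]

theorem parts_avoid_of_mem {S : Finset α} (Q : Finpartition S) {B : Finset α} (hB : B ∈ Q.parts) :
    (Q.avoid B).parts = Q.parts.erase B := by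
  ext C
  rw [Finpartition.mem_avoid, Finset.mem_erase]
  constructor
  · rintro ⟨D, hD, hle, rfl⟩
    have hne : D ≠ B := fun h => hle (h ▸ le_rfl)
    have hd : Disjoint D B := Q.disjoint hD hB hne
    rw [hd.sdiff_eq_left]
    exact ⟨hne, hD⟩
  · rintro ⟨hne, hC⟩
    have hd : Disjoint C B := Q.disjoint hC hB hne
    refine ⟨C, hC, fun hle => Q.ne_bot hC ?_, hd.sdiff_eq_left⟩
    exact disjoint_self.1 (hd.mono_right hle)

/-- Splitting off one block of a partition. -/
theorem sum_finpartition_blocks {M : Type} [AddCommMonoid M] (S : Finset α)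
    (G : Finset α → ℕ → M) :
    ∑ Q : Finpartition S, ∑ B ∈ Q.parts, G B Q.parts.card =
      ∑ B ∈ S.powerset.erase ∅, ∑ Q : Finpartition (S \ B), G B (Q.parts.card + 1) := by
  rw [Finset.sum_sigma', Finset.sum_sigma']
  refine Finset.sum_bij' (fun x _ => ⟨x.2, x.1.avoid x.2⟩)
    (fun y hy => ⟨y.2.extend (b := y.1) (c := S)
      (by simp only [Finset.mem_sigma, Finset.mem_erase] at hy; exact hy.1.1)
      Finset.sdiff_disjoint
      (Finset.sdiff_union_of_subset (by
        simp only [Finset.mem_sigma, Finset.mem_erase, Finset.mem_powerset] at hy; exact hy.1.2)), y.1⟩)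
    ?_ ?_ ?_ ?_ ?_
  · rintro ⟨Q, B⟩ h
    simp only [Finset.mem_sigma, Finset.mem_univ, true_and] at h
    simp only [Finset.mem_sigma, Finset.mem_univ, and_true, Finset.mem_erase, Finset.mem_powerset]
    exact ⟨Q.ne_bot h, Q.le h⟩
  · rintro ⟨B, Q⟩ h
    simp only [Finset.mem_sigma, Finset.mem_univ, true_and, Finpartition.extend_parts]
    exact Finset.mem_insert_self _ _
  · rintro ⟨Q, B⟩ h
    simp only [Finset.mem_sigma, Finset.mem_univ, true_and] at h
    congr 1
    ext1
    rw [Finpartition.extend_parts]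
    change insert B (Q.avoid B).parts = Q.parts
    rw [parts_avoid_of_mem Q h, Finset.insert_erase h]
  · rintro ⟨B, Q⟩ h
    simp only [Finset.mem_sigma, Finset.mem_univ, and_true, Finset.mem_erase, Finset.mem_powerset] at h
    congr 1
    ext1
    rw [parts_avoid_of_mem _ (by rw [Finpartition.extend_parts]; exact Finset.mem_insert_self _ _),
      Finpartition.extend_parts]
    refine Finset.erase_insert fun hB => ?_
    exact h.1 (disjoint_self.1 (Finset.sdiff_disjoint.mono_left (Q.le hB)))
  · rintro ⟨Q, B⟩ h
    simp only [Finset.mem_sigma, Finset.mem_univ, true_and] at h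
    dsimp only
    rw [parts_avoid_of_mem Q h, Finset.card_erase_of_mem h,
      Nat.sub_add_cancel (Finset.card_pos.2 ⟨B, h⟩)]

theorem sum_powerset_neg_one_pow_sdiff {S : Finset α} (hS : S.Nonempty) :
    ∑ B ∈ S.powerset, (-1 : ℂ) ^ (S \ B).card = 0 := by
  have h : ∀ B ∈ S.powerset, (-1 : ℂ) ^ (S \ B).card = (-1) ^ S.card * (-1) ^ B.card := fun B hB => by
    have hB' := Finset.mem_powerset.1 hB
    rw [← Finset.card_sdiff_add_card_eq_card hB', pow_add, mul_assoc, ← pow_add, Even.neg_one_pow ⟨_, rfl⟩,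
      mul_one]
  rw [Finset.sum_congr rfl h, ← Finset.mul_sum]
  have := Finset.sum_powerset_neg_one_pow_card_of_nonempty hS
  have h2 : ∑ B ∈ S.powerset, (-1 : ℂ) ^ B.card = ((∑ B ∈ S.powerset, (-1 : ℤ) ^ B.card : ℤ) : ℂ) := by
    push_cast; rfl
  rw [h2, this, Int.cast_zero, mul_zero]

theorem sum_finpartition_neg_one_pow (S : Finset α) :
    ∑ Q : Finpartition S, (-1 : ℂ) ^ Q.parts.card * (Q.parts.card.factorial : ℂ) =
      (-1) ^ S.card := by
  induction S using Finset.strongInduction with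
  | H S ih =>
    rcases S.eq_empty_or_nonempty with rfl | hS
    · have h : ∀ Q : Finpartition (∅ : Finset α), Q.parts = ∅ := fun Q =>
        Finpartition.parts_eq_empty_iff.2 rfl
      have hu : ∀ Q Q' : Finpartition (∅ : Finset α), Q = Q' := fun Q Q' => by
        ext1; rw [h, h]
      have hc : Fintype.card (Finpartition (∅ : Finset α)) = 1 :=
        Fintype.card_eq_one_iff.2 ⟨Finpartition.empty (Finset α), fun Q => hu _ _⟩
      simp only [h, Finset.card_empty, pow_zero, Nat.factorial_zero, Nat.cast_one, mul_one,
        Finset.sum_const, Finset.card_univ, hc, one_smul]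
    · have h1 : ∀ Q : Finpartition S, (-1 : ℂ) ^ Q.parts.card * (Q.parts.card.factorial : ℂ) =
          ∑ B ∈ Q.parts, (-1 : ℂ) ^ Q.parts.card * ((Q.parts.card - 1).factorial : ℂ) := fun Q => by
        have hpos : Q.parts.card ≠ 0 := by
          rw [Ne, Finset.card_eq_zero, Finpartition.parts_eq_empty_iff]
          exact hS.ne_empty
        rw [Finset.sum_const, nsmul_eq_mul, ← Nat.mul_factorial_pred hpos]
        push_cast; ring
      rw [Finset.sum_congr rfl fun Q _ => h1 Q,
        sum_finpartition_blocks S fun _ n => (-1 : ℂ) ^ n * ((n - 1).factorial : ℂ)]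
      have h2 : ∀ B ∈ S.powerset.erase ∅, ∑ Q : Finpartition (S \ B),
          (-1 : ℂ) ^ (Q.parts.card + 1) * ((Q.parts.card + 1 - 1).factorial : ℂ) =
          -(-1) ^ (S \ B).card := fun B hB => by
        rw [Finset.mem_erase, Finset.mem_powerset] at hB
        have hlt : S \ B ⊂ S := Finset.sdiff_ssubset hB.2 (Finset.nonempty_iff_ne_empty.2 hB.1)
        rw [← ih _ hlt, ← Finset.sum_neg_distrib]
        refine Finset.sum_congr rfl fun Q _ => ?_
        rw [Nat.add_sub_cancel, pow_succ]; ring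
      rw [Finset.sum_congr rfl h2, Finset.sum_neg_distrib]
      have h3 := sum_powerset_neg_one_pow_sdiff hS
      rw [← Finset.add_sum_erase _ _ (Finset.empty_mem_powerset S), Finset.sdiff_empty] at h3
      linear_combination -h3

theorem sum_cumulant_coefficients {M : Type} [AddCommGroup M] [Module ℂ M] {S : Finset α} {a : α}
    (ha : a ∈ S) (F : Finset α → M) :
    ∑ P : Finpartition S, ((-1 : ℂ) ^ (P.parts.card - 1) * ((P.parts.card - 1).factorial : ℂ)) •
      (∑ B ∈ P.parts, if a ∈ B then F B else 0) =
    ∑ B ∈ S.powerset, if a ∈ B then ((-1 : ℂ) ^ (S \ B).card) • F B else 0 := by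
  simp only [Finset.smul_sum]
  rw [sum_finpartition_blocks S fun B n => ((-1 : ℂ) ^ (n - 1) * ((n - 1).factorial : ℂ)) •
    (if a ∈ B then F B else 0), ← Finset.add_sum_erase _ _ (Finset.empty_mem_powerset S),
    if_neg (Finset.notMem_empty a), zero_add]
  refine Finset.sum_congr rfl fun B _ => ?_
  rw [← Finset.sum_smul]
  simp only [Nat.add_sub_cancel]
  rw [sum_finpartition_neg_one_pow, smul_ite, smul_zero]

end Partitions

section Decluster
variable {m : ℕ} (J : Finset (Fin m))

theorem mem_decluster_of_mem {B : Finset (Option {i : Fin m // i ∉ J})} {i : Fin m} (h : i ∈ J) :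
    i ∈ decluster J B ↔ none ∈ B := by
  simp [decluster, h]

theorem mem_decluster_of_notMem {B : Finset (Option {i : Fin m // i ∉ J})} {i : Fin m} (h : i ∉ J) :
    i ∈ decluster J B ↔ some ⟨i, h⟩ ∈ B := by
  simp [decluster, h]

theorem disjoint_decluster {B B' : Finset (Option {i : Fin m // i ∉ J})} (h : Disjoint B B') :
    Disjoint (decluster J B) (decluster J B') := by
  rw [Finset.disjoint_left] at h ⊢
  intro i hi hi'
  by_cases hJ : i ∈ J
  · rw [mem_decluster_of_mem J hJ] at hi hi'
    exact h hi hi'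
  · rw [mem_decluster_of_notMem J hJ] at hi hi'
    exact h hi hi'

/-- The clusters containing `J` correspond to the sets of particles containing `J`. -/
theorem sum_decluster {M : Type} [AddCommGroup M] [Module ℂ M] (F : Finset (Fin m) → M) :
    (∑ B ∈ (Finset.univ : Finset (Option {i : Fin m // i ∉ J})).powerset,
      if none ∈ B then ((-1 : ℂ) ^ (Finset.univ \ B).card) • F (decluster J B) else 0) =
    ∑ W : Finset (Fin m) with J ⊆ W, ((-1 : ℂ) ^ Wᶜ.card) • F W := by
  classical
  rw [← Finset.sum_filter]
  refine Finset.sum_bij' (fun B _ => decluster J B)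
    (fun W _ => insert none (Finset.univ.filter fun o : Option {i : Fin m // i ∉ J} =>
      ∃ i, o = some i ∧ i.1 ∈ W)) ?_ ?_ ?_ ?_ ?_
  · intro B hB
    rw [Finset.mem_filter] at hB
    rw [Finset.mem_filter]
    exact ⟨Finset.mem_univ _, fun i hi => (mem_decluster_of_mem J hi).2 hB.2⟩
  · intro W _
    simp
  · intro B hB
    rw [Finset.mem_filter] at hB
    ext o
    rcases o with _ | ⟨i, hi⟩
    · simp [hB.2]
    · simp [mem_decluster_of_notMem J hi, hi]
  · intro W hW
    rw [Finset.mem_filter] at hW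
    ext i
    by_cases hi : i ∈ J
    · simp [mem_decluster_of_mem J hi, hW.2 hi]
    · simp [mem_decluster_of_notMem J hi, hi]
  · intro B hB
    rw [Finset.mem_filter] at hB
    congr 2
    refine Finset.card_bij' (i := fun o ho => match o, ho with
      | none, ho => absurd hB.2 (Finset.mem_sdiff.1 ho).2
      | some i, _ => i.1)
      (j := fun i hi => some ⟨i, fun hJ => Finset.mem_compl.1 hi ((mem_decluster_of_mem J hJ).2 hB.2)⟩)
      ?_ ?_ ?_ ?_
    · rintro (_ | ⟨i, hi⟩) ho
      · exact absurd hB.2 (Finset.mem_sdiff.1 ho).2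
      · rw [Finset.mem_compl, mem_decluster_of_notMem J hi]
        exact (Finset.mem_sdiff.1 ho).2
    · intro i hi
      rw [Finset.mem_sdiff]
      refine ⟨Finset.mem_univ _, ?_⟩
      rwa [Finset.mem_compl, mem_decluster_of_notMem J] at hi
    · rintro (_ | ⟨i, hi⟩) ho
      · exact absurd hB.2 (Finset.mem_sdiff.1 ho).2
      · rfl
    · intro i hi
      rfl

end Decluster

section HamiltonianGraph
variable {ν : ℕ} {ħ : ℝ} {Φ : ∀ k : ℕ, (Fin k → Pos ν) → ℝ} {n : ℕ}

theorem minimalGraph_snd_eq_zero {p : Hil ν (Fin n) × Hil ν (Fin n)} (hp : p ∈ minimalGraph ħ Φ n)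
    (h0 : p.1 = 0) : p.2 = 0 := by
  obtain ⟨φ, h1, h2, h3, h4⟩ := hp
  have h5 : φ = 0 := by
    refine (Continuous.ae_eq_iff_eq (μ := (volume : Measure (Fin n → Pos ν))) h1.continuous
      continuous_zero).1 ?_
    rw [h0] at h3
    exact h3.symm.trans (Lp.coeFn_zero _ _ _)
  have h6 : hamiltonianExpr ħ Φ (0 : (Fin n → Pos ν) → ℂ) = 0 := by
    funext q
    have := hamiltonianExpr_smul ħ Φ (0 : ℂ) (contDiff_zero_fun : ContDiff ℝ (⊤ : ℕ∞)
      (0 : (Fin n → Pos ν) → ℂ)) q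
    simpa using this
  rw [h5, h6] at h4
  exact Lp.ext (h4.trans (Lp.coeFn_zero _ _ _).symm)

theorem graph_hamiltonian (hH : IsSelfAdjoint (hamiltonian ħ Φ n)) :
    (hamiltonian ħ Φ n).graph = (minimalGraph ħ Φ n).topologicalClosure := by
  have hg : (minimalGraph ħ Φ n).toLinearPMap.graph = minimalGraph ħ Φ n :=
    Submodule.toLinearPMap_graph_eq _ fun p hp h0 => minimalGraph_snd_eq_zero hp h0
  have hc : (minimalGraph ħ Φ n).toLinearPMap.IsClosable := by
    by_contra hn
    have h1 : hamiltonian ħ Φ n = (minimalGraph ħ Φ n).toLinearPMap := LinearPMap.closure_def' hn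
    have h2 := hH.isClosed
    rw [h1] at h2
    exact hn h2.isClosable
  rw [hamiltonian, ← hc.graph_closure_eq_closure_graph, hg]

theorem minimalGraph_le_graph (hH : IsSelfAdjoint (hamiltonian ħ Φ n)) :
    minimalGraph ħ Φ n ≤ (hamiltonian ħ Φ n).graph := by
  rw [graph_hamiltonian hH]
  exact Submodule.le_topologicalClosure _

theorem mem_graph_hamiltonian_iff (hH : IsSelfAdjoint (hamiltonian ħ Φ n)) {a b : Hil ν (Fin n)} :
    (a, b) ∈ (hamiltonian ħ Φ n).graph ↔
      ∀ p ∈ minimalGraph ħ Φ n, inner ℂ p.2 a = inner ℂ p.1 b := by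
  rw [mem_graph_iff_of_isSelfAdjoint hH]
  constructor
  · intro h p hp
    exact h p.1 p.2 (minimalGraph_le_graph hH hp)
  · intro h x y hxy
    rw [graph_hamiltonian hH] at hxy
    have hcl : IsClosed {p : Hil ν (Fin n) × Hil ν (Fin n) | (inner ℂ p.2 a : ℂ) = inner ℂ p.1 b} :=
      isClosed_eq (continuous_snd.inner continuous_const) (continuous_fst.inner continuous_const)
    exact closure_minimal h hcl hxy

theorem map_graph_hamiltonian (hH : IsSelfAdjoint (hamiltonian ħ Φ n)) {P : Op ν n}
    (hP : ∀ p ∈ minimalGraph ħ Φ n, (P p.1, P p.2) ∈ minimalGraph ħ Φ n) {ψ η : Hil ν (Fin n)}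
    (h : (ψ, η) ∈ (hamiltonian ħ Φ n).graph) : (P ψ, P η) ∈ (hamiltonian ħ Φ n).graph := by
  rw [graph_hamiltonian hH] at h ⊢
  have hc : Continuous fun p : Hil ν (Fin n) × Hil ν (Fin n) => (P p.1, P p.2) := by fun_prop
  exact map_mem_closure (f := fun p : Hil ν (Fin n) × Hil ν (Fin n) => (P p.1, P p.2))
    (s := (minimalGraph ħ Φ n : Set (Hil ν (Fin n) × Hil ν (Fin n))))
    (t := (minimalGraph ħ Φ n : Set (Hil ν (Fin n) × Hil ν (Fin n)))) hc h (fun p hp => hP p hp)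

end HamiltonianGraph

section Permutations
variable {ν : ℕ} {ħ : ℝ} {Φ : ∀ k : ℕ, (Fin k → Pos ν) → ℝ} {n : ℕ}

theorem potential_eq_of_range (hΦ : ∀ (k : ℕ) (σ : Equiv.Perm (Fin k)) (q : Fin k → Pos ν),
    Φ k (q ∘ σ) = Φ k q) {k l : ℕ} {X : Type} (f : Fin k ↪ X) (g : Fin l ↪ X)
    (h : Set.range f = Set.range g) (q : X → Pos ν) :
    Φ k (fun i => q (f i)) = Φ l (fun i => q (g i)) := by
  have hkl : k = l := by
    have h1 := Nat.card_range_of_injective f.injective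
    have h2 := Nat.card_range_of_injective g.injective
    rw [h, h2] at h1
    simpa using h1.symm
  subst hkl
  choose σ hσ using fun i => show f i ∈ Set.range g by rw [← h]; exact ⟨i, rfl⟩
  have hinj : Function.Injective σ := fun a b hab => f.injective (by rw [← hσ, ← hσ, hab])
  let s : Equiv.Perm (Fin k) := Equiv.ofBijective σ (Finite.injective_iff_bijective.1 hinj)
  rw [← hΦ k s fun i => q (g i)]
  congr 1
  funext i
  exact congrArg q (hσ i).symm

theorem potentialEnergy_perm (hΦ : ∀ (k : ℕ) (σ : Equiv.Perm (Fin k)) (q : Fin k → Pos ν),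
    Φ k (q ∘ σ) = Φ k q) (σ : Equiv.Perm (Fin n)) (q : Fin n → Pos ν) :
    potentialEnergy Φ (fun i => q (σ i)) = potentialEnergy Φ q := by
  unfold potentialEnergy
  refine Finset.sum_bij' (fun S _ => S.map σ.toEmbedding) (fun S _ => S.map σ.symm.toEmbedding)
    ?_ ?_ ?_ ?_ ?_
  · intro S hS; simpa using hS
  · intro S hS; simpa using hS
  · intro S _; ext; simp
  · intro S _; ext; simp
  · intro S _
    refine potential_eq_of_range hΦ ((S.orderEmbOfFin rfl).toEmbedding.trans σ.toEmbedding)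
      ((S.map σ.toEmbedding).orderEmbOfFin rfl).toEmbedding ?_ q
    have h1 : Set.range ((S.map σ.toEmbedding).orderEmbOfFin rfl).toEmbedding =
      ↑(S.map σ.toEmbedding) := Finset.range_orderEmbOfFin _ _
    have h2 : Set.range (S.orderEmbOfFin rfl).toEmbedding = ↑S := Finset.range_orderEmbOfFin _ _
    rw [h1, Function.Embedding.coe_trans, Set.range_comp, h2, Finset.coe_map]

theorem totalLaplacian_perm (σ : Equiv.Perm (Fin n)) (φ : (Fin n → Pos ν) → ℂ)
    (q : Fin n → Pos ν) :
    totalLaplacian (fun q => φ fun i => q (σ i)) q = totalLaplacian φ fun i => q (σ i) := by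
  unfold totalLaplacian
  rw [← Equiv.sum_comp σ]
  refine Finset.sum_congr rfl fun i _ => ?_
  refine congrFun (congrArg (fun g : Pos ν → ℂ => Δ g) ?_) (q (σ i))
  funext y
  refine congrArg φ ?_
  funext j
  by_cases h : j = i
  · subst h; simp
  · simp [Function.update_of_ne h, Function.update_of_ne (fun h' => h (σ.injective h'))]

theorem permOp_minimalGraph (hΦ : ∀ (k : ℕ) (σ : Equiv.Perm (Fin k)) (q : Fin k → Pos ν),
    Φ k (q ∘ σ) = Φ k q) (σ : Equiv.Perm (Fin n)) (p : Hil ν (Fin n) × Hil ν (Fin n))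
    (hp : p ∈ minimalGraph ħ Φ n) : (permOp σ p.1, permOp σ p.2) ∈ minimalGraph ħ Φ n := by
  obtain ⟨φ, h1, h2, h3, h4⟩ := hp
  have hσ := (measurePreserving_relabel (ν := ν) σ).quasiMeasurePreserving
  refine ⟨fun q => φ fun i => q (σ i), ?_, ?_, ?_, ?_⟩
  · exact h1.comp (contDiff_pi.2 fun i => contDiff_apply ℝ (Pos ν) (σ i))
  · exact h2.comp_homeomorph (Homeomorph.piCongrLeft (Y := fun _ : Fin n => Pos ν) σ).symm
  · filter_upwards [coeFn_relabel σ p.1, hσ.ae h3] with x h5 h6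
    rw [permOp_eq_relabel, h5, h6]
  · filter_upwards [coeFn_relabel σ p.2, hσ.ae h4] with x h5 h6
    rw [permOp_eq_relabel, h5, h6, hamiltonianExpr, hamiltonianExpr, totalLaplacian_perm,
      potentialEnergy_perm hΦ]

theorem isUnitaryGroupOf_hamiltonian (hH : IsSelfAdjoint (hamiltonian ħ Φ n)) :
    IsUnitaryGroupOf (hamiltonian ħ Φ n) (unitaryGroup (hamiltonian ħ Φ n)) :=
  isUnitaryGroupOf_unitaryGroup hH

theorem permOp_graph (hΦ : ∀ (k : ℕ) (σ : Equiv.Perm (Fin k)) (q : Fin k → Pos ν),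
    Φ k (q ∘ σ) = Φ k q) (hH : IsSelfAdjoint (hamiltonian ħ Φ n)) (σ : Equiv.Perm (Fin n))
    (ψ η : Hil ν (Fin n)) (h : (ψ, η) ∈ (hamiltonian ħ Φ n).graph) :
    (permOp σ ψ, permOp σ η) ∈ (hamiltonian ħ Φ n).graph :=
  map_graph_hamiltonian hH (permOp_minimalGraph hΦ σ) h

theorem isSymmetricOp_evol (hΦ : ∀ (k : ℕ) (σ : Equiv.Perm (Fin k)) (q : Fin k → Pos ν),
    Φ k (q ∘ σ) = Φ k q) (hH : IsSelfAdjoint (hamiltonian ħ Φ n)) (t : ℝ) :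
    IsSymmetricOp (evol ħ Φ n t) := fun σ =>
  (isUnitaryGroupOf_hamiltonian hH).commute_of_map_graph hH (permOp_graph hΦ hH σ) _

theorem permOp_mul_inv (σ : Equiv.Perm (Fin n)) : permOp (ν := ν) σ * permOp σ⁻¹ = 1 :=
  ContinuousLinearMap.ext fun ψ => relabel_relabel_symm σ ψ

theorem permOp_inv_mul (σ : Equiv.Perm (Fin n)) : permOp (ν := ν) σ⁻¹ * permOp σ = 1 :=
  ContinuousLinearMap.ext fun ψ => relabel_symm_relabel σ ψ

theorem isSymmetricOp_of_isComm (hΦ : ∀ (k : ℕ) (σ : Equiv.Perm (Fin k)) (q : Fin k → Pos ν),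
    Φ k (q ∘ σ) = Φ k q) (hH : IsSelfAdjoint (hamiltonian ħ Φ n)) {T S : Op ν n}
    (hT : IsSymmetricOp T) (h : IsComm (hamiltonian ħ Φ n) T S) : IsSymmetricOp S := by
  intro σ
  have h1 : IsComm (hamiltonian ħ Φ n) (permOp σ * T * permOp σ⁻¹) (permOp σ * S * permOp σ⁻¹) := by
    intro ψ η hψ
    obtain ⟨ξ, h2, h3⟩ := h _ _ (permOp_graph hΦ hH σ⁻¹ ψ η hψ)
    refine ⟨permOp σ ξ, permOp_graph hΦ hH σ _ _ h2, ?_⟩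
    simp only [mul_apply_eq_comp, h3, map_smul, map_sub]
  rw [hT σ, mul_assoc, permOp_mul_inv, mul_one] at h1
  have h2 := h1.unique hH h
  calc permOp σ * S = permOp σ * S * permOp σ⁻¹ * permOp σ := by
        rw [mul_assoc _ (permOp σ⁻¹), permOp_inv_mul, mul_one]
    _ = S * permOp σ := by rw [h2]

end Permutations

section TestFunctions
variable {ν : ℕ} {ħ : ℝ} {Φ : ∀ k : ℕ, (Fin k → Pos ν) → ℝ} {s m : ℕ}

/-- The Hamiltonian of the particles selected by `f`, acting on a function of all particles. -/
noncomputable def partialHam (ħ : ℝ) (Φ : ∀ k : ℕ, (Fin k → Pos ν) → ℝ) (f : Fin s ↪ Fin m)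
    (φ : (Fin m → Pos ν) → ℂ) (q : Fin m → Pos ν) : ℂ :=
  -((ħ : ℂ) ^ 2 / 2) * (∑ i, (Δ fun z : Pos ν => φ (Function.update q (f i) z)) (q (f i))) +
    (potentialEnergy Φ fun i => q (f i) : ℂ) * φ q

theorem laplacian_update_eq {φ : (Fin m → Pos ν) → ℂ} (hφ : ContDiff ℝ (⊤ : ℕ∞) φ) (j : Fin m)
    (q : Fin m → Pos ν) :
    (Δ fun z : Pos ν => φ (Function.update q j z)) (q j) =
      ∑ k, iteratedFDeriv ℝ 2 φ q
        ![ContinuousLinearMap.single ℝ (fun _ : Fin m => Pos ν) j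
            (EuclideanSpace.basisFun (Fin ν) ℝ k),
          ContinuousLinearMap.single ℝ (fun _ : Fin m => Pos ν) j
            (EuclideanSpace.basisFun (Fin ν) ℝ k)] := by
  rw [InnerProductSpace.laplacian_eq_iteratedFDeriv_orthonormalBasis _
    (EuclideanSpace.basisFun (Fin ν) ℝ)]
  set L := ContinuousLinearMap.single ℝ (fun _ : Fin m => Pos ν) j
  have hL : ∀ z, Function.update q j z = L z + Function.update q j 0 := fun z => by
    funext i
    by_cases h : i = j
    · subst h; simp [L]
    · simp [L, h]
  have h1 : (fun z : Pos ν => φ (Function.update q j z)) =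
      (fun x => φ (x + Function.update q j 0)) ∘ L := by
    funext z; exact congrArg φ (hL z)
  have hc : ContDiff ℝ 2 fun x => φ (x + Function.update q j 0) :=
    (hφ.of_le (WithTop.coe_le_coe.2 (le_top : (2 : ℕ∞) ≤ ⊤))).comp (contDiff_id.add contDiff_const)
  refine Finset.sum_congr rfl fun k _ => ?_
  rw [h1, L.iteratedFDeriv_comp_right hc _ le_rfl]
  rw [iteratedFDeriv_comp_add_right, ← hL, Function.update_eq_self]
  simp only [ContinuousMultilinearMap.compContinuousLinearMap_apply]
  congr 1
  funext i
  fin_cases i <;> rfl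

theorem memLp_laplacian {φ : (Fin m → Pos ν) → ℂ} (hφ : ContDiff ℝ (⊤ : ℕ∞) φ)
    (hc : HasCompactSupport φ) (j : Fin m) :
    MemLp (fun q : Fin m → Pos ν => (Δ fun z : Pos ν => φ (Function.update q j z)) (q j)) 2
      volume := by
  have h1 : (fun q : Fin m → Pos ν => (Δ fun z : Pos ν => φ (Function.update q j z)) (q j)) =
      fun q => (fun M : ContinuousMultilinearMap ℝ (fun _ : Fin 2 => Fin m → Pos ν) ℂ =>
        ∑ k, M ![ContinuousLinearMap.single ℝ (fun _ : Fin m => Pos ν) j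
            (EuclideanSpace.basisFun (Fin ν) ℝ k),
          ContinuousLinearMap.single ℝ (fun _ : Fin m => Pos ν) j
            (EuclideanSpace.basisFun (Fin ν) ℝ k)]) (iteratedFDeriv ℝ 2 φ q) := by
    funext q; exact laplacian_update_eq hφ j q
  have hcont : Continuous (iteratedFDeriv ℝ 2 φ) := hφ.continuous_iteratedFDeriv
    (WithTop.coe_le_coe.2 (le_top : (2 : ℕ∞) ≤ ⊤))
  refine Continuous.memLp_of_hasCompactSupport ?_ ?_
  · rw [h1]
    refine continuous_finsetSum _ fun k _ => ?_
    exact (ContinuousMultilinearMap.apply ℝ (fun _ : Fin 2 => Fin m → Pos ν) ℂ _).continuous.comp hcont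
  · rw [h1]
    refine (hc.iteratedFDeriv (𝕜 := ℝ) 2).mono fun q hq hM => hq ?_
    refine Finset.sum_eq_zero fun k _ => ?_
    rw [hM]
    rfl

theorem memLp_potential_mul_of_equiv (hΦ : ∀ (k : ℕ) (K : Set (Fin k → Pos ν)), IsCompact K →
    MemLp (Φ k) 2 (volume.restrict K)) {k : ℕ} {κ : Type} [Fintype κ] (e : Fin k ⊕ κ ≃ Fin m)
    {φ : (Fin m → Pos ν) → ℂ} (hφ : Continuous φ) (hc : HasCompactSupport φ) :
    MemLp (fun q : Fin m → Pos ν => (Φ k (fun i => q (e (Sum.inl i))) : ℂ) * φ q) 2 volume := by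
  have hm : MeasurePreserving (splitEquiv (ν := ν) e) volume volume := measurePreserving_splitConf e
  have hcont : Continuous (splitConf (ν := ν) e) := by
    unfold splitConf
    fun_prop
  obtain ⟨K1, hK1d⟩ : ∃ K1 : Set (Fin k → Pos ν), K1 = (fun q => (splitConf e q).1) '' tsupport φ :=
    ⟨_, rfl⟩
  obtain ⟨K2, hK2d⟩ : ∃ K2 : Set (κ → Pos ν), K2 = (fun q => (splitConf e q).2) '' tsupport φ :=
    ⟨_, rfl⟩
  have hK1 : IsCompact K1 := hK1d ▸ IsCompact.image hc (continuous_fst.comp hcont)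
  have hK2 : IsCompact K2 := hK2d ▸ IsCompact.image hc (continuous_snd.comp hcont)
  haveI : IsFiniteMeasure ((volume : Measure (κ → Pos ν)).restrict K2) :=
    ⟨by simpa using hK2.measure_lt_top⟩
  have h1 := (hΦ k K1 hK1).comp_fst ((volume : Measure (κ → Pos ν)).restrict K2)
  rw [Measure.prod_restrict, ← Measure.volume_eq_prod] at h1
  have hD : MeasurableSet (K1 ×ˢ K2) := hK1.measurableSet.prod hK2.measurableSet
  have h2 := h1.comp_measurePreserving (hm.restrict_preimage hD)
  obtain ⟨D, hDd⟩ : ∃ D, D = (splitEquiv (ν := ν) e) ⁻¹' (K1 ×ˢ K2) := ⟨_, rfl⟩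
  rw [← hDd] at h2
  have hDm : MeasurableSet D := hDd ▸ (splitEquiv e).measurable hD
  have h3 : MemLp φ ∞ (volume.restrict D) :=
    (hφ.memLp_top_of_hasCompactSupport hc volume).restrict D
  have h4 : MemLp (fun q : Fin m → Pos ν => (Φ k (fun i => q (e (Sum.inl i))) : ℂ)) 2
      (volume.restrict D) := by
    have h := h2.ofReal (K := ℂ)
    exact h
  have h5 : MemLp (fun q : Fin m → Pos ν => (Φ k (fun i => q (e (Sum.inl i))) : ℂ) * φ q) 2
      (volume.restrict D) := MemLp.mul (p := 2) (q := ∞) (r := 2) h3 h4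
  rw [← memLp_indicator_iff_restrict hDm] at h5
  refine (memLp_congr_ae (Eventually.of_forall fun q => ?_)).1 h5
  by_cases hq : q ∈ D
  · rw [Set.indicator_of_mem hq]
  · rw [Set.indicator_of_notMem hq]
    have : q ∉ tsupport φ := fun hq' => hq (by
      rw [hDd, hK1d, hK2d]
      exact ⟨⟨q, hq', rfl⟩, ⟨q, hq', rfl⟩⟩)
    rw [image_eq_zero_of_notMem_tsupport this, mul_zero]

theorem memLp_potential_mul (hΦ : ∀ (k : ℕ) (K : Set (Fin k → Pos ν)), IsCompact K →
    MemLp (Φ k) 2 (volume.restrict K)) {k : ℕ} (f : Fin k ↪ Fin m) {φ : (Fin m → Pos ν) → ℂ}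
    (hφ : Continuous φ) (hc : HasCompactSupport φ) :
    MemLp (fun q : Fin m → Pos ν => (Φ k (fun i => q (f i)) : ℂ) * φ q) 2 volume :=
  memLp_potential_mul_of_equiv hΦ (embEquiv f) hφ hc

theorem memLp_partialHam (hΦ : ∀ (k : ℕ) (K : Set (Fin k → Pos ν)), IsCompact K →
    MemLp (Φ k) 2 (volume.restrict K)) (f : Fin s ↪ Fin m) {φ : (Fin m → Pos ν) → ℂ}
    (hφ : ContDiff ℝ (⊤ : ℕ∞) φ) (hc : HasCompactSupport φ) :
    MemLp (partialHam ħ Φ f φ) 2 volume := by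
  have h1 : MemLp (fun q : Fin m → Pos ν =>
      ∑ i, (Δ fun z : Pos ν => φ (Function.update q (f i) z)) (q (f i))) 2 volume :=
    memLp_finsetSum _ fun i _ => memLp_laplacian hφ hc (f i)
  have h2 : MemLp (fun q : Fin m → Pos ν => (potentialEnergy Φ fun i => q (f i) : ℂ) * φ q) 2
      volume := by
    unfold potentialEnergy
    simp only [Complex.ofReal_sum, Finset.sum_mul]
    refine memLp_finsetSum _ fun S _ => ?_
    exact memLp_potential_mul hΦ ((S.orderEmbOfFin rfl).toEmbedding.trans f) hφ.continuous hc
  exact (h1.const_mul _).add h2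

theorem partialHam_refl (φ : (Fin s → Pos ν) → ℂ) :
    partialHam ħ Φ (Function.Embedding.refl (Fin s)) φ = hamiltonianExpr ħ Φ φ := rfl

theorem inner_tensor_eq_integral {ι κ ρ : Type} [Fintype ι] [Fintype κ] [Fintype ρ]
    (e : ι ⊕ κ ≃ ρ) (g : Hil ν ι) (χ : Hil ν κ) {U : Hil ν ρ} {ψ : (ρ → Pos ν) → ℂ}
    (h : U =ᵐ[volume] ψ) :
    (inner ℂ (tensor e g χ) U : ℂ) = ∫ y, ∫ x,
      (starRingEnd ℂ) (g x) * (starRingEnd ℂ) (χ y) * ψ ((splitEquiv e).symm (x, y)) := by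
  have hm : MeasurePreserving (splitEquiv (ν := ν) e) volume volume := measurePreserving_splitConf e
  let G : (ι → Pos ν) × (κ → Pos ν) → ℂ := fun p =>
    (starRingEnd ℂ) (g p.1) * (starRingEnd ℂ) (χ p.2) * ψ ((splitEquiv e).symm p)
  have h1 : (fun x => (inner ℂ (tensor e g χ x) (U x) : ℂ)) =ᵐ[volume] G ∘ splitEquiv e := by
    filter_upwards [coeFn_tensor e g χ, h] with x h2 h3
    rw [h2, h3]
    have h4 : (splitEquiv e).symm (splitConf e x) = x := (splitEquiv e).symm_apply_apply x
    simp only [G, Function.comp_apply, RCLike.inner_apply, map_mul, coe_splitEquiv, h4]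
    ring
  have h2 : Integrable (G ∘ splitEquiv e) volume := (L2.integrable_inner _ _).congr h1
  have h3 : Integrable G volume := (hm.integrable_comp_emb (splitEquiv e).measurableEmbedding).1 h2
  rw [L2.inner_def, integral_congr_ae h1]
  have h4 := hm.integral_comp (splitEquiv e).measurableEmbedding G
  have h5 := integral_prod_symm G h3
  exact h4.trans h5

theorem exists_graph_slice (hΦ : ∀ (k : ℕ) (K : Set (Fin k → Pos ν)), IsCompact K →
    MemLp (Φ k) 2 (volume.restrict K)) (hH : IsSelfAdjoint (hamiltonian ħ Φ s))
    {κ : Type} [Fintype κ] (e : Fin s ⊕ κ ≃ Fin m) {u : Hil ν (Fin m)} (hu : IsTestVec u) :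
    ∃ F : Hil ν (Fin m), ∀ k, (slice e k u, slice e k F) ∈ (hamiltonian ħ Φ s).graph := by
  obtain ⟨φ, hφ, hc, hφu⟩ := hu
  let f : Fin s ↪ Fin m := ⟨fun i => e (Sum.inl i), fun a b hab => Sum.inl_injective (e.injective hab)⟩
  let F : Hil ν (Fin m) := (memLp_partialHam (ħ := ħ) hΦ f hφ hc).toLp
  refine ⟨F, fun k => ?_⟩
  have hF : F =ᵐ[volume] partialHam ħ Φ f φ := MemLp.coeFn_toLp _
  rw [mem_graph_hamiltonian_iff hH]
  intro p hp
  set χ := onBasis (Hil ν κ) k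
  have hs : ∀ w U, (inner ℂ w (slice e k U) : ℂ) = inner ℂ (tensor e w χ) U := fun w U =>
    ContinuousLinearMap.adjoint_inner_right _ _ _
  rw [hs, hs, inner_tensor_eq_integral e _ _ hφu, inner_tensor_eq_integral e _ _ hF]
  refine congrArg (fun g : (κ → Pos ν) → ℂ => ∫ y, g y) (funext fun y => ?_)
  let J : (Fin s → Pos ν) → Fin m → Pos ν := fun x => (splitEquiv e).symm (x, y)
  have hJl : ∀ x i, J x (e (Sum.inl i)) = x i := fun x i => by
    have := congrArg Prod.fst ((splitEquiv (ν := ν) e).apply_symm_apply (x, y))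
    exact congrFun this i
  have hJr : ∀ x j, J x (e (Sum.inr j)) = y j := fun x j => by
    have := congrArg Prod.snd ((splitEquiv (ν := ν) e).apply_symm_apply (x, y))
    exact congrFun this j
  have hJeq : J = fun x r => Sum.elim x y (e.symm r) := by
    funext x r
    obtain ⟨z, rfl⟩ := e.surjective r
    rcases z with i | j
    · rw [hJl]; simp
    · rw [hJr]; simp
  have hJ : ContDiff ℝ (⊤ : ℕ∞) J := by
    rw [hJeq, contDiff_pi]
    intro r
    rcases e.symm r with i | j
    · exact contDiff_apply ℝ (Pos ν) i
    · exact contDiff_const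
  have hJemb : IsClosedEmbedding J := by
    have hl : Function.LeftInverse (fun q : Fin m → Pos ν => fun i => q (e (Sum.inl i))) J := fun x => by
      funext i; exact hJl x i
    exact hl.isClosedEmbedding (by fun_prop) hJ.continuous
  have hu1 : ContDiff ℝ (⊤ : ℕ∞) (φ ∘ J) := hφ.comp hJ
  have hu2 : HasCompactSupport (φ ∘ J) := hc.comp_isClosedEmbedding hJemb
  have hupd : ∀ x i z, J (Function.update x i z) = Function.update (J x) (f i) z := fun x i z => by
    funext r
    obtain ⟨w, rfl⟩ := e.surjective r
    rcases w with i' | j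
    · rw [hJl]
      by_cases h : i' = i
      · subst h
        rw [Function.update_self]
        exact (Function.update_self (f i') z (J x)).symm
      · rw [Function.update_of_ne h, Function.update_of_ne, hJl]
        intro h'
        exact h (Sum.inl_injective (e.injective h'))
    · rw [hJr, Function.update_of_ne, hJr]
      intro h'
      exact Sum.inr_ne_inl (e.injective h')
  have hham : ∀ x, partialHam ħ Φ f φ (J x) = hamiltonianExpr ħ Φ (φ ∘ J) x := fun x => by
    unfold partialHam hamiltonianExpr totalLaplacian
    have h1 : ∀ i, J x (f i) = x i := hJl x
    simp only [h1, Function.comp_apply, hupd]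
  have hmem1 : MemLp (φ ∘ J) 2 volume := hu1.continuous.memLp_of_hasCompactSupport hu2
  have hmem2 : MemLp (hamiltonianExpr ħ Φ (φ ∘ J)) 2 volume := by
    rw [← partialHam_refl]
    exact memLp_partialHam hΦ _ hu1 hu2
  have hmin : (hmem1.toLp (φ ∘ J), hmem2.toLp (hamiltonianExpr ħ Φ (φ ∘ J))) ∈ minimalGraph ħ Φ s :=
    ⟨φ ∘ J, hu1, hu2, hmem1.coeFn_toLp, hmem2.coeFn_toLp⟩
  have hsym := inner_graph_comm hH (minimalGraph_le_graph hH hp) (minimalGraph_le_graph hH hmin)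
  rw [L2.inner_def, L2.inner_def] at hsym
  have h1 : (∫ x, (inner ℂ (p.2 x) (hmem1.toLp (φ ∘ J) x) : ℂ)) =
      ∫ x, (starRingEnd ℂ) (p.2 x) * φ (J x) := by
    refine integral_congr_ae ?_
    filter_upwards [hmem1.coeFn_toLp] with x hx
    rw [hx, RCLike.inner_apply, mul_comm]; rfl
  have h2 : (∫ x, (inner ℂ (p.1 x) (hmem2.toLp (hamiltonianExpr ħ Φ (φ ∘ J)) x) : ℂ)) =
      ∫ x, (starRingEnd ℂ) (p.1 x) * partialHam ħ Φ f φ (J x) := by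
    refine integral_congr_ae ?_
    filter_upwards [hmem2.coeFn_toLp] with x hx
    rw [hx, RCLike.inner_apply, mul_comm, hham]
  rw [h1, h2] at hsym
  have h3 : ∀ g ψ : (Fin s → Pos ν) → ℂ, (∫ x, (starRingEnd ℂ) (g x) * (starRingEnd ℂ) (χ y) * ψ x) =
      (starRingEnd ℂ) (χ y) * ∫ x, (starRingEnd ℂ) (g x) * ψ x := fun g ψ => by
    rw [← integral_const_mul]
    refine integral_congr_ae (Eventually.of_forall fun x => ?_)
    ring
  exact (h3 _ _).trans ((congrArg _ hsym).trans (h3 _ _).symm)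

theorem exists_isComm_partialTrace (hΦ : ∀ (k : ℕ) (K : Set (Fin k → Pos ν)), IsCompact K →
    MemLp (Φ k) 2 (volume.restrict K)) (hH : IsSelfAdjoint (hamiltonian ħ Φ s))
    {κ : Type} [Fintype κ] (e : Fin s ⊕ κ ≃ Fin m) {u v : Hil ν (Fin m)} (hu : IsTestVec u)
    (hv : IsTestVec v) : ∃ S : Op ν s, traceNorm S ≠ ∞ ∧
      IsComm (hamiltonian ħ Φ s) (partialTrace e (InnerProductSpace.rankOne ℂ u v)) S := by
  obtain ⟨F, hF⟩ := exists_graph_slice hΦ hH e hu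
  obtain ⟨G, hG⟩ := exists_graph_slice hΦ hH e hv
  have hfin : ∀ a b : Hil ν (Fin m), traceNorm (partialTrace e (InnerProductSpace.rankOne ℂ a b)) ≠ ∞ := fun a b =>
    ne_top_of_le_ne_top (traceNorm_rankOne_ne_top a b)
      (traceNorm_partialTrace_le e _ (traceNorm_rankOne_ne_top a b))
  have hrep : ∀ a b : Hil ν (Fin m), IsRep (fun p : basisSet (Hil ν κ) × Unit => slice e p.1 a)
      (fun p => slice e p.1 b) (partialTrace e (InnerProductSpace.rankOne ℂ a b)) := fun a b =>
    isRep_partialTrace (J := Unit) (u := fun _ => a) (v := fun _ => b) e (isRep_rankOne a b)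
      (Summable.of_finite (f := fun _ : Unit => ‖a‖ * ‖b‖))
  have hT' := hrep F v
  have hT'' := hrep u G
  have hn := ENNReal.add_ne_top.2 ⟨hfin F v, hfin u G⟩
  generalize partialTrace e (InnerProductSpace.rankOne ℂ F v) = T' at hT' hn
  generalize partialTrace e (InnerProductSpace.rankOne ℂ u G) = T'' at hT'' hn
  have hT := hrep u v
  generalize partialTrace e (InnerProductSpace.rankOne ℂ u v) = T at hT
  refine ⟨Complex.I • (T' - T''), ?_, fun ψ η hψ => ⟨T' ψ, ?_, ?_⟩⟩
  · rw [traceNorm_smul]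
    exact ENNReal.mul_ne_top enorm_ne_top (ne_top_of_le_ne_top hn (traceNorm_sub_le _ _))
  · have h1 := (hT ψ).prodMk (hT' ψ)
    refine (isClosed_graph hH).mem_of_tendsto h1 (Eventually.of_forall fun A => ?_)
    refine Submodule.sum_mem _ fun p _ => ?_
    exact Submodule.smul_mem _ (inner ℂ (slice e p.1 v) ψ) (hF p.1)
  · have h1 : T η = T'' ψ := by
      refine (hT η).unique ?_
      have h2 : (fun p : basisSet (Hil ν κ) × Unit => (inner ℂ (slice e p.1 v) η : ℂ) • slice e p.1 u) =
          fun p => (inner ℂ (slice e p.1 G) ψ : ℂ) • slice e p.1 u := by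
        funext p
        rw [inner_graph_comm hH (hG p.1) hψ]
      rw [h2]
      exact hT'' ψ
    rw [h1, smul_apply, sub_apply]

end TestFunctions

section SequenceSpaces
variable {ν : ℕ}

theorem IsSymmetricOp.add {n : ℕ} {S T : Op ν n} (hS : IsSymmetricOp S) (hT : IsSymmetricOp T) :
    IsSymmetricOp (S + T) := fun σ => by rw [mul_add, add_mul, hS σ, hT σ]

theorem IsSymmetricOp.smul {n : ℕ} {T : Op ν n} (c : ℂ) (hT : IsSymmetricOp T) :
    IsSymmetricOp (c • T) := fun σ => by rw [mul_smul_comm, smul_mul_assoc, hT σ]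

theorem IsSymmetricOp.mul {n : ℕ} {S T : Op ν n} (hS : IsSymmetricOp S) (hT : IsSymmetricOp T) :
    IsSymmetricOp (S * T) := fun σ => by rw [← mul_assoc, hS σ, mul_assoc, hT σ, mul_assoc]

theorem isSymmetricOp_zero {n : ℕ} : IsSymmetricOp (0 : Op ν n) := fun σ => by simp

theorem isClosed_isSymmetricOp (n : ℕ) : IsClosed {T : Op ν n | IsSymmetricOp T} := by
  simp only [IsSymmetricOp, Set.ofPred_forall]
  exact isClosed_iInter fun σ => isClosed_eq (by fun_prop) (by fun_prop)

/-- An extended norm on sequences of operators which controls every component. -/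
structure SeqNorm (ν : ℕ) where
  /-- The extended norm. -/
  toFun : OpSeq ν → ℝ≥0∞
  add_le : ∀ f g, toFun (f + g) ≤ toFun f + toFun g
  smul_eq : ∀ (c : ℂ) f, toFun (c • f) = ‖c‖ₑ * toFun f
  /-- The constants bounding the components. -/
  bound : ℕ → ℝ
  enorm_le : ∀ f n, ‖f n‖ₑ ≤ ENNReal.ofReal (bound n) * toFun f
  lsc : LowerSemicontinuous toFun

namespace SeqNorm
variable (N : SeqNorm ν)

theorem zero_eq : N.toFun 0 = 0 := by
  have := N.smul_eq 0 0
  simpa using this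

/-- The symmetric sequences of finite norm. -/
noncomputable def submodule : Submodule ℂ (OpSeq ν) where
  carrier := {f | (∀ n, IsSymmetricOp (f n)) ∧ N.toFun f < ∞}
  zero_mem' := ⟨fun n => isSymmetricOp_zero, by rw [N.zero_eq]; exact ENNReal.zero_lt_top⟩
  add_mem' := fun {f g} hf hg => ⟨fun n => (hf.1 n).add (hg.1 n),
    (N.add_le f g).trans_lt (ENNReal.add_lt_top.2 ⟨hf.2, hg.2⟩)⟩
  smul_mem' := fun c f hf => ⟨fun n => (hf.1 n).smul c, by
    rw [N.smul_eq]; exact ENNReal.mul_lt_top enorm_lt_top hf.2⟩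

/-- The Banach space of symmetric sequences of finite norm. -/
def Space : Type := N.submodule

noncomputable instance : AddCommGroup N.Space := inferInstanceAs (AddCommGroup N.submodule)
noncomputable instance : Module ℂ N.Space := inferInstanceAs (Module ℂ N.submodule)

/-- The sequence of operators. -/
def Space.val {N : SeqNorm ν} (x : N.Space) : OpSeq ν := Subtype.val x

/-- A symmetric sequence of finite norm as an element of the Banach space. -/
def Space.mk {N : SeqNorm ν} (f : OpSeq ν) (hf : f ∈ N.submodule) : N.Space := ⟨f, hf⟩

theorem Space.mem (x : N.Space) : x.val ∈ N.submodule := Subtype.property x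

theorem Space.ext {x y : N.Space} (h : x.val = y.val) : x = y := Subtype.ext h

@[simp] theorem Space.val_add (x y : N.Space) : (x + y).val = x.val + y.val := rfl
@[simp] theorem Space.val_sub (x y : N.Space) : (x - y).val = x.val - y.val := rfl
@[simp] theorem Space.val_zero : (0 : N.Space).val = 0 := rfl
@[simp] theorem Space.val_smul (c : ℂ) (x : N.Space) : (c • x).val = c • x.val := rfl

theorem Space.val_sum {J : Type} (F : Finset J) (x : J → N.Space) :
    (∑ j ∈ F, x j).val = ∑ j ∈ F, (x j).val :=
  map_sum (⟨⟨Space.val, rfl⟩, fun _ _ => rfl⟩ : N.Space →+ OpSeq ν) _ _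

noncomputable instance : Norm N.Space := ⟨fun x => (N.toFun x.val).toReal⟩

theorem Space.norm_def (x : N.Space) : ‖x‖ = (N.toFun x.val).toReal := rfl

theorem Space.toFun_val (x : N.Space) : N.toFun x.val = ENNReal.ofReal ‖x‖ :=
  (ENNReal.ofReal_toReal (Space.mem N x).2.ne).symm

noncomputable instance : NormedAddCommGroup N.Space :=
  NormedAddCommGroup.ofCore (𝕜 := ℂ)
    { norm_nonneg := fun x => ENNReal.toReal_nonneg
      norm_smul := fun c x => by
        rw [Space.norm_def, Space.val_smul, N.smul_eq, ENNReal.toReal_mul, toReal_enorm]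
        rfl
      norm_triangle := fun x y => by
        simp only [Space.norm_def]
        rw [← ENNReal.toReal_add (Space.mem N x).2.ne (Space.mem N y).2.ne]
        exact ENNReal.toReal_mono (ENNReal.add_ne_top.2 ⟨(Space.mem N x).2.ne, (Space.mem N y).2.ne⟩)
          (N.add_le _ _)
      norm_eq_zero_iff := fun x => by
        constructor
        · intro h
          have h1 : N.toFun x.val = 0 := by
            rw [Space.toFun_val, h, ENNReal.ofReal_zero]
          refine Space.ext N (funext fun n => ?_)
          have h2 := N.enorm_le x.val n
          rw [h1, mul_zero] at h2
          rw [nonpos_iff_eq_zero, ← ofReal_norm, ENNReal.ofReal_eq_zero] at h2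
          exact norm_le_zero_iff.1 h2
        · rintro rfl
          rw [Space.norm_def, Space.val_zero, N.zero_eq, ENNReal.toReal_zero] }

noncomputable instance : NormedSpace ℂ N.Space where
  norm_smul_le := fun c x => by
    rw [Space.norm_def, Space.val_smul, N.smul_eq, ENNReal.toReal_mul, toReal_enorm]
    rfl

/-- The `n`-th component. -/
noncomputable def Space.component (n : ℕ) : N.Space →L[ℂ] Op ν n :=
  LinearMap.mkContinuous
    { toFun := fun x => x.val n
      map_add' := fun _ _ => rfl
      map_smul' := fun _ _ => rfl } (max (N.bound n) 0) (fun x => by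
    have h := ENNReal.toReal_mono (ENNReal.mul_ne_top ENNReal.ofReal_ne_top (Space.mem N x).2.ne)
      (N.enorm_le x.val n)
    rw [ENNReal.toReal_mul, toReal_enorm, ENNReal.toReal_ofReal'] at h
    exact h)

instance : CompleteSpace N.Space := by
  refine Metric.complete_of_cauchySeq_tendsto fun u hu => ?_
  have h1 : ∀ n, ∃ T, Tendsto (fun k => (u k).val n) atTop (𝓝 T) := fun n =>
    cauchySeq_tendsto_of_complete ((Space.component N n).uniformContinuous.comp_cauchySeq hu)
  choose f hf using h1
  have hf' : Tendsto (fun k => (u k).val) atTop (𝓝 f) := tendsto_pi_nhds.2 hf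
  have hle : ∀ ε > 0, ∃ K, ∀ k ≥ K, N.toFun ((u k).val - f) ≤ ENNReal.ofReal ε := by
    intro ε hε
    obtain ⟨K, hK⟩ := Metric.cauchySeq_iff.1 hu ε hε
    refine ⟨K, fun k hk => ?_⟩
    have h2 : Tendsto (fun j => (u k).val - (u j).val) atTop (𝓝 ((u k).val - f)) :=
      tendsto_const_nhds.sub hf'
    refine (N.lsc.isClosed_preimage (ENNReal.ofReal ε)).mem_of_tendsto h2 ?_
    filter_upwards [eventually_ge_atTop K] with j hj
    have h3 := hK k hk j hj
    rw [dist_eq_norm] at h3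
    change N.toFun (u k - u j).val ≤ _
    rw [Space.toFun_val]
    exact ENNReal.ofReal_le_ofReal h3.le
  have hmem : f ∈ N.submodule := by
    constructor
    · intro n
      exact (isClosed_isSymmetricOp n).mem_of_tendsto (hf n)
        (Eventually.of_forall fun k => (Space.mem N (u k)).1 n)
    · obtain ⟨K, hK⟩ := hle 1 one_pos
      have h2 : f = (u K).val + (-1 : ℂ) • ((u K).val - f) := by
        rw [neg_one_smul]; abel
      rw [h2]
      refine (N.add_le _ _).trans_lt (ENNReal.add_lt_top.2 ⟨(Space.mem N (u K)).2, ?_⟩)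
      rw [N.smul_eq]
      exact ENNReal.mul_lt_top enorm_lt_top ((hK K le_rfl).trans_lt ENNReal.ofReal_lt_top)
  refine ⟨Space.mk f hmem, Metric.tendsto_atTop'.2 fun ε hε => ?_⟩
  obtain ⟨K, hK⟩ := hle (ε / 2) (half_pos hε)
  refine ⟨K, fun k hk => ?_⟩
  rw [dist_eq_norm]
  have := hK k hk.le
  change N.toFun (u k - Space.mk f hmem).val ≤ _ at this
  rw [Space.toFun_val, ENNReal.ofReal_le_ofReal_iff (half_pos hε).le] at this
  linarith

theorem Space.tendsto_iff {J : Type} {l : Filter J} {u : J → N.Space} {x : N.Space} :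
    Tendsto u l (𝓝 x) ↔ Tendsto (fun j => N.toFun ((u j).val - x.val)) l (𝓝 0) := by
  rw [tendsto_iff_norm_sub_tendsto_zero]
  have h : (fun j => N.toFun ((u j).val - x.val)) = fun j => ENNReal.ofReal ‖u j - x‖ := by
    funext j; exact Space.toFun_val N (u j - x)
  rw [h]
  constructor
  · intro h1
    have := ENNReal.tendsto_ofReal h1
    rwa [ENNReal.ofReal_zero] at this
  · intro h1
    have := (ENNReal.tendsto_toReal ENNReal.zero_ne_top).comp h1
    simpa [Function.comp_def] using this

/-- The bounded operator on the Banach space induced by a map which is linear and bounded there. -/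
noncomputable def mkCLM (F : OpSeq ν → OpSeq ν) (C : ℝ) (hC : 0 ≤ C)
    (hsym : ∀ f ∈ N.submodule, ∀ n, IsSymmetricOp (F f n))
    (hle : ∀ f ∈ N.submodule, N.toFun (F f) ≤ ENNReal.ofReal C * N.toFun f)
    (hadd : ∀ f ∈ N.submodule, ∀ g ∈ N.submodule, F (f + g) = F f + F g)
    (hsmul : ∀ (c : ℂ), ∀ f ∈ N.submodule, F (c • f) = c • F f) : N.Space →L[ℂ] N.Space :=
  LinearMap.mkContinuous
    { toFun := fun x => Space.mk (F x.val) ⟨hsym _ (Space.mem N x), (hle _ (Space.mem N x)).trans_lt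
        (ENNReal.mul_lt_top ENNReal.ofReal_lt_top (Space.mem N x).2)⟩
      map_add' := fun x y => Space.ext N (hadd _ (Space.mem N x) _ (Space.mem N y))
      map_smul' := fun c x => Space.ext N (hsmul c _ (Space.mem N x)) } C (fun x => by
    have h := ENNReal.toReal_mono (ENNReal.mul_ne_top ENNReal.ofReal_ne_top (Space.mem N x).2.ne)
      (hle _ (Space.mem N x))
    rw [ENNReal.toReal_mul, ENNReal.toReal_ofReal hC] at h
    exact h)

end SeqNorm

theorem lowerSemicontinuous_traceNorm {E : Type} [NormedAddCommGroup E] [InnerProductSpace ℂ E]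
    [CompleteSpace E] : LowerSemicontinuous (traceNorm : (E →L[ℂ] E) → ℝ≥0∞) :=
  lowerSemicontinuous_iff_isClosed_preimage.2 fun c => isClosed_traceNorm_le c

/-- The norm of `𝔏¹_α`. -/
noncomputable def trNorm (α : ℝ) (hα : 0 < α) : SeqNorm ν where
  toFun := normTr α
  add_le f g := by
    unfold normTr
    rw [← ENNReal.tsum_add]
    refine ENNReal.tsum_le_tsum fun n => ?_
    rw [← mul_add]
    gcongr
    exact traceNorm_add_le _ _
  smul_eq c f := by
    unfold normTr
    rw [← ENNReal.tsum_mul_left]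
    refine tsum_congr fun n => ?_
    rw [Pi.smul_apply, traceNorm_smul]
    ring
  bound n := (α ^ n)⁻¹
  enorm_le f n := by
    have h1 : ENNReal.ofReal (α ^ n) * traceNorm (f n) ≤ normTr α f := ENNReal.le_tsum n
    refine (enorm_le_traceNorm (f n)).trans ?_
    calc traceNorm (f n) = ENNReal.ofReal (α ^ n)⁻¹ * (ENNReal.ofReal (α ^ n) * traceNorm (f n)) := by
          rw [← mul_assoc, ← ENNReal.ofReal_mul (by positivity), inv_mul_cancel₀ (by positivity),
            ENNReal.ofReal_one, one_mul]
      _ ≤ _ := by gcongr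
  lsc := by
    refine lowerSemicontinuous_tsum fun n => ?_
    have h1 : LowerSemicontinuous fun f : OpSeq ν => traceNorm (f n) :=
      lowerSemicontinuous_traceNorm.comp (continuous_apply n)
    exact (ENNReal.continuous_const_mul ENNReal.ofReal_ne_top).comp_lowerSemicontinuous h1
      (fun a b hab => mul_le_mul_right hab _)

/-- The norm of `𝔏_γ`. -/
noncomputable def bdNorm (γ : ℝ) (hγ : 0 < γ) : SeqNorm ν where
  toFun := normBd γ
  add_le f g := by
    unfold normBd
    refine iSup_le fun n => ?_
    refine le_trans ?_ (add_le_add (le_iSup _ n) (le_iSup _ n))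
    rw [← mul_add]
    gcongr
    rw [Pi.add_apply, ← ofReal_norm, ← ofReal_norm, ← ofReal_norm,
      ← ENNReal.ofReal_add (norm_nonneg _) (norm_nonneg _)]
    exact ENNReal.ofReal_le_ofReal (norm_add_le _ _)
  smul_eq c f := by
    unfold normBd
    rw [ENNReal.mul_iSup]
    refine iSup_congr fun n => ?_
    rw [Pi.smul_apply, enorm_smul]
    ring
  bound n := (γ ^ n / n.factorial)⁻¹
  enorm_le f n := by
    have h1 : ENNReal.ofReal (γ ^ n / n.factorial) * ‖f n‖ₑ ≤ normBd γ f :=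
      le_iSup (fun n => ENNReal.ofReal (γ ^ n / n.factorial) * ‖f n‖ₑ) n
    calc ‖f n‖ₑ = ENNReal.ofReal (γ ^ n / n.factorial)⁻¹ *
          (ENNReal.ofReal (γ ^ n / n.factorial) * ‖f n‖ₑ) := by
          rw [← mul_assoc, ← ENNReal.ofReal_mul (by positivity), inv_mul_cancel₀ (by positivity),
            ENNReal.ofReal_one, one_mul]
      _ ≤ _ := by gcongr
  lsc := by
    refine lowerSemicontinuous_iSup fun n => ?_
    have h1 : Continuous fun f : OpSeq ν => ‖f n‖ₑ := (continuous_apply n).enorm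
    exact ((ENNReal.continuous_const_mul ENNReal.ofReal_ne_top).comp h1).lowerSemicontinuous

theorem MemTr.traceNorm_ne_top {α : ℝ} (hα : 0 < α) {f : OpSeq ν} (hf : MemTr α f) (n : ℕ) :
    traceNorm (f n) ≠ ∞ := fun h => by
  have h1 : ENNReal.ofReal (α ^ n) * traceNorm (f n) ≤ normTr α f := ENNReal.le_tsum n
  rw [h, ENNReal.mul_top (by simpa using pow_pos hα n)] at h1
  exact (h1.trans_lt hf.2).ne rfl

end SequenceSpaces

section Symmetry
variable {ν k m n : ℕ}

theorem exists_perm_trans (f g : Fin k ↪ Fin m) :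
    ∃ σ : Equiv.Perm (Fin m), f.trans σ.toEmbedding = g := by
  obtain ⟨σ, hσ⟩ := Equiv.Perm.exists_extending_pair f g f.injective g.injective
  exact ⟨σ, Function.Embedding.ext hσ⟩

theorem lift_trans_perm (σ : Equiv.Perm (Fin m)) (f : Fin k ↪ Fin m) (A : Op ν k) :
    lift (f.trans σ.toEmbedding) A = permOp σ * lift f A * permOp σ⁻¹ := by
  rw [lift_trans, lift_equiv]
  rfl

theorem IsSymmetricOp.conj_eq {T : Op ν n} (hT : IsSymmetricOp T) (σ : Equiv.Perm (Fin n)) :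
    permOp σ * T * permOp σ⁻¹ = T := by
  rw [hT σ, mul_assoc, permOp_mul_inv, mul_one]

theorem isSymmetricOp_of_conj_eq {T : Op ν n}
    (h : ∀ σ : Equiv.Perm (Fin n), permOp σ * T * permOp σ⁻¹ = T) : IsSymmetricOp T := fun σ => by
  conv_rhs => rw [← h σ]
  rw [mul_assoc _ (permOp σ⁻¹), permOp_inv_mul, mul_one]

theorem exists_perm_of_range_eq (f g : Fin k ↪ Fin m) (h : Set.range f = Set.range g) :
    ∃ σ : Equiv.Perm (Fin k), σ.toEmbedding.trans g = f := by
  refine ⟨(Equiv.ofInjective f f.injective).trans ((Equiv.setCongr h).trans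
    (Equiv.ofInjective g g.injective).symm), Function.Embedding.ext fun i => ?_⟩
  exact Equiv.apply_ofInjective_symm g.injective _

theorem lift_eq_of_range_eq {A : Op ν k} (hA : IsSymmetricOp A) {f g : Fin k ↪ Fin m}
    (h : Set.range f = Set.range g) : lift f A = lift g A := by
  obtain ⟨σ, rfl⟩ := exists_perm_of_range_eq f g h
  rw [lift_trans, lift_equiv]
  exact congrArg (lift g) (hA.conj_eq σ)

theorem traceNorm_mul_ne_top {E : Type} [NormedAddCommGroup E] [InnerProductSpace ℂ E]
    [CompleteSpace E] {T : E →L[ℂ] E} (hT : traceNorm T ≠ ∞) (A : E →L[ℂ] E) :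
    traceNorm (A * T) ≠ ∞ :=
  ne_top_of_le_ne_top (ENNReal.mul_ne_top enorm_ne_top hT) (traceNorm_mul_le A T)

theorem traceNorm_mul_ne_top' {E : Type} [NormedAddCommGroup E] [InnerProductSpace ℂ E]
    [CompleteSpace E] {T : E →L[ℂ] E} (hT : traceNorm T ≠ ∞) (A : E →L[ℂ] E) :
    traceNorm (T * A) ≠ ∞ :=
  ne_top_of_le_ne_top (ENNReal.mul_ne_top hT enorm_ne_top) (traceNorm_mul_le' T A)

theorem opTrace_mul_conj {E : Type} [NormedAddCommGroup E] [InnerProductSpace ℂ E]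
    [CompleteSpace E] {T : E →L[ℂ] E} (hT : traceNorm T ≠ ∞) (A U V : E →L[ℂ] E) :
    opTrace (A * (U * T * V)) = opTrace (V * A * U * T) := by
  have h1 := opTrace_comm (traceNorm_mul_ne_top hT U) (V * A)
  have h2 := opTrace_comm (traceNorm_mul_ne_top' (traceNorm_mul_ne_top hT U) V) A
  rw [h2, mul_assoc (V * A), h1]
  simp only [mul_assoc]

theorem opTrace_lift_mul_eq {T : Op ν m} (hT : IsSymmetricOp T) (hT' : traceNorm T ≠ ∞)
    (f g : Fin k ↪ Fin m) (A : Op ν k) : opTrace (lift f A * T) = opTrace (lift g A * T) := by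
  obtain ⟨σ, rfl⟩ := exists_perm_trans f g
  rw [lift_trans_perm]
  have h1 := opTrace_mul_conj hT' (lift f A) (permOp σ⁻¹) (permOp σ)
  rw [← h1]
  have h2 := hT.conj_eq σ⁻¹
  rw [inv_inv] at h2
  rw [h2]

theorem eq_of_opTrace_mul {E : Type} [NormedAddCommGroup E] [InnerProductSpace ℂ E]
    [CompleteSpace E] {S T : E →L[ℂ] E}
    (h : ∀ A : E →L[ℂ] E, opTrace (A * S) = opTrace (A * T)) : S = T :=
  eq_of_opTrace_mul_eq fun A hA => by
    rw [opTrace_comm hA, opTrace_comm hA, h]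

end Symmetry

section Subsets
variable {ν k m n : ℕ} {g : OpSeq ν}

theorem onSubset_eq_lift (Z : Finset (Fin m)) (A : Op ν Z.card) :
    onSubset Z A = lift (Z.orderEmbOfFin rfl).toEmbedding A :=
  ampliation_eq_lift _ _ (fun i => rfl) A

theorem range_orderEmbOfFin_toEmbedding (Z : Finset (Fin m)) :
    Set.range (Z.orderEmbOfFin rfl).toEmbedding = ↑Z := Finset.range_orderEmbOfFin _ _

theorem map_orderEmbOfFin_univ (Z : Finset (Fin m)) :
    Finset.univ.map (Z.orderEmbOfFin rfl).toEmbedding = Z := by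
  rw [← Finset.coe_inj, Finset.coe_map, Finset.coe_univ, Set.image_univ,
    range_orderEmbOfFin_toEmbedding]

theorem onSubset_eq_lift_of_map (hg : ∀ n, IsSymmetricOp (g n)) (f : Fin n ↪ Fin m)
    (Z : Finset (Fin m)) (hZ : Finset.univ.map f = Z) :
    onSubset Z (g Z.card) = lift f (g n) := by
  have hn : Z.card = n := by rw [← hZ, Finset.card_map, Finset.card_univ, Fintype.card_fin]
  subst hn
  rw [onSubset_eq_lift]
  refine lift_eq_of_range_eq (hg _) ?_
  rw [range_orderEmbOfFin_toEmbedding]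
  conv_lhs => rw [← hZ]
  simp

theorem lift_onSubset (hg : ∀ n, IsSymmetricOp (g n)) (f : Fin k ↪ Fin m) (Z : Finset (Fin k)) :
    lift f (onSubset Z (g Z.card)) = onSubset (Z.map f) (g (Z.map f).card) := by
  rw [onSubset_eq_lift, ← lift_trans]
  refine (onSubset_eq_lift_of_map hg _ _ ?_).symm
  rw [← Finset.map_map, map_orderEmbOfFin_univ]

theorem conj_onSubset (hg : ∀ n, IsSymmetricOp (g n)) (σ : Equiv.Perm (Fin m))
    (Z : Finset (Fin m)) : permOp σ * onSubset Z (g Z.card) * permOp σ⁻¹ =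
      onSubset (Z.map σ.toEmbedding) (g (Z.map σ.toEmbedding).card) := by
  rw [← lift_onSubset hg, lift_equiv]
  rfl

theorem norm_onSubset_le (Z : Finset (Fin m)) (A : Op ν Z.card) : ‖onSubset Z A‖ ≤ ‖A‖ := by
  rw [onSubset_eq_lift]
  exact norm_lift_le _ _

/-- The sequence `∑_Z c_{|Zᶜ|} g_{|Z|}(Z)`. -/
noncomputable def subsetSum (c : ℕ → ℂ) (g : OpSeq ν) : OpSeq ν :=
  fun s => ∑ Z : Finset (Fin s), c Zᶜ.card • onSubset Z (g Z.card)

theorem isSymmetricOp_subsetSum (c : ℕ → ℂ) (hg : ∀ n, IsSymmetricOp (g n)) (s : ℕ) :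
    IsSymmetricOp (subsetSum c g s) := by
  refine isSymmetricOp_of_conj_eq fun σ => ?_
  rw [subsetSum, Finset.mul_sum, Finset.sum_mul]
  refine Finset.sum_nbij' (fun Z => Z.map σ.toEmbedding) (fun Z => Z.map σ.symm.toEmbedding)
    (fun _ _ => Finset.mem_univ _) (fun _ _ => Finset.mem_univ _) (fun Z _ => ?_) (fun Z _ => ?_)
    fun Z _ => ?_
  · ext; simp
  · ext; simp
  · have h1 : Zᶜ.card = (Z.map σ.toEmbedding)ᶜ.card := by
      rw [Finset.card_compl, Finset.card_compl, Finset.card_map]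
    rw [mul_smul_comm, smul_mul_assoc, conj_onSubset hg, h1]

theorem lift_subsetSum (c : ℕ → ℂ) (hg : ∀ n, IsSymmetricOp (g n)) (f : Fin k ↪ Fin m) :
    lift f (subsetSum c g k) = ∑ W ∈ (Finset.univ.map f).powerset,
      c (Finset.univ.map f \ W).card • onSubset W (g W.card) := by
  rw [subsetSum, map_sum]
  refine Finset.sum_bij (fun Z _ => Z.map f) (fun Z _ => ?_) (fun Z _ Z' _ h => ?_) (fun W hW => ?_)
    fun Z _ => ?_
  · rw [Finset.mem_powerset]
    exact Finset.map_subset_map.2 (Finset.subset_univ Z)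
  · exact Finset.map_injective f h
  · rw [Finset.mem_powerset, Finset.subset_map_iff] at hW
    obtain ⟨Z, -, rfl⟩ := hW
    exact ⟨Z, Finset.mem_univ _, rfl⟩
  · have h1 : Zᶜ.card = (Finset.univ.map f \ Z.map f).card := by
      rw [← Finset.map_sdiff, Finset.card_map, Finset.compl_eq_univ_sdiff]
    rw [map_smul, lift_onSubset hg, h1]

theorem onSubset_subsetSum (c : ℕ → ℂ) (hg : ∀ n, IsSymmetricOp (g n)) (Z : Finset (Fin m)) :
    onSubset Z (subsetSum c g Z.card) =
      ∑ W ∈ Z.powerset, c (Z \ W).card • onSubset W (g W.card) := by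
  rw [onSubset_eq_lift, lift_subsetSum c hg, map_orderEmbOfFin_univ]

theorem sum_superset {M : Type} [AddCommMonoid M] (W : Finset (Fin m)) (F : Finset (Fin m) → M) :
    ∑ Z with W ⊆ Z, F Z = ∑ V ∈ Wᶜ.powerset, F Vᶜ := by
  refine Finset.sum_nbij' (fun Z => Zᶜ) (fun V => Vᶜ) (fun Z hZ => ?_) (fun V hV => ?_)
    (fun Z _ => compl_compl Z) (fun V _ => compl_compl V) (fun Z _ => by rw [compl_compl])
  · rw [Finset.mem_powerset]
    exact Finset.compl_subset_compl.2 (Finset.mem_filter.1 hZ).2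
  · refine Finset.mem_filter.2 ⟨Finset.mem_univ _, ?_⟩
    rw [Finset.mem_powerset] at hV
    exact Finset.subset_compl_comm.1 hV

theorem subsetSum_subsetSum (c d : ℕ → ℂ) (hg : ∀ n, IsSymmetricOp (g n)) :
    subsetSum c (subsetSum d g) = subsetSum
      (fun n => ∑ k ∈ Finset.range (n + 1), (n.choose k : ℂ) * (c k * d (n - k))) g := by
  funext s
  change ∑ Z : Finset (Fin s), c Zᶜ.card • onSubset Z (subsetSum d g Z.card) = _
  simp only [onSubset_subsetSum d hg, Finset.smul_sum, smul_smul]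
  simp only [subsetSum]
  rw [Finset.sum_comm' (t' := Finset.univ) (s' := fun W => Finset.univ.filter fun Z => W ⊆ Z)
    (fun Z W => by simp)]
  refine Finset.sum_congr rfl fun W _ => ?_
  rw [← Finset.sum_smul, sum_superset]
  congr 1
  have h1 : ∀ V ∈ Wᶜ.powerset, c Vᶜᶜ.card * d (Vᶜ \ W).card =
      (fun k => c k * d (Wᶜ.card - k)) V.card := fun V hV => by
    rw [Finset.mem_powerset] at hV
    have : Vᶜ \ W = Wᶜ \ V := by
      ext; simp [and_comm]
    rw [compl_compl, this, Finset.card_sdiff_of_subset hV]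
  rw [Finset.sum_congr rfl h1, Finset.sum_powerset_apply_card (fun k => c k * d (Wᶜ.card - k))]
  simp only [nsmul_eq_mul]

theorem creat_eq_subsetSum (g : OpSeq ν) :
    creat g = subsetSum (fun n => if n = 1 then 1 else 0) g := by
  funext s
  simp only [subsetSum, ite_smul, one_smul, zero_smul]
  rw [← Finset.sum_filter]
  refine Finset.sum_bij (fun j _ => Finset.univ.erase j) (fun j _ => ?_) (fun i _ j _ h => ?_)
    (fun Z hZ => ?_) fun j _ => rfl
  · refine Finset.mem_filter.2 ⟨Finset.mem_univ _, ?_⟩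
    rw [← Finset.compl_singleton, compl_compl, Finset.card_singleton]
  · rw [← Finset.compl_singleton, ← Finset.compl_singleton, compl_inj_iff] at h
    exact Finset.singleton_injective h
  · obtain ⟨j, hj⟩ := Finset.card_eq_one.1 (Finset.mem_filter.1 hZ).2
    exact ⟨j, Finset.mem_univ _, by rw [← Finset.compl_singleton, ← hj, compl_compl]⟩

theorem iterate_creat (hg : ∀ n, IsSymmetricOp (g n)) (n : ℕ) :
    creat^[n] g = subsetSum (fun r => if r = n then (n.factorial : ℂ) else 0) g := by
  induction n with
  | zero =>
    funext s
    simp only [Function.iterate_zero, id, subsetSum, Nat.factorial_zero, Nat.cast_one, ite_smul, one_smul, zero_smul]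
    rw [← Finset.sum_filter, Finset.sum_eq_single Finset.univ]
    · exact (lift_refl (g s)).symm.trans (onSubset_eq_lift_of_map hg _ _ (by ext; simp)).symm
    · intro Z hZ hZ'
      simp only [Finset.mem_filter, Finset.mem_univ, true_and, Finset.card_eq_zero,
        Finset.compl_eq_empty_iff] at hZ
      exact absurd hZ hZ'
    · intro h
      simp at h
  | succ n ih =>
    rw [Function.iterate_succ_apply', ih, creat_eq_subsetSum, subsetSum_subsetSum _ _ hg]
    congr 1
    funext r
    rcases r with _ | r
    · simp
    · rw [Finset.sum_eq_single 1]
      · simp only [if_true, one_mul, Nat.add_sub_cancel, Nat.choose_one_right]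
        by_cases h : r = n
        · subst h
          rw [if_pos rfl, if_pos rfl, Nat.factorial_succ]
          push_cast; ring
        · rw [if_neg h, if_neg (by omega), mul_zero]
      · intro k _ hk
        rw [if_neg hk, zero_mul, mul_zero]
      · intro h
        simp at h

theorem sum_embedding {M : Type} [AddCommMonoid M] (n s : ℕ) (G : Finset (Fin s) → M) :
    ∑ j : Fin n ↪ Fin s, G (Finset.univ.map j) =
      n.factorial • ∑ W ∈ Finset.powersetCard n Finset.univ, G W := by
  have h1 : ∀ j ∈ (Finset.univ : Finset (Fin n ↪ Fin s)),
      Finset.univ.map j ∈ Finset.powersetCard n (Finset.univ : Finset (Fin s)) := fun j _ => by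
    rw [Finset.mem_powersetCard]
    exact ⟨Finset.subset_univ _, by simp⟩
  rw [← Finset.sum_fiberwise_of_maps_to h1, Finset.smul_sum]
  refine Finset.sum_congr rfl fun W hW => ?_
  have hc := (Finset.mem_powersetCard.1 hW).2
  subst hc
  have h2 : ∀ j ∈ (Finset.univ : Finset (Fin W.card ↪ Fin s)).filter
      (fun j => Finset.univ.map j = W), G (Finset.univ.map j) = G W := fun j hj => by
    rw [(Finset.mem_filter.1 hj).2]
  rw [Finset.sum_congr rfl h2, Finset.sum_const]
  congr 1
  have hp : W.card.factorial = Fintype.card (Equiv.Perm (Fin W.card)) := by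
    rw [Fintype.card_perm, Fintype.card_fin]
  rw [hp, ← Finset.card_univ]
  symm
  refine Finset.card_bij (fun σ _ => σ.toEmbedding.trans (W.orderEmbOfFin rfl).toEmbedding)
    (fun σ _ => ?_) (fun σ _ τ _ h => ?_) (fun j hj => ?_)
  · refine Finset.mem_filter.2 ⟨Finset.mem_univ _, ?_⟩
    rw [← Finset.map_map, Finset.map_univ_equiv, map_orderEmbOfFin_univ]
  · ext i
    have := DFunLike.congr_fun h i
    exact congrArg Fin.val ((W.orderEmbOfFin rfl).injective this)
  · obtain ⟨σ, hσ⟩ := exists_perm_of_range_eq j (W.orderEmbOfFin rfl).toEmbedding (by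
      rw [range_orderEmbOfFin_toEmbedding]
      conv_rhs => rw [← (Finset.mem_filter.1 hj).2]
      simp)
    exact ⟨σ, Finset.mem_univ _, hσ⟩

theorem expCreat_eq_subsetSum (ε : ℂ) (g : OpSeq ν) :
    expCreat ε g = subsetSum (fun n => ε ^ n) g := by
  funext s
  simp only [expCreat, subsetSum]
  have h1 : ∀ n ∈ Finset.range (s + 1), (ε ^ n / (n.factorial : ℂ)) • ∑ j : Fin n ↪ Fin s,
      onSubset (Finset.univ.map j)ᶜ (g (Finset.univ.map j)ᶜ.card) =
      ∑ V ∈ Finset.powersetCard n Finset.univ, ε ^ V.card • onSubset Vᶜ (g Vᶜ.card) := fun n _ => by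
    rw [sum_embedding n s (fun V => onSubset Vᶜ (g Vᶜ.card)), ← Nat.cast_smul_eq_nsmul ℂ, smul_smul,
      div_mul_cancel₀ _ (by exact_mod_cast n.factorial_ne_zero), Finset.smul_sum]
    refine Finset.sum_congr rfl fun V hV => ?_
    rw [(Finset.mem_powersetCard.1 hV).2]
  rw [Finset.sum_congr rfl h1]
  have h2 := Finset.sum_powerset (Finset.univ : Finset (Fin s))
    (fun V => ε ^ V.card • onSubset Vᶜ (g Vᶜ.card))
  rw [Finset.card_univ, Fintype.card_fin] at h2
  rw [← h2, Finset.powerset_univ]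
  refine Finset.sum_nbij' (fun V => Vᶜ) (fun V => Vᶜ) (fun _ _ => Finset.mem_univ _)
    (fun _ _ => Finset.mem_univ _) (fun _ _ => compl_compl _) (fun _ _ => compl_compl _) fun V _ => ?_
  rw [compl_compl]

end Subsets

section PartialTraces
variable {ν s n m p k : ℕ}

theorem opTrace_mul_trLast {T : Op ν (s + n)} (hT : traceNorm T ≠ ∞) (A : Op ν s) :
    opTrace (A * trLast s n T) = opTrace (lift (Fin.castAddEmb n) A * T) :=
  opTrace_mul_partialTrace finSumFinEquiv (Fin.castAddEmb n) (fun i => rfl) hT A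

theorem traceNorm_trLast_le {T : Op ν (s + n)} (hT : traceNorm T ≠ ∞) :
    traceNorm (trLast s n T) ≤ traceNorm T := traceNorm_partialTrace_le _ T hT

theorem traceNorm_trLast_ne_top {T : Op ν (s + n)} (hT : traceNorm T ≠ ∞) :
    traceNorm (trLast s n T) ≠ ∞ := ne_top_of_le_ne_top hT (traceNorm_trLast_le hT)

theorem trLast_add {S T : Op ν (s + n)} (hS : traceNorm S ≠ ∞) (hT : traceNorm T ≠ ∞) :
    trLast s n (S + T) = trLast s n S + trLast s n T := by
  have hST : traceNorm (S + T) ≠ ∞ :=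
    ne_top_of_le_ne_top (ENNReal.add_ne_top.2 ⟨hS, hT⟩) (traceNorm_add_le _ _)
  refine eq_of_opTrace_mul fun A => ?_
  rw [opTrace_mul_trLast hST, mul_add, mul_add,
    opTrace_add (traceNorm_mul_ne_top hS _) (traceNorm_mul_ne_top hT _),
    opTrace_add (traceNorm_mul_ne_top (traceNorm_trLast_ne_top hS) _)
      (traceNorm_mul_ne_top (traceNorm_trLast_ne_top hT) _),
    opTrace_mul_trLast hS, opTrace_mul_trLast hT]

theorem trLast_smul (c : ℂ) {T : Op ν (s + n)} (hT : traceNorm T ≠ ∞) :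
    trLast s n (c • T) = c • trLast s n T := by
  have hcT : traceNorm (c • T) ≠ ∞ := by
    rw [traceNorm_smul]; exact ENNReal.mul_ne_top enorm_ne_top hT
  refine eq_of_opTrace_mul fun A => ?_
  rw [opTrace_mul_trLast hcT, mul_smul_comm, mul_smul_comm, opTrace_smul, opTrace_smul,
    opTrace_mul_trLast hT]

theorem isSymmetricOp_trLast {T : Op ν (s + n)} (hT : IsSymmetricOp T) (hT' : traceNorm T ≠ ∞) :
    IsSymmetricOp (trLast s n T) := by
  refine isSymmetricOp_of_conj_eq fun σ => eq_of_opTrace_mul fun A => ?_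
  rw [opTrace_mul_conj (traceNorm_trLast_ne_top hT'), opTrace_mul_trLast hT',
    opTrace_mul_trLast hT']
  have h1 : permOp σ⁻¹ * A * permOp σ = lift (σ⁻¹ : Equiv.Perm (Fin s)).toEmbedding A := by
    rw [lift_equiv]; rfl
  rw [h1, ← lift_trans]
  exact opTrace_lift_mul_eq hT hT' _ _ A

variable {f : OpSeq ν}

theorem opTrace_mul_iterate_annih (hf : ∀ n, IsSymmetricOp (f n)) (hf' : ∀ n, traceNorm (f n) ≠ ∞)
    (h : m = p + k) (e : Fin p ↪ Fin m) (B : Op ν p) :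
    opTrace (B * annih^[k] f p) = opTrace (lift e B * f m) := by
  subst h
  induction k generalizing f with
  | zero =>
    conv_lhs => rw [← lift_refl B]
    exact opTrace_lift_mul_eq (hf p) (hf' p) _ _ B
  | succ k ih =>
    rw [Function.iterate_succ_apply, ih (f := annih f)
      (fun n => isSymmetricOp_trLast (hf (n + 1)) (hf' (n + 1)))
      (fun n => traceNorm_trLast_ne_top (hf' (n + 1))) (Fin.castAddEmb k)]
    rw [annih, opTrace_mul_trLast (hf' _), ← lift_trans]
    exact opTrace_lift_mul_eq (hf _) (hf' _) _ _ B

theorem iterate_annih_eq (hf : ∀ n, IsSymmetricOp (f n)) (hf' : ∀ n, traceNorm (f n) ≠ ∞)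
    (n s : ℕ) : annih^[n] f s = trLast s n (f (s + n)) :=
  eq_of_opTrace_mul fun A => by
    rw [opTrace_mul_iterate_annih hf hf' rfl (Fin.castAddEmb n), opTrace_mul_trLast (hf' _)]

end PartialTraces

section Operators
variable {ν : ℕ}

/-- The annihilation operator on `𝔏¹_α`. -/
noncomputable def annihCLM (α : ℝ) (hα : 0 < α) :
    (trNorm (ν := ν) α hα).Space →L[ℂ] (trNorm (ν := ν) α hα).Space :=
  (trNorm α hα).mkCLM annih α⁻¹ (by positivity)
    (fun f hf n => isSymmetricOp_trLast (hf.1 _) (MemTr.traceNorm_ne_top hα hf _))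
    (fun f hf => by
      change normTr α (annih f) ≤ _ * normTr α f
      calc normTr α (annih f) ≤ ∑' n, ENNReal.ofReal α⁻¹ *
            (ENNReal.ofReal (α ^ (n + 1)) * traceNorm (f (n + 1))) := by
            refine ENNReal.tsum_le_tsum fun n => ?_
            rw [← mul_assoc, ← ENNReal.ofReal_mul (by positivity), pow_succ', inv_mul_cancel_left₀ hα.ne']
            gcongr
            exact traceNorm_trLast_le (MemTr.traceNorm_ne_top hα hf _)
        _ ≤ _ := by
            rw [ENNReal.tsum_mul_left]
            gcongr
            exact ENNReal.tsum_comp_le_tsum_of_injective (add_left_injective 1)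
              (fun n => ENNReal.ofReal (α ^ n) * traceNorm (f n)))
    (fun f hf g hg => funext fun n => trLast_add (MemTr.traceNorm_ne_top hα hf _)
      (MemTr.traceNorm_ne_top hα hg _))
    (fun c f hf => funext fun n => trLast_smul c (MemTr.traceNorm_ne_top hα hf _))

theorem annihCLM_val {α : ℝ} {hα : 0 < α} (x : (trNorm (ν := ν) α hα).Space) :
    (annihCLM α hα x).val = annih x.val := rfl

theorem onSubset_add {m : ℕ} (Z : Finset (Fin m)) (A B : Op ν Z.card) :
    onSubset Z (A + B) = onSubset Z A + onSubset Z B := by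
  simp only [onSubset_eq_lift, map_add]

theorem onSubset_smul {m : ℕ} (Z : Finset (Fin m)) (c : ℂ) (A : Op ν Z.card) :
    onSubset Z (c • A) = c • onSubset Z A := by
  simp only [onSubset_eq_lift, map_smul]

theorem normBd_creat_le {γ : ℝ} (hγ : 0 < γ) (g : OpSeq ν) :
    normBd γ (creat g) ≤ ENNReal.ofReal γ * normBd γ g := by
  refine iSup_le fun s => ?_
  rcases s with _ | n
  · have : creat g 0 = 0 := Finset.sum_eq_zero fun j _ => j.elim0
    rw [this, ← ofReal_norm, norm_zero, ENNReal.ofReal_zero, mul_zero]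
    exact zero_le
  have h1 : ‖creat g (n + 1)‖ ≤ (n + 1) * ‖g n‖ := by
    refine (norm_sum_le _ _).trans ?_
    have h2 : ∀ j ∈ (Finset.univ : Finset (Fin (n + 1))),
        ‖onSubset (Finset.univ.erase j) (g (Finset.univ.erase j).card)‖ ≤ ‖g n‖ := fun j _ => by
      refine (norm_onSubset_le _ _).trans (le_of_eq ?_)
      have : (Finset.univ.erase j).card = n := by
        rw [Finset.card_erase_of_mem (Finset.mem_univ j), Finset.card_univ, Fintype.card_fin,
          Nat.add_sub_cancel]
      rw [this]
    refine (Finset.sum_le_sum h2).trans (le_of_eq ?_)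
    rw [Finset.sum_const, Finset.card_univ, Fintype.card_fin, nsmul_eq_mul]
    push_cast; rfl
  have h3 : ENNReal.ofReal (γ ^ n / n.factorial) * ‖g n‖ₑ ≤ normBd γ g :=
    le_iSup (fun n => ENNReal.ofReal (γ ^ n / n.factorial) * ‖g n‖ₑ) n
  calc ENNReal.ofReal (γ ^ (n + 1) / (n + 1).factorial) * ‖creat g (n + 1)‖ₑ
      ≤ ENNReal.ofReal (γ ^ (n + 1) / (n + 1).factorial) * ENNReal.ofReal ((n + 1) * ‖g n‖) := by
        gcongr
        rw [← ofReal_norm]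
        exact ENNReal.ofReal_le_ofReal h1
    _ = ENNReal.ofReal γ * (ENNReal.ofReal (γ ^ n / n.factorial) * ‖g n‖ₑ) := by
        rw [← ofReal_norm, ← ENNReal.ofReal_mul (by positivity), ← ENNReal.ofReal_mul (by positivity),
          ← ENNReal.ofReal_mul (by positivity)]
        congr 1
        rw [Nat.factorial_succ]
        have : (n.factorial : ℝ) ≠ 0 := by exact_mod_cast n.factorial_ne_zero
        push_cast
        field_simp
        ring
    _ ≤ _ := by gcongr

/-- The creation operator on `𝔏_γ`. -/
noncomputable def creatCLM (γ : ℝ) (hγ : 0 < γ) :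
    (bdNorm (ν := ν) γ hγ).Space →L[ℂ] (bdNorm (ν := ν) γ hγ).Space :=
  (bdNorm γ hγ).mkCLM creat γ hγ.le
    (fun f hf n => by
      rw [creat_eq_subsetSum]; exact isSymmetricOp_subsetSum _ hf.1 n)
    (fun f hf => normBd_creat_le hγ f)
    (fun f hf g hg => funext fun n => by
      simp only [creat, Pi.add_apply, onSubset_add, Finset.sum_add_distrib])
    (fun c f hf => funext fun n => by
      simp only [creat, Pi.smul_apply, onSubset_smul, Finset.smul_sum])

theorem creatCLM_val {γ : ℝ} {hγ : 0 < γ} (x : (bdNorm (ν := ν) γ hγ).Space) :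
    (creatCLM γ hγ x).val = creat x.val := rfl

variable {ħ : ℝ} {Φ : ∀ k : ℕ, (Fin k → Pos ν) → ℝ}

theorem evol_mul_neg {n : ℕ} (hH : IsSelfAdjoint (hamiltonian ħ Φ n)) (t : ℝ) :
    evol ħ Φ n t * evol ħ Φ n (-t) = 1 := by
  unfold evol
  rw [neg_div]
  exact (isUnitaryGroupOf_hamiltonian hH).mul_neg_self _

theorem enorm_evol_le {n : ℕ} (hH : IsSelfAdjoint (hamiltonian ħ Φ n)) (t : ℝ) :
    ‖evol ħ Φ n t‖ₑ ≤ 1 := (isUnitaryGroupOf_hamiltonian hH).enorm_le _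

theorem traceNorm_groupG_le (hH : ∀ n, IsSelfAdjoint (hamiltonian ħ Φ n)) (t : ℝ) (f : OpSeq ν)
    (n : ℕ) : traceNorm (groupG ħ Φ t f n) ≤ traceNorm (f n) := by
  refine (traceNorm_mul_mul_le _ _ _).trans ?_
  calc _ ≤ 1 * traceNorm (f n) * 1 := by
        gcongr
        · exact enorm_evol_le (hH n) t
        · exact enorm_evol_le (hH n) (-t)
    _ = _ := by rw [one_mul, mul_one]

theorem enorm_groupG_le (hH : ∀ n, IsSelfAdjoint (hamiltonian ħ Φ n)) (t : ℝ) (f : OpSeq ν)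
    (n : ℕ) : ‖groupG ħ Φ t f n‖ₑ ≤ ‖f n‖ₑ := by
  have h1 : ∀ t, ‖evol ħ Φ n t‖ ≤ 1 := fun t => (isUnitaryGroupOf_hamiltonian (hH n)).norm_le _
  rw [← ofReal_norm, ← ofReal_norm]
  refine ENNReal.ofReal_le_ofReal ?_
  refine (norm_mul_le _ _).trans ?_
  refine (mul_le_of_le_one_right (norm_nonneg _) (h1 _)).trans ?_
  exact (norm_mul_le _ _).trans (mul_le_of_le_one_left (norm_nonneg _) (h1 _))

theorem isSymmetricOp_groupG (hΦ : ∀ (k : ℕ) (σ : Equiv.Perm (Fin k)) (q : Fin k → Pos ν),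
    Φ k (q ∘ σ) = Φ k q) (hH : ∀ n, IsSelfAdjoint (hamiltonian ħ Φ n)) (t : ℝ) {f : OpSeq ν}
    (hf : ∀ n, IsSymmetricOp (f n)) (n : ℕ) : IsSymmetricOp (groupG ħ Φ t f n) :=
  ((isSymmetricOp_evol hΦ (hH n) t).mul (hf n)).mul (isSymmetricOp_evol hΦ (hH n) (-t))

theorem groupG_add (t : ℝ) (f g : OpSeq ν) :
    groupG ħ Φ t (f + g) = groupG ħ Φ t f + groupG ħ Φ t g := funext fun n => by
  simp only [groupG, Pi.add_apply, mul_add, add_mul]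

theorem groupG_smul (t : ℝ) (c : ℂ) (f : OpSeq ν) :
    groupG ħ Φ t (c • f) = c • groupG ħ Φ t f := funext fun n => by
  simp only [groupG, Pi.smul_apply, mul_smul_comm, smul_mul_assoc]

/-- The group `𝒢(t)` on `𝔏¹_α`. -/
noncomputable def groupTr (hΦ : ∀ (k : ℕ) (σ : Equiv.Perm (Fin k)) (q : Fin k → Pos ν),
    Φ k (q ∘ σ) = Φ k q) (hH : ∀ n, IsSelfAdjoint (hamiltonian ħ Φ n)) (α : ℝ) (hα : 0 < α)
    (t : ℝ) : (trNorm (ν := ν) α hα).Space →L[ℂ] (trNorm (ν := ν) α hα).Space :=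
  (trNorm α hα).mkCLM (groupG ħ Φ t) 1 zero_le_one
    (fun f hf => isSymmetricOp_groupG hΦ hH t hf.1)
    (fun f hf => by
      rw [ENNReal.ofReal_one, one_mul]
      refine ENNReal.tsum_le_tsum fun n => ?_
      gcongr
      exact traceNorm_groupG_le hH t f n)
    (fun f _ g _ => groupG_add t f g) (fun c f _ => groupG_smul t c f)

/-- The group `𝒢(t)` on `𝔏_γ`. -/
noncomputable def groupBd (hΦ : ∀ (k : ℕ) (σ : Equiv.Perm (Fin k)) (q : Fin k → Pos ν),
    Φ k (q ∘ σ) = Φ k q) (hH : ∀ n, IsSelfAdjoint (hamiltonian ħ Φ n)) (γ : ℝ) (hγ : 0 < γ)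
    (t : ℝ) : (bdNorm (ν := ν) γ hγ).Space →L[ℂ] (bdNorm (ν := ν) γ hγ).Space :=
  (bdNorm γ hγ).mkCLM (groupG ħ Φ t) 1 zero_le_one
    (fun f hf => isSymmetricOp_groupG hΦ hH t hf.1)
    (fun f hf => by
      rw [ENNReal.ofReal_one, one_mul]
      refine iSup_mono fun n => ?_
      gcongr
      exact enorm_groupG_le hH t f n)
    (fun f _ g _ => groupG_add t f g) (fun c f _ => groupG_smul t c f)

end Operators

section Exponentials
variable {X : Type} [NormedAddCommGroup X] [NormedSpace ℂ X] [CompleteSpace X]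

theorem hasSum_exp_smul (a : X →L[ℂ] X) (ε : ℂ) :
    HasSum (fun n : ℕ => (ε ^ n / (n.factorial : ℂ)) • a ^ n) (NormedSpace.exp (ε • a)) := by
  have h := NormedSpace.exp_series_hasSum_exp' (𝕂 := ℂ) (ε • a)
  refine h.congr_fun ?_
  intro n
  rw [smul_pow, smul_smul, div_eq_inv_mul]

theorem exp_neg_mul_exp (a : X →L[ℂ] X) : NormedSpace.exp (-a) * NormedSpace.exp a = 1 := by
  letI : NormedAlgebra ℚ (X →L[ℂ] X) := NormedAlgebra.restrictScalars ℚ ℂ _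
  rw [← NormedSpace.exp_add_of_commute (Commute.refl a).neg_left, neg_add_cancel, NormedSpace.exp_zero]

theorem exp_mul_exp_neg (a : X →L[ℂ] X) : NormedSpace.exp a * NormedSpace.exp (-a) = 1 := by
  have := exp_neg_mul_exp (-a)
  rwa [neg_neg] at this

theorem summable_norm_exp (a : X →L[ℂ] X) (ε : ℂ) :
    Summable fun n : ℕ => ‖(ε ^ n / (n.factorial : ℂ)) • a ^ n‖ := by
  have h := NormedSpace.norm_expSeries_summable' (𝕂 := ℂ) (ε • a)
  refine h.congr fun n => ?_
  rw [smul_pow, smul_smul, div_eq_inv_mul]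

/-- The `n`-fold commutator `[a, …, [a, b] … ]`. -/
def adPow {R : Type} [Ring R] (a b : R) : ℕ → R
  | 0 => b
  | n + 1 => a * adPow a b n - adPow a b n * a

theorem adPow_eq {R : Type} [Ring R] [Algebra ℂ R] (a b : R) (n : ℕ) :
    adPow a b n = ∑ m ∈ Finset.HasAntidiagonal.antidiagonal n,
      (n.choose m.1 : ℂ) • (-1 : ℂ) ^ m.2 • (a ^ m.1 * b * a ^ m.2) := by
  let L := LinearMap.mulLeft ℂ a
  let T := (-1 : ℂ) • LinearMap.mulRight ℂ a
  have h1 : adPow a b n = ((L + T) ^ n) b := by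
    induction n with
    | zero => rfl
    | succ n ih =>
      rw [pow_succ', Module.End.mul_apply, ← ih]
      simp [adPow, L, T, sub_eq_add_neg]
  have hc : Commute L T := (LinearMap.commute_mulLeft_right a a).smul_right _
  rw [h1, hc.add_pow', LinearMap.sum_apply]
  refine Finset.sum_congr rfl fun m _ => ?_
  simp only [L, T, smul_pow, LinearMap.pow_mulLeft, LinearMap.pow_mulRight, LinearMap.smul_apply,
    Module.End.mul_apply, LinearMap.mulLeft_apply, LinearMap.mulRight_apply, mul_smul_comm]
  rw [← Nat.cast_smul_eq_nsmul ℂ, mul_assoc]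

theorem adPow_div_factorial {R : Type} [Ring R] [Algebra ℂ R] (a b : R) (n : ℕ) :
    (n.factorial : ℂ)⁻¹ • adPow a b n = ∑ kl ∈ Finset.HasAntidiagonal.antidiagonal n,
      (((1 : ℂ) ^ kl.1 / (kl.1.factorial : ℂ)) • a ^ kl.1 * b) *
        (((-1 : ℂ) ^ kl.2 / (kl.2.factorial : ℂ)) • a ^ kl.2) := by
  rw [adPow_eq, Finset.smul_sum]
  refine Finset.sum_congr rfl fun kl hkl => ?_
  have hn := Finset.HasAntidiagonal.mem_antidiagonal.1 hkl
  rw [smul_mul_assoc, smul_mul_assoc, mul_smul_comm, smul_smul, smul_smul, smul_smul]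
  congr 1
  rw [← hn, Nat.choose_symm_add, Nat.add_choose, Nat.cast_div (Nat.factorial_mul_factorial_dvd_factorial_add _ _)
    (by exact_mod_cast (Nat.mul_pos (Nat.factorial_pos _) (Nat.factorial_pos _)).ne')]
  have h1 : ((kl.1 + kl.2).factorial : ℂ) ≠ 0 := by exact_mod_cast Nat.factorial_ne_zero _
  have h2 : (kl.1.factorial : ℂ) ≠ 0 := by exact_mod_cast Nat.factorial_ne_zero _
  have h3 : (kl.2.factorial : ℂ) ≠ 0 := by exact_mod_cast Nat.factorial_ne_zero _
  push_cast
  field_simp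
  rw [one_pow]

theorem hasSum_adPow (a b : X →L[ℂ] X) :
    HasSum (fun n : ℕ => (n.factorial : ℂ)⁻¹ • adPow a b n)
      (NormedSpace.exp a * b * NormedSpace.exp (-a)) := by
  have h1 := summable_norm_exp a 1
  have h2 := summable_norm_exp a (-1)
  have h1' : Summable fun n : ℕ => ‖((1 : ℂ) ^ n / (n.factorial : ℂ)) • a ^ n * b‖ :=
    Summable.of_nonneg_of_le (fun _ => norm_nonneg _) (fun n => norm_mul_le _ _) (h1.mul_right ‖b‖)
  have h3 := tsum_mul_tsum_eq_tsum_sum_antidiagonal_of_summable_norm h1' h2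
  have h4 := (summable_norm_sum_mul_antidiagonal_of_summable_norm h1' h2).of_norm.hasSum
  rw [← h3, h1.of_norm.tsum_mul_right, (hasSum_exp_smul a 1).tsum_eq, (hasSum_exp_smul a (-1)).tsum_eq,
    one_smul, neg_one_smul] at h4
  refine h4.congr_fun fun n => ?_
  rw [adPow_div_factorial]

end Exponentials

section Cumulants
variable {ν m k : ℕ} {ħ : ℝ} {Φ : ∀ k : ℕ, (Fin k → Pos ν) → ℝ}

theorem groupOn_apply (t : ℝ) (Z : Finset (Fin m)) (X : Op ν m) :
    groupOn ħ Φ t Z X =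
      onSubset Z (evol ħ Φ Z.card t) * X * onSubset Z (evol ħ Φ Z.card (-t)) :=
  LinearMap.mulLeftRight_apply _ _ _

theorem groupOn_onSubset (t : ℝ) (Z : Finset (Fin m)) (h : OpSeq ν) :
    groupOn ħ Φ t Z (onSubset Z (h Z.card)) = onSubset Z (groupG ħ Φ t h Z.card) := by
  rw [groupOn_apply]
  simp only [onSubset_eq_lift, groupG, map_mul]

theorem groupOn_lift_trans (t : ℝ) (Z : Finset (Fin m)) (f : Fin k ↪ Fin Z.card) (A : Op ν k) :
    groupOn ħ Φ t Z (lift (f.trans (Z.orderEmbOfFin rfl).toEmbedding) A) =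
      lift (Z.orderEmbOfFin rfl).toEmbedding
        (evol ħ Φ Z.card t * lift f A * evol ħ Φ Z.card (-t)) := by
  rw [groupOn_apply]
  simp only [onSubset_eq_lift, map_mul, lift_trans]

theorem groupOn_lift_of_disjoint (hH : ∀ n, IsSelfAdjoint (hamiltonian ħ Φ n)) (t : ℝ)
    (Z : Finset (Fin m)) (f : Fin k ↪ Fin m) (h : Disjoint (↑Z : Set (Fin m)) (Set.range f))
    (A : Op ν k) : groupOn ħ Φ t Z (lift f A) = lift f A := by
  rw [groupOn_apply, onSubset_eq_lift, onSubset_eq_lift,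
    commute_lift _ f (by rwa [range_orderEmbOfFin_toEmbedding]), mul_assoc, ← map_mul,
    evol_mul_neg (hH _), map_one, mul_one]

theorem exists_trans_orderEmbOfFin (f : Fin k ↪ Fin m) (Z : Finset (Fin m))
    (h : Set.range f ⊆ ↑Z) :
    ∃ f' : Fin k ↪ Fin Z.card, f'.trans (Z.orderEmbOfFin rfl).toEmbedding = f := by
  refine ⟨⟨fun i => (Z.orderIsoOfFin rfl).symm ⟨f i, h ⟨i, rfl⟩⟩, fun i j hij => ?_⟩, ?_⟩
  · have := (Z.orderIsoOfFin rfl).symm.injective hij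
    exact f.injective (congrArg Subtype.val this)
  · ext i
    exact congrArg (fun z : {z // z ∈ Z} => (z : Fin m).val)
      ((Z.orderIsoOfFin rfl).apply_symm_apply ⟨f i, h ⟨i, rfl⟩⟩)

theorem prod_groupOn_lift_of_disjoint (hH : ∀ n, IsSelfAdjoint (hamiltonian ħ Φ n)) (t : ℝ)
    {β : Type} (D : β → Finset (Fin m)) (L : List β) (f : Fin k ↪ Fin m)
    (h : ∀ b ∈ L, Disjoint (↑(D b) : Set (Fin m)) (Set.range f)) (A : Op ν k) :
    (L.map fun b => groupOn ħ Φ t (D b)).prod (lift f A) = lift f A := by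
  induction L with
  | nil => rfl
  | cons b L ih =>
    rw [List.map_cons, List.prod_cons, Module.End.mul_apply,
      ih fun b hb => h b (List.mem_cons_of_mem _ hb),
      groupOn_lift_of_disjoint hH _ _ _ (h b List.mem_cons_self)]

theorem prod_groupOn_lift (hH : ∀ n, IsSelfAdjoint (hamiltonian ħ Φ n)) (t : ℝ)
    {β : Type} (D : β → Finset (Fin m)) (L : List β)
    (hL : L.Pairwise fun a b => Disjoint (D a) (D b)) (f : Fin k ↪ Fin m) {b₀ : β} (hb : b₀ ∈ L)
    (h : Set.range f ⊆ ↑(D b₀)) (A : Op ν k) :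
    (L.map fun b => groupOn ħ Φ t (D b)).prod (lift f A) = groupOn ħ Φ t (D b₀) (lift f A) := by
  induction L with
  | nil => simp at hb
  | cons b L ih =>
    rw [List.pairwise_cons] at hL
    rw [List.map_cons, List.prod_cons, Module.End.mul_apply]
    rcases List.mem_cons.1 hb with rfl | hb'
    · rw [prod_groupOn_lift_of_disjoint hH]
      intro b' hb'
      exact ((Finset.disjoint_coe.2 (hL.1 b' hb')).mono_left h).symm
    · rw [ih hL.2 hb']
      obtain ⟨f', hf'⟩ := exists_trans_orderEmbOfFin f _ h
      rw [← hf', groupOn_lift_trans, groupOn_lift_of_disjoint hH]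
      rw [range_orderEmbOfFin_toEmbedding]
      exact Finset.disjoint_coe.2 (hL.1 _ hb')

theorem pairwise_decluster (J : Finset (Fin m))
    (P : Finpartition (Finset.univ : Finset (Option {i : Fin m // i ∉ J}))) :
    P.parts.toList.Pairwise fun B B' => Disjoint (decluster J B) (decluster J B') :=
  P.parts.nodup_toList.pairwise_of_forall_ne fun B hB B' hB' h =>
    disjoint_decluster J (P.disjoint (Finset.mem_toList.1 hB) (Finset.mem_toList.1 hB') h)

theorem sum_ite_none_mem {M : Type} [AddCommMonoid M] (J : Finset (Fin m))
    (P : Finpartition (Finset.univ : Finset (Option {i : Fin m // i ∉ J})))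
    (F : Finset (Option {i : Fin m // i ∉ J}) → M) :
    ∃ B ∈ P.parts, none ∈ B ∧ (∑ B ∈ P.parts, if none ∈ B then F B else 0) = F B := by
  refine ⟨P.part none, P.part_mem.2 (Finset.mem_univ _), P.mem_part (Finset.mem_univ _), ?_⟩
  rw [Finset.sum_eq_single (P.part none)]
  · rw [if_pos (P.mem_part (Finset.mem_univ _))]
  · intro B hB hne
    rw [if_neg]
    intro h
    exact hne (P.part_eq_of_mem hB h).symm
  · intro h
    exact absurd (P.part_mem.2 (Finset.mem_univ _)) h

theorem prod_toList_groupOn_lift (hH : ∀ n, IsSelfAdjoint (hamiltonian ħ Φ n)) (t : ℝ)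
    (J : Finset (Fin m)) (P : Finpartition (Finset.univ : Finset (Option {i : Fin m // i ∉ J})))
    {L : List (Finset (Option {i : Fin m // i ∉ J}))} (hL : L.Perm P.parts.toList)
    (f : Fin k ↪ Fin m) (h : Set.range f ⊆ ↑J) (A : Op ν k) :
    (L.map fun B => groupOn ħ Φ t (decluster J B)).prod (lift f A) =
      ∑ B ∈ P.parts, if none ∈ B then groupOn ħ Φ t (decluster J B) (lift f A) else 0 := by
  obtain ⟨B, hB, hn, hsum⟩ := sum_ite_none_mem J P
    fun B => groupOn ħ Φ t (decluster J B) (lift f A)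
  rw [hsum]
  refine prod_groupOn_lift hH t _ L ?_ f (hL.mem_iff.2 (Finset.mem_toList.2 hB)) ?_ A
  · exact (hL.pairwise_iff fun h => h.symm).2 (pairwise_decluster J P)
  · intro i hi
    exact (mem_decluster_of_mem J (h hi)).2 hn

theorem sum_finpartition_decluster {M : Type} [AddCommGroup M] [Module ℂ M] (J : Finset (Fin m))
    (F : Finset (Fin m) → M) :
    ∑ P : Finpartition (Finset.univ : Finset (Option {i : Fin m // i ∉ J})),
      ((-1 : ℂ) ^ (P.parts.card - 1) * ((P.parts.card - 1).factorial : ℂ)) •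
        (∑ B ∈ P.parts, if none ∈ B then F (decluster J B) else 0) =
    ∑ W : Finset (Fin m) with J ⊆ W, ((-1 : ℂ) ^ Wᶜ.card) • F W := by
  rw [sum_cumulant_coefficients (Finset.mem_univ none) fun B => F (decluster J B), sum_decluster]

theorem cumulant_lift (hH : ∀ n, IsSelfAdjoint (hamiltonian ħ Φ n)) (t : ℝ)
    (J : Finset (Fin m)) (f : Fin k ↪ Fin m) (h : Set.range f ⊆ ↑J) (A : Op ν k) :
    cumulant ħ Φ t J (lift f A) =
      ∑ W : Finset (Fin m) with J ⊆ W, ((-1 : ℂ) ^ Wᶜ.card) • groupOn ħ Φ t W (lift f A) := by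
  rw [← sum_finpartition_decluster, cumulant, LinearMap.sum_apply]
  refine Finset.sum_congr rfl fun P _ => ?_
  rw [LinearMap.smul_apply, prod_toList_groupOn_lift hH t J P (List.Perm.refl _) f h]

theorem opTrace_sum {E J : Type} [NormedAddCommGroup E] [InnerProductSpace ℂ E] [CompleteSpace E]
    (F : Finset J) {T : J → E →L[ℂ] E} (hT : ∀ j ∈ F, traceNorm (T j) ≠ ∞) :
    traceNorm (∑ j ∈ F, T j) ≠ ∞ ∧ opTrace (∑ j ∈ F, T j) = ∑ j ∈ F, opTrace (T j) := by
  classical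
  induction F using Finset.induction_on with
  | empty =>
    refine ⟨by simp [traceNorm_zero], ?_⟩
    have := opTrace_smul (0 : ℂ) (0 : E →L[ℂ] E)
    simpa using this
  | insert a F ha ih =>
    obtain ⟨h1, h2⟩ := ih fun j hj => hT j (Finset.mem_insert_of_mem hj)
    have h3 := hT a (Finset.mem_insert_self a F)
    rw [Finset.sum_insert ha, Finset.sum_insert ha, opTrace_add h3 h1, h2]
    exact ⟨ne_top_of_le_ne_top (ENNReal.add_ne_top.2 ⟨h3, h1⟩) (traceNorm_add_le _ _), rfl⟩

theorem traceNorm_smul_ne_top {E : Type} [NormedAddCommGroup E] [InnerProductSpace ℂ E]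
    [CompleteSpace E] (c : ℂ) {T : E →L[ℂ] E} (hT : traceNorm T ≠ ∞) : traceNorm (c • T) ≠ ∞ := by
  rw [traceNorm_smul]; exact ENNReal.mul_ne_top enorm_ne_top hT

theorem traceNorm_groupOn_ne_top (t : ℝ) (Z : Finset (Fin m)) {X : Op ν m}
    (hX : traceNorm X ≠ ∞) : traceNorm (groupOn ħ Φ t Z X) ≠ ∞ := by
  rw [groupOn_apply]
  exact traceNorm_mul_ne_top' (traceNorm_mul_ne_top hX _) _

theorem opTrace_mul_groupOn (t : ℝ) (Z : Finset (Fin m)) {X : Op ν m} (hX : traceNorm X ≠ ∞)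
    (B : Op ν m) : opTrace (B * groupOn ħ Φ (-t) Z X) = opTrace (groupOn ħ Φ t Z B * X) := by
  rw [groupOn_apply, groupOn_apply, opTrace_mul_conj hX, neg_neg]

theorem opTrace_mul_prod_groupOn (t : ℝ) {β : Type} (D : β → Finset (Fin m)) (L : List β)
    {X : Op ν m} (hX : traceNorm X ≠ ∞) (B : Op ν m) :
    traceNorm ((L.map fun b => groupOn ħ Φ (-t) (D b)).prod X) ≠ ∞ ∧
    opTrace (B * (L.map fun b => groupOn ħ Φ (-t) (D b)).prod X) =
      opTrace ((L.reverse.map fun b => groupOn ħ Φ t (D b)).prod B * X) := by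
  induction L generalizing B with
  | nil => exact ⟨hX, rfl⟩
  | cons b L ih =>
    refine ⟨traceNorm_groupOn_ne_top _ _ (ih 0).1, ?_⟩
    rw [List.map_cons, List.prod_cons, Module.End.mul_apply, opTrace_mul_groupOn _ _ (ih 0).1,
      (ih _).2, List.reverse_cons, List.map_append, List.prod_append, Module.End.mul_apply]
    simp

theorem opTrace_lift_mul_cumulant (hH : ∀ n, IsSelfAdjoint (hamiltonian ħ Φ n)) (t : ℝ)
    (J : Finset (Fin m)) (f : Fin k ↪ Fin m) (h : Set.range f ⊆ ↑J) (A : Op ν k) {X : Op ν m}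
    (hX : traceNorm X ≠ ∞) :
    traceNorm (cumulant ħ Φ (-t) J X) ≠ ∞ ∧ opTrace (lift f A * cumulant ħ Φ (-t) J X) =
      ∑ W : Finset (Fin m) with J ⊆ W,
        ((-1 : ℂ) ^ Wᶜ.card) • opTrace (groupOn ħ Φ t W (lift f A) * X) := by
  rw [← sum_finpartition_decluster J fun W => opTrace (groupOn ħ Φ t W (lift f A) * X), cumulant,
    LinearMap.sum_apply]
  have h1 := fun P : Finpartition (Finset.univ : Finset (Option {i : Fin m // i ∉ J})) =>
    opTrace_mul_prod_groupOn (ħ := ħ) (Φ := Φ) t (decluster J) P.parts.toList hX (lift f A)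
  refine ⟨(opTrace_sum _ fun P _ => traceNorm_smul_ne_top _ (h1 P).1).1, ?_⟩
  rw [Finset.mul_sum]
  refine (opTrace_sum _ fun P _ => traceNorm_mul_ne_top
    (traceNorm_smul_ne_top _ (h1 P).1) _).2.trans ?_
  refine Finset.sum_congr rfl fun P _ => ?_
  rw [mul_smul_comm, opTrace_smul, (h1 P).2,
    prod_toList_groupOn_lift hH t J P (List.reverse_perm _) f h, Finset.sum_mul,
    (opTrace_sum _ fun B _ => traceNorm_mul_ne_top hX _).2, smul_eq_mul]
  congr 1
  refine Finset.sum_congr rfl fun B _ => ?_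
  split_ifs
  · rfl
  · rw [zero_mul]
    simpa using opTrace_smul (0 : ℂ) (0 : Op ν m)

end Cumulants

section Series
variable {ν : ℕ}

theorem SeqNorm.tendsto_sum (N : SeqNorm ν) {u : ℕ → N.Space} {x : N.Space} (h : HasSum u x) :
    Tendsto (fun K => N.toFun (∑ n ∈ Finset.range K, (u n).val - x.val)) atTop (𝓝 0) := by
  have h1 := (SeqNorm.Space.tendsto_iff N).1 h.tendsto_sum_nat
  simpa only [SeqNorm.Space.val_sum] using h1

theorem SeqNorm.hasSum_component (N : SeqNorm ν) {u : ℕ → N.Space} {x : N.Space} (h : HasSum u x)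
    (s : ℕ) : HasSum (fun n => (u n).val s) (x.val s) :=
  h.mapL (SeqNorm.Space.component N s)

theorem hasSum_apply {X : Type} [NormedAddCommGroup X] [NormedSpace ℂ X] {u : ℕ → X →L[ℂ] X}
    {a : X →L[ℂ] X} (h : HasSum u a) (x : X) : HasSum (fun n => u n x) (a x) :=
  h.mapL (ContinuousLinearMap.apply ℂ X x)

variable {α : ℝ} {hα : 0 < α} {γ : ℝ} {hγ : 0 < γ}

theorem memTr_val (x : (trNorm (ν := ν) α hα).Space) : MemTr α x.val := SeqNorm.Space.mem _ x

theorem memBd_val (x : (bdNorm (ν := ν) γ hγ).Space) : MemBd γ x.val := SeqNorm.Space.mem _ x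

theorem val_annihCLM_pow (n : ℕ) (x : (trNorm (ν := ν) α hα).Space) :
    ((annihCLM α hα ^ n) x).val = annih^[n] x.val := by
  induction n with
  | zero => rfl
  | succ n ih => rw [pow_succ', mul_apply_eq_comp, annihCLM_val, ih, Function.iterate_succ_apply']

theorem val_creatCLM_pow (n : ℕ) (x : (bdNorm (ν := ν) γ hγ).Space) :
    ((creatCLM γ hγ ^ n) x).val = creat^[n] x.val := by
  induction n with
  | zero => rfl
  | succ n ih => rw [pow_succ', mul_apply_eq_comp, creatCLM_val, ih, Function.iterate_succ_apply']

/-- The operator `e^{ε𝔞}` on `𝔏¹_α`. -/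
noncomputable def expAnnihCLM (α : ℝ) (hα : 0 < α) (ε : ℂ) :
    (trNorm (ν := ν) α hα).Space →L[ℂ] (trNorm (ν := ν) α hα).Space :=
  NormedSpace.exp (ε • annihCLM α hα)

/-- The operator `e^{ε𝔞⁺}` on `𝔏_γ`. -/
noncomputable def expCreatCLM (γ : ℝ) (hγ : 0 < γ) (ε : ℂ) :
    (bdNorm (ν := ν) γ hγ).Space →L[ℂ] (bdNorm (ν := ν) γ hγ).Space :=
  NormedSpace.exp (ε • creatCLM γ hγ)

theorem hasSum_expAnnihCLM (ε : ℂ) (x : (trNorm (ν := ν) α hα).Space) :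
    HasSum (fun n : ℕ => (ε ^ n / (n.factorial : ℂ)) • (annihCLM α hα ^ n) x)
      (expAnnihCLM α hα ε x) :=
  hasSum_apply (hasSum_exp_smul (annihCLM α hα) ε) x

theorem hasSum_expCreatCLM (ε : ℂ) (x : (bdNorm (ν := ν) γ hγ).Space) :
    HasSum (fun n : ℕ => (ε ^ n / (n.factorial : ℂ)) • (creatCLM γ hγ ^ n) x)
      (expCreatCLM γ hγ ε x) :=
  hasSum_apply (hasSum_exp_smul (creatCLM γ hγ) ε) x

theorem val_expAnnihCLM (ε : ℂ) (x : (trNorm (ν := ν) α hα).Space) :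
    (expAnnihCLM α hα ε x).val = expAnnih ε x.val := by
  funext s
  have h := SeqNorm.hasSum_component _ (hasSum_expAnnihCLM ε x) s
  rw [expAnnih, ← h.tsum_eq]
  refine tsum_congr fun n => ?_
  rw [SeqNorm.Space.val_smul, Pi.smul_apply, val_annihCLM_pow,
    iterate_annih_eq (SeqNorm.Space.mem _ x).1 (MemTr.traceNorm_ne_top hα (memTr_val x))]

theorem inv_factorial_smul_iterate_creat {g : OpSeq ν} (hg : ∀ n, IsSymmetricOp (g n)) (n : ℕ) :
    (n.factorial : ℂ)⁻¹ • creat^[n] g = subsetSum (fun r => if r = n then 1 else 0) g := by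
  rw [iterate_creat hg]
  funext s
  rw [Pi.smul_apply, subsetSum, subsetSum, Finset.smul_sum]
  refine Finset.sum_congr rfl fun Z _ => ?_
  rw [smul_smul]
  congr 1
  have : (n.factorial : ℂ) ≠ 0 := by exact_mod_cast n.factorial_ne_zero
  split_ifs
  · rw [inv_mul_cancel₀ this]
  · rw [mul_zero]

theorem subsetSum_eq_zero {c : ℕ → ℂ} {s : ℕ} (h : ∀ r ≤ s, c r = 0) (g : OpSeq ν) :
    subsetSum c g s = 0 :=
  Finset.sum_eq_zero fun Z _ => by
    rw [h _ (by simpa using Finset.card_le_univ Zᶜ), zero_smul]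

theorem val_expCreatCLM (ε : ℂ) (x : (bdNorm (ν := ν) γ hγ).Space) :
    (expCreatCLM γ hγ ε x).val = expCreat ε x.val := by
  funext s
  have hx := (SeqNorm.Space.mem _ x).1
  have h := SeqNorm.hasSum_component _ (hasSum_expCreatCLM ε x) s
  have h1 : ∀ n : ℕ, ((ε ^ n / (n.factorial : ℂ)) • (creatCLM γ hγ ^ n) x).val s =
      ε ^ n • subsetSum (fun r => if r = n then 1 else 0) x.val s := fun n => by
    rw [SeqNorm.Space.val_smul, Pi.smul_apply, val_creatCLM_pow,
      ← inv_factorial_smul_iterate_creat hx, Pi.smul_apply, smul_smul, div_eq_mul_inv]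
  rw [expCreat_eq_subsetSum]
  refine h.unique ?_
  simp only [h1]
  have h2 : subsetSum (fun n => ε ^ n) x.val s = ∑ n ∈ Finset.range (s + 1),
      ε ^ n • subsetSum (fun r => if r = n then 1 else 0) x.val s := by
    simp only [subsetSum, Finset.smul_sum, smul_smul]
    rw [Finset.sum_comm]
    refine Finset.sum_congr rfl fun Z _ => ?_
    rw [← Finset.sum_smul]
    congr 1
    have : Zᶜ.card ∈ Finset.range (s + 1) := by
      rw [Finset.mem_range, Nat.lt_succ_iff]
      simpa using Finset.card_le_univ Zᶜ
    rw [Finset.sum_eq_single_of_mem _ this, if_pos rfl, mul_one]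
    intro n _ hn
    rw [if_neg (Ne.symm hn), mul_zero]
  rw [h2]
  refine hasSum_sum_of_ne_finset_zero fun n hn => ?_
  rw [subsetSum_eq_zero, smul_zero]
  intro r hr
  rw [if_neg]
  rintro rfl
  exact hn (Finset.mem_range.2 (Nat.lt_succ_iff.2 hr))

theorem expAnnihCLM_neg_apply (x : (trNorm (ν := ν) α hα).Space) :
    expAnnihCLM α hα (-1) (expAnnihCLM α hα 1 x) = x := by
  have := DFunLike.congr_fun (exp_neg_mul_exp (annihCLM (ν := ν) α hα)) x
  rwa [mul_apply_eq_comp, ← neg_one_smul ℂ, ← one_smul ℂ (annihCLM α hα), smul_smul, mul_one] at this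

theorem expAnnihCLM_apply_neg (x : (trNorm (ν := ν) α hα).Space) :
    expAnnihCLM α hα 1 (expAnnihCLM α hα (-1) x) = x := by
  have := DFunLike.congr_fun (exp_mul_exp_neg (annihCLM (ν := ν) α hα)) x
  rwa [mul_apply_eq_comp, ← neg_one_smul ℂ, ← one_smul ℂ (annihCLM α hα), smul_smul, mul_one] at this

theorem expCreatCLM_neg_apply (x : (bdNorm (ν := ν) γ hγ).Space) :
    expCreatCLM γ hγ (-1) (expCreatCLM γ hγ 1 x) = x := by
  have := DFunLike.congr_fun (exp_neg_mul_exp (creatCLM (ν := ν) γ hγ)) x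
  rwa [mul_apply_eq_comp, ← neg_one_smul ℂ, ← one_smul ℂ (creatCLM γ hγ), smul_smul, mul_one] at this

theorem expCreatCLM_apply_neg (x : (bdNorm (ν := ν) γ hγ).Space) :
    expCreatCLM γ hγ 1 (expCreatCLM γ hγ (-1) x) = x := by
  have := DFunLike.congr_fun (exp_mul_exp_neg (creatCLM (ν := ν) γ hγ)) x
  rwa [mul_apply_eq_comp, ← neg_one_smul ℂ, ← one_smul ℂ (creatCLM γ hγ), smul_smul, mul_one] at this

end Series

section Groups
variable {ν : ℕ} {ħ : ℝ} {Φ : ∀ k : ℕ, (Fin k → Pos ν) → ℝ} {α : ℝ} {hα : 0 < α} {γ : ℝ}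
  {hγ : 0 < γ} (hΦ : ∀ (k : ℕ) (σ : Equiv.Perm (Fin k)) (q : Fin k → Pos ν), Φ k (q ∘ σ) = Φ k q)
  (hH : ∀ n, IsSelfAdjoint (hamiltonian ħ Φ n))

theorem val_groupTr (t : ℝ) (x : (trNorm (ν := ν) α hα).Space) :
    (groupTr hΦ hH α hα t x).val = groupG ħ Φ t x.val := rfl

theorem val_groupBd (t : ℝ) (x : (bdNorm (ν := ν) γ hγ).Space) :
    (groupBd hΦ hH γ hγ t x).val = groupG ħ Φ t x.val := rfl

theorem val_adPow_annih (t : ℝ) (n : ℕ) (x : (trNorm (ν := ν) α hα).Space) :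
    (adPow (annihCLM α hα) (groupTr hΦ hH α hα t) n x).val =
      commLeft annih (groupG ħ Φ t) n x.val := by
  induction n generalizing x with
  | zero => rfl
  | succ n ih =>
    rw [adPow, sub_apply, mul_apply_eq_comp, mul_apply_eq_comp, SeqNorm.Space.val_sub, annihCLM_val,
      ih, ih, annihCLM_val]
    rfl

theorem val_adPow_creat (t : ℝ) (n : ℕ) (x : (bdNorm (ν := ν) γ hγ).Space) :
    (adPow (-creatCLM γ hγ) (groupBd hΦ hH γ hγ t) n x).val =
      commRight creat (groupG ħ Φ t) n x.val := by
  induction n generalizing x with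
  | zero => rfl
  | succ n ih =>
    have h1 : adPow (-creatCLM γ hγ) (groupBd hΦ hH γ hγ t) (n + 1) x =
        adPow (-creatCLM γ hγ) (groupBd hΦ hH γ hγ t) n (creatCLM γ hγ x) -
          creatCLM γ hγ (adPow (-creatCLM γ hγ) (groupBd hΦ hH γ hγ t) n x) := by
      rw [adPow, neg_mul, mul_neg, sub_neg_eq_add, add_comm, ← sub_eq_add_neg]
      rfl
    rw [h1, SeqNorm.Space.val_sub, ih, creatCLM_val, creatCLM_val, ih]
    rfl

theorem opTrace_mul_iterate_groupG (hΦ : ∀ (k : ℕ) (σ : Equiv.Perm (Fin k)) (q : Fin k → Pos ν),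
    Φ k (q ∘ σ) = Φ k q) (hH : ∀ n, IsSelfAdjoint (hamiltonian ħ Φ n))
    (t : ℝ) {f : OpSeq ν} (hf : ∀ n, IsSymmetricOp (f n))
    (hf' : ∀ n, traceNorm (f n) ≠ ∞) {s m j k : ℕ} (A : Op ν s) (e : Fin s ↪ Fin m)
    (W : Finset (Fin m)) (he : Set.range e ⊆ ↑W) (hW : W.card = s + j) (hm : m = W.card + k)
    (hk : ∀ n, IsSymmetricOp (annih^[k] f n)) (hk' : ∀ n, traceNorm (annih^[k] f n) ≠ ∞) :
    opTrace (A * annih^[j] (groupG ħ Φ (-t) (annih^[k] f)) s) =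
      opTrace (groupOn ħ Φ t W (lift e A) * f m) := by
  obtain ⟨e', rfl⟩ := exists_trans_orderEmbOfFin e W he
  rw [opTrace_mul_iterate_annih (fun n => isSymmetricOp_groupG hΦ hH _ hk n)
    (fun n => ne_top_of_le_ne_top (hk' n) (traceNorm_groupG_le hH _ _ n)) hW e', groupG,
    opTrace_mul_conj (hk' _), opTrace_mul_iterate_annih hf hf' hm (W.orderEmbOfFin rfl).toEmbedding,
    groupOn_lift_trans, neg_neg]

theorem commLeft_eq_bbgkyTerm (hΦ : ∀ (k : ℕ) (σ : Equiv.Perm (Fin k)) (q : Fin k → Pos ν),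
    Φ k (q ∘ σ) = Φ k q) (hH : ∀ n, IsSelfAdjoint (hamiltonian ħ Φ n))
    (t : ℝ) {f : OpSeq ν} (hα : 0 < α) (hf : MemTr α f) (n s : ℕ) :
    commLeft annih (groupG ħ Φ (-t)) n f s = bbgkyTerm ħ Φ t f s n := by
  have hf' := MemTr.traceNorm_ne_top hα hf
  let x : (trNorm (ν := ν) α hα).Space := SeqNorm.Space.mk f hf
  have hx : ∀ k, annih^[k] f = ((annihCLM α hα ^ k) x).val := fun k => (val_annihCLM_pow k x).symm
  have hk : ∀ k n, IsSymmetricOp (annih^[k] f n) := fun k n => by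
    rw [hx]; exact (SeqNorm.Space.mem _ _).1 n
  have hk' : ∀ k n, traceNorm (annih^[k] f n) ≠ ∞ := fun k n => by
    rw [hx]; exact MemTr.traceNorm_ne_top hα (memTr_val _) n
  have hcomm : commLeft annih (groupG ħ Φ (-t)) n f s =
      ∑ m ∈ Finset.HasAntidiagonal.antidiagonal n, (n.choose m.1 : ℂ) • (-1 : ℂ) ^ m.2 •
        annih^[m.1] (groupG ħ Φ (-t) (annih^[m.2] f)) s := by
    have h1 := val_adPow_annih (hα := hα) hΦ hH (-t) n x
    have h2 : f = x.val := rfl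
    conv_lhs => rw [h2]
    rw [← h1, adPow_eq, sum_apply, SeqNorm.Space.val_sum, Finset.sum_apply]
    refine Finset.sum_congr rfl fun m _ => ?_
    rw [smul_apply, smul_apply, mul_apply_eq_comp, mul_apply_eq_comp, SeqNorm.Space.val_smul,
      SeqNorm.Space.val_smul, val_annihCLM_pow, val_groupTr, val_annihCLM_pow]
    rfl
  have htr : ∀ j k, traceNorm (annih^[j] (groupG ħ Φ (-t) (annih^[k] f)) s) ≠ ∞ := fun j k => by
    rw [hx k, ← val_groupTr hΦ hH, ← val_annihCLM_pow]
    exact MemTr.traceNorm_ne_top hα (memTr_val _) s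
  refine eq_of_opTrace_mul fun A => ?_
  set J : Finset (Fin (s + n)) := Finset.univ.map (Fin.castAddEmb n) with hJ
  have hJr : Set.range (Fin.castAddEmb n : Fin s ↪ Fin (s + n)) = ↑J := by simp [hJ]
  have hJc : Jᶜ.card = n := by
    rw [Finset.card_compl, hJ, Finset.card_map, Finset.card_univ, Fintype.card_fin, Fintype.card_fin,
      Nat.add_sub_cancel_left]
  obtain ⟨hcum, hc⟩ := opTrace_lift_mul_cumulant (Φ := Φ) hH t J (Fin.castAddEmb n) hJr.le A
    (hf' (s + n))
  rw [bbgkyTerm, opTrace_mul_trLast hcum, hc, sum_superset]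
  have h1 : ∀ V ∈ Jᶜ.powerset, ((-1 : ℂ) ^ Vᶜᶜ.card) •
      opTrace (groupOn ħ Φ t Vᶜ (lift (Fin.castAddEmb n) A) * f (s + n)) =
      (fun k => (-1 : ℂ) ^ k * opTrace (A * annih^[n - k] (groupG ħ Φ (-t) (annih^[k] f)) s))
        V.card := fun V hV => by
    rw [Finset.mem_powerset] at hV
    have hle : V.card ≤ n := (Finset.card_le_card hV).trans_eq hJc
    have hVc : Vᶜ.card = s + n - V.card := by rw [Finset.card_compl, Fintype.card_fin]
    rw [compl_compl, smul_eq_mul]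
    dsimp only
    rw [opTrace_mul_iterate_groupG hΦ hH t hf.1 hf' A (Fin.castAddEmb n) Vᶜ (by
      rw [hJr, Finset.coe_subset]; exact Finset.subset_compl_comm.1 hV) (by omega) (by omega)
      (hk _) (hk' _)]
  rw [Finset.sum_congr rfl h1, Finset.sum_powerset_apply_card
    (fun k => (-1 : ℂ) ^ k * opTrace (A * annih^[n - k] (groupG ħ Φ (-t) (annih^[k] f)) s)), hJc,
    hcomm, Finset.mul_sum, (opTrace_sum _ fun m _ => traceNorm_mul_ne_top
      (traceNorm_smul_ne_top _ (traceNorm_smul_ne_top _ (htr _ _))) _).2,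
    ← Finset.Nat.sum_antidiagonal_swap, Finset.Nat.sum_antidiagonal_eq_sum_range_succ_mk]
  refine Finset.sum_congr rfl fun k hk => ?_
  have hkn : k ≤ n := Nat.lt_succ_iff.1 (Finset.mem_range.1 hk)
  simp only [Prod.swap_prod_mk, mul_smul_comm, opTrace_smul, nsmul_eq_mul, Nat.choose_symm hkn]

theorem adPow_creat_term (hΦ : ∀ (k : ℕ) (σ : Equiv.Perm (Fin k)) (q : Fin k → Pos ν),
    Φ k (q ∘ σ) = Φ k q) (hH : ∀ n, IsSelfAdjoint (hamiltonian ħ Φ n))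
    (t : ℝ) (x : (bdNorm (ν := ν) γ hγ).Space) (k l : ℕ) :
    (((((((1 : ℂ) ^ k / (k.factorial : ℂ)) • (-creatCLM γ hγ) ^ k * groupBd hΦ hH γ hγ t) *
        (((-1 : ℂ) ^ l / (l.factorial : ℂ)) • (-creatCLM γ hγ) ^ l)) : (bdNorm (ν := ν) γ hγ).Space →L[ℂ] (bdNorm (ν := ν) γ hγ).Space) x)).val =
      (-1 : ℂ) ^ k • subsetSum (fun r => if r = k then 1 else 0)
        (groupG ħ Φ t (subsetSum (fun r => if r = l then 1 else 0) x.val)) := by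
  have hg := memBd_val x
  have h4 : (-1 : ℂ) ^ l • (-creatCLM (ν := ν) γ hγ) ^ l = creatCLM γ hγ ^ l := by
    rw [← neg_one_smul ℂ (creatCLM γ hγ), smul_pow, smul_smul, ← mul_pow, neg_one_mul, neg_neg,
      one_pow, one_smul]
  have h5 : (-creatCLM (ν := ν) γ hγ) ^ k = (-1 : ℂ) ^ k • creatCLM γ hγ ^ k := by
    rw [← neg_one_smul ℂ (creatCLM γ hγ), smul_pow]
  have h6 := inv_factorial_smul_iterate_creat hg.1 l
  have h7 := inv_factorial_smul_iterate_creat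
    (isSymmetricOp_groupG hΦ hH t (isSymmetricOp_subsetSum (fun r => if r = l then 1 else 0) hg.1)) k
  rw [div_eq_inv_mul, div_eq_inv_mul, mul_smul, mul_smul, h4, h5, one_pow, one_smul,
    smul_comm _ ((-1 : ℂ) ^ k), ← h7, ← h6]
  rw [mul_apply_eq_comp, mul_apply_eq_comp, smul_apply, smul_apply, smul_apply,
    SeqNorm.Space.val_smul, SeqNorm.Space.val_smul, val_creatCLM_pow, val_groupBd,
    SeqNorm.Space.val_smul, val_creatCLM_pow]

theorem commRight_div_factorial_eq_sum (hΦ : ∀ (k : ℕ) (σ : Equiv.Perm (Fin k)) (q : Fin k → Pos ν),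
    Φ k (q ∘ σ) = Φ k q) (hH : ∀ n, IsSelfAdjoint (hamiltonian ħ Φ n))
    (t : ℝ) (x : (bdNorm (ν := ν) γ hγ).Space) (n : ℕ) :
    (n.factorial : ℂ)⁻¹ • commRight creat (groupG ħ Φ t) n x.val =
      ∑ kl ∈ Finset.HasAntidiagonal.antidiagonal n, (-1 : ℂ) ^ kl.1 •
        subsetSum (fun r => if r = kl.1 then 1 else 0)
          (groupG ħ Φ t (subsetSum (fun r => if r = kl.2 then 1 else 0) x.val)) := by
  have h2 := val_adPow_creat hΦ hH t n x
  rw [← h2, ← SeqNorm.Space.val_smul, ← smul_apply, adPow_div_factorial, sum_apply,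
    SeqNorm.Space.val_sum]
  exact Finset.sum_congr rfl fun kl _ => adPow_creat_term hΦ hH t x kl.1 kl.2

theorem subsetSum_groupG_subsetSum (t : ℝ) {g : OpSeq ν} (hg : ∀ n, IsSymmetricOp (g n)) (s k l : ℕ) :
    ((-1 : ℂ) ^ k • subsetSum (fun r => if r = k then 1 else 0)
      (groupG ħ Φ t (subsetSum (fun r => if r = l then 1 else 0) g))) s =
      ∑ W : Finset (Fin s), ∑ Z ∈ W.powerset, if (Wᶜ.card, (W \ Z).card) = (k, l) then
        (-1 : ℂ) ^ Wᶜ.card • groupOn ħ Φ t W (onSubset Z (g Z.card)) else 0 := by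
  rw [Pi.smul_apply, subsetSum, Finset.smul_sum]
  refine Finset.sum_congr rfl fun W _ => ?_
  rw [← groupOn_onSubset, onSubset_subsetSum _ hg, map_sum, Finset.smul_sum, Finset.smul_sum]
  refine Finset.sum_congr rfl fun Z _ => ?_
  rw [map_smul]
  by_cases h3 : Wᶜ.card = k
  · by_cases h4 : (W \ Z).card = l
    · rw [if_pos h3, if_pos h4, if_pos (Prod.ext h3 h4), one_smul, one_smul, h3]
    · rw [if_neg h4, if_neg fun h => h4 (congrArg Prod.snd h), zero_smul, smul_zero, smul_zero]
  · rw [if_neg h3, if_neg fun h => h3 (congrArg Prod.fst h), zero_smul, smul_zero]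

theorem commRight_div_factorial (hΦ : ∀ (k : ℕ) (σ : Equiv.Perm (Fin k)) (q : Fin k → Pos ν),
    Φ k (q ∘ σ) = Φ k q) (hH : ∀ n, IsSelfAdjoint (hamiltonian ħ Φ n))
    (t : ℝ) (x : (bdNorm (ν := ν) γ hγ).Space) (n s : ℕ) :
    ((n.factorial : ℂ)⁻¹ • commRight creat (groupG ħ Φ t) n x.val) s =
      ∑ Z : Finset (Fin s) with Zᶜ.card = n, cumulant ħ Φ t Z (onSubset Z (x.val Z.card)) := by
  rw [commRight_div_factorial_eq_sum hΦ hH t x, Finset.sum_apply]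
  simp only [subsetSum_groupG_subsetSum t (memBd_val x).1]
  rw [Finset.sum_comm]
  have h3 : ∀ W : Finset (Fin s), (∑ kl ∈ Finset.HasAntidiagonal.antidiagonal n,
      ∑ Z ∈ W.powerset, if (Wᶜ.card, (W \ Z).card) = kl then
        (-1 : ℂ) ^ Wᶜ.card • groupOn ħ Φ t W (onSubset Z (x.val Z.card)) else 0) =
      ∑ Z ∈ W.powerset, if Zᶜ.card = n then
        (-1 : ℂ) ^ Wᶜ.card • groupOn ħ Φ t W (onSubset Z (x.val Z.card)) else 0 := fun W => by
    rw [Finset.sum_comm]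
    refine Finset.sum_congr rfl fun Z hZ => ?_
    have hZW := Finset.mem_powerset.1 hZ
    have h4 : Zᶜ.card = Wᶜ.card + (W \ Z).card := by
      rw [Finset.card_compl, Finset.card_compl, Finset.card_sdiff_of_subset hZW]
      have h5 := Finset.card_le_card hZW
      have h6 := Finset.card_le_univ W
      omega
    rw [Finset.sum_ite_eq, h4]
    simp only [Finset.HasAntidiagonal.mem_antidiagonal]
  simp only [h3]
  rw [Finset.sum_comm' (t' := Finset.univ) (s' := fun Z => Finset.univ.filter fun W => Z ⊆ W)
    (fun W Z => by simp), Finset.sum_filter]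
  refine Finset.sum_congr rfl fun Z _ => ?_
  split_ifs with h4
  · rw [onSubset_eq_lift, cumulant_lift hH _ _ _ (by rw [range_orderEmbOfFin_toEmbedding])]
  · exact Finset.sum_const_zero

theorem dualTerm_eq {t : ℝ} {g : OpSeq ν} {n s : ℕ} (h : n ≤ s) : dualTerm ħ Φ t g s n =
    ∑ Z : Finset (Fin s) with Zᶜ.card = n, cumulant ħ Φ t Z (onSubset Z (g Z.card)) := by
  rw [dualTerm, sum_embedding (s - n) s fun Z => cumulant ħ Φ t Z (onSubset Z (g Z.card)),
    ← Nat.cast_smul_eq_nsmul ℂ, smul_smul, inv_mul_cancel₀ (by exact_mod_cast Nat.factorial_ne_zero _),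
    one_smul]
  refine Finset.sum_congr ?_ fun _ _ => rfl
  ext Z
  have h1 := Finset.card_le_univ Z
  have h2 := Finset.card_compl Z
  rw [Fintype.card_fin] at h1 h2
  rw [Finset.mem_powersetCard, Finset.mem_filter]
  simp only [Finset.subset_univ, Finset.mem_univ, true_and]
  omega

/-- The BBGKY group as a group of bounded operators on `𝔏¹_α`. -/
noncomputable def bbgkyCLM (α : ℝ) (hα : 0 < α) (t : ℝ) :
    (trNorm (ν := ν) α hα).Space →L[ℂ] (trNorm (ν := ν) α hα).Space :=
  expAnnihCLM α hα 1 * groupTr hΦ hH α hα (-t) * expAnnihCLM α hα (-1)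

/-- The dual BBGKY group as a group of bounded operators on `𝔏_γ`. -/
noncomputable def dualBbgkyCLM (γ : ℝ) (hγ : 0 < γ) (t : ℝ) :
    (bdNorm (ν := ν) γ hγ).Space →L[ℂ] (bdNorm (ν := ν) γ hγ).Space :=
  expCreatCLM γ hγ (-1) * groupBd hΦ hH γ hγ t * expCreatCLM γ hγ 1

theorem hasSum_bbgkyCLM (t : ℝ) (x : (trNorm (ν := ν) α hα).Space) :
    HasSum (fun n : ℕ => (n.factorial : ℂ)⁻¹ •
      adPow (annihCLM α hα) (groupTr hΦ hH α hα (-t)) n x) (bbgkyCLM hΦ hH α hα t x) := by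
  have h := hasSum_apply (hasSum_adPow (annihCLM α hα) (groupTr hΦ hH α hα (-t))) x
  rw [bbgkyCLM, expAnnihCLM, expAnnihCLM, one_smul, neg_one_smul]
  exact h

theorem hasSum_dualBbgkyCLM (t : ℝ) (x : (bdNorm (ν := ν) γ hγ).Space) :
    HasSum (fun n : ℕ => (n.factorial : ℂ)⁻¹ •
      adPow (-creatCLM γ hγ) (groupBd hΦ hH γ hγ t) n x) (dualBbgkyCLM hΦ hH γ hγ t x) := by
  have h := hasSum_apply (hasSum_adPow (-creatCLM γ hγ) (groupBd hΦ hH γ hγ t)) x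
  rw [dualBbgkyCLM, expCreatCLM, expCreatCLM, one_smul, neg_one_smul]
  rw [neg_neg] at h
  exact h

theorem val_bbgkyCLM (t : ℝ) (x : (trNorm (ν := ν) α hα).Space) :
    (bbgkyCLM hΦ hH α hα t x).val = bbgky ħ Φ t x.val := by
  funext s
  have h := SeqNorm.hasSum_component _ (hasSum_bbgkyCLM hΦ hH t x) s
  rw [bbgky, ← h.tsum_eq]
  refine tsum_congr fun n => ?_
  rw [SeqNorm.Space.val_smul, Pi.smul_apply, val_adPow_annih,
    commLeft_eq_bbgkyTerm hΦ hH t hα (SeqNorm.Space.mem _ x)]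

theorem val_dualBbgkyCLM (t : ℝ) (x : (bdNorm (ν := ν) γ hγ).Space) :
    (dualBbgkyCLM hΦ hH γ hγ t x).val = dualBbgky ħ Φ t x.val := by
  funext s
  have h := SeqNorm.hasSum_component _ (hasSum_dualBbgkyCLM hΦ hH t x) s
  refine h.unique ?_
  have h1 : ∀ n : ℕ, ((n.factorial : ℂ)⁻¹ •
      adPow (-creatCLM γ hγ) (groupBd hΦ hH γ hγ t) n x).val s =
      ∑ Z : Finset (Fin s) with Zᶜ.card = n, cumulant ħ Φ t Z (onSubset Z (x.val Z.card)) := fun n => by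
    rw [SeqNorm.Space.val_smul, val_adPow_creat, commRight_div_factorial hΦ hH t x]
  simp only [h1]
  have h2 : dualBbgky ħ Φ t x.val s = ∑ n ∈ Finset.range (s + 1),
      ∑ Z : Finset (Fin s) with Zᶜ.card = n, cumulant ħ Φ t Z (onSubset Z (x.val Z.card)) :=
    Finset.sum_congr rfl fun n hn => dualTerm_eq (Nat.lt_succ_iff.1 (Finset.mem_range.1 hn))
  rw [h2]
  refine hasSum_sum_of_ne_finset_zero fun n hn => Finset.sum_eq_zero fun Z hZ => ?_
  have h3 := Finset.card_le_univ Zᶜ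
  rw [(Finset.mem_filter.1 hZ).2, Fintype.card_fin] at h3
  exact absurd (Finset.mem_range.2 (Nat.lt_succ_iff.2 h3)) hn

end Groups

section Derivatives
variable {ν : ℕ} {ħ : ℝ} {Φ : ∀ k : ℕ, (Fin k → Pos ν) → ℝ} {n : ℕ}

theorem isCommH_iff (hħ : 0 < ħ) (T S : Op ν n) :
    IsCommH ħ Φ n T S ↔ IsComm (hamiltonian ħ Φ n) T ((ħ : ℂ) • S) := by
  have h0 : (ħ : ℂ) ≠ 0 := by exact_mod_cast hħ.ne'
  have key : ∀ ψ η ξ : Hil ν (Fin n), S ψ = -(Complex.I / (ħ : ℂ)) • (T η - ξ) ↔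
      ((ħ : ℂ) • S) ψ = Complex.I • (ξ - T η) := fun ψ η ξ => by
    have h1 : Complex.I • (ξ - T η) = (ħ : ℂ) • (-(Complex.I / (ħ : ℂ)) • (T η - ξ)) := by
      rw [smul_smul, mul_neg, mul_div_cancel₀ _ h0, neg_smul, ← smul_neg, neg_sub]
    rw [h1, smul_apply]
    exact (smul_right_injective _ h0).eq_iff.symm
  simp only [IsCommH, IsComm, key]

theorem IsCommH.unique (hħ : 0 < ħ) (hH : IsSelfAdjoint (hamiltonian ħ Φ n)) {T S S' : Op ν n}
    (h : IsCommH ħ Φ n T S) (h' : IsCommH ħ Φ n T S') : S = S' := by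
  have h0 : (ħ : ℂ) ≠ 0 := by exact_mod_cast hħ.ne'
  exact smul_right_injective _ h0
    (((isCommH_iff hħ T S).1 h).unique hH ((isCommH_iff hħ T S').1 h'))

theorem isCommH_sum_smul (hħ : 0 < ħ) {J : Type} (F : Finset J) (c : J → ℂ) {T S : J → Op ν n}
    (h : ∀ j ∈ F, IsCommH ħ Φ n (T j) (S j)) :
    IsCommH ħ Φ n (∑ j ∈ F, c j • T j) (∑ j ∈ F, c j • S j) := by
  rw [isCommH_iff hħ, Finset.smul_sum]
  refine IsComm.sum F fun j hj => ?_
  rw [smul_comm]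
  exact ((isCommH_iff hħ _ _).1 (h j hj)).smul (c j)

theorem isCommH_of_tendsto (hħ : 0 < ħ) (hH : IsSelfAdjoint (hamiltonian ħ Φ n))
    {T S : ℕ → Op ν n} {T' S' : Op ν n} (h : ∀ k, IsCommH ħ Φ n (T k) (S k))
    (hT : Tendsto T atTop (𝓝 T')) (hS : Tendsto S atTop (𝓝 S')) : IsCommH ħ Φ n T' S' := by
  rw [isCommH_iff hħ]
  refine isComm_of_tendsto hH (T := T) (S := fun k => (ħ : ℂ) • S k)
    (fun k => (isCommH_iff hħ _ _).1 (h k)) (fun x => ?_) (fun x => ?_)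
  · exact ((ContinuousLinearMap.apply ℂ _ x).continuous.tendsto T').comp hT
  · exact ((ContinuousLinearMap.apply ℂ _ x).continuous.tendsto _).comp (hS.const_smul (ħ : ℂ))

theorem inv_smul_groupG_sub (hħ : 0 < ħ) (t : ℝ) (f : OpSeq ν) (n : ℕ) :
    (t : ℂ)⁻¹ • (groupG ħ Φ t f n - f n) = (ħ : ℂ)⁻¹ • (((t / ħ : ℝ) : ℂ)⁻¹ •
      (unitaryGroup (hamiltonian ħ Φ n) (t / ħ) * f n *
        unitaryGroup (hamiltonian ħ Φ n) (-(t / ħ)) - f n)) := by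
  have h0 : (ħ : ℂ) ≠ 0 := by exact_mod_cast hħ.ne'
  rw [groupG, evol, evol, neg_div, smul_smul]
  congr 1
  push_cast
  rw [inv_div, ← mul_div_assoc, inv_mul_cancel₀ h0, one_div]

theorem tendsto_div_punctured (hħ : 0 < ħ) : Tendsto (fun t : ℝ => t / ħ) (𝓝[≠] 0) (𝓝[≠] 0) := by
  refine tendsto_nhdsWithin_iff.2 ⟨?_, ?_⟩
  · have : Tendsto (fun t : ℝ => t / ħ) (𝓝 0) (𝓝 (0 / ħ)) := tendsto_id.div_const ħ
    rw [zero_div] at this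
    exact this.mono_left nhdsWithin_le_nhds
  · filter_upwards [self_mem_nhdsWithin] with t ht
    exact div_ne_zero ht hħ.ne'

theorem tendsto_mul_punctured (hħ : 0 < ħ) : Tendsto (fun t : ℝ => ħ * t) (𝓝[≠] 0) (𝓝[≠] 0) := by
  have := tendsto_div_punctured (inv_pos.2 hħ)
  refine this.congr fun t => ?_
  rw [div_inv_eq_mul, mul_comm]

theorem diffQuot_sub (hħ : 0 < ħ) (t : ℝ) (f : OpSeq ν) (S : Op ν n) :
    (t : ℂ)⁻¹ • (groupG ħ Φ t f n - f n) - S = (ħ : ℂ)⁻¹ • (((t / ħ : ℝ) : ℂ)⁻¹ •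
      (unitaryGroup (hamiltonian ħ Φ n) (t / ħ) * f n *
        unitaryGroup (hamiltonian ħ Φ n) (-(t / ħ)) - f n) - (ħ : ℂ) • S) := by
  have h0 : (ħ : ℂ) ≠ 0 := by exact_mod_cast hħ.ne'
  rw [inv_smul_groupG_sub hħ, smul_sub _ _ ((ħ : ℂ) • S), smul_smul _ (ħ : ℂ), inv_mul_cancel₀ h0,
    one_smul]

theorem isCommH_of_tendsto_inner (hħ : 0 < ħ) (hH : IsSelfAdjoint (hamiltonian ħ Φ n)) {f : OpSeq ν}
    {S : Op ν n} (h : ∀ x y, Tendsto (fun t : ℝ =>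
      (inner ℂ x (((t : ℂ)⁻¹ • (groupG ħ Φ t f n - f n) - S) y) : ℂ)) (𝓝[≠] 0) (𝓝 0)) :
    IsCommH ħ Φ n (f n) S := by
  have h0 : (ħ : ℂ) ≠ 0 := by exact_mod_cast hħ.ne'
  rw [isCommH_iff hħ]
  refine isComm_of_tendsto_inner hH (isUnitaryGroupOf_hamiltonian hH) fun x y => ?_
  have h1 := ((h x y).comp (tendsto_mul_punctured hħ)).const_mul (ħ : ℂ)
  rw [mul_zero, ← zero_add (0 : ℂ)] at h1
  have h2 := h1.add_const (inner ℂ x (((ħ : ℂ) • S) y))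
  rw [zero_add, zero_add] at h2
  refine h2.congr fun t => ?_
  simp only [Function.comp_apply]
  rw [diffQuot_sub hħ, mul_div_cancel_left₀ _ hħ.ne', smul_apply, inner_smul_right,
    mul_inv_cancel_left₀ h0, sub_apply, inner_sub_right, sub_add_cancel]

theorem tendsto_traceNorm_diffQuot (hħ : 0 < ħ) (hH : IsSelfAdjoint (hamiltonian ħ Φ n)) {f : OpSeq ν}
    {S : Op ν n} (h : IsCommH ħ Φ n (f n) S) (hS : traceNorm S ≠ ∞) :
    Tendsto (fun t : ℝ => traceNorm ((t : ℂ)⁻¹ • (groupG ħ Φ t f n - f n) - S)) (𝓝[≠] 0) (𝓝 0) := by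
  have h1 := ((isCommH_iff hħ _ _).1 h).tendsto_traceNorm hH (isUnitaryGroupOf_hamiltonian hH)
    (traceNorm_smul_ne_top _ hS)
  have h2 := ENNReal.Tendsto.const_mul (a := ‖(ħ : ℂ)⁻¹‖ₑ) (h1.comp (tendsto_div_punctured hħ))
    (Or.inr enorm_ne_top)
  rw [mul_zero] at h2
  refine h2.congr fun t => ?_
  rw [diffQuot_sub hħ, traceNorm_smul]
  rfl

theorem traceNorm_diffQuot_le (hħ : 0 < ħ) (hH : IsSelfAdjoint (hamiltonian ħ Φ n)) {f : OpSeq ν}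
    {S : Op ν n} (h : IsCommH ħ Φ n (f n) S) {t : ℝ} (ht : t ≠ 0) :
    traceNorm ((t : ℂ)⁻¹ • (groupG ħ Φ t f n - f n)) ≤ traceNorm S := by
  have h1 := ((isCommH_iff hħ _ _).1 h).traceNorm_conj_sub_le hH (isUnitaryGroupOf_hamiltonian hH)
    (t / ħ)
  rw [inv_smul_groupG_sub hħ, traceNorm_smul, traceNorm_smul]
  refine (mul_le_mul_right (mul_le_mul_right h1 _) _).trans (le_of_eq ?_)
  rw [traceNorm_smul]
  have h2 : ‖(ħ : ℂ)⁻¹‖ₑ * (‖(((t / ħ : ℝ) : ℂ))⁻¹‖ₑ * (‖(ħ : ℂ)‖ₑ * ENNReal.ofReal |t / ħ|)) = 1 := by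
    have ht' : t / ħ ≠ 0 := div_ne_zero ht hħ.ne'
    rw [← ofReal_norm, ← ofReal_norm, ← ofReal_norm, norm_inv, norm_inv, Complex.norm_real,
      Complex.norm_real, ← ENNReal.ofReal_mul (by positivity), ← ENNReal.ofReal_mul (by positivity),
      ← ENNReal.ofReal_mul (by positivity), ← Real.norm_eq_abs]
    have h3 : ‖t / ħ‖ ≠ 0 := norm_ne_zero_iff.2 ht'
    have h4 : ‖ħ‖ ≠ 0 := norm_ne_zero_iff.2 hħ.ne'
    rw [show ‖ħ‖⁻¹ * (‖t / ħ‖⁻¹ * (‖ħ‖ * ‖t / ħ‖)) = 1 by field_simp, ENNReal.ofReal_one]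
  calc _ = ‖(ħ : ℂ)⁻¹‖ₑ * (‖(((t / ħ : ℝ) : ℂ))⁻¹‖ₑ * (‖(ħ : ℂ)‖ₑ * ENNReal.ofReal |t / ħ|)) *
        traceNorm S := by ring
    _ = _ := by rw [h2, one_mul]

theorem norm_diffQuot_le (hħ : 0 < ħ) (hH : IsSelfAdjoint (hamiltonian ħ Φ n)) {f : OpSeq ν}
    {S : Op ν n} (h : IsCommH ħ Φ n (f n) S) {t : ℝ} (ht : t ≠ 0) :
    ‖(t : ℂ)⁻¹ • (groupG ħ Φ t f n - f n)‖ ≤ ‖S‖ := by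
  have h1 := ((isCommH_iff hħ _ _).1 h).norm_conj_sub_le hH (isUnitaryGroupOf_hamiltonian hH)
    (t / ħ)
  rw [inv_smul_groupG_sub hħ, norm_smul, norm_smul]
  refine (mul_le_mul_of_nonneg_left (mul_le_mul_of_nonneg_left h1 (norm_nonneg _))
    (norm_nonneg _)).trans (le_of_eq ?_)
  have h3 : ‖t / ħ‖ ≠ 0 := norm_ne_zero_iff.2 (div_ne_zero ht hħ.ne')
  have h4 : ‖ħ‖ ≠ 0 := norm_ne_zero_iff.2 hħ.ne'
  rw [norm_smul, norm_inv, norm_inv, Complex.norm_real, Complex.norm_real, ← Real.norm_eq_abs]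
  field_simp

theorem tendsto_opTrace_diffQuot (hħ : 0 < ħ) (hH : IsSelfAdjoint (hamiltonian ħ Φ n)) {f : OpSeq ν}
    {S T : Op ν n} (h : IsCommH ħ Φ n (f n) S) (hT : traceNorm T ≠ ∞) :
    Tendsto (fun t : ℝ => opTrace (((t : ℂ)⁻¹ • (groupG ħ Φ t f n - f n) - S) * T)) (𝓝[≠] 0)
      (𝓝 0) := by
  have h1 := ((isCommH_iff hħ _ _).1 h).tendsto_opTrace hH (isUnitaryGroupOf_hamiltonian hH) hT
  have h2 := (h1.comp (tendsto_div_punctured hħ)).const_mul (ħ : ℂ)⁻¹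
  rw [mul_zero] at h2
  refine h2.congr fun t => ?_
  rw [diffQuot_sub hħ, smul_mul_assoc, opTrace_smul]
  rfl

variable (hH : ∀ n, IsSelfAdjoint (hamiltonian ħ Φ n))

theorem tendsto_normTr_diffQuot_iff (hħ : 0 < ħ) (hH : ∀ n, IsSelfAdjoint (hamiltonian ħ Φ n))
    {α : ℝ} (hα : 0 < α) {f k : OpSeq ν} (hk : MemTr α k) :
    Tendsto (fun t : ℝ => normTr α ((t : ℂ)⁻¹ • (groupG ħ Φ t f - f) - k)) (𝓝[≠] 0) (𝓝 0) ↔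
      ∀ n, IsCommH ħ Φ n (f n) (k n) := by
  constructor
  · intro h n
    refine isCommH_of_tendsto_inner hħ (hH n) fun x y => ?_
    have h1 := ENNReal.Tendsto.const_mul (a := ENNReal.ofReal ((trNorm (ν := ν) α hα).bound n)) h
      (Or.inr ENNReal.ofReal_ne_top)
    rw [mul_zero] at h1
    have h2 : Tendsto (fun t : ℝ => ‖(((t : ℂ)⁻¹ • (groupG ħ Φ t f - f) - k) n : Op ν n)‖ₑ)
        (𝓝[≠] 0) (𝓝 0) :=
      tendsto_of_tendsto_of_tendsto_of_le_of_le tendsto_const_nhds h1 (fun _ => zero_le)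
        (fun t => (trNorm (ν := ν) α hα).enorm_le _ n)
    have h3 : Tendsto (fun t : ℝ => (((t : ℂ)⁻¹ • (groupG ħ Φ t f - f) - k) n : Op ν n))
        (𝓝[≠] 0) (𝓝 0) := by
      rw [tendsto_zero_iff_norm_tendsto_zero]
      have := (ENNReal.tendsto_toReal ENNReal.zero_ne_top).comp h2
      simpa only [Function.comp_def, toReal_enorm, ENNReal.toReal_zero] using this
    have h4 := ((ContinuousLinearMap.apply ℂ (Hil ν (Fin n)) y).continuous.tendsto _).comp h3
    have h5 := (tendsto_const_nhds (x := x)).inner (𝕜 := ℂ) h4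
    simp only [map_zero, inner_zero_right] at h5
    exact h5
  · intro h
    have h1 : ∀ g : OpSeq ν, normTr α g =
        ∫⁻ n, ENNReal.ofReal (α ^ n) * traceNorm (g n) ∂(Measure.count : Measure ℕ) := fun g =>
      (lintegral_count _).symm
    simp only [h1]
    have h2 : ∫⁻ n, (0 : ℝ≥0∞) ∂(Measure.count : Measure ℕ) = 0 := lintegral_zero
    rw [← h2]
    refine tendsto_lintegral_filter_of_dominated_convergence
      (fun n => 2 * (ENNReal.ofReal (α ^ n) * traceNorm (k n)))
      (Eventually.of_forall fun t => Measurable.of_discrete) ?_ ?_ ?_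
    · filter_upwards [self_mem_nhdsWithin] with t ht
      refine Eventually.of_forall fun n => ?_
      rw [mul_left_comm]
      gcongr
      refine (traceNorm_sub_le _ _).trans ?_
      rw [two_mul]
      gcongr
      exact traceNorm_diffQuot_le hħ (hH n) (h n) ht
    · rw [lintegral_const_mul' _ _ (by simp), ← h1]
      exact ENNReal.mul_ne_top (by simp) hk.2.ne
    · refine Eventually.of_forall fun n => ?_
      have h3 := ENNReal.Tendsto.const_mul (a := ENNReal.ofReal (α ^ n))
        (tendsto_traceNorm_diffQuot hħ (hH n) (h n) (hk.traceNorm_ne_top hα n))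
        (Or.inr ENNReal.ofReal_ne_top)
      rw [mul_zero] at h3
      exact h3

end Derivatives

section Symmetrization
variable {ν n : ℕ}

theorem permOp_mul (σ τ : Equiv.Perm (Fin n)) :
    permOp (ν := ν) (σ * τ) = permOp σ * permOp τ :=
  ContinuousLinearMap.ext fun ψ => relabel_trans τ σ ψ

/-- The average of an operator over the permutations of the particles. -/
noncomputable def symmetrize (T : Op ν n) : Op ν n :=
  ((Fintype.card (Equiv.Perm (Fin n)) : ℂ))⁻¹ • ∑ σ : Equiv.Perm (Fin n), permOp σ * T * permOp σ⁻¹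

theorem isSymmetricOp_symmetrize (T : Op ν n) : IsSymmetricOp (symmetrize T) := by
  refine isSymmetricOp_of_conj_eq fun τ => ?_
  rw [symmetrize, mul_smul_comm, smul_mul_assoc, Finset.mul_sum, Finset.sum_mul]
  congr 1
  refine (Finset.sum_congr rfl fun σ _ => ?_).trans
    (Equiv.sum_comp (Equiv.mulLeft τ) fun σ => permOp σ * T * permOp σ⁻¹)
  rw [Equiv.coe_mulLeft, mul_inv_rev, permOp_mul, permOp_mul]
  simp only [mul_assoc]

theorem traceNorm_symmetrize_ne_top {T : Op ν n} (hT : traceNorm T ≠ ∞) :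
    traceNorm (symmetrize T) ≠ ∞ :=
  traceNorm_smul_ne_top _ (opTrace_sum _ fun _ _ =>
    traceNorm_mul_ne_top' (traceNorm_mul_ne_top hT _) _).1

theorem opTrace_mul_symmetrize {S T : Op ν n} (hS : IsSymmetricOp S) (hT : traceNorm T ≠ ∞) :
    opTrace (S * symmetrize T) = opTrace (S * T) := by
  have h1 : ∀ σ : Equiv.Perm (Fin n), opTrace (S * (permOp σ * T * permOp σ⁻¹)) = opTrace (S * T) :=
    fun σ => by
      have h2 := hS.conj_eq σ⁻¹
      rw [inv_inv] at h2
      rw [opTrace_mul_conj hT, h2]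
  rw [symmetrize, mul_smul_comm, opTrace_smul, Finset.mul_sum, (opTrace_sum _ fun σ _ =>
    traceNorm_mul_ne_top (traceNorm_mul_ne_top' (traceNorm_mul_ne_top hT _) _) _).2]
  simp only [h1]
  rw [Finset.sum_const, Finset.card_univ, nsmul_eq_mul, inv_mul_cancel_left₀]
  exact_mod_cast Fintype.card_ne_zero

theorem memTr_of_forall_eq_zero {α : ℝ} {f : OpSeq ν} (hf : ∀ n, IsSymmetricOp (f n))
    (hf' : ∀ n, traceNorm (f n) ≠ ∞) (N : ℕ) (h : ∀ n, N < n → f n = 0) : MemTr α f := by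
  refine ⟨hf, ?_⟩
  rw [normTr, tsum_eq_sum (s := Finset.range (N + 1))]
  · exact ENNReal.sum_lt_top.2 fun n _ => ENNReal.mul_lt_top ENNReal.ofReal_lt_top (hf' n).lt_top
  · intro n hn
    rw [h n (by simpa using hn), traceNorm_zero, mul_zero]

end Symmetrization

section Pairing
variable {ν : ℕ} {γ : ℝ} {g f : OpSeq ν}

theorem MemBd.norm_le (hγ : 0 < γ) (hg : MemBd γ g) (n : ℕ) :
    ((n.factorial : ℝ))⁻¹ * ‖g n‖ ≤ (normBd γ g).toReal * γ⁻¹ ^ n := by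
  have h1 : ENNReal.ofReal (γ ^ n / n.factorial) * ‖g n‖ₑ ≤ normBd γ g :=
    le_iSup (fun n => ENNReal.ofReal (γ ^ n / n.factorial) * ‖g n‖ₑ) n
  have h2 := ENNReal.toReal_mono hg.2.ne h1
  rw [ENNReal.toReal_mul, toReal_enorm, ENNReal.toReal_ofReal (by positivity)] at h2
  rw [inv_pow, ← div_eq_mul_inv, le_div_iff₀ (by positivity)]
  calc _ = γ ^ n / n.factorial * ‖g n‖ := by field_simp
    _ ≤ _ := h2

theorem MemTr.summable {α : ℝ} (hα : 0 < α) (hf : MemTr α f) :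
    Summable fun n => α ^ n * (traceNorm (f n)).toReal := by
  refine (ENNReal.summable_toReal hf.2.ne).congr fun n => ?_
  rw [ENNReal.toReal_mul, ENNReal.toReal_ofReal (by positivity)]

theorem MemTr.tsum_eq {α : ℝ} (hα : 0 < α) (hf : MemTr α f) :
    ∑' n, α ^ n * (traceNorm (f n)).toReal = (normTr α f).toReal := by
  rw [normTr, ENNReal.tsum_toReal_eq fun n =>
    ENNReal.mul_ne_top ENNReal.ofReal_ne_top (hf.traceNorm_ne_top hα n)]
  refine tsum_congr fun n => ?_
  rw [ENNReal.toReal_mul, ENNReal.toReal_ofReal (by positivity)]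

theorem norm_pairing_term_le (hγ : 0 < γ) (hg : MemBd γ g) (hf : MemTr γ⁻¹ f) (n : ℕ) :
    ‖((n.factorial : ℂ))⁻¹ * opTrace (g n * f n)‖ ≤
      (normBd γ g).toReal * (γ⁻¹ ^ n * (traceNorm (f n)).toReal) := by
  rw [norm_mul, norm_inv, Complex.norm_natCast]
  calc _ ≤ ((n.factorial : ℝ))⁻¹ * (‖g n‖ * (traceNorm (f n)).toReal) := by
        gcongr
        exact norm_opTrace_mul_le (hf.traceNorm_ne_top (inv_pos.2 hγ) n) _
    _ = ((n.factorial : ℝ))⁻¹ * ‖g n‖ * (traceNorm (f n)).toReal := by ring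
    _ ≤ (normBd γ g).toReal * γ⁻¹ ^ n * (traceNorm (f n)).toReal := by
        exact mul_le_mul_of_nonneg_right (hg.norm_le hγ n) ENNReal.toReal_nonneg
    _ = _ := by ring

theorem summable_pairing (hγ : 0 < γ) (hg : MemBd γ g) (hf : MemTr γ⁻¹ f) :
    Summable fun n => ((n.factorial : ℂ))⁻¹ * opTrace (g n * f n) :=
  Summable.of_norm_bounded ((hf.summable (inv_pos.2 hγ)).mul_left _)
    (norm_pairing_term_le hγ hg hf)

theorem norm_pairing_le (hγ : 0 < γ) (hg : MemBd γ g) (hf : MemTr γ⁻¹ f) :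
    ‖pairing g f‖ ≤ (normBd γ g).toReal * (normTr γ⁻¹ f).toReal := by
  rw [← hf.tsum_eq (inv_pos.2 hγ), ← tsum_mul_left]
  exact tsum_of_norm_bounded ((hf.summable (inv_pos.2 hγ)).mul_left _).hasSum
    (norm_pairing_term_le hγ hg hf)

/-- The pairing with a fixed sequence of trace class operators. -/
noncomputable def pairingLeft (hγ : 0 < γ) (y : (trNorm (ν := ν) γ⁻¹ (inv_pos.2 hγ)).Space) :
    (bdNorm (ν := ν) γ hγ).Space →L[ℂ] ℂ :=
  LinearMap.mkContinuous
    { toFun := fun x => pairing x.val y.val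
      map_add' := fun x x' => by
        have hy := memTr_val y
        rw [pairing, pairing, pairing, ← (summable_pairing hγ (memBd_val x) hy).tsum_add
          (summable_pairing hγ (memBd_val x') hy)]
        refine tsum_congr fun n => ?_
        have h1 := hy.traceNorm_ne_top (inv_pos.2 hγ) n
        rw [SeqNorm.Space.val_add, Pi.add_apply, add_mul,
          opTrace_add (traceNorm_mul_ne_top h1 _) (traceNorm_mul_ne_top h1 _), mul_add]
      map_smul' := fun c x => by
        rw [pairing, pairing, RingHom.id_apply, smul_eq_mul, ← tsum_mul_left]
        refine tsum_congr fun n => ?_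
        rw [SeqNorm.Space.val_smul, Pi.smul_apply, smul_mul_assoc, opTrace_smul]
        ring } ‖y‖ (fun x => by
    exact (norm_pairing_le hγ (memBd_val x) (memTr_val y)).trans_eq (mul_comm _ _))

/-- The pairing with a fixed sequence of bounded operators. -/
noncomputable def pairingRight (hγ : 0 < γ) (x : (bdNorm (ν := ν) γ hγ).Space) :
    (trNorm (ν := ν) γ⁻¹ (inv_pos.2 hγ)).Space →L[ℂ] ℂ :=
  LinearMap.mkContinuous
    { toFun := fun y => pairing x.val y.val
      map_add' := fun y y' => by
        have hx := memBd_val x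
        rw [pairing, pairing, pairing, ← (summable_pairing hγ hx (memTr_val y)).tsum_add
          (summable_pairing hγ hx (memTr_val y'))]
        refine tsum_congr fun n => ?_
        have h1 := (memTr_val y).traceNorm_ne_top (inv_pos.2 hγ) n
        have h2 := (memTr_val y').traceNorm_ne_top (inv_pos.2 hγ) n
        rw [SeqNorm.Space.val_add, Pi.add_apply, mul_add,
          opTrace_add (traceNorm_mul_ne_top h1 _) (traceNorm_mul_ne_top h2 _), mul_add]
      map_smul' := fun c y => by
        rw [pairing, pairing, RingHom.id_apply, smul_eq_mul, ← tsum_mul_left]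
        refine tsum_congr fun n => ?_
        rw [SeqNorm.Space.val_smul, Pi.smul_apply, mul_smul_comm, opTrace_smul]
        ring } ‖x‖ (fun y => norm_pairing_le hγ (memBd_val x) (memTr_val y))

theorem pairing_creat (hγ : 0 < γ) (hg : MemBd γ g) (hc : MemBd γ (creat g)) (hf : MemTr γ⁻¹ f) :
    pairing (creat g) f = pairing g (annih f) := by
  have hf' := fun n => hf.traceNorm_ne_top (inv_pos.2 hγ) n
  have h0 : creat g 0 = 0 := Finset.sum_eq_zero fun j _ => j.elim0
  rw [pairing, (summable_pairing hγ hc hf).tsum_eq_zero_add, h0, zero_mul]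
  have h00 : opTrace (0 : Op ν 0) = 0 := by simpa using opTrace_smul (0 : ℂ) (0 : Op ν 0)
  rw [h00, mul_zero, zero_add]
  refine tsum_congr fun n => ?_
  have h1 : ∀ j ∈ (Finset.univ : Finset (Fin (n + 1))),
      opTrace (onSubset (Finset.univ.erase j) (g (Finset.univ.erase j).card) * f (n + 1)) =
        opTrace (g n * annih f n) := fun j _ => by
    rw [onSubset_eq_lift_of_map hg.1 j.succAboveEmb _ (by
      ext i
      simp [Fin.exists_succAbove_eq_iff])]
    rw [opTrace_lift_mul_eq (hf.1 _) (hf' _) _ (Fin.castAddEmb 1)]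
    exact (opTrace_mul_trLast (hf' (n + 1)) (g n)).symm
  rw [creat, Finset.sum_mul, (opTrace_sum _ fun j _ => traceNorm_mul_ne_top (hf' (n + 1)) _).2,
    Finset.sum_congr rfl h1, Finset.sum_const, Finset.card_univ, Fintype.card_fin, nsmul_eq_mul,
    Nat.factorial_succ]
  have h2 : ((n : ℂ) + 1) ≠ 0 := by exact_mod_cast n.succ_ne_zero
  push_cast
  rw [mul_inv, mul_assoc, mul_left_comm, inv_mul_cancel_left₀ h2]

theorem pairing_expCreatCLM (hγ : 0 < γ) (ε : ℂ) (x : (bdNorm (ν := ν) γ hγ).Space)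
    (y : (trNorm (ν := ν) γ⁻¹ (inv_pos.2 hγ)).Space) :
    pairing (expCreatCLM γ hγ ε x).val y.val =
      pairing x.val (expAnnihCLM γ⁻¹ (inv_pos.2 hγ) ε y).val := by
  have hstep : ∀ n : ℕ, ∀ y : (trNorm (ν := ν) γ⁻¹ (inv_pos.2 hγ)).Space,
      pairing ((creatCLM γ hγ ^ n) x).val y.val =
        pairing x.val ((annihCLM γ⁻¹ (inv_pos.2 hγ) ^ n) y).val := fun n => by
    induction n with
    | zero => exact fun y => rfl
    | succ n ih =>
      intro y
      rw [pow_succ', mul_apply_eq_comp, creatCLM_val, pairing_creat hγ (memBd_val _)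
        (memBd_val (creatCLM γ hγ ((creatCLM γ hγ ^ n) x))) (memTr_val y), ← annihCLM_val, ih,
        pow_succ, mul_apply_eq_comp]
  have h1 := (hasSum_expCreatCLM ε x).mapL (pairingLeft hγ y)
  have h2 := (hasSum_expAnnihCLM ε y).mapL (pairingRight hγ x)
  refine h1.unique (h2.congr_fun fun n => ?_)
  rw [map_smul, map_smul]
  congr 1
  exact hstep n y

end Pairing

section Generators
variable {ν : ℕ} {ħ : ℝ} {Φ : ∀ k : ℕ, (Fin k → Pos ν) → ℝ} {α : ℝ} {hα : 0 < α} {γ : ℝ}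
  {hγ : 0 < γ}

theorem MemTr.exists_val (hα : 0 < α) {f : OpSeq ν} (hf : MemTr α f) :
    ∃ x : (trNorm (ν := ν) α hα).Space, x.val = f := ⟨SeqNorm.Space.mk f hf, rfl⟩

theorem MemBd.exists_val (hγ : 0 < γ) {g : OpSeq ν} (hg : MemBd γ g) :
    ∃ x : (bdNorm (ν := ν) γ hγ).Space, x.val = g := ⟨SeqNorm.Space.mk g hg, rfl⟩

theorem tendsto_neg_punctured : Tendsto (fun t : ℝ => -t) (𝓝[≠] 0) (𝓝[≠] 0) := by
  refine tendsto_nhdsWithin_iff.2 ⟨?_, ?_⟩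
  · have : Tendsto (fun t : ℝ => -t) (𝓝 0) (𝓝 (-0)) := tendsto_id.neg
    rw [neg_zero] at this
    exact this.mono_left nhdsWithin_le_nhds
  · filter_upwards [self_mem_nhdsWithin] with t ht
    exact neg_ne_zero.2 ht

theorem tendsto_groupTr_neg_iff (hħ : 0 < ħ)
    (hΦ : ∀ (k : ℕ) (σ : Equiv.Perm (Fin k)) (q : Fin k → Pos ν), Φ k (q ∘ σ) = Φ k q)
    (hH : ∀ n, IsSelfAdjoint (hamiltonian ħ Φ n)) (x y : (trNorm (ν := ν) α hα).Space) :
    Tendsto (fun t : ℝ => (t : ℂ)⁻¹ • (groupTr hΦ hH α hα (-t) x - x)) (𝓝[≠] 0) (𝓝 y) ↔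
      ∀ n, IsCommH ħ Φ n (x.val n) (-(y.val n)) := by
  have h1 := tendsto_normTr_diffQuot_iff (f := x.val) hħ hH hα (memTr_val (-y))
  have h2 := SeqNorm.Space.tendsto_iff (trNorm (ν := ν) α hα) (l := 𝓝[≠] (0 : ℝ))
    (u := fun t : ℝ => (t : ℂ)⁻¹ • (groupTr hΦ hH α hα t x - x)) (x := -y)
  refine Iff.trans ?_ (h2.trans h1)
  constructor
  · intro h
    refine (h.comp tendsto_neg_punctured).neg.congr fun t => ?_
    simp only [Function.comp_apply, neg_neg, Complex.ofReal_neg, inv_neg, neg_smul]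
  · intro h
    have := (h.comp tendsto_neg_punctured).neg
    rw [neg_neg] at this
    refine this.congr fun t => ?_
    simp only [Function.comp_apply, neg_neg, Complex.ofReal_neg, inv_neg, neg_smul]

theorem tendsto_bbgky_iff (hħ : 0 < ħ)
    (hΦ : ∀ (k : ℕ) (σ : Equiv.Perm (Fin k)) (q : Fin k → Pos ν), Φ k (q ∘ σ) = Φ k q)
    (hH : ∀ n, IsSelfAdjoint (hamiltonian ħ Φ n)) (x y : (trNorm (ν := ν) α hα).Space) :
    Tendsto (fun t : ℝ => normTr α ((t : ℂ)⁻¹ • (bbgky ħ Φ t x.val - x.val) - y.val))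
      (𝓝[≠] 0) (𝓝 0) ↔ ∀ n, IsCommH ħ Φ n ((expAnnihCLM α hα (-1) x).val n)
        (-((expAnnihCLM α hα (-1) y).val n)) := by
  have h2 := SeqNorm.Space.tendsto_iff (trNorm (ν := ν) α hα) (l := 𝓝[≠] (0 : ℝ))
    (u := fun t : ℝ => (t : ℂ)⁻¹ • (bbgkyCLM hΦ hH α hα t x - x)) (x := y)
  have h3 : ∀ t : ℝ, expAnnihCLM α hα (-1) ((t : ℂ)⁻¹ • (bbgkyCLM hΦ hH α hα t x - x)) =
      (t : ℂ)⁻¹ • (groupTr hΦ hH α hα (-t) (expAnnihCLM α hα (-1) x) - expAnnihCLM α hα (-1) x) :=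
    fun t => by
      rw [map_smul, map_sub, bbgkyCLM, mul_apply_eq_comp, mul_apply_eq_comp, expAnnihCLM_neg_apply]
  rw [← tendsto_groupTr_neg_iff hħ hΦ hH]
  simp only [← val_bbgkyCLM hΦ hH (hα := hα)]
  refine h2.symm.trans ⟨fun h => ?_, fun h => ?_⟩
  · have := ((expAnnihCLM α hα (-1)).continuous.tendsto _).comp h
    exact this.congr h3
  · have := ((expAnnihCLM α hα 1).continuous.tendsto _).comp h
    rw [expAnnihCLM_apply_neg] at this
    refine this.congr fun t => ?_
    rw [Function.comp_apply, ← h3, expAnnihCLM_apply_neg]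

theorem isBbgkyGen_iff (hħ : 0 < ħ)
    (hΦ : ∀ (k : ℕ) (σ : Equiv.Perm (Fin k)) (q : Fin k → Pos ν), Φ k (q ∘ σ) = Φ k q)
    (hH : ∀ n, IsSelfAdjoint (hamiltonian ħ Φ n)) (hα : 0 < α) (f h : OpSeq ν) :
    IsBbgkyGen ħ Φ α f h ↔
      MemTr α f ∧ ∃ k, IsNegN ħ Φ α (expAnnih (-1) f) k ∧ h = expAnnih 1 k := by
  constructor
  · rintro ⟨hf, hh, hlim⟩
    obtain ⟨x, rfl⟩ := hf.exists_val hα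
    obtain ⟨y, rfl⟩ := hh.exists_val hα
    refine ⟨hf, (expAnnihCLM α hα (-1) y).val, ⟨?_, memTr_val _, ?_⟩, ?_⟩
    · rw [← val_expAnnihCLM (hα := hα)]
      exact memTr_val _
    · rw [← val_expAnnihCLM (hα := hα)]
      exact (tendsto_bbgky_iff hħ hΦ hH x y).1 hlim
    · rw [← val_expAnnihCLM (hα := hα), expAnnihCLM_apply_neg]
  · rintro ⟨hf, k, ⟨h1, h2, h3⟩, rfl⟩
    obtain ⟨x, rfl⟩ := hf.exists_val hα
    obtain ⟨z, rfl⟩ := h2.exists_val hα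
    rw [← val_expAnnihCLM (hα := hα)] at h3 ⊢
    refine ⟨hf, memTr_val _, (tendsto_bbgky_iff hħ hΦ hH x _).2 ?_⟩
    rw [expAnnihCLM_neg_apply]
    exact h3

theorem tendsto_pairing_groupBd_iff (hħ : 0 < ħ)
    (hΦ : ∀ (k : ℕ) (σ : Equiv.Perm (Fin k)) (q : Fin k → Pos ν), Φ k (q ∘ σ) = Φ k q)
    (hH : ∀ n, IsSelfAdjoint (hamiltonian ħ Φ n)) (x y : (bdNorm (ν := ν) γ hγ).Space) :
    (∀ f : OpSeq ν, MemTr γ⁻¹ f → Tendsto (fun t : ℝ =>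
      pairing ((t : ℂ)⁻¹ • (groupBd hΦ hH γ hγ t x - x) - y).val f) (𝓝[≠] 0) (𝓝 0)) ↔
      ∀ n, IsCommH ħ Φ n (x.val n) (y.val n) := by
  constructor
  · intro h n
    refine isCommH_of_tendsto_inner hħ (hH n) fun u v => ?_
    let T : Op ν n := InnerProductSpace.rankOne ℂ v u
    have hT : traceNorm T ≠ ∞ := traceNorm_rankOne_ne_top v u
    have hsingle : ∀ m, m ≠ n → (Pi.single n (symmetrize T) : OpSeq ν) m = 0 := fun m hm =>
      Pi.single_eq_of_ne hm _
    have hf : MemTr γ⁻¹ (Pi.single n (symmetrize T) : OpSeq ν) := by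
      refine memTr_of_forall_eq_zero (fun m => ?_) (fun m => ?_) n
        (fun m hm => hsingle m hm.ne')
      · rcases eq_or_ne m n with rfl | hm
        · rw [Pi.single_eq_same]
          exact isSymmetricOp_symmetrize T
        · rw [hsingle m hm]
          exact isSymmetricOp_zero
      · rcases eq_or_ne m n with rfl | hm
        · rw [Pi.single_eq_same]
          exact traceNorm_symmetrize_ne_top hT
        · rw [hsingle m hm, traceNorm_zero]
          exact ENNReal.zero_ne_top
    have h1 := (h _ hf).const_mul (n.factorial : ℂ)
    rw [mul_zero] at h1
    refine h1.congr fun t => ?_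
    have h0 : (n.factorial : ℂ) ≠ 0 := by exact_mod_cast n.factorial_ne_zero
    have h00 : opTrace (0 : Op ν 0) = 0 := by simpa using opTrace_smul (0 : ℂ) (0 : Op ν 0)
    rw [pairing, tsum_eq_single n fun m hm => by
      rw [hsingle m hm, mul_zero]
      have : opTrace (0 : Op ν m) = 0 := by simpa using opTrace_smul (0 : ℂ) (0 : Op ν m)
      rw [this, mul_zero], Pi.single_eq_same, opTrace_mul_symmetrize ((memBd_val _).1 n) hT,
      mul_inv_cancel_left₀ h0, opTrace_mul_rankOne]
    rfl
  · intro h f hf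
    have hγ' := inv_pos.2 hγ
    have hf' := hf.traceNorm_ne_top hγ'
    rw [← tsum_zero (α := ℂ) (β := ℕ)]
    refine tendsto_tsum_of_dominated_convergence
      (bound := fun n => 2 * ((normBd γ y.val).toReal * (γ⁻¹ ^ n * (traceNorm (f n)).toReal)))
      (((hf.summable hγ').mul_left _).mul_left _) (fun n => ?_) ?_
    · have := (tendsto_opTrace_diffQuot hħ (hH n) (h n) (hf' n)).const_mul ((n.factorial : ℂ))⁻¹
      rw [mul_zero] at this
      exact this
    · filter_upwards [self_mem_nhdsWithin] with t ht n
      rw [norm_mul, norm_inv, Complex.norm_natCast]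
      have h1 : ‖((t : ℂ)⁻¹ • (groupBd hΦ hH γ hγ t x - x) - y).val n‖ ≤ 2 * ‖y.val n‖ := by
        rw [two_mul]
        exact (norm_sub_le _ _).trans (add_le_add (norm_diffQuot_le hħ (hH n) (h n) ht) le_rfl)
      calc _ ≤ ((n.factorial : ℝ))⁻¹ * (2 * ‖y.val n‖ * (traceNorm (f n)).toReal) := by
            refine mul_le_mul_of_nonneg_left ((norm_opTrace_mul_le (hf' n) _).trans ?_)
              (by positivity)
            exact mul_le_mul_of_nonneg_right h1 ENNReal.toReal_nonneg
        _ = 2 * (((n.factorial : ℝ))⁻¹ * ‖y.val n‖ * (traceNorm (f n)).toReal) := by ring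
        _ ≤ 2 * ((normBd γ y.val).toReal * γ⁻¹ ^ n * (traceNorm (f n)).toReal) := by
            refine mul_le_mul_of_nonneg_left ?_ two_pos.le
            exact mul_le_mul_of_nonneg_right ((memBd_val y).norm_le hγ n) ENNReal.toReal_nonneg
        _ = _ := by ring

theorem tendsto_dualBbgky_iff (hħ : 0 < ħ)
    (hΦ : ∀ (k : ℕ) (σ : Equiv.Perm (Fin k)) (q : Fin k → Pos ν), Φ k (q ∘ σ) = Φ k q)
    (hH : ∀ n, IsSelfAdjoint (hamiltonian ħ Φ n)) (x y : (bdNorm (ν := ν) γ hγ).Space) :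
    (∀ f : OpSeq ν, MemTr γ⁻¹ f → Tendsto (fun t : ℝ =>
      pairing ((t : ℂ)⁻¹ • (dualBbgky ħ Φ t x.val - x.val) - y.val) f) (𝓝[≠] 0) (𝓝 0)) ↔
      ∀ n, IsCommH ħ Φ n ((expCreatCLM γ hγ 1 x).val n) ((expCreatCLM γ hγ 1 y).val n) := by
  rw [← tendsto_pairing_groupBd_iff hħ hΦ hH]
  have h3 : ∀ t : ℝ, expCreatCLM γ hγ 1 ((t : ℂ)⁻¹ • (dualBbgkyCLM hΦ hH γ hγ t x - x) - y) =
      (t : ℂ)⁻¹ • (groupBd hΦ hH γ hγ t (expCreatCLM γ hγ 1 x) - expCreatCLM γ hγ 1 x) -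
        expCreatCLM γ hγ 1 y := fun t => by
    rw [map_sub, map_smul, map_sub, dualBbgkyCLM, mul_apply_eq_comp, mul_apply_eq_comp,
      expCreatCLM_apply_neg]
  simp only [← val_dualBbgkyCLM hΦ hH (hγ := hγ), ← h3]
  constructor
  · intro h f hf
    obtain ⟨w, rfl⟩ := hf.exists_val (inv_pos.2 hγ)
    simp only [pairing_expCreatCLM]
    exact h _ (memTr_val _)
  · intro h f hf
    obtain ⟨w, rfl⟩ := hf.exists_val (inv_pos.2 hγ)
    have := h _ (memTr_val (expAnnihCLM γ⁻¹ (inv_pos.2 hγ) (-1) w))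
    simp only [pairing_expCreatCLM, expAnnihCLM_apply_neg] at this
    exact this

theorem isDualGen_iff (hħ : 0 < ħ)
    (hΦ : ∀ (k : ℕ) (σ : Equiv.Perm (Fin k)) (q : Fin k → Pos ν), Φ k (q ∘ σ) = Φ k q)
    (hH : ∀ n, IsSelfAdjoint (hamiltonian ħ Φ n)) (hγ : 0 < γ) (g h : OpSeq ν) :
    IsDualGen ħ Φ γ g h ↔
      MemBd γ g ∧ ∃ k, IsN ħ Φ γ (expCreat 1 g) k ∧ h = expCreat (-1) k := by
  constructor
  · rintro ⟨hf, hh, hlim⟩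
    obtain ⟨x, rfl⟩ := hf.exists_val hγ
    obtain ⟨y, rfl⟩ := hh.exists_val hγ
    refine ⟨hf, (expCreatCLM γ hγ 1 y).val, ⟨?_, memBd_val _, ?_⟩, ?_⟩
    · rw [← val_expCreatCLM (hγ := hγ)]
      exact memBd_val _
    · rw [← val_expCreatCLM (hγ := hγ)]
      exact (tendsto_dualBbgky_iff hħ hΦ hH x y).1 hlim
    · rw [← val_expCreatCLM (hγ := hγ), expCreatCLM_neg_apply]
  · rintro ⟨hf, k, ⟨h1, h2, h3⟩, rfl⟩
    obtain ⟨x, rfl⟩ := hf.exists_val hγ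
    obtain ⟨z, rfl⟩ := h2.exists_val hγ
    rw [← val_expCreatCLM (hγ := hγ)] at h3 ⊢
    refine ⟨hf, memBd_val _, (tendsto_dualBbgky_iff hħ hΦ hH x _).2 ?_⟩
    rw [expCreatCLM_apply_neg]
    exact h3

end Generators

section ShiftRecursion
variable {X : Type} [NormedAddCommGroup X] [NormedSpace ℂ X] {a : X →L[ℂ] X} {ε : ℂ}
  {D : ℕ → ℕ → X}

theorem eq_sum_of_shift_recursion (hD : ∀ n j, D n (j + 1) = a (D n j) + ε • D (n + 1) j)
    (k m : ℕ) : D m k = ∑ pn ∈ Finset.HasAntidiagonal.antidiagonal k,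
      k.choose pn.1 • (ε ^ pn.2 • (a ^ pn.1) (D (m + pn.2) 0)) := by
  induction k generalizing m with
  | zero => simp
  | succ k ih =>
    rw [Finset.sum_antidiagonal_choose_succ_nsmul
      (fun p n => ε ^ n • (a ^ p) (D (m + n) 0)), hD, ih m, ih (m + 1), map_sum, Finset.smul_sum,
      add_comm]
    congr 1
    · refine Finset.sum_congr rfl fun pn _ => ?_
      rw [smul_comm ε, smul_smul ε, pow_succ', Nat.add_right_comm, Nat.add_assoc]
    · refine Finset.sum_congr rfl fun pn hpn => ?_
      have h1 := Finset.HasAntidiagonal.mem_antidiagonal.1 hpn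
      rw [map_nsmul, map_smul, pow_succ', mul_apply_eq_comp, Nat.choose_symm_of_eq_add h1.symm]

theorem smul_eq_sum_of_shift_recursion (hε : ε * ε = 1)
    (hD : ∀ n j, D n (j + 1) = a (D n j) + ε • D (n + 1) j) (k : ℕ) :
    (ε ^ k / (k.factorial : ℂ)) • D 0 k = ∑ pn ∈ Finset.HasAntidiagonal.antidiagonal k,
      (ε ^ pn.1 / (pn.1.factorial : ℂ)) • (a ^ pn.1) ((pn.2.factorial : ℂ)⁻¹ • D pn.2 0) := by
  rw [eq_sum_of_shift_recursion hD, Finset.smul_sum]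
  refine Finset.sum_congr rfl fun pn hpn => ?_
  have h1 : pn.1 + pn.2 = k := Finset.HasAntidiagonal.mem_antidiagonal.1 hpn
  rw [map_smul, ← Nat.cast_smul_eq_nsmul ℂ, smul_smul, smul_smul, smul_smul, zero_add, ← h1,
    Nat.cast_add_choose, pow_add]
  congr 1
  have h2 : ((pn.1 + pn.2).factorial : ℂ) ≠ 0 := by exact_mod_cast Nat.factorial_ne_zero _
  have h3 : ε ^ pn.2 * ε ^ pn.2 = 1 := by rw [← mul_pow, hε, one_pow]
  calc _ = ε ^ pn.1 * (ε ^ pn.2 * ε ^ pn.2) * (((pn.1 + pn.2).factorial : ℂ) *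
        ((pn.1 + pn.2).factorial : ℂ)⁻¹) * ((pn.1.factorial : ℂ)⁻¹ * (pn.2.factorial : ℂ)⁻¹) := by
        rw [div_eq_mul_inv, div_eq_mul_inv, mul_inv]; ring
    _ = _ := by rw [h3, mul_inv_cancel₀ h2, div_eq_mul_inv]; ring

theorem sum_smul_eq_of_shift_recursion (hε : ε * ε = 1)
    (hD : ∀ n j, D n (j + 1) = a (D n j) + ε • D (n + 1) j) (K : ℕ) :
    ∑ k ∈ Finset.range K, (ε ^ k / (k.factorial : ℂ)) • D 0 k =
      ∑ p ∈ Finset.range K, (ε ^ p / (p.factorial : ℂ)) •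
        (a ^ p) (∑ n ∈ Finset.range (K - p), (n.factorial : ℂ)⁻¹ • D n 0) := by
  have h1 := Finset.sum_range_diag_flip K fun p n =>
    (ε ^ p / (p.factorial : ℂ)) • (a ^ p) ((n.factorial : ℂ)⁻¹ • D n 0)
  simp only [map_sum, Finset.smul_sum]
  rw [← h1]
  refine Finset.sum_congr rfl fun k _ => ?_
  rw [smul_eq_sum_of_shift_recursion hε hD]
  exact Finset.Nat.sum_antidiagonal_eq_sum_range_succ (fun p n =>
    (ε ^ p / (p.factorial : ℂ)) • (a ^ p) ((n.factorial : ℂ)⁻¹ • D n 0)) k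

theorem norm_pow_apply_le (a : X →L[ℂ] X) (p : ℕ) (x : X) : ‖(a ^ p) x‖ ≤ ‖a‖ ^ p * ‖x‖ := by
  induction p with
  | zero => simp
  | succ p ih =>
    rw [pow_succ', pow_succ', mul_apply_eq_comp, mul_assoc]
    exact (a.le_opNorm _).trans (mul_le_mul_of_nonneg_left ih (norm_nonneg _))

theorem tendsto_sum_exp_mul [CompleteSpace X] {S : ℕ → X} {h : X} (a : X →L[ℂ] X) (hε : ‖ε‖ = 1)
    (hS : Tendsto S atTop (𝓝 h)) :
    Tendsto (fun K => ∑ p ∈ Finset.range K, (ε ^ p / (p.factorial : ℂ)) • (a ^ p) (S (K - p)))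
      atTop (𝓝 (∑' p : ℕ, (ε ^ p / (p.factorial : ℂ)) • (a ^ p) h)) := by
  obtain ⟨M, hM⟩ := (Metric.isBounded_range_of_tendsto S hS).exists_norm_le
  have hM' : ∀ n, ‖S n‖ ≤ M := fun n => hM _ (Set.mem_range_self n)
  have hM0 : 0 ≤ M := (norm_nonneg _).trans (hM' 0)
  let F : ℕ → ℕ → X := fun K p =>
    if p < K then (ε ^ p / (p.factorial : ℂ)) • (a ^ p) (S (K - p)) else 0
  have hF : ∀ K, ∑' p, F K p =
      ∑ p ∈ Finset.range K, (ε ^ p / (p.factorial : ℂ)) • (a ^ p) (S (K - p)) := fun K => by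
    rw [tsum_eq_sum (s := Finset.range K) fun p hp => if_neg (by simpa using hp)]
    exact Finset.sum_congr rfl fun p hp => if_pos (Finset.mem_range.1 hp)
  simp only [← hF]
  refine tendsto_tsum_of_dominated_convergence
    (bound := fun p => ‖a‖ ^ p / (p.factorial : ℝ) * M)
    ((Real.summable_pow_div_factorial ‖a‖).mul_right M) (fun p => ?_)
    (Eventually.of_forall fun K p => ?_)
  · have h1 : Tendsto (fun K => (ε ^ p / (p.factorial : ℂ)) • (a ^ p) (S (K - p))) atTop
        (𝓝 ((ε ^ p / (p.factorial : ℂ)) • (a ^ p) h)) :=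
      ((((a ^ p).continuous.tendsto h).comp (hS.comp (tendsto_sub_atTop_nat p)))).const_smul _
    refine h1.congr' ?_
    filter_upwards [eventually_gt_atTop p] with K hK
    exact (if_pos hK).symm
  · by_cases hp : p < K
    · simp only [F, if_pos hp]
      rw [norm_smul, norm_div, norm_pow, hε, one_pow, Complex.norm_natCast]
      calc _ ≤ 1 / (p.factorial : ℝ) * (‖a‖ ^ p * M) := by
            refine mul_le_mul_of_nonneg_left ?_ (by positivity)
            exact (norm_pow_apply_le a p _).trans
              (mul_le_mul_of_nonneg_left (hM' _) (by positivity))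
        _ = _ := by ring
    · simp only [F, if_neg hp, norm_zero]
      positivity

end ShiftRecursion

section Commutators
variable {ν : ℕ}

theorem CommLeft.exists_iterate {A : OpSeq ν → OpSeq ν} {R : OpSeq ν → OpSeq ν → Prop} {n : ℕ}
    {f h : OpSeq ν} (H : CommLeft A R n f h) : ∃ b, R (A^[n] f) b := by
  induction n generalizing f h with
  | zero => exact ⟨h, H⟩
  | succ n ih =>
    obtain ⟨h₁, h₂, -, H₂, -⟩ := H
    exact ih H₂

theorem CommRight.exists_iterate {A : OpSeq ν → OpSeq ν} {R : OpSeq ν → OpSeq ν → Prop} {n : ℕ}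
    {f h : OpSeq ν} (H : CommRight A R n f h) : ∃ b, R (A^[n] f) b := by
  induction n generalizing f h with
  | zero => exact ⟨h, H⟩
  | succ n ih =>
    obtain ⟨h₁, h₂, H₁, -, -⟩ := H
    exact ih H₁

/-- The values `[A, …, [A, R] … ] (A^j f)` of the commutators, for given `b_j = R (A^j f)`. -/
noncomputable def leftTable (A : OpSeq ν → OpSeq ν) (b : ℕ → OpSeq ν) : ℕ → ℕ → OpSeq ν
  | 0 => b
  | n + 1 => fun j => A (leftTable A b n j) - leftTable A b n (j + 1)

/-- The values `[ … [R, A], …, A] (A^j g)` of the commutators, for given `b_j = R (A^j g)`. -/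
noncomputable def rightTable (A : OpSeq ν → OpSeq ν) (b : ℕ → OpSeq ν) : ℕ → ℕ → OpSeq ν
  | 0 => b
  | n + 1 => fun j => rightTable A b n (j + 1) - A (rightTable A b n j)

theorem commLeft_leftTable {A : OpSeq ν → OpSeq ν} {R : OpSeq ν → OpSeq ν → Prop}
    {b : ℕ → OpSeq ν} {f : OpSeq ν} (hb : ∀ j, R (A^[j] f) (b j)) (n j : ℕ) :
    CommLeft A R n (A^[j] f) (leftTable A b n j) := by
  induction n generalizing j with
  | zero => exact hb j
  | succ n ih =>
    refine ⟨_, _, ih j, ?_, rfl⟩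
    have := ih (j + 1)
    rwa [Function.iterate_succ_apply'] at this

theorem CommLeft.eq_leftTable {A : OpSeq ν → OpSeq ν} {R : OpSeq ν → OpSeq ν → Prop}
    (hR : ∀ f h h', R f h → R f h' → h = h') {b : ℕ → OpSeq ν} {f : OpSeq ν}
    (hb : ∀ j, R (A^[j] f) (b j)) {n j : ℕ} {h : OpSeq ν} (H : CommLeft A R n (A^[j] f) h) :
    h = leftTable A b n j := by
  induction n generalizing j h with
  | zero => exact hR _ _ _ H (hb j)
  | succ n ih =>
    obtain ⟨h₁, h₂, H₁, H₂, rfl⟩ := H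
    rw [← Function.iterate_succ_apply' A] at H₂
    rw [ih H₁, ih H₂]
    rfl

theorem CommRight.eq_rightTable {A : OpSeq ν → OpSeq ν} {R : OpSeq ν → OpSeq ν → Prop}
    (hR : ∀ f h h', R f h → R f h' → h = h') {b : ℕ → OpSeq ν} {f : OpSeq ν}
    (hb : ∀ j, R (A^[j] f) (b j)) {n j : ℕ} {h : OpSeq ν} (H : CommRight A R n (A^[j] f) h) :
    h = rightTable A b n j := by
  induction n generalizing j h with
  | zero => exact hR _ _ _ H (hb j)
  | succ n ih =>
    obtain ⟨h₁, h₂, H₁, H₂, rfl⟩ := H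
    rw [← Function.iterate_succ_apply' A] at H₁
    rw [ih H₁, ih H₂]
    rfl

variable {ħ : ℝ} {Φ : ∀ k : ℕ, (Fin k → Pos ν) → ℝ} {α : ℝ} {hα : 0 < α} {γ : ℝ} {hγ : 0 < γ}

theorem IsNegN.unique (hħ : 0 < ħ) (hH : ∀ n, IsSelfAdjoint (hamiltonian ħ Φ n)) (f h h' : OpSeq ν)
    (H : IsNegN ħ Φ α f h) (H' : IsNegN ħ Φ α f h') : h = h' :=
  funext fun n => neg_injective ((H.2.2 n).unique hħ (hH n) (H'.2.2 n))

theorem IsN.unique (hħ : 0 < ħ) (hH : ∀ n, IsSelfAdjoint (hamiltonian ħ Φ n)) (f h h' : OpSeq ν)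
    (H : IsN ħ Φ γ f h) (H' : IsN ħ Φ γ f h') : h = h' :=
  funext fun n => (H.2.2 n).unique hħ (hH n) (H'.2.2 n)

/-- `leftTable` in the Banach space `𝔏¹_α`. -/
noncomputable def annihTable (b : ℕ → (trNorm (ν := ν) α hα).Space) :
    ℕ → ℕ → (trNorm (ν := ν) α hα).Space
  | 0 => b
  | n + 1 => fun j => annihCLM α hα (annihTable b n j) - annihTable b n (j + 1)

/-- `rightTable` in the Banach space `𝔏_γ`. -/
noncomputable def creatTable (b : ℕ → (bdNorm (ν := ν) γ hγ).Space) :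
    ℕ → ℕ → (bdNorm (ν := ν) γ hγ).Space
  | 0 => b
  | n + 1 => fun j => creatTable b n (j + 1) - creatCLM γ hγ (creatTable b n j)

theorem val_annihTable (b : ℕ → (trNorm (ν := ν) α hα).Space) (n j : ℕ) :
    (annihTable b n j).val = leftTable annih (fun k => (b k).val) n j := by
  induction n generalizing j with
  | zero => rfl
  | succ n ih => rw [annihTable, leftTable, SeqNorm.Space.val_sub, annihCLM_val, ih, ih]

theorem val_creatTable (b : ℕ → (bdNorm (ν := ν) γ hγ).Space) (n j : ℕ) :
    (creatTable b n j).val = rightTable creat (fun k => (b k).val) n j := by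
  induction n generalizing j with
  | zero => rfl
  | succ n ih => rw [creatTable, rightTable, SeqNorm.Space.val_sub, creatCLM_val, ih, ih]

theorem annihTable_succ (b : ℕ → (trNorm (ν := ν) α hα).Space) (n j : ℕ) :
    annihTable b n (j + 1) = annihCLM α hα (annihTable b n j) + (-1 : ℂ) • annihTable b (n + 1) j := by
  rw [show annihTable b (n + 1) j = annihCLM α hα (annihTable b n j) - annihTable b n (j + 1) from rfl,
    neg_one_smul, neg_sub, add_sub_cancel]

theorem creatTable_succ (b : ℕ → (bdNorm (ν := ν) γ hγ).Space) (n j : ℕ) :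
    creatTable b n (j + 1) = creatCLM γ hγ (creatTable b n j) + (1 : ℂ) • creatTable b (n + 1) j := by
  rw [show creatTable b (n + 1) j = creatTable b n (j + 1) - creatCLM γ hγ (creatTable b n j) from rfl,
    one_smul, add_sub_cancel]

theorem isBbgkyGen_of_sumsToTr (hħ : 0 < ħ)
    (hΦ : ∀ (k : ℕ) (σ : Equiv.Perm (Fin k)) (q : Fin k → Pos ν), Φ k (q ∘ σ) = Φ k q)
    (hH : ∀ n, IsSelfAdjoint (hamiltonian ħ Φ n)) (hα : 0 < α) {f h : OpSeq ν} {c : ℕ → OpSeq ν}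
    (hh : MemTr α h) (hc : ∀ n, CommLeft annih (IsNegN ħ Φ α) n f (c n))
    (hs : SumsToTr α (fun n => (n.factorial : ℂ)⁻¹ • c n) h) : IsBbgkyGen ħ Φ α f h := by
  choose b hb using fun n => (hc n).exists_iterate
  obtain ⟨x, rfl⟩ := (hb 0).1.exists_val hα
  obtain ⟨y, rfl⟩ := hh.exists_val hα
  choose B hB using fun n => (hb n).2.1.exists_val hα
  have hb' : ∀ j, IsNegN ħ Φ α (annih^[j] x.val) ((fun k => (B k).val) j) := fun j => by
    simpa only [hB] using hb j
  have hcB : ∀ n, c n = (annihTable B n 0).val := fun n => by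
    rw [val_annihTable]
    exact CommLeft.eq_leftTable (IsNegN.unique hħ hH) hb' (j := 0) (hc n)
  have hlim : Tendsto (fun K => ∑ n ∈ Finset.range K, (n.factorial : ℂ)⁻¹ • annihTable B n 0) atTop
      (𝓝 y) := by
    rw [SeqNorm.Space.tendsto_iff]
    simp only [SeqNorm.Space.val_sum, SeqNorm.Space.val_smul, ← hcB]
    exact hs
  have h1 := tendsto_sum_exp_mul (ε := -1) (annihCLM α hα) (by simp) hlim
  rw [(hasSum_expAnnihCLM (-1) y).tsum_eq] at h1
  simp only [← sum_smul_eq_of_shift_recursion (by norm_num) (annihTable_succ B)] at h1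
  have h2 := (hasSum_expAnnihCLM (-1) x).tendsto_sum_nat
  refine ⟨memTr_val x, hh, (tendsto_bbgky_iff hħ hΦ hH x y).2 fun n => ?_⟩
  refine isCommH_of_tendsto hħ (hH n) (T := fun K => (∑ k ∈ Finset.range K,
    ((-1 : ℂ) ^ k / (k.factorial : ℂ)) • (annihCLM α hα ^ k) x).val n)
    (S := fun K => -((∑ k ∈ Finset.range K,
    ((-1 : ℂ) ^ k / (k.factorial : ℂ)) • annihTable B 0 k).val n)) (fun K => ?_)
    (((SeqNorm.Space.component _ n).continuous.tendsto _).comp h2)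
    (((SeqNorm.Space.component _ n).continuous.tendsto _).comp h1).neg
  rw [SeqNorm.Space.val_sum, SeqNorm.Space.val_sum, Finset.sum_apply, Finset.sum_apply,
    ← Finset.sum_neg_distrib]
  have := isCommH_sum_smul hħ (Finset.range K) (fun k => (-1 : ℂ) ^ k / (k.factorial : ℂ))
    (fun k _ => (hb' k).2.2 n)
  simp only [smul_neg, ← val_annihCLM_pow] at this
  exact this

theorem onSubset_eq_zero {m : ℕ} {Z : Finset (Fin m)} {A : Op ν Z.card} (h : A = 0) :
    onSubset Z A = 0 := by
  rw [h, ← zero_smul ℂ (0 : Op ν Z.card), onSubset_smul, zero_smul]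

theorem creat_eq_zero {g : OpSeq ν} {q : ℕ} (h : ∀ r < q, g r = 0) {s : ℕ} (hs : s < q + 1) :
    creat g s = 0 :=
  Finset.sum_eq_zero fun j _ => onSubset_eq_zero (h _ (by
    rw [Finset.card_erase_of_mem (Finset.mem_univ j), Finset.card_univ, Fintype.card_fin]
    have := j.pos
    omega))

theorem creatCLM_pow_eq_zero {x : (bdNorm (ν := ν) γ hγ).Space} {q : ℕ} (h : ∀ r < q, x.val r = 0)
    (p : ℕ) {s : ℕ} (hs : s < q + p) : ((creatCLM γ hγ ^ p) x).val s = 0 := by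
  induction p generalizing s with
  | zero => exact h s hs
  | succ p ih =>
    rw [pow_succ', mul_apply_eq_comp, creatCLM_val]
    exact creat_eq_zero (fun r hr => ih hr) hs

theorem expCreatCLM_eq_sum (ε : ℂ) (x : (bdNorm (ν := ν) γ hγ).Space) {s M : ℕ} (hs : s < M) :
    (expCreatCLM γ hγ ε x).val s =
      (∑ p ∈ Finset.range M, (ε ^ p / (p.factorial : ℂ)) • (creatCLM γ hγ ^ p) x).val s := by
  refine (SeqNorm.hasSum_component _ (hasSum_expCreatCLM ε x) s).unique ?_
  rw [SeqNorm.Space.val_sum, Finset.sum_apply]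
  refine hasSum_sum_of_ne_finset_zero fun p hp => ?_
  rw [SeqNorm.Space.val_smul, Pi.smul_apply, creatCLM_pow_eq_zero (q := 0) (by simp) p, smul_zero]
  rw [Finset.mem_range] at hp
  omega

theorem expCreatCLM_eq_zero (ε : ℂ) {x : (bdNorm (ν := ν) γ hγ).Space} {q : ℕ}
    (h : ∀ r < q, x.val r = 0) {s : ℕ} (hs : s < q) : (expCreatCLM γ hγ ε x).val s = 0 := by
  rw [expCreatCLM_eq_sum ε x s.lt_succ_self, SeqNorm.Space.val_sum, Finset.sum_apply]
  refine Finset.sum_eq_zero fun p _ => ?_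
  rw [SeqNorm.Space.val_smul, Pi.smul_apply, creatCLM_pow_eq_zero h p (by omega), smul_zero]

theorem creatTable_eq_zero {b : ℕ → (bdNorm (ν := ν) γ hγ).Space}
    (hb : ∀ j, ∀ s < j, (b j).val s = 0) (n j : ℕ) {s : ℕ} (hs : s < n + j) :
    (creatTable b n j).val s = 0 := by
  induction n generalizing j s with
  | zero => exact hb j s (by omega)
  | succ n ih =>
    rw [creatTable, SeqNorm.Space.val_sub, Pi.sub_apply, ih (j + 1) (by omega), creatCLM_val,
      creat_eq_zero (fun r hr => ih j hr) (by omega), sub_zero]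

theorem expCreatCLM_sum_creatTable {b : ℕ → (bdNorm (ν := ν) γ hγ).Space}
    (hb : ∀ j, ∀ s < j, (b j).val s = 0) {s M : ℕ} (hs : s < M) :
    (expCreatCLM γ hγ 1 (∑ n ∈ Finset.range M, (n.factorial : ℂ)⁻¹ • creatTable b n 0)).val s =
      (∑ k ∈ Finset.range M, ((1 : ℂ) ^ k / (k.factorial : ℂ)) • b k).val s := by
  have h0 := sum_smul_eq_of_shift_recursion (by norm_num) (creatTable_succ b) M
  rw [show (fun k => ((1 : ℂ) ^ k / (k.factorial : ℂ)) • b k) =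
    fun k => ((1 : ℂ) ^ k / (k.factorial : ℂ)) • creatTable b 0 k from rfl, h0,
    expCreatCLM_eq_sum 1 _ hs, SeqNorm.Space.val_sum, SeqNorm.Space.val_sum, Finset.sum_apply,
    Finset.sum_apply]
  refine Finset.sum_congr rfl fun p hp => ?_
  rw [Finset.mem_range] at hp
  rw [← Finset.sum_range_add_sum_Ico _ (Nat.sub_le M p), map_add, smul_add, SeqNorm.Space.val_add,
    Pi.add_apply, add_eq_left, SeqNorm.Space.val_smul, Pi.smul_apply,
    creatCLM_pow_eq_zero (q := M - p) _ p (by omega), smul_zero]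
  intro r hr
  rw [SeqNorm.Space.val_sum, Finset.sum_apply]
  refine Finset.sum_eq_zero fun n hn => ?_
  rw [SeqNorm.Space.val_smul, Pi.smul_apply, creatTable_eq_zero hb n 0, smul_zero]
  rw [Finset.mem_Ico] at hn
  omega

theorem isDualGen_iff_hasSum (hħ : 0 < ħ)
    (hΦ : ∀ (k : ℕ) (σ : Equiv.Perm (Fin k)) (q : Fin k → Pos ν), Φ k (q ∘ σ) = Φ k q)
    (hH : ∀ n, IsSelfAdjoint (hamiltonian ħ Φ n)) (hγ : 0 < γ) {g h : OpSeq ν} {c : ℕ → OpSeq ν}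
    (hh : MemBd γ h) (hc : ∀ n, CommRight creat (IsN ħ Φ γ) n g (c n)) :
    IsDualGen ħ Φ γ g h ↔ ∀ s, HasSum (fun n => (n.factorial : ℂ)⁻¹ • c n s) (h s) := by
  choose b hb using fun n => (hc n).exists_iterate
  obtain ⟨x, rfl⟩ := (hb 0).1.exists_val hγ
  obtain ⟨y, rfl⟩ := hh.exists_val hγ
  choose B hB using fun n => (hb n).2.1.exists_val hγ
  have hb' : ∀ j, IsN ħ Φ γ (creat^[j] x.val) ((fun k => (B k).val) j) := fun j => by
    simpa only [hB] using hb j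
  have hcB : ∀ n, c n = (creatTable B n 0).val := fun n => by
    rw [val_creatTable]
    exact CommRight.eq_rightTable (IsN.unique hħ hH) hb' (j := 0) (hc n)
  have hB0 : ∀ j, ∀ s < j, (B j).val s = 0 := fun j s hs => by
    have h1 := (hb' j).2.2 s
    rw [← val_creatCLM_pow (hγ := hγ), creatCLM_pow_eq_zero (q := 0) (by simp) j (by omega)] at h1
    have h2 : IsCommH ħ Φ s 0 (0 : Op ν s) := by
      rw [isCommH_iff hħ, smul_zero]
      exact isComm_zero
    exact h1.unique hħ (hH s) h2
  let S : ℕ → (bdNorm (ν := ν) γ hγ).Space := fun M =>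
    ∑ n ∈ Finset.range M, (n.factorial : ℂ)⁻¹ • creatTable B n 0
  have hS : ∀ s M, s < M → IsCommH ħ Φ s ((expCreatCLM γ hγ 1 x).val s)
      ((expCreatCLM γ hγ 1 (S M)).val s) := fun s M hs => by
    rw [expCreatCLM_sum_creatTable hB0 hs, expCreatCLM_eq_sum 1 x hs, SeqNorm.Space.val_sum,
      SeqNorm.Space.val_sum, Finset.sum_apply, Finset.sum_apply]
    have := isCommH_sum_smul hħ (Finset.range M) (fun k => (1 : ℂ) ^ k / (k.factorial : ℂ))
      (fun k _ => (hb' k).2.2 s)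
    simp only [← val_creatCLM_pow (hγ := hγ)] at this
    exact this
  have hSs : ∀ s M, s < M → HasSum (fun n => (n.factorial : ℂ)⁻¹ • c n s) ((S M).val s) :=
    fun s M hs => by
      simp only [hcB]
      rw [SeqNorm.Space.val_sum, Finset.sum_apply]
      refine hasSum_sum_of_ne_finset_zero fun n hn => ?_
      rw [Finset.mem_range] at hn
      rw [creatTable_eq_zero hB0 n 0 (by omega), smul_zero]
  have hgen : IsDualGen ħ Φ γ x.val y.val ↔ ∀ n, IsCommH ħ Φ n ((expCreatCLM γ hγ 1 x).val n)
      ((expCreatCLM γ hγ 1 y).val n) :=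
    ⟨fun h => (tendsto_dualBbgky_iff hħ hΦ hH x y).1 h.2.2,
      fun h => ⟨memBd_val x, hh, (tendsto_dualBbgky_iff hħ hΦ hH x y).2 h⟩⟩
  rw [hgen]
  constructor
  · intro h s
    have h1 : ∀ r < s + 1, (expCreatCLM γ hγ 1 (y - S (s + 1))).val r = 0 := fun r hr => by
      rw [map_sub, SeqNorm.Space.val_sub, Pi.sub_apply, sub_eq_zero]
      exact (h r).unique hħ (hH r) (hS r _ hr)
    have h2 := expCreatCLM_eq_zero (-1) h1 s.lt_succ_self
    rw [expCreatCLM_neg_apply, SeqNorm.Space.val_sub, Pi.sub_apply, sub_eq_zero] at h2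
    rw [h2]
    exact hSs s _ s.lt_succ_self
  · intro h s
    have h1 : ∀ r < s + 1, (y - S (s + 1)).val r = 0 := fun r hr => by
      rw [SeqNorm.Space.val_sub, Pi.sub_apply, sub_eq_zero]
      exact (h r).unique (hSs r _ hr)
    have h2 := expCreatCLM_eq_zero 1 h1 s.lt_succ_self
    rw [map_sub, SeqNorm.Space.val_sub, Pi.sub_apply, sub_eq_zero] at h2
    rw [h2]
    exact hS s _ s.lt_succ_self

end Commutators

section TestSequences
variable {ν : ℕ} {ħ : ℝ} {Φ : ∀ k : ℕ, (Fin k → Pos ν) → ℝ} {α : ℝ} {hα : 0 < α}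

theorem trLast_zero (s n : ℕ) : trLast s n (0 : Op ν (s + n)) = 0 := by
  have h := trLast_smul (s := s) (n := n) 0 (T := (0 : Op ν (s + n)))
    (by rw [traceNorm_zero]; exact ENNReal.zero_ne_top)
  rwa [zero_smul, zero_smul] at h

theorem exists_isComm_trLast (hΦ : ∀ (k : ℕ) (K : Set (Fin k → Pos ν)), IsCompact K →
    MemLp (Φ k) 2 (volume.restrict K)) {s k : ℕ} (hH : IsSelfAdjoint (hamiltonian ħ Φ s))
    {T : Op ν (s + k)} (hT : T ∈ Submodule.span ℂ {T : Op ν (s + k) | ∃ u v, IsTestVec u ∧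
      IsTestVec v ∧ T = InnerProductSpace.rankOne ℂ u v}) :
    traceNorm T ≠ ∞ ∧ ∃ S : Op ν s, traceNorm S ≠ ∞ ∧
      IsComm (hamiltonian ħ Φ s) (trLast s k T) S := by
  induction hT using Submodule.span_induction with
  | mem T h =>
    obtain ⟨u, v, hu, hv, rfl⟩ := h
    exact ⟨traceNorm_rankOne_ne_top u v, exists_isComm_partialTrace hΦ hH finSumFinEquiv hu hv⟩
  | zero =>
    refine ⟨by rw [traceNorm_zero]; exact ENNReal.zero_ne_top, 0,
      by rw [traceNorm_zero]; exact ENNReal.zero_ne_top, ?_⟩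
    rw [trLast_zero]
    exact isComm_zero
  | add T T' _ _ h h' =>
    obtain ⟨h1, S, h2, h3⟩ := h
    obtain ⟨h1', S', h2', h3'⟩ := h'
    refine ⟨ne_top_of_le_ne_top (ENNReal.add_ne_top.2 ⟨h1, h1'⟩) (traceNorm_add_le _ _), S + S',
      ne_top_of_le_ne_top (ENNReal.add_ne_top.2 ⟨h2, h2'⟩) (traceNorm_add_le _ _), ?_⟩
    rw [trLast_add h1 h1']
    exact h3.add h3'
  | smul c T _ h =>
    obtain ⟨h1, S, h2, h3⟩ := h
    refine ⟨traceNorm_smul_ne_top _ h1, c • S, traceNorm_smul_ne_top _ h2, ?_⟩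
    rw [trLast_smul c h1]
    exact h3.smul c

theorem IsTestSeq.traceNorm_ne_top {f : OpSeq ν} (hf : IsTestSeq f) (n : ℕ) :
    traceNorm (f n) ≠ ∞ := by
  have h := hf.2.2 n
  generalize f n = T at h
  induction h using Submodule.span_induction with
  | mem T h =>
    obtain ⟨u, v, -, -, rfl⟩ := h
    exact traceNorm_rankOne_ne_top u v
  | zero => rw [traceNorm_zero]; exact ENNReal.zero_ne_top
  | add T T' _ _ h h' =>
    exact ne_top_of_le_ne_top (ENNReal.add_ne_top.2 ⟨h, h'⟩) (traceNorm_add_le _ _)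
  | smul c T _ h => exact traceNorm_smul_ne_top _ h

theorem IsTestSeq.exists_isNegN_iterate (hħ : 0 < ħ)
    (hΦ : ∀ (k : ℕ) (σ : Equiv.Perm (Fin k)) (q : Fin k → Pos ν), Φ k (q ∘ σ) = Φ k q)
    (hΦloc : ∀ (k : ℕ) (K : Set (Fin k → Pos ν)), IsCompact K → MemLp (Φ k) 2 (volume.restrict K))
    (hH : ∀ n, IsSelfAdjoint (hamiltonian ħ Φ n)) (hα : 0 < α) {f : OpSeq ν} (hf : IsTestSeq f)
    {N : ℕ} (hN : ∀ n, N < n → f n = 0) (k : ℕ) :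
    ∃ b : OpSeq ν, IsNegN ħ Φ α (annih^[k] f) b ∧ ∀ s, N < s + k → b s = 0 := by
  have hf' := hf.traceNorm_ne_top
  have hmem : MemTr α f := memTr_of_forall_eq_zero hf.1 hf' N hN
  have hg : MemTr α (annih^[k] f) := by
    obtain ⟨x, rfl⟩ := hmem.exists_val hα
    rw [← val_annihCLM_pow (hα := hα)]
    exact memTr_val _
  have hex : ∀ s, ∃ S : Op ν s, traceNorm S ≠ ∞ ∧
      IsComm (hamiltonian ħ Φ s) (annih^[k] f s) S := fun s => by
    rw [iterate_annih_eq hf.1 hf']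
    exact (exists_isComm_trLast hΦloc (hH s) (hf.2.2 (s + k))).2
  choose S hS hS' using hex
  have h0 : (ħ : ℂ) ≠ 0 := by exact_mod_cast hħ.ne'
  have hzero : ∀ s, N < s + k → S s = 0 := fun s hs => by
    have h1 := hS' s
    rw [iterate_annih_eq hf.1 hf', hN _ hs, trLast_zero] at h1
    exact h1.unique (hH s) isComm_zero
  have hbzero : ∀ s, N < s + k → (-(ħ : ℂ)⁻¹) • S s = 0 := fun s hs => by
    rw [hzero s hs, smul_zero]
  refine ⟨fun s => (-(ħ : ℂ)⁻¹) • S s, ⟨hg, memTr_of_forall_eq_zero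
    (fun s => (isSymmetricOp_of_isComm hΦ (hH s) (hg.1 s) (hS' s)).smul _)
    (fun s => traceNorm_smul_ne_top _ (hS s)) N (fun s hs => hbzero s (by omega)),
    fun s => ?_⟩, hbzero⟩
  have h1 : (ħ : ℂ) • -((-(ħ : ℂ)⁻¹) • S s) = S s := by
    rw [neg_smul, neg_neg, smul_smul, mul_inv_cancel₀ h0, one_smul]
  rw [isCommH_iff hħ]
  exact h1.symm ▸ hS' s

theorem leftTable_annih_eq_zero {b : ℕ → OpSeq ν} {N : ℕ} (hb : ∀ j s, N < s + j → b j s = 0)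
    (n j s : ℕ) (hs : N < s + n + j) : leftTable annih b n j s = 0 := by
  induction n generalizing j s with
  | zero => exact hb j s hs
  | succ n ih =>
    change trLast s 1 (leftTable annih b n j (s + 1)) - leftTable annih b n (j + 1) s = 0
    rw [ih j (s + 1) (by omega), ih (j + 1) s (by omega),
      trLast_zero, sub_zero]

theorem IsTestSeq.exists_commLeft (hħ : 0 < ħ)
    (hΦ : ∀ (k : ℕ) (σ : Equiv.Perm (Fin k)) (q : Fin k → Pos ν), Φ k (q ∘ σ) = Φ k q)
    (hΦloc : ∀ (k : ℕ) (K : Set (Fin k → Pos ν)), IsCompact K → MemLp (Φ k) 2 (volume.restrict K))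
    (hH : ∀ n, IsSelfAdjoint (hamiltonian ħ Φ n)) (hα : 0 < α) {f : OpSeq ν} (hf : IsTestSeq f) :
    ∃ (c : ℕ → OpSeq ν) (h : OpSeq ν), MemTr α h ∧
      (∀ n, CommLeft annih (IsNegN ħ Φ α) n f (c n)) ∧
      SumsToTr α (fun n => (n.factorial : ℂ)⁻¹ • c n) h := by
  obtain ⟨N, hN⟩ := hf.2.1
  choose b hb hb0 using hf.exists_isNegN_iterate hħ hΦ hΦloc hH hα hN
  choose B hB using fun n => (hb n).2.1.exists_val hα
  obtain rfl : (fun k => (B k).val) = b := funext hB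
  refine ⟨fun n => (annihTable B n 0).val,
    (∑ n ∈ Finset.range (N + 1), (n.factorial : ℂ)⁻¹ • annihTable B n 0).val, memTr_val _,
    fun n => ?_, ?_⟩
  · beta_reduce
    rw [val_annihTable]
    exact commLeft_leftTable hb n 0
  · refine SeqNorm.tendsto_sum (trNorm α hα) (u := fun n => (n.factorial : ℂ)⁻¹ • annihTable B n 0)
      (hasSum_sum_of_ne_finset_zero fun n hn => ?_)
    rw [Finset.mem_range] at hn
    have : annihTable B n 0 = 0 := SeqNorm.Space.ext _ (funext fun s => by
      rw [val_annihTable]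
      exact leftTable_annih_eq_zero hb0 n 0 s (by omega))
    rw [this, smul_zero]

end TestSequences

end BBGKY

open BBGKY
theorem mainTheorem4 (ν : ℕ) (ħ : ℝ) (hħ : 0 < ħ) (Φ : ∀ k : ℕ, (Fin k → Pos ν) → ℝ)
    (hΦsymm : ∀ (k : ℕ) (σ : Equiv.Perm (Fin k)) (q : Fin k → Pos ν), Φ k (q ∘ σ) = Φ k q)
    (hΦloc : ∀ (k : ℕ) (K : Set (Fin k → Pos ν)), IsCompact K →
      MemLp (Φ k) 2 (volume.restrict K))
    (hH : ∀ n : ℕ, IsSelfAdjoint (hamiltonian ħ Φ n)) :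
    (∀ α : ℝ, 1 < α →
      -- the operators exp(± 𝔞)
      (∀ ε : ℂ, ε = 1 ∨ ε = -1 → ∀ f : OpSeq ν, MemTr α f →
        MemTr α (expAnnih ε f) ∧
        SumsToTr α (fun n => (ε ^ n / (n.factorial : ℂ)) • annih^[n] f) (expAnnih ε f)) ∧
      -- the group U(t)
      (∀ (t : ℝ) (f : OpSeq ν), MemTr α f →
        MemTr α (bbgky ħ Φ t f) ∧
        (∀ n s : ℕ, commLeft annih (groupG ħ Φ (-t)) n f s = bbgkyTerm ħ Φ t f s n) ∧
        SumsToTr α (fun n => (n.factorial : ℂ)⁻¹ • commLeft annih (groupG ħ Φ (-t)) n f)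
          (bbgky ħ Φ t f) ∧
        bbgky ħ Φ t f = expAnnih 1 (groupG ħ Φ (-t) (expAnnih (-1) f))) ∧
      -- its generator
      (∀ f h : OpSeq ν, IsBbgkyGen ħ Φ α f h ↔
        MemTr α f ∧ ∃ k, IsNegN ħ Φ α (expAnnih (-1) f) k ∧ h = expAnnih 1 k) ∧
      (∀ (f : OpSeq ν) (c : ℕ → OpSeq ν) (h : OpSeq ν), MemTr α h →
        (∀ n, CommLeft annih (IsNegN ħ Φ α) n f (c n)) →
        SumsToTr α (fun n => (n.factorial : ℂ)⁻¹ • c n) h → IsBbgkyGen ħ Φ α f h) ∧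
      (∀ f : OpSeq ν, IsTestSeq f → ∃ (c : ℕ → OpSeq ν) (h : OpSeq ν),
        (∀ n, CommLeft annih (IsNegN ħ Φ α) n f (c n)) ∧
        SumsToTr α (fun n => (n.factorial : ℂ)⁻¹ • c n) h ∧ IsBbgkyGen ħ Φ α f h)) ∧
    (∀ γ : ℝ, 0 < γ → γ < 1 →
      -- the operators exp(± 𝔞⁺)
      (∀ ε : ℂ, ε = 1 ∨ ε = -1 → ∀ g : OpSeq ν, MemBd γ g →
        MemBd γ (expCreat ε g) ∧
        SumsToBd γ (fun n => (ε ^ n / (n.factorial : ℂ)) • creat^[n] g) (expCreat ε g)) ∧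
      -- the group U⁺(t)
      (∀ (t : ℝ) (g : OpSeq ν), MemBd γ g →
        MemBd γ (dualBbgky ħ Φ t g) ∧
        (∀ s n : ℕ, n ≤ s →
          (n.factorial : ℂ)⁻¹ • commRight creat (groupG ħ Φ t) n g s = dualTerm ħ Φ t g s n) ∧
        SumsToBd γ (fun n => (n.factorial : ℂ)⁻¹ • commRight creat (groupG ħ Φ t) n g)
          (dualBbgky ħ Φ t g) ∧
        dualBbgky ħ Φ t g = expCreat (-1) (groupG ħ Φ t (expCreat 1 g))) ∧
      -- its generator
      (∀ g h : OpSeq ν, IsDualGen ħ Φ γ g h ↔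
        MemBd γ g ∧ ∃ k, IsN ħ Φ γ (expCreat 1 g) k ∧ h = expCreat (-1) k) ∧
      (∀ (g : OpSeq ν) (c : ℕ → OpSeq ν) (h : OpSeq ν), MemBd γ h →
        (∀ n, CommRight creat (IsN ħ Φ γ) n g (c n)) →
        (IsDualGen ħ Φ γ g h ↔ ∀ s : ℕ, HasSum (fun n => (n.factorial : ℂ)⁻¹ • c n s) (h s)))) := by
  refine ⟨fun α hα1 => ?_, fun γ hγ hγ1 => ?_⟩
  · have hα : 0 < α := one_pos.trans hα1
    refine ⟨fun ε _ f hf => ?_, fun t f hf => ?_, isBbgkyGen_iff hħ hΦsymm hH hα,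
      fun f c h hh hc hs => isBbgkyGen_of_sumsToTr hħ hΦsymm hH hα hh hc hs, fun f hf => ?_⟩
    · obtain ⟨x, rfl⟩ := hf.exists_val hα
      have h := SeqNorm.tendsto_sum _ (hasSum_expAnnihCLM ε x)
      simp only [SeqNorm.Space.val_smul, val_annihCLM_pow, val_expAnnihCLM] at h
      refine ⟨?_, h⟩
      rw [← val_expAnnihCLM (hα := hα)]
      exact memTr_val _
    · obtain ⟨x, rfl⟩ := hf.exists_val hα
      have h := SeqNorm.tendsto_sum _ (hasSum_bbgkyCLM hΦsymm hH t x)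
      simp only [SeqNorm.Space.val_smul, val_adPow_annih, val_bbgkyCLM] at h
      refine ⟨?_, fun n s => commLeft_eq_bbgkyTerm hΦsymm hH t hα hf n s, h, ?_⟩
      · rw [← val_bbgkyCLM hΦsymm hH (hα := hα)]
        exact memTr_val _
      · rw [← val_bbgkyCLM hΦsymm hH (hα := hα), bbgkyCLM, mul_apply_eq_comp, mul_apply_eq_comp,
          val_expAnnihCLM, val_groupTr, val_expAnnihCLM]
    · obtain ⟨c, h, hh, hc, hs⟩ := hf.exists_commLeft hħ hΦsymm hΦloc hH hα
      exact ⟨c, h, hc, hs, isBbgkyGen_of_sumsToTr hħ hΦsymm hH hα hh hc hs⟩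
  · refine ⟨fun ε _ g hg => ?_, fun t g hg => ?_, isDualGen_iff hħ hΦsymm hH hγ,
      fun g c h hh hc => isDualGen_iff_hasSum hħ hΦsymm hH hγ hh hc⟩
    · obtain ⟨x, rfl⟩ := hg.exists_val hγ
      have h := SeqNorm.tendsto_sum _ (hasSum_expCreatCLM ε x)
      simp only [SeqNorm.Space.val_smul, val_creatCLM_pow, val_expCreatCLM] at h
      refine ⟨?_, h⟩
      rw [← val_expCreatCLM (hγ := hγ)]
      exact memBd_val _
    · obtain ⟨x, rfl⟩ := hg.exists_val hγ
      have h := SeqNorm.tendsto_sum _ (hasSum_dualBbgkyCLM hΦsymm hH t x)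
      simp only [SeqNorm.Space.val_smul, val_adPow_creat, val_dualBbgkyCLM] at h
      refine ⟨?_, fun s n hn => ?_, h, ?_⟩
      · rw [← val_dualBbgkyCLM hΦsymm hH (hγ := hγ)]
        exact memBd_val _
      · rw [dualTerm_eq hn]
        exact commRight_div_factorial hΦsymm hH t x n s
      · rw [← val_dualBbgkyCLM hΦsymm hH (hγ := hγ), dualBbgkyCLM, mul_apply_eq_comp,
          mul_apply_eq_comp, val_expCreatCLM, val_groupBd, val_expCreatCLM]
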